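/- Let $\mathsf k$ be an algebraically closed field of characteristic $0$, let $n,m\ge 1$ and let $p$ be a positive divisor of $m$. For a commutative $\mathsf k$-algebra $D$, a $\mathsf k$-automorphism $\sigma$ of $D$ and $0\ne a\in D$, the rank one generalized Weyl algebra $D(a,\sigma)$ is the $\mathsf k$-algebra generated over $D$ by $X^+,X^-$ with relations $$X^+d=\sigma(d)X^+,\quad X^-d=\sigma^{-1}(d)X^-\ (d\in D),\quad X^-X^+=a,\quad X^+X^-=\sigma(a),$$ and $D^n(a^n,\sigma^n)=D(a,\sigma)^{\otimes n}$ (tensor product over $\mathsf k$). Let $G(m,p,n)=A(m,p,n)\rtimes S_n$, where $A(m,p,n)$ is the group of all $(\zeta_1,\dots,\zeta_n)\in(\mathsf k^\times)^n$ with $\zeta_i^m=1$ for all $i$ and $(\zeta_1\cdots\zeta_n)^{m/p}=1$. It acts on $D^n(a^n,\sigma^n)$ by automorphisms: $S_n$ permutes the tensor factors, and $(\zeta_1,\dots,\zeta_n)$ fixes $D^{\otimes n}$ and sends $X_i^{\pm}$ to $\zeta_i^{\pm1}X_i^{\pm}$, where $X_i^\pm$ is $X^\pm$ in the $i$-th factor.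 (1) (Classical type.) If $D=\mathsf k[h]$ and $\sigma(h)=h-1$, then $D^n(a^n,\sigma^n)^{G(m,p,n)}$ and the $n$-th Weyl algebra $W_n(\mathsf k)$ are Ore domains, and there is an isomorphism of $\mathsf k$-algebras $$\operatorname{Frac}\bigl(D^n(a^n,\sigma^n)^{G(m,p,n)}\bigr)\simeq\operatorname{Frac}W_n(\mathsf k).$$ (2) (Quantum type.) If $D=\mathsf k[h^{\pm1}]$ and $\sigma(h)=qh$, where $q\in\mathsf k^\times$ is not a root of unity, then $D^n(a^n,\sigma^n)^{G(m,p,n)}$ and $\mathsf k_{q^{m/p}}[x,y]\otimes\mathsf k_{q^m}[x,y]^{\otimes(n-1)}$ are Ore domains, and there is an isomorphism of $\mathsf k$-algebras $$\operatorname{Frac}\bigl(D^n(a^n,\sigma^n)^{G(m,p,n)}\bigr)\simeq\operatorname{Frac}\bigl(\mathsf k_{q^{m/p}}[x,y]\otimes\mathsf k_{q^m}[x,y]^{\otimes(n-1)}\bigr),$$ where $\mathsf k_r[x,y]$ denotes the quantum plane, generated by $x,y$ with the relation $yx=r\,xy$. Here $\operatorname{Frac}$ denotes the skew field of fractions of an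 Ore domain. -/

import Mathlib

open Polynomial TensorProduct
open scoped LaurentPolynomial nonZeroDivisors

noncomputable section

namespace GWANoether

/-! ### Ore domains and their skew fields of fractions -/

/-- An Ore domain: a (not necessarily commutative) domain satisfying the left and the right Ore
condition. -/
class IsOreDomain (A : Type*) [Ring A] : Prop extends IsDomain A where
  left_ore : ∀ (r s : A), s ≠ 0 → ∃ r' s' : A, s' ≠ 0 ∧ s' * r = r' * s
  right_ore : ∀ (r s : A), s ≠ 0 → ∃ r' s' : A, s' ≠ 0 ∧ r * s' = s * r'

/-- In an Ore domain the nonzero elements form an Ore set. -/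
instance IsOreDomain.oreSet (A : Type*) [Ring A] [IsOreDomain A] : OreLocalization.OreSet A⁰ :=
  Classical.choice <| OreLocalization.nonempty_oreSet_iff_of_noZeroDivisors.2 fun r s => by
    obtain ⟨r', s', hs', h⟩ := IsOreDomain.left_ore r (s : A) (nonZeroDivisors.ne_zero s.2)
    exact ⟨r', ⟨s', mem_nonZeroDivisors_of_ne_zero hs'⟩, h⟩

/-- The skew field of fractions `Frac A` of an Ore domain `A`: the localization of `A` at all its
nonzero elements. -/
abbrev SkewFrac (A : Type*) [Ring A] [IsOreDomain A] : Type _ := OreLocalization A⁰ A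

/-- `Frac A` and `Frac B` exist and are isomorphic as `k`-algebras. -/
def FracIsomorphic (k : Type*) [CommRing k] (A B : Type*) [Ring A] [Algebra k A] [Ring B]
    [Algebra k B] : Prop :=
  ∃ (_ : IsOreDomain A) (_ : IsOreDomain B), Nonempty (SkewFrac A ≃ₐ[k] SkewFrac B)

/-! ### Generalized Weyl algebras of degree one -/

section GWA

variable (k : Type*) [Field k] (D : Type*) [CommRing D] [Algebra k D]

/-- Generators of a generalized Weyl algebra: the elements of the base ring, `X⁺` and `X⁻`. -/
inductive GWAGen where
  | base (d : D)
  | plus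
  | minus

variable {D}

open GWAGen in
/-- Defining relations of the generalized Weyl algebra `D(a, σ)`. -/
inductive GWARel (σ : D ≃ₐ[k] D) (a : D) :
    FreeAlgebra k (GWAGen D) → FreeAlgebra k (GWAGen D) → Prop
  -- the base ring `D`, as a `k`-algebra
  | base_add (d e : D) : GWARel σ a (FreeAlgebra.ι k (base (d + e)))
      (FreeAlgebra.ι k (base d) + FreeAlgebra.ι k (base e))
  | base_mul (d e : D) : GWARel σ a (FreeAlgebra.ι k (base (d * e)))
      (FreeAlgebra.ι k (base d) * FreeAlgebra.ι k (base e))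
  | base_scalar (c : k) : GWARel σ a (FreeAlgebra.ι k (base (algebraMap k D c)))
      (algebraMap k _ c)
  -- the relations of `X⁺` and `X⁻`
  | plus_base (d : D) : GWARel σ a (FreeAlgebra.ι k plus * FreeAlgebra.ι k (base d))
      (FreeAlgebra.ι k (base (σ d)) * FreeAlgebra.ι k plus)
  | minus_base (d : D) : GWARel σ a (FreeAlgebra.ι k minus * FreeAlgebra.ι k (base d))
      (FreeAlgebra.ι k (base (σ.symm d)) * FreeAlgebra.ι k minus)
  | minus_plus : GWARel σ a (FreeAlgebra.ι k minus * FreeAlgebra.ι k plus)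
      (FreeAlgebra.ι k (base a))
  | plus_minus : GWARel σ a (FreeAlgebra.ι k plus * FreeAlgebra.ι k minus)
      (FreeAlgebra.ι k (base (σ a)))

variable {k}

/-- The generalized Weyl algebra `D(a, σ)` of degree one over the commutative base ring `D`. -/
def GWA (a : D) (σ : D ≃ₐ[k] D) : Type _ := RingQuot (GWARel k σ a)

instance (a : D) (σ : D ≃ₐ[k] D) : Ring (GWA a σ) :=
  inferInstanceAs (Ring (RingQuot (GWARel k σ a)))

instance (a : D) (σ : D ≃ₐ[k] D) : Algebra k (GWA a σ) :=
  inferInstanceAs (Algebra k (RingQuot (GWARel k σ a)))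

namespace GWA

variable {a : D} {σ : D ≃ₐ[k] D}

/-- The quotient map from the free algebra. -/
def mk (a : D) (σ : D ≃ₐ[k] D) : FreeAlgebra k (GWAGen D) →ₐ[k] GWA a σ :=
  RingQuot.mkAlgHom k (GWARel k σ a)

lemma mk_rel {x y : FreeAlgebra k (GWAGen D)} (h : GWARel k σ a x y) : mk a σ x = mk a σ y :=
  RingQuot.mkAlgHom_rel k h

/-- The image in `D(a, σ)` of a generator. -/
def gen (a : D) (σ : D ≃ₐ[k] D) (x : GWAGen D) : GWA a σ := mk a σ (FreeAlgebra.ι k x)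

/-- The element `d` of the base ring, in `D(a, σ)`. -/
def base (a : D) (σ : D ≃ₐ[k] D) (d : D) : GWA a σ := gen a σ (.base d)

/-- The generator `X⁺`. -/
def Xp (a : D) (σ : D ≃ₐ[k] D) : GWA a σ := gen a σ .plus

/-- The generator `X⁻`. -/
def Xm (a : D) (σ : D ≃ₐ[k] D) : GWA a σ := gen a σ .minus

lemma base_add (d e : D) : base a σ (d + e) = base a σ d + base a σ e := by
  simpa [base, gen] using mk_rel (GWARel.base_add (σ := σ) (a := a) d e)

lemma base_mul (d e : D) : base a σ (d * e) = base a σ d * base a σ e := by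
  simpa [base, gen] using mk_rel (GWARel.base_mul (σ := σ) (a := a) d e)

lemma base_algebraMap (c : k) : base a σ (algebraMap k D c) = algebraMap k _ c := by
  simpa [base, gen] using mk_rel (GWARel.base_scalar (σ := σ) (a := a) c)

lemma Xp_base (d : D) : Xp a σ * base a σ d = base a σ (σ d) * Xp a σ := by
  simpa [base, gen, Xp] using mk_rel (GWARel.plus_base (σ := σ) (a := a) d)

lemma Xm_base (d : D) : Xm a σ * base a σ d = base a σ (σ.symm d) * Xm a σ := by
  simpa [base, gen, Xm] using mk_rel (GWARel.minus_base (σ := σ) (a := a) d)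

lemma Xm_Xp : Xm a σ * Xp a σ = base a σ a := by
  simpa [base, gen, Xm, Xp] using mk_rel (GWARel.minus_plus (σ := σ) (a := a))

lemma Xp_Xm : Xp a σ * Xm a σ = base a σ (σ a) := by
  simpa [base, gen, Xm, Xp] using mk_rel (GWARel.plus_minus (σ := σ) (a := a))

/-- The images of the generators under `D ∋ d ↦ d`, `X⁺ ↦ ζ X⁺`, `X⁻ ↦ ζ⁻¹ X⁻`. -/
def scaleGen (a : D) (σ : D ≃ₐ[k] D) (ζ : kˣ) : GWAGen D → GWA a σ
  | .base d => base a σ d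
  | .plus => (ζ : k) • Xp a σ
  | .minus => ((ζ⁻¹ : kˣ) : k) • Xm a σ

/-- The endomorphism of `D(a, σ)` fixing `D`, with `X⁺ ↦ ζ X⁺` and `X⁻ ↦ ζ⁻¹ X⁻`. -/
def scaleHom (a : D) (σ : D ≃ₐ[k] D) (ζ : kˣ) : GWA a σ →ₐ[k] GWA a σ :=
  RingQuot.liftAlgHom k (s := GWARel k σ a) ⟨FreeAlgebra.lift k (scaleGen a σ ζ), by
    intro x y h
    cases h <;>
      simp [scaleGen, base_add, base_mul, base_algebraMap, Xp_base, Xm_base, Xm_Xp, Xp_Xm]⟩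

lemma scaleHom_gen (ζ : kˣ) (x : GWAGen D) : scaleHom a σ ζ (gen a σ x) = scaleGen a σ ζ x :=
  (RingQuot.liftAlgHom_mkAlgHom_apply k (FreeAlgebra.lift k (scaleGen a σ ζ)) _ _).trans
    (FreeAlgebra.lift_ι_apply _ _)

lemma hom_ext {B : Type*} [Semiring B] [Algebra k B] {f g : GWA a σ →ₐ[k] B}
    (h : ∀ x, f (gen a σ x) = g (gen a σ x)) : f = g := by
  refine RingQuot.ringQuot_ext' k (s := GWARel k σ a) f g ?_
  ext x
  exact h x

lemma scaleHom_one : scaleHom a σ (1 : kˣ) = AlgHom.id k (GWA a σ) := by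
  apply hom_ext
  rintro (d | _ | _) <;> simp [scaleHom_gen, scaleGen, base, Xp, Xm]

lemma scaleHom_mul (ζ ξ : kˣ) :
    scaleHom a σ (ζ * ξ) = (scaleHom a σ ζ).comp (scaleHom a σ ξ) := by
  apply hom_ext
  rintro (d | _ | _)
  · simp [scaleHom_gen, scaleGen, base]
  · simp [scaleHom_gen, scaleGen, Xp, smul_smul, mul_comm]
  · simp [scaleHom_gen, scaleGen, Xm, smul_smul, mul_comm]

/-- The action of `kˣ` on `D(a, σ)` by automorphisms fixing `D`, with `ζ · X⁺ = ζ X⁺` and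
`ζ · X⁻ = ζ⁻¹ X⁻`. -/
def scale (a : D) (σ : D ≃ₐ[k] D) : kˣ →* (GWA a σ ≃ₐ[k] GWA a σ) where
  toFun ζ := AlgEquiv.ofAlgHom (scaleHom a σ ζ) (scaleHom a σ ζ⁻¹)
    (by rw [← scaleHom_mul, mul_inv_cancel, scaleHom_one])
    (by rw [← scaleHom_mul, inv_mul_cancel, scaleHom_one])
  map_one' := by
    ext x
    exact DFunLike.congr_fun scaleHom_one x
  map_mul' ζ ξ := by
    ext x
    exact DFunLike.congr_fun (scaleHom_mul ζ ξ) x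

end GWA

end GWA

/-! ### The groups `G(m,p,n)` and their action on tensor powers -/

section Action

variable (k : Type*) [Field k]

/-- The group of monomial `n × n` matrices: pairs of a vector of nonzero scalars and a
permutation. -/
abbrev MonomialGroup (n : ℕ) : Type _ :=
  (Fin n → kˣ) ⋊[mulAutArrow] Equiv.Perm (Fin n)

/-- The group `G(m,p,n) = A(m,p,n) ⋊ Sₙ`, where `A(m,p,n)` consists of the vectors
`(ζ₁, …, ζₙ)` of `m`-th roots of unity with `(ζ₁ ⋯ ζₙ) ^ (m / p) = 1`. -/
def complexReflectionGroup (m p n : ℕ) : Subgroup (MonomialGroup k n) where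
  carrier := {g | (∀ i, g.left i ^ m = 1) ∧ (∏ i, g.left i) ^ (m / p) = 1}
  one_mem' := by simp
  mul_mem' := by
    rintro g h ⟨hg1, hg2⟩ ⟨hh1, hh2⟩
    refine ⟨fun i => ?_, ?_⟩
    · simp only [SemidirectProduct.mul_left, Pi.mul_apply, mul_pow, hg1, one_mul]
      exact hh1 (g.right⁻¹ • i)
    · simp only [SemidirectProduct.mul_left, Pi.mul_apply, Finset.prod_mul_distrib, mul_pow, hg2,
        one_mul]
      rw [← hh2]
      congr 1
      exact Equiv.prod_comp (g.right⁻¹ : Equiv.Perm (Fin n)) h.left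
  inv_mem' := by
    rintro g ⟨hg1, hg2⟩
    refine ⟨fun i => ?_, ?_⟩
    · have := hg1 (g.right • i)
      simp only [SemidirectProduct.inv_left]
      change ((g.left⁻¹) (_ • i)) ^ m = 1
      simpa using this
    · have h : ∏ i, (g⁻¹).left i = ∏ i, (g.left i)⁻¹ := by
        rw [SemidirectProduct.inv_left]
        exact Equiv.prod_comp ((g.right⁻¹)⁻¹ : Equiv.Perm (Fin n)) (g.left⁻¹)
      rw [h, Finset.prod_inv_distrib, inv_pow, hg2, inv_one]

variable {k} {A : Type*} [Ring A] [Algebra k A] (n : ℕ)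

lemma linearMap_map_mul (f : (⨂[k] _ : Fin n, A) →ₗ[k] (⨂[k] _ : Fin n, A))
    (h : ∀ x y : Fin n → A, f (PiTensorProduct.tprod k (x * y)) =
      f (PiTensorProduct.tprod k x) * f (PiTensorProduct.tprod k y))
    (s t : ⨂[k] _ : Fin n, A) : f (s * t) = f s * f t := by
  refine (LinearMap.map_mul_iff f).2 ?_ s t
  ext x y
  simpa using h x y

lemma algEquiv_ext {e f : (⨂[k] _ : Fin n, A) ≃ₐ[k] (⨂[k] _ : Fin n, A)}
    (h : ∀ x : Fin n → A, e (PiTensorProduct.tprod k x) = f (PiTensorProduct.tprod k x)) :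
    e = f := by
  have : e.toLinearMap = f.toLinearMap := PiTensorProduct.ext (MultilinearMap.ext h)
  ext t
  exact DFunLike.congr_fun this t

/-- The automorphism `e₁ ⊗ ⋯ ⊗ eₙ` of `A^{⊗ n}`. -/
def tensorEquiv (e : Fin n → (A ≃ₐ[k] A)) : (⨂[k] _ : Fin n, A) ≃ₐ[k] (⨂[k] _ : Fin n, A) :=
  AlgEquiv.ofLinearEquiv (PiTensorProduct.congr fun i => (e i).toLinearEquiv)
    (by simp [PiTensorProduct.one_def, Pi.one_def])
    (linearMap_map_mul n (PiTensorProduct.congr fun i => (e i).toLinearEquiv).toLinearMap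
      fun x y => by simp; rfl)

lemma tensorEquiv_tprod (e : Fin n → (A ≃ₐ[k] A)) (x : Fin n → A) :
    tensorEquiv n e (PiTensorProduct.tprod k x) = PiTensorProduct.tprod k fun i => e i (x i) :=
  PiTensorProduct.congr_tprod (fun i => (e i).toLinearEquiv) x

/-- The automorphism of `A^{⊗ n}` moving the `i`-th factor to the `π(i)`-th place. -/
def permEquiv (π : Equiv.Perm (Fin n)) : (⨂[k] _ : Fin n, A) ≃ₐ[k] (⨂[k] _ : Fin n, A) :=
  AlgEquiv.ofLinearEquiv (PiTensorProduct.reindex k (fun _ => A) π)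
    (by simp [PiTensorProduct.one_def, Pi.one_def])
    (linearMap_map_mul n (PiTensorProduct.reindex k (fun _ => A) π).toLinearMap
      fun x y => by
        simp only [LinearEquiv.coe_coe, PiTensorProduct.reindex_tprod,
          PiTensorProduct.tprod_mul_tprod]
        rfl)

lemma permEquiv_tprod (π : Equiv.Perm (Fin n)) (x : Fin n → A) :
    permEquiv n π (PiTensorProduct.tprod k x) = PiTensorProduct.tprod k fun i => x (π.symm i) :=
  PiTensorProduct.reindex_tprod (R := k) (s := fun _ => A) π x

/-- The action of `(kˣ)ⁿ` on `A^{⊗ n}`, factor by factor, induced by an action of `kˣ` on `A`. -/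
def torusAction (τ : kˣ →* (A ≃ₐ[k] A)) :
    (Fin n → kˣ) →* ((⨂[k] _ : Fin n, A) ≃ₐ[k] (⨂[k] _ : Fin n, A)) where
  toFun ζ := tensorEquiv n fun i => τ (ζ i)
  map_one' := algEquiv_ext n fun x => by simp [tensorEquiv_tprod]
  map_mul' ζ ξ := algEquiv_ext n fun x => by simp [tensorEquiv_tprod]

/-- The action of `Sₙ` on `A^{⊗ n}` by permutation of the factors. -/
def permAction :
    Equiv.Perm (Fin n) →* ((⨂[k] _ : Fin n, A) ≃ₐ[k] (⨂[k] _ : Fin n, A)) where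
  toFun π := permEquiv n π
  map_one' := algEquiv_ext n fun x => by
    simp only [permEquiv_tprod, AlgEquiv.one_apply]
    rfl
  map_mul' π ρ := algEquiv_ext n fun x => by
    simp only [permEquiv_tprod, AlgEquiv.mul_apply]
    rfl

/-- The action of the monomial group on `A^{⊗ n}`. -/
def monomialAction (τ : kˣ →* (A ≃ₐ[k] A)) :
    MonomialGroup k n →* ((⨂[k] _ : Fin n, A) ≃ₐ[k] (⨂[k] _ : Fin n, A)) :=
  SemidirectProduct.lift (torusAction n τ) (permAction n) fun π => by
    refine MonoidHom.ext fun ζ => ?_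
    change torusAction n τ (mulAutArrow π ζ) = permAction n π * torusAction n τ ζ * (permAction n π)⁻¹
    rw [eq_mul_inv_iff_mul_eq]
    refine algEquiv_ext n fun x => ?_
    simp only [torusAction, permAction, MonoidHom.coe_mk, OneHom.coe_mk, AlgEquiv.mul_apply,
      permEquiv_tprod, tensorEquiv_tprod]
    rfl

/-- The subalgebra of `G(m,p,n)`-invariants of `A^{⊗ n}`. -/
def invariants (m p : ℕ) (τ : kˣ →* (A ≃ₐ[k] A)) : Subalgebra k (⨂[k] _ : Fin n, A) where
  carrier := {x | ∀ g ∈ complexReflectionGroup k m p n, monomialAction n τ g x = x}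
  mul_mem' hx hy g hg := by rw [map_mul, hx g hg, hy g hg]
  add_mem' hx hy g hg := by rw [map_add, hx g hg, hy g hg]
  algebraMap_mem' c g _ := by rw [AlgEquiv.commutes]

end Action

/-- `Dⁿ(aⁿ, σⁿ)^{G(m,p,n)}`: the `G(m,p,n)`-invariants of the `n`-th tensor power of the
generalized Weyl algebra `D(a, σ)`. -/
abbrev GWAInvariants {k : Type*} [Field k] {D : Type*} [CommRing D] [Algebra k D]
    (m p n : ℕ) (a : D) (σ : D ≃ₐ[k] D) : Subalgebra k (⨂[k] _ : Fin n, GWA a σ) :=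
  invariants n m p (GWA.scale a σ)

/-! ### Weyl algebras and quantum planes -/

section Targets

variable (k : Type*) [Field k]

/-- Defining relations of the `n`-th Weyl algebra: generators `xᵢ = ι (inl i)`, `yᵢ = ι (inr i)`
with `xᵢ xⱼ = xⱼ xᵢ`, `yᵢ yⱼ = yⱼ yᵢ` and `yᵢ xⱼ = xⱼ yᵢ + δᵢⱼ`. -/
inductive WeylRel (n : ℕ) :
    FreeAlgebra k (Fin n ⊕ Fin n) → FreeAlgebra k (Fin n ⊕ Fin n) → Prop
  | xx (i j : Fin n) : WeylRel n
      (FreeAlgebra.ι k (.inl i) * FreeAlgebra.ι k (.inl j))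
      (FreeAlgebra.ι k (.inl j) * FreeAlgebra.ι k (.inl i))
  | yy (i j : Fin n) : WeylRel n
      (FreeAlgebra.ι k (.inr i) * FreeAlgebra.ι k (.inr j))
      (FreeAlgebra.ι k (.inr j) * FreeAlgebra.ι k (.inr i))
  | yx (i j : Fin n) : WeylRel n
      (FreeAlgebra.ι k (.inr i) * FreeAlgebra.ι k (.inl j))
      (FreeAlgebra.ι k (.inl j) * FreeAlgebra.ι k (.inr i) + if i = j then 1 else 0)

/-- The `n`-th Weyl algebra `Wₙ(k)`. -/
def WeylAlgebra (n : ℕ) : Type _ := RingQuot (WeylRel k n)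

instance (n : ℕ) : Ring (WeylAlgebra k n) := inferInstanceAs (Ring (RingQuot (WeylRel k n)))

instance (n : ℕ) : Algebra k (WeylAlgebra k n) :=
  inferInstanceAs (Algebra k (RingQuot (WeylRel k n)))

/-- Defining relation of the quantum plane: generators `x = ι false`, `y = ι true` with
`y x = q x y`. -/
inductive QuantumPlaneRel (q : k) : FreeAlgebra k Bool → FreeAlgebra k Bool → Prop
  | yx : QuantumPlaneRel q (FreeAlgebra.ι k true * FreeAlgebra.ι k false)
      (q • (FreeAlgebra.ι k false * FreeAlgebra.ι k true))

/-- The quantum plane `k_q[x, y]`. -/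
def QuantumPlane (q : k) : Type _ := RingQuot (QuantumPlaneRel k q)

instance (q : k) : Ring (QuantumPlane k q) := inferInstanceAs (Ring (RingQuot (QuantumPlaneRel k q)))

instance (q : k) : Algebra k (QuantumPlane k q) :=
  inferInstanceAs (Algebra k (RingQuot (QuantumPlaneRel k q)))

end Targets

end GWANoether

end

open GWANoether

noncomputable section

namespace GWANoether

/-! ### Polynomial growth and the Ore condition -/

section Growth

/-! Everything takes place in one division ring `E`, the skew field of fractions of the whole tensor
power D(a,σ)^{⊗n}. Sending X⁺ of the i-th factor to the i-th generator of ℤⁿ embeds the tensor power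
in a skew group ring of ℤⁿ over (Laurent) polynomials (`gwaEmb_injective`). That ring is a domain of
polynomial growth, and all subalgebras of such a domain are Ore
(`HasPolyGrowth.isOreDomain_of_injective`). It then suffices to map the target algebra injectively
into `E` so that its image generates the same skew subfield as the invariants
(`fracIsomorphic_of_skewAdjoin_eq`).

Write xᵢ for Xᵢ⁺, let `L` be the double commutant of the xᵢ, which is a commutative field, and put
tᵢ = xᵢ^m, y = (x₁⋯xₙ)^{m/p}. The comparison with the invariants is an averaging argument. Let `T`
be a skew subfield fixed pointwise by G(m,p,n) and containing k, y and the symmetric functions of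
the tᵢ. The sum of a Laurent monomial x^λ over the group is zero if the corresponding character of
A(m,p,n) is nontrivial, and otherwise a power of y times a symmetric polynomial in the tᵢ
(`Frame.IsGood.sum_monomial_mem`). Hence every invariant in the right `T`-span of the Laurent
monomials lies in `T` (`Frame.IsGood.mem_of_fixed`), and `T` contains all the invariants as soon as
the base ring preserves this span. Conversely the generators of `T` are quotients of invariants,
obtained by clearing the denominators tᵢ - tⱼ.

Classical type: hᵢ acts on `L` as xᵢ∂/∂xᵢ. With cᵢ = ∏_{j≠i}(tᵢ - tⱼ)⁻¹, Lagrange interpolation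
shows that the fields ∑ tᵢ^d cᵢ ∂/∂tᵢ are dual, up to sign, to the coefficients of ∏(X - tᵢ)
(`Frame.IsClassical.field_symm`). Since y^p is the constant coefficient up to sign, y can replace
that coefficient. The coordinates y, p₁, …, p_{n-1} and their dual fields satisfy the Weyl relations
and generate `T`.

Quantum type: hᵢ acts on `L` by xᵢ ↦ q⁻¹xᵢ. The polynomials P = ∏(1 - X/tⱼ) and Q = ∑ cⱼ ∏_{i≠j}(X -
tᵢ) hⱼ satisfy quadratic exchange relations (`IsShiftSystem.isExchange`). A noncommutative Euclidean
step splits off the leading coefficients a, b, which q^m-commute, and leaves a pair of lower degree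
which commutes with a and b and satisfies the same relations (`IsExchange.reduce`). Iteration gives
n commuting q^m-pairs. In the first pair a = ±y⁻ᵖ is replaced by y, which changes the parameter to
q^{m/p}. The leading coefficients never vanish: letting one hᵢ tend to infinity, along an embedding
of `E` in Laurent series, the reduced pair tends to a pair of the same kind in the remaining
variables (`IsShiftSystem.isNondegenerate`). -/

/-- A `k`-algebra has polynomial growth if it has an exhaustive multiplicative filtration by
finite-dimensional subspaces whose dimensions are polynomially bounded. -/
def HasPolyGrowth (k S : Type*) [Field k] [Ring S] [Algebra k S] : Prop :=
  ∃ V : ℕ → Submodule k S, Monotone V ∧ (∀ i j, ∀ x ∈ V i, ∀ y ∈ V j, x * y ∈ V (i + j)) ∧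
    (∀ x, ∃ i, x ∈ V i) ∧ (∀ i, FiniteDimensional k (V i)) ∧
    ∃ c d : ℕ, ∀ i, Module.finrank k (V i) ≤ c * (i + 1) ^ d

/-- Contradicts a dimension that doubles with every increase of the filtration degree by `e`. -/
lemma exists_poly_lt_two_pow (c d a e : ℕ) : ∃ j : ℕ, c * (a + j * e + 1) ^ d < 2 ^ j := by
  have h1 := tendsto_pow_const_div_const_pow_of_one_lt (r := (2 : ℝ)) d (by norm_num)
  have h2 := h1.eventually (gt_mem_nhds (show (0 : ℝ) < 1 / (c * (a + e + 1) ^ d + 1) by positivity))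
  obtain ⟨j, hj, hj1⟩ := (h2.and (Filter.eventually_ge_atTop 1)).exists
  refine ⟨j, ?_⟩
  rw [div_lt_div_iff₀ (by positivity) (by positivity), one_mul] at hj
  -- This uses `1 ≤ j` and separates `j` from the constants, so that only the limit of j^d / 2^j is
  -- needed.
  have h3 : a + j * e + 1 ≤ j * (a + e + 1) := by nlinarith
  have h4 : c * (a + j * e + 1) ^ d ≤ j ^ d * (c * (a + e + 1) ^ d + 1) := by
    calc c * (a + j * e + 1) ^ d ≤ c * (j * (a + e + 1)) ^ d := by gcongr
      _ = j ^ d * (c * (a + e + 1) ^ d) := by rw [mul_pow]; ring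
      _ ≤ _ := by gcongr; omega
  refine lt_of_le_of_lt h4 ?_
  exact_mod_cast hj

variable {k R S : Type*} [Field k] [Ring R] [Algebra k R] [Ring S] [Algebra k S]

lemma HasPolyGrowth.of_injective (h : HasPolyGrowth k S) (f : R →ₐ[k] S)
    (hf : Function.Injective f) : HasPolyGrowth k R := by
  obtain ⟨V, hm, hmul, hex, hfd, c, d, hcd⟩ := h
  have key : ∀ i, ∃ g : (V i).comap f.toLinearMap →ₗ[k] V i, Function.Injective g := fun i =>
    ⟨f.toLinearMap.restrict (fun x hx => hx), fun x y hxy => by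
      have := congrArg Subtype.val hxy
      exact Subtype.ext (hf this)⟩
  refine ⟨fun i => (V i).comap f.toLinearMap, fun i j hij => Submodule.comap_mono (hm hij), ?_, ?_,
    ?_, c, d, ?_⟩
  · intro i j x hx y hy
    simpa using hmul i j _ hx _ hy
  · intro x
    exact hex (f x)
  · intro i
    obtain ⟨g, hg⟩ := key i
    exact Module.Finite.of_injective g hg
  · intro i
    obtain ⟨g, hg⟩ := key i
    exact (LinearMap.finrank_le_finrank_of_injective hg).trans (hcd i)

/-- The counting argument behind the Ore conditions: an operation `μ` on a filtered space raising
the filtration degree by `e` has a nontrivial coincidence. -/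
lemma exists_coincidence {M : Type*} [AddCommGroup M] [Module k M] (V : ℕ → Submodule k M)
    (hfd : ∀ i, FiniteDimensional k (V i)) (c d e N : ℕ)
    (hcd : ∀ i, Module.finrank k (V i) ≤ c * (i + 1) ^ d) (hN : V N ≠ ⊥)
    (f g : M →ₗ[k] M) (hf : ∀ i, ∀ x ∈ V i, f x ∈ V (i + e)) (hg : ∀ i, ∀ x ∈ V i, g x ∈ V (i + e)) :
    ∃ x y : M, (x ≠ 0 ∨ y ≠ 0) ∧ f x = g y := by
  by_contra! hcon
  -- If there is no coincidence, (x, y) ↦ f x - g y embeds two copies of `V i` in `V (i + e)`.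
  have step : ∀ i, 2 * Module.finrank k (V i) ≤ Module.finrank k (V (i + e)) := by
    intro i
    let F : (V i × V i) →ₗ[k] V (i + e) :=
      (f.restrict (hf i)).coprod (-(g.restrict (hg i)))
    have hF : Function.Injective F := by
      rw [← LinearMap.ker_eq_bot, LinearMap.ker_eq_bot']
      rintro ⟨x, y⟩ hxy
      have h1 : f x - g y = 0 := by
        have := congrArg Subtype.val hxy
        simpa [F, sub_eq_add_neg] using this
      by_contra hne
      refine hcon x y ?_ (sub_eq_zero.1 h1)
      by_contra! h0
      exact hne (Prod.ext (Subtype.ext h0.1) (Subtype.ext h0.2))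
    have := LinearMap.finrank_le_finrank_of_injective hF
    rwa [Module.finrank_prod, ← two_mul] at this
  have hpos : 1 ≤ Module.finrank k (V N) := by
    rw [Nat.one_le_iff_ne_zero, Ne, Submodule.finrank_eq_zero]
    exact hN
  have grow : ∀ j, 2 ^ j ≤ Module.finrank k (V (N + j * e)) := by
    intro j
    induction j with
    | zero => simpa using hpos
    | succ j ih =>
      have := step (N + j * e)
      rw [show N + (j + 1) * e = N + j * e + e by ring, pow_succ]
      omega
  obtain ⟨j, hj⟩ := exists_poly_lt_two_pow c d N e
  exact absurd ((grow j).trans (hcd _)) (not_le.2 hj)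

/-- Both Ore conditions are coincidences of two multiplication operators, which polynomial growth
forces. In a domain with `s ≠ 0` the multiplier of `r` cannot vanish, since then the multiplier of
`s` would vanish too. -/
theorem HasPolyGrowth.isOreDomain [IsDomain R] (h : HasPolyGrowth k R) : IsOreDomain R := by
  obtain ⟨V, hm, hmul, hex, hfd, c, d, hcd⟩ := h
  have key : ∀ r s : R, ∃ e N, r ∈ V e ∧ s ∈ V e ∧ V N ≠ ⊥ := fun r s => by
    obtain ⟨i, hi⟩ := hex r
    obtain ⟨j, hj⟩ := hex s
    obtain ⟨N, hN⟩ := hex 1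
    refine ⟨i + j, N, hm (Nat.le_add_right _ _) hi, hm (Nat.le_add_left _ _) hj, fun h0 => ?_⟩
    rw [h0, Submodule.mem_bot] at hN
    exact one_ne_zero hN
  constructor
  · intro r s hs
    obtain ⟨e, N, hr, hs', hN⟩ := key r s
    by_cases hr0 : r = 0
    · exact ⟨0, 1, one_ne_zero, by simp [hr0]⟩
    obtain ⟨x, y, hxy, h⟩ := exists_coincidence V hfd c d e N hcd hN (LinearMap.mulRight k r)
      (LinearMap.mulRight k s) (fun i x hx => hmul i e x hx r hr) (fun i x hx => hmul i e x hx s hs')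
    simp only [LinearMap.mulRight_apply] at h
    refine ⟨y, x, fun hx => ?_, h⟩
    rw [hx, zero_mul] at h
    rcases mul_eq_zero.1 h.symm with hy | hy
    · simp [hx, hy] at hxy
    · exact hs hy
  · intro r s hs
    obtain ⟨e, N, hr, hs', hN⟩ := key r s
    by_cases hr0 : r = 0
    · exact ⟨0, 1, one_ne_zero, by simp [hr0]⟩
    obtain ⟨x, y, hxy, h⟩ := exists_coincidence V hfd c d e N hcd hN (LinearMap.mulLeft k r)
      (LinearMap.mulLeft k s) (fun i x hx => add_comm e i ▸ hmul e i r hr x hx)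
      (fun i x hx => add_comm e i ▸ hmul e i s hs' x hx)
    simp only [LinearMap.mulLeft_apply] at h
    refine ⟨y, x, fun hx => ?_, h⟩
    rw [hx, mul_zero] at h
    rcases mul_eq_zero.1 h.symm with hy | hy
    · exact hs hy
    · simp [hx, hy] at hxy

/-- A subalgebra, up to isomorphism, of a domain of polynomial growth is an Ore domain. -/
theorem HasPolyGrowth.isOreDomain_of_injective [IsDomain S] (h : HasPolyGrowth k S)
    (f : R →ₐ[k] S) (hf : Function.Injective f) : IsOreDomain R :=
  haveI : IsDomain R := hf.isDomain f.toRingHom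
  (h.of_injective f hf).isOreDomain

end Growth

/-! ### Skew fields of fractions inside a division ring -/

section Frac

variable {k R E : Type*} [Field k] [Ring R] [Algebra k R] [DivisionRing E] [Algebra k E]

/-- The canonical map of an Ore domain to its skew field of fractions. -/
def toFrac (k R : Type*) [Field k] [Ring R] [Algebra k R] [IsOreDomain R] : R →ₐ[k] SkewFrac R :=
  { OreLocalization.numeratorRingHom (R := R) (S := R⁰) with commutes' := fun _ => rfl }

lemma toFrac_injective [IsOreDomain R] : Function.Injective (toFrac k R) :=
  OreLocalization.numeratorHom_inj (S := R⁰) inf_le_left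

/-- A homomorphism from an Ore domain to a ring under which nonzero elements become invertible
extends to the skew field of fractions. -/
def fracLiftRingHom [IsOreDomain R] {H : Type*} [Ring H] (f : R →+* H)
    (hf : ∀ r, r ≠ 0 → IsUnit (f r)) : SkewFrac R →+* H :=
  OreLocalization.universalHom f
    { toFun := fun s => (hf s (nonZeroDivisors.ne_zero s.2)).unit
      map_one' := by ext; simp
      map_mul' := fun x y => by ext; simp }
    (fun s => by simp)

lemma fracLiftRingHom_toFrac [IsOreDomain R] {H : Type*} [Ring H] (f : R →+* H)
    (hf : ∀ r, r ≠ 0 → IsUnit (f r)) (r : R) : fracLiftRingHom f hf (toFrac k R r) = f r :=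
  OreLocalization.universalHom_commutes _ _ _

lemma exists_div_eq [IsOreDomain R] (x : SkewFrac R) :
    ∃ r s : R, s ≠ 0 ∧ x = (toFrac k R s)⁻¹ * toFrac k R r := by
  induction x using OreLocalization.ind with
  | _ r s =>
  have hs : (s : R) ≠ 0 := nonZeroDivisors.ne_zero s.2
  refine ⟨r, s, hs, ?_⟩
  have h0 : toFrac k R s ≠ 0 := fun h => hs (toFrac_injective (k := k) (by rw [h, map_zero]))
  rw [eq_inv_mul_iff_mul_eq₀ h0]
  exact OreLocalization.numeratorHom_apply (S := R⁰) (r := r) ▸ by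
    change (s : R) /ₒ (1 : R⁰) * (r /ₒ s) = r /ₒ 1
    rw [OreLocalization.mul_cancel]

/-- The extension of an injective algebra homomorphism to the skew field of fractions. -/
def fracLift [IsOreDomain R] (f : R →ₐ[k] E) (hf : Function.Injective f) : SkewFrac R →ₐ[k] E :=
  { fracLiftRingHom f.toRingHom (fun r hr => IsUnit.mk0 _ (by
      intro h; exact hr (hf (by rw [map_zero]; exact h)))) with
    commutes' := fun c => by
      have := fracLiftRingHom_toFrac (k := k) f.toRingHom (fun r hr => IsUnit.mk0 _ (by
        intro h; exact hr (hf (by rw [map_zero]; exact h)))) (algebraMap k R c)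
      rw [AlgHom.commutes] at this
      exact this.trans (f.commutes c) }

@[simp] lemma fracLift_toFrac [IsOreDomain R] (f : R →ₐ[k] E) (hf : Function.Injective f) (r : R) :
    fracLift f hf (toFrac k R r) = f r :=
  fracLiftRingHom_toFrac f.toRingHom (fun r hr => IsUnit.mk0 _ (by
    intro h; exact hr (hf (by rw [map_zero]; exact h)))) r

lemma fracLift_injective [IsOreDomain R] (f : R →ₐ[k] E) (hf : Function.Injective f) :
    Function.Injective (fracLift f hf) :=
  (fracLift f hf).toRingHom.injective

variable (k) in
/-- The skew subfield of `E` generated over `k` by a set. -/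
def skewAdjoin (s : Set E) : Subfield E := Subfield.closure (Set.range (algebraMap k E) ∪ s)

lemma subset_skewAdjoin (s : Set E) : s ⊆ skewAdjoin k s :=
  Set.subset_union_right.trans Subfield.subset_closure

lemma algebraMap_mem_skewAdjoin (s : Set E) (c : k) : algebraMap k E c ∈ skewAdjoin k s :=
  Subfield.subset_closure (Or.inl ⟨c, rfl⟩)

lemma skewAdjoin_le {s : Set E} {T : Subfield E} (h1 : ∀ c : k, algebraMap k E c ∈ T)
    (h2 : s ⊆ T) : skewAdjoin k s ≤ T :=
  Subfield.closure_le.2 (Set.union_subset (by rintro _ ⟨c, rfl⟩; exact h1 c) h2)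

lemma skewAdjoin_le_skewAdjoin {s t : Set E} (h : s ⊆ skewAdjoin k t) :
    skewAdjoin k s ≤ skewAdjoin k t :=
  skewAdjoin_le (algebraMap_mem_skewAdjoin t) h

/-- Every fraction s⁻¹r maps into the skew field generated by the image. Conversely the range is
itself a skew field containing the generators. -/
lemma mem_range_fracLift [IsOreDomain R] (f : R →ₐ[k] E) (hf : Function.Injective f) {x : E} :
    x ∈ (fracLift f hf).range ↔ x ∈ skewAdjoin k (Set.range f) := by
  constructor
  · rintro ⟨y, rfl⟩
    obtain ⟨r, s, hs, rfl⟩ := exists_div_eq (k := k) y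
    simp only [AlgHom.toRingHom_eq_coe, RingHom.coe_coe, map_mul, map_inv₀, fracLift_toFrac]
    exact mul_mem (inv_mem (subset_skewAdjoin _ ⟨s, rfl⟩)) (subset_skewAdjoin _ ⟨r, rfl⟩)
  · intro hx
    have : skewAdjoin k (Set.range f) ≤ (fracLift f hf).toRingHom.fieldRange := by
      refine skewAdjoin_le (fun c => ⟨algebraMap k _ c, (fracLift f hf).commutes c⟩) ?_
      rintro _ ⟨r, rfl⟩
      exact ⟨toFrac k R r, fracLift_toFrac f hf r⟩
    exact this hx

/-- Both skew fields of fractions are identified with the same subset of `E`, so the isomorphism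
need not be given by formulas. -/
theorem fracIsomorphic_of_skewAdjoin_eq {R' : Type*} [Ring R'] [Algebra k R'] [IsOreDomain R]
    [IsOreDomain R'] (f : R →ₐ[k] E) (hf : Function.Injective f) (g : R' →ₐ[k] E)
    (hg : Function.Injective g)
    (h : skewAdjoin k (Set.range f) = skewAdjoin k (Set.range g)) : FracIsomorphic k R R' := by
  refine ⟨inferInstance, inferInstance, ⟨?_⟩⟩
  have hr : (fracLift f hf).range = (fracLift g hg).range := by
    ext x
    rw [mem_range_fracLift, mem_range_fracLift, h]
  exact (AlgEquiv.ofInjective _ (fracLift_injective f hf)).trans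
    ((Subalgebra.equivOfEq _ _ hr).trans (AlgEquiv.ofInjective _ (fracLift_injective g hg)).symm)

end Frac

/-! ### Homomorphisms out of tensor powers -/

section ProdHom

variable {k B S : Type*} [Field k] [Ring B] [Algebra k B] [Ring S] [Algebra k S]

/-- Multiplicativity on pure tensors of the map out of a tensor power: the images of different
factors commute, so the two products can be interleaved. -/
lemma list_prod_ofFn_mul {M : Type*} [Monoid M] {n : ℕ} (x y : Fin n → M)
    (h : ∀ i j, i ≠ j → Commute (x i) (y j)) :
    (List.ofFn fun i => x i * y i).prod = (List.ofFn x).prod * (List.ofFn y).prod := by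
  induction n with
  | zero => simp
  | succ n ih =>
    rw [List.ofFn_succ, List.ofFn_succ, List.ofFn_succ, List.prod_cons, List.prod_cons,
      List.prod_cons, ih _ _ fun i j hij => h _ _ fun h' => hij (Fin.succ_injective _ h')]
    have hc : Commute (List.ofFn fun i : Fin n => x i.succ).prod (y 0) := by
      refine Commute.list_prod_left _ _ fun z hz => ?_
      obtain ⟨i, rfl⟩ := (List.mem_ofFn' _ _).1 hz
      exact h _ _ (Fin.succ_ne_zero i)
    rw [mul_assoc, mul_assoc, ← mul_assoc (y 0), ← hc.eq, mul_assoc]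

lemma list_prod_ofFn_mulSingle {M : Type*} [Monoid M] {n : ℕ} (i : Fin n) (x : M) :
    (List.ofFn (Pi.mulSingle i x : Fin n → M)).prod = x := by
  induction n with
  | zero => exact i.elim0
  | succ n ih =>
    rw [List.ofFn_succ, List.prod_cons]
    refine Fin.cases ?_ (fun j => ?_) i
    · have : (fun j : Fin n => (Pi.mulSingle 0 x : Fin (n + 1) → M) j.succ) = fun _ => 1 := by
        funext j
        exact Pi.mulSingle_eq_of_ne (Fin.succ_ne_zero j) x
      rw [this, Pi.mulSingle_eq_same]
      simp
    · have : (fun l : Fin n => (Pi.mulSingle j.succ x : Fin (n + 1) → M) l.succ)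
          = Pi.mulSingle j x := by
        funext l
        by_cases h : l = j
        · subst h; simp
        · rw [Pi.mulSingle_eq_of_ne h, Pi.mulSingle_eq_of_ne (by simpa using h)]
      rw [this, ih, Pi.mulSingle_eq_of_ne (Fin.succ_ne_zero j).symm, one_mul]

/-- The homomorphism `B^{⊗ n} → S` given by homomorphisms `B → S` with commuting images. -/
def prodHom {n : ℕ} (φ : Fin n → B →ₐ[k] S)
    (h : ∀ i j, i ≠ j → ∀ x y, Commute (φ i x) (φ j y)) : (⨂[k] _ : Fin n, B) →ₐ[k] S :=
  PiTensorProduct.liftAlgHom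
    ((MultilinearMap.mkPiAlgebraFin k n S).compLinearMap fun i => (φ i).toLinearMap)
    (by simp [MultilinearMap.mkPiAlgebraFin_apply])
    (fun x y => by
      simp only [MultilinearMap.compLinearMap_apply, MultilinearMap.mkPiAlgebraFin_apply,
        AlgHom.toLinearMap_apply, Pi.mul_apply, map_mul]
      exact list_prod_ofFn_mul _ _ fun i j hij => h i j hij _ _)

lemma prodHom_tprod {n : ℕ} (φ : Fin n → B →ₐ[k] S)
    (h : ∀ i j, i ≠ j → ∀ x y, Commute (φ i x) (φ j y)) (x : Fin n → B) :
    prodHom φ h (PiTensorProduct.tprod k x) = (List.ofFn fun i => φ i (x i)).prod := by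
  simp [prodHom, PiTensorProduct.liftAlgHom, MultilinearMap.mkPiAlgebraFin_apply]

lemma prodHom_single {n : ℕ} (φ : Fin n → B →ₐ[k] S)
    (h : ∀ i j, i ≠ j → ∀ x y, Commute (φ i x) (φ j y)) (i : Fin n) (x : B) :
    prodHom φ h (PiTensorProduct.singleAlgHom i x) = φ i x := by
  rw [PiTensorProduct.singleAlgHom_apply, prodHom_tprod, ← list_prod_ofFn_mulSingle i (φ i x)]
  congr 2
  funext j
  by_cases hj : j = i
  · subst hj; simp
  · simp [Pi.mulSingle_eq_of_ne hj]

lemma single_commute {n : ℕ} {i j : Fin n} (hij : i ≠ j) (x y : B) :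
    Commute (PiTensorProduct.singleAlgHom i x : ⨂[k] _ : Fin n, B)
      (PiTensorProduct.singleAlgHom j y) := by
  simp only [PiTensorProduct.singleAlgHom_apply]
  exact Commute.tprod (Pi.mulSingle_commute (f := fun _ : Fin n => B) hij x y)

/-- The tensor power is generated by the elements of the factors. -/
lemma tensor_induction {n : ℕ} (U : Subalgebra k (⨂[k] _ : Fin n, B))
    (h : ∀ i x, PiTensorProduct.singleAlgHom i x ∈ U) : U = ⊤ := by
  rw [eq_top_iff]
  -- The inclusions of the factors into `U` assemble to a map of the whole tensor power, which is a
  -- right inverse of the inclusion of `U`.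
  let ψ : (⨂[k] _ : Fin n, B) →ₐ[k] U := prodHom
    (fun i => (PiTensorProduct.singleAlgHom i).codRestrict U (h i))
    (fun i j hij x y => Subtype.ext (single_commute hij x y).eq)
  have : U.val.comp ψ = AlgHom.id k _ := by
    ext i x
    have := prodHom_single (fun i => (PiTensorProduct.singleAlgHom i).codRestrict U (h i))
      (fun i j hij x y => Subtype.ext (single_commute hij x y).eq) i x
    exact congrArg Subtype.val this
  intro x _
  have hx := DFunLike.congr_fun this x
  simp only [AlgHom.comp_apply, AlgHom.id_apply] at hx
  rw [← hx]
  exact (ψ x).2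

end ProdHom

/-! ### Skew group rings of `ℤⁿ` -/

section Skew

variable {k D : Type*} [Field k] [CommRing D] [Algebra k D] {n : ℕ}
  [MulSemiringAction (Multiplicative (Fin n → ℤ)) D]
  
/-- ℤⁿ has unique products: among two finite nonempty supports some product arises in exactly one
way. The coefficient of `a * b` there is one product of nonzero elements of `D`, because the action
is by bijections. -/
instance skew_isDomain [IsDomain D] :
    IsDomain (SkewMonoidAlgebra D (Multiplicative (Fin n → ℤ))) := by
  have : NoZeroDivisors (SkewMonoidAlgebra D (Multiplicative (Fin n → ℤ))) := by
    refine ⟨fun {a b} hab => ?_⟩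
    contrapose! hab
    have ha : a.support.Nonempty := by
      rw [Finset.nonempty_iff_ne_empty, Ne, SkewMonoidAlgebra.support_eq_empty]; exact hab.1
    have hb : b.support.Nonempty := by
      rw [Finset.nonempty_iff_ne_empty, Ne, SkewMonoidAlgebra.support_eq_empty]; exact hab.2
    obtain ⟨da, a0, db, b0, h⟩ := UniqueProds.uniqueMul_of_nonempty ha hb
    intro h0
    have key : (a * b).coeff (da * db) = a.coeff da * (da • b.coeff db) := by
      classical
      rw [SkewMonoidAlgebra.coeff_mul, SkewMonoidAlgebra.sum_def, Finsupp.sum, Finset.sum_eq_single da]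
      · rw [SkewMonoidAlgebra.sum_def, Finsupp.sum, Finset.sum_eq_single db]
        · simp
        · intro y hy hne
          rw [if_neg fun he => hne (h a0 hy he).2]
        · intro hdb
          exact absurd b0 hdb
      · intro x hx hne
        rw [SkewMonoidAlgebra.sum_def, Finsupp.sum]
        refine Finset.sum_eq_zero fun y hy => ?_
        rw [if_neg fun he => hne (h hx hy he).1]
      · intro hda
        exact absurd a0 hda
    rw [h0, SkewMonoidAlgebra.coeff_zero] at key
    rcases mul_eq_zero.1 key.symm with h1 | h1
    · exact SkewMonoidAlgebra.mem_support_iff.1 a0 h1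
    · rw [smul_eq_zero_iff_eq] at h1
      exact SkewMonoidAlgebra.mem_support_iff.1 b0 h1
  exact NoZeroDivisors.to_isDomain _

variable [SMulCommClass (Multiplicative (Fin n → ℤ)) k D]

/-- Filter by coefficients in `W N` and exponents in the box [-N, N]ⁿ. Invariance of `W N` under the
group makes this multiplicative, and the dimension is at most (2N+1)ⁿ times that of `W N`. -/
theorem skew_hasPolyGrowth (W : ℕ → Submodule k D) (hm : Monotone W)
    (hmul : ∀ i j, ∀ x ∈ W i, ∀ y ∈ W j, x * y ∈ W (i + j)) (hex : ∀ x, ∃ i, x ∈ W i)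
    (hfd : ∀ i, FiniteDimensional k (W i)) (c d : ℕ)
    (hcd : ∀ i, Module.finrank k (W i) ≤ c * (i + 1) ^ d)
    (hst : ∀ (g : Multiplicative (Fin n → ℤ)) i, ∀ x ∈ W i, g • x ∈ W i) :
    HasPolyGrowth k (SkewMonoidAlgebra D (Multiplicative (Fin n → ℤ))) := by
  classical
  let box : ℕ → Finset (Fin n → ℤ) := fun N => Finset.Icc (fun _ => -(N : ℤ)) (fun _ => (N : ℤ))
  have hbox : ∀ N v, v ∈ box N ↔ ∀ i, |v i| ≤ N := fun N v => by
    simp only [box, Finset.mem_Icc, Pi.le_def, abs_le, forall_and]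
  let V : ℕ → Submodule k (SkewMonoidAlgebra D (Multiplicative (Fin n → ℤ))) := fun N =>
    { carrier := {f | ∀ g, f.coeff g ∈ W N ∧ (f.coeff g ≠ 0 → Multiplicative.toAdd g ∈ box N)}
      zero_mem' := fun g => by simp
      add_mem' := fun {f f'} hf hf' g => by
        rw [SkewMonoidAlgebra.coeff_add, Finsupp.add_apply]
        refine ⟨add_mem (hf g).1 (hf' g).1, fun h => ?_⟩
        by_cases h0 : f.coeff g = 0
        · rw [h0, zero_add] at h
          exact (hf' g).2 h
        · exact (hf g).2 h0
      smul_mem' := fun r f hf g => by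
        rw [SkewMonoidAlgebra.coeff_smul, Finsupp.smul_apply]
        refine ⟨Submodule.smul_mem _ _ (hf g).1, fun h => (hf g).2 fun h0 => h ?_⟩
        rw [h0, smul_zero] }
  -- An element of `V N` is determined by its coefficients at the finitely many exponents in the
  -- box.
  have key : ∀ N, ∃ F : V N →ₗ[k] (box N → W N), Function.Injective F := fun N => by
    refine ⟨{ toFun := fun f v => ⟨f.1.coeff (Multiplicative.ofAdd v.1), (f.2 _).1⟩
              map_add' := fun f f' => by
                funext v
                exact Subtype.ext (by simp)
              map_smul' := fun r f => by
                funext v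
                exact Subtype.ext (by simp) }, ?_⟩
    intro f f' h
    refine Subtype.ext (SkewMonoidAlgebra.ext fun g => ?_)
    by_cases hg : Multiplicative.toAdd g ∈ box N
    · have := congrArg Subtype.val (congrFun h ⟨Multiplicative.toAdd g, hg⟩)
      exact this
    · rw [not_imp_comm.1 (f.2 g).2 hg, not_imp_comm.1 (f'.2 g).2 hg]
  refine ⟨V, ?_, ?_, ?_, ?_, c * 2 ^ n, n + d, ?_⟩
  · intro i j hij f hf g
    refine ⟨hm hij (hf g).1, fun h => ?_⟩
    rw [hbox]
    exact fun l => ((hbox _ _).1 ((hf g).2 h) l).trans (by exact_mod_cast hij)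
  · intro i j x hx y hy g
    have hsum : ∀ g, (x * y).coeff g = ∑ a ∈ x.support, ∑ b ∈ y.support,
        if a * b = g then x.coeff a * (a • y.coeff b) else 0 := fun g => by
      rw [SkewMonoidAlgebra.coeff_mul, SkewMonoidAlgebra.sum_def, Finsupp.sum]
      rfl
    rw [hsum]
    refine ⟨Submodule.sum_mem _ fun a _ => Submodule.sum_mem _ fun b _ => ?_, fun h => ?_⟩
    · split_ifs
      · exact hmul _ _ _ (hx a).1 _ (hst _ _ _ (hy b).1)
      · exact zero_mem _
    · obtain ⟨a, ha, h1⟩ := Finset.exists_ne_zero_of_sum_ne_zero h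
      obtain ⟨b, hb, h2⟩ := Finset.exists_ne_zero_of_sum_ne_zero h1
      have hab : a * b = g := by
        by_contra h3
        exact h2 (if_neg h3)
      rw [← hab, hbox]
      intro l
      have e1 := (hbox _ _).1 ((hx a).2 (SkewMonoidAlgebra.mem_support_iff.1 ha)) l
      have e2 := (hbox _ _).1 ((hy b).2 (SkewMonoidAlgebra.mem_support_iff.1 hb)) l
      rw [toAdd_mul, Pi.add_apply]
      push_cast
      exact (abs_add_le _ _).trans (add_le_add e1 e2)
  · intro f
    have h1 : ∀ s : Finset (Multiplicative (Fin n → ℤ)), ∃ N, ∀ g ∈ s, f.coeff g ∈ W N ∧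
        Multiplicative.toAdd g ∈ box N := by
      intro s
      induction s using Finset.induction_on with
      | empty => exact ⟨0, by simp⟩
      | insert g s hg ih =>
        obtain ⟨N, hN⟩ := ih
        obtain ⟨M, hM⟩ := hex (f.coeff g)
        -- The three summands bound the earlier terms, the new coefficient and the new exponent.
        refine ⟨N + M + ∑ l, (Multiplicative.toAdd g l).natAbs, fun g' hg' => ?_⟩
        rcases Finset.mem_insert.1 hg' with rfl | hg'
        · refine ⟨hm (by omega) hM, (hbox _ _).2 fun l => ?_⟩
          have : (Multiplicative.toAdd g' l).natAbs ≤ ∑ l, (Multiplicative.toAdd g' l).natAbs :=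
            Finset.single_le_sum (f := fun l => (Multiplicative.toAdd g' l).natAbs)
              (fun _ _ => Nat.zero_le _) (Finset.mem_univ l)
          rw [Int.abs_eq_natAbs]
          exact_mod_cast this.trans (Nat.le_add_left _ (N + M))
        · refine ⟨hm (by omega) (hN g' hg').1, (hbox _ _).2 fun l => ?_⟩
          exact ((hbox _ _).1 (hN g' hg').2 l).trans (by
            rw [add_assoc, Nat.cast_add]
            exact le_add_of_nonneg_right (Nat.cast_nonneg _))
    obtain ⟨N, hN⟩ := h1 f.support
    refine ⟨N, fun g => ?_⟩
    by_cases hg : g ∈ f.support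
    · exact ⟨(hN g hg).1, fun _ => (hN g hg).2⟩
    · rw [SkewMonoidAlgebra.notMem_support_iff.1 hg]
      exact ⟨zero_mem _, fun h => absurd rfl h⟩
  · intro i
    obtain ⟨F, hF⟩ := key i
    exact Module.Finite.of_injective F hF
  · intro i
    obtain ⟨F, hF⟩ := key i
    refine (LinearMap.finrank_le_finrank_of_injective hF).trans ?_
    rw [Module.finrank_pi_fintype, Finset.sum_const, smul_eq_mul, Finset.card_univ,
      Fintype.card_coe]
    have hc : (box i).card = (2 * i + 1) ^ n := by
      simp only [box, Pi.card_Icc, Int.card_Icc, Finset.prod_const, Finset.card_univ,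
        Fintype.card_fin]
      congr 1
      omega
    rw [hc]
    calc (2 * i + 1) ^ n * Module.finrank k (W i)
        ≤ (2 * (i + 1)) ^ n * (c * (i + 1) ^ d) := by
          gcongr
          · omega
          · exact hcd i
      _ = c * 2 ^ n * (i + 1) ^ (n + d) := by rw [mul_pow, pow_add]; ring

end Skew

/-! ### The structure of generalized Weyl algebras -/

namespace GWA

variable {k D : Type*} [Field k] [CommRing D] [Algebra k D] {a : D} {σ : D ≃ₐ[k] D}

/-- The base ring inside the generalized Weyl algebra. -/
def baseHom (a : D) (σ : D ≃ₐ[k] D) : D →ₐ[k] GWA a σ :=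
  AlgHom.ofLinearMap
    { toFun := base a σ
      map_add' := base_add
      map_smul' := fun c d => by
        rw [Algebra.smul_def, base_mul, base_algebraMap, Algebra.smul_def, RingHom.id_apply] }
    (by
      have := base_algebraMap (a := a) (σ := σ) 1
      rwa [map_one, map_one] at this)
    base_mul

@[simp] lemma baseHom_apply (d : D) : baseHom a σ d = base a σ d := rfl

lemma eq_top_of_gen_mem (U : Subalgebra k (GWA a σ)) (h : ∀ x, gen a σ x ∈ U) : U = ⊤ := by
  rw [eq_top_iff]
  rintro x -
  obtain ⟨y, rfl⟩ := RingQuot.mkAlgHom_surjective k (GWARel k σ a) x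
  change mk a σ y ∈ U
  induction y using FreeAlgebra.induction with
  | grade0 r => rw [AlgHom.commutes]; exact U.algebraMap_mem r
  | grade1 x => exact h x
  | mul y z hy hz => rw [map_mul]; exact mul_mem hy hz
  | add y z hy hz => rw [map_add]; exact add_mem hy hz

section Lift

variable {B : Type*} [Ring B] [Algebra k B]

/-- The universal property of the generalized Weyl algebra. -/
def lift (f : D →ₐ[k] B) (P M : B) (hP : ∀ d, P * f d = f (σ d) * P)
    (hM : ∀ d, M * f d = f (σ.symm d) * M) (hMP : M * P = f a) (hPM : P * M = f (σ a)) :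
    GWA a σ →ₐ[k] B :=
  RingQuot.liftAlgHom k (s := GWARel k σ a)
    ⟨FreeAlgebra.lift k fun | .base d => f d | .plus => P | .minus => M, by
      intro x y h
      cases h <;> simp [hP, hM, hMP, hPM]⟩

variable (f : D →ₐ[k] B) (P M : B) (hP : ∀ d, P * f d = f (σ d) * P)
    (hM : ∀ d, M * f d = f (σ.symm d) * M) (hMP : M * P = f a) (hPM : P * M = f (σ a))

@[simp] lemma lift_base (d : D) : lift f P M hP hM hMP hPM (base a σ d) = f d :=
  (RingQuot.liftAlgHom_mkAlgHom_apply k _ _ _).trans (FreeAlgebra.lift_ι_apply _ _)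

@[simp] lemma lift_Xp : lift f P M hP hM hMP hPM (Xp a σ) = P :=
  (RingQuot.liftAlgHom_mkAlgHom_apply k _ _ _).trans (FreeAlgebra.lift_ι_apply _ _)

@[simp] lemma lift_Xm : lift f P M hP hM hMP hPM (Xm a σ) = M :=
  (RingQuot.liftAlgHom_mkAlgHom_apply k _ _ _).trans (FreeAlgebra.lift_ι_apply _ _)

end Lift

/-- The elements `(X⁺)ʲ` for `j ≥ 0` and `(X⁻)⁻ʲ` for `j < 0`. -/
def Xz (a : D) (σ : D ≃ₐ[k] D) : ℤ → GWA a σ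
  | .ofNat j => Xp a σ ^ j
  | .negSucc j => Xm a σ ^ (j + 1)

/-- The span is stable under left multiplication by the generators: D moves to the left of `X⁺` and
`X⁻`, and an adjacent `X⁺`, `X⁻` collapses to an element of D. As it contains 1, it is everything.
-/
lemma span_base_mul_Xz :
    Submodule.span k (Set.range fun x : D × ℤ => base a σ x.1 * Xz a σ x.2) = ⊤ := by
  set W := Submodule.span k (Set.range fun x : D × ℤ => base a σ x.1 * Xz a σ x.2) with hW
  have hb : ∀ d j, base a σ d * Xz a σ j ∈ W := fun d j => Submodule.subset_span ⟨(d, j), rfl⟩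
  -- Either the power of `X⁺` grows, or one `X⁻` is cancelled at the price of the coefficient `σ a`.
  have hP : ∀ j, ∃ d j', Xp a σ * Xz a σ j = base a σ d * Xz a σ j' := by
    rintro (j | j)
    · exact ⟨1, Int.ofNat (j + 1), by
        rw [← baseHom_apply, map_one, one_mul, Xz, Xz, pow_succ']⟩
    · refine ⟨σ a, -(j : ℤ), ?_⟩
      rw [Xz, pow_succ', ← mul_assoc, Xp_Xm]
      cases j with
      | zero => simp [Xz]
      | succ j => rfl
  have hM : ∀ j, ∃ d j', Xm a σ * Xz a σ j = base a σ d * Xz a σ j' := by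
    rintro (j | j)
    · cases j with
      | zero => exact ⟨1, Int.negSucc 0, by
          rw [← baseHom_apply, map_one, one_mul]; simp [Xz]⟩
      | succ j =>
        refine ⟨a, Int.ofNat j, ?_⟩
        rw [Xz, pow_succ', ← mul_assoc, Xm_Xp, Xz]
    · exact ⟨1, Int.negSucc (j + 1), by
        rw [← baseHom_apply, map_one, one_mul, Xz, Xz, ← pow_succ']⟩
  let U : Subalgebra k (GWA a σ) :=
    { carrier := {x | ∀ w ∈ W, x * w ∈ W}
      mul_mem' := fun {x y} hx hy w hw => by rw [mul_assoc]; exact hx _ (hy _ hw)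
      add_mem' := fun {x y} hx hy w hw => by rw [add_mul]; exact add_mem (hx _ hw) (hy _ hw)
      algebraMap_mem' := fun r w hw => by
        rw [← Algebra.smul_def]; exact W.smul_mem r hw }
  have hgen : ∀ x : GWA a σ, (∀ d j, x * (base a σ d * Xz a σ j) ∈ W) → x ∈ U := by
    intro x hx w hw
    induction hw using Submodule.span_induction with
    | mem w hw => obtain ⟨⟨d, j⟩, rfl⟩ := hw; exact hx d j
    | zero => rw [mul_zero]; exact zero_mem _
    | add y z _ _ hy hz => rw [mul_add]; exact add_mem hy hz
    | smul c y _ hy => rw [mul_smul_comm]; exact W.smul_mem c hy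
  have hU : U = ⊤ := by
    refine eq_top_of_gen_mem U ?_
    rintro (e | _ | _)
    · refine hgen _ fun d j => ?_
      change base a σ e * _ ∈ W
      rw [← mul_assoc, ← base_mul]
      exact hb _ _
    · refine hgen _ fun d j => ?_
      change Xp a σ * _ ∈ W
      obtain ⟨d', j', h⟩ := hP j
      rw [← mul_assoc, Xp_base, mul_assoc, h, ← mul_assoc, ← base_mul]
      exact hb _ _
    · refine hgen _ fun d j => ?_
      change Xm a σ * _ ∈ W
      obtain ⟨d', j', h⟩ := hM j
      rw [← mul_assoc, Xm_base, mul_assoc, h, ← mul_assoc, ← base_mul]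
      exact hb _ _
  rw [eq_top_iff]
  rintro x -
  have hx : x ∈ U := by rw [hU]; trivial
  have h1 : (1 : GWA a σ) ∈ W := by
    have := hb 1 0
    rw [← baseHom_apply, map_one, one_mul] at this
    simpa [Xz] using this
  simpa using hx 1 h1

lemma span_basis_mul_Xz {κ : Type*} (b : Module.Basis κ k D) :
    Submodule.span k (Set.range fun x : κ × ℤ => base a σ (b x.1) * Xz a σ x.2) = ⊤ := by
  rw [eq_top_iff, ← span_base_mul_Xz, Submodule.span_le]
  rintro _ ⟨⟨d, j⟩, rfl⟩
  have hd : d ∈ Submodule.span k (Set.range b) := by rw [b.span_eq]; trivial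
  change base a σ d * Xz a σ j ∈ Submodule.span k _
  induction hd using Submodule.span_induction with
  | mem d hd => obtain ⟨i, rfl⟩ := hd; exact Submodule.subset_span ⟨(i, j), rfl⟩
  | zero => rw [← baseHom_apply, map_zero, zero_mul]; exact zero_mem _
  | add x y _ _ hx hy => rw [base_add, add_mul]; exact add_mem hx hy
  | smul c x _ hx =>
    rw [← baseHom_apply, map_smul, smul_mul_assoc]
    exact Submodule.smul_mem _ _ hx

end GWA

/-! ### The embedding of tensor powers of generalized Weyl algebras into skew group rings -/

/-- Different group elements give independent components. In one component all vectors are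
multiplied by the same nonzero `w g`, which is injective on a domain. -/
lemma linearIndependent_single_mul {k D' I : Type*} [Field k] [CommRing D'] [IsDomain D']
    [Algebra k D'] {n : ℕ} (u : I → D')
    (hu : LinearIndependent k u) (w : Multiplicative (Fin n → ℤ) → D') (hw : ∀ g, w g ≠ 0) :
    LinearIndependent k fun x : Multiplicative (Fin n → ℤ) × I =>
      SkewMonoidAlgebra.single x.1 (u x.2 * w x.1) := by
  have h0 : ∀ g : Multiplicative (Fin n → ℤ), LinearIndependent k fun i : I => u i * w g :=
    fun g => hu.map' (LinearMap.mulRight k (w g))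
      (LinearMap.ker_eq_bot.2 (mul_left_injective₀ (hw g)))
  have h1 := Finsupp.linearIndependent_single (fun g (i : I) => u i * w g) h0
  have h2 := h1.comp (fun x : Multiplicative (Fin n → ℤ) × I =>
    (⟨x.1, x.2⟩ : Σ _ : Multiplicative (Fin n → ℤ), I)) (fun x y hxy => by
      simp only [Sigma.mk.injEq, heq_eq_eq] at hxy
      exact Prod.ext hxy.1 hxy.2)
  exact LinearIndependent.of_comp (SkewMonoidAlgebra.coeffLinearEquiv (S := k) (k := D')
    (G := Multiplicative (Fin n → ℤ))).toLinearMap h2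

section Embedding

variable {k D D' : Type*} [Field k] [CommRing D] [Algebra k D] [CommRing D'] [Algebra k D']
  {n : ℕ} [MulSemiringAction (Multiplicative (Fin n → ℤ)) D']

/-- The `l`-th generator of `ℤⁿ`, written multiplicatively. -/
def shiftGen {n : ℕ} (l : Fin n) : Multiplicative (Fin n → ℤ) := Multiplicative.ofAdd (Pi.single l 1)

/-- Compatibility of embeddings of `D` into `D'` with the action of `ℤⁿ` on `D'`. -/
structure IsShiftEmbedding (σ : D ≃ₐ[k] D) (ι : Fin n → D →ₐ[k] D') : Prop where
  smul_self : ∀ l d, shiftGen l • ι l d = ι l (σ d)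
  smul_of_ne : ∀ l j d, l ≠ j → shiftGen l • ι j d = ι j d
  injective : ∀ l, Function.Injective (ι l)

variable {a : D} {σ : D ≃ₐ[k] D} {ι : Fin n → D →ₐ[k] D'}

lemma IsShiftEmbedding.inv_smul_self (h : IsShiftEmbedding σ ι) (l : Fin n) (d : D) :
    (shiftGen l)⁻¹ • ι l d = ι l (σ.symm d) := by
  rw [inv_smul_eq_iff, h.smul_self, AlgEquiv.apply_symm_apply]

lemma IsShiftEmbedding.inv_smul_of_ne (h : IsShiftEmbedding σ ι) (l j : Fin n) (d : D)
    (hl : l ≠ j) : (shiftGen l)⁻¹ • ι j d = ι j d := by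
  rw [inv_smul_eq_iff, h.smul_of_ne _ _ _ hl]

/-- No twisting occurs in the product: the coefficient of one factor comes from a copy of `D` fixed
by the shifts of all other factors. -/
lemma list_prod_ofFn_single {N : ℕ} (l : Fin N → Fin n) (hl : Function.Injective l) (j : Fin N → ℤ)
    (c : Fin N → D) (h : IsShiftEmbedding σ ι) :
    (List.ofFn fun i => SkewMonoidAlgebra.single (shiftGen (l i) ^ j i) (ι (l i) (c i))).prod =
      SkewMonoidAlgebra.single (∏ i, shiftGen (l i) ^ j i) (∏ i, ι (l i) (c i)) := by
  induction N with
  | zero => simp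
  | succ N ih =>
    rw [List.ofFn_succ, List.prod_cons, ih (fun i => l i.succ) (hl.comp (Fin.succ_injective N)),
      SkewMonoidAlgebra.single_mul_single, Fin.prod_univ_succ, Fin.prod_univ_succ,
      Finset.smul_prod']
    congr 2
    refine Finset.prod_congr rfl fun i _ => ?_
    have hne : l 0 ≠ l i.succ := fun h => (Fin.succ_ne_zero i).symm (hl h)
    have : shiftGen (l 0) ∈ MulAction.stabilizer (Multiplicative (Fin n → ℤ))
        (ι (l i.succ) (c i.succ)) := h.smul_of_ne _ _ _ hne
    exact zpow_mem this (j 0)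

variable [SMulCommClass (Multiplicative (Fin n → ℤ)) k D']

/-- Coefficients inside the skew group ring. -/
def skewCoeff (k D' : Type*) [Field k] [CommRing D'] [Algebra k D'] (n : ℕ)
    [MulSemiringAction (Multiplicative (Fin n → ℤ)) D']
    [SMulCommClass (Multiplicative (Fin n → ℤ)) k D'] :
    D' →ₐ[k] SkewMonoidAlgebra D' (Multiplicative (Fin n → ℤ)) :=
  { SkewMonoidAlgebra.singleOneRingHom with
    commutes' := fun c => by rw [SkewMonoidAlgebra.coe_algebraMap]; rfl }

lemma skewCoeff_apply (d : D') : skewCoeff k D' n d = SkewMonoidAlgebra.single 1 d := rfl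

/-- The embedding of the `l`-th factor. -/
def factorHom (a : D) (h : IsShiftEmbedding σ ι) (l : Fin n) :
    GWA a σ →ₐ[k] SkewMonoidAlgebra D' (Multiplicative (Fin n → ℤ)) :=
  GWA.lift ((skewCoeff k D' n).comp (ι l)) (SkewMonoidAlgebra.single (shiftGen l) 1)
    -- As `X⁺` goes to a bare group element, the relation `X⁻X⁺ = a` forces this image of `X⁻`.
    (SkewMonoidAlgebra.single (shiftGen l)⁻¹ (ι l a))
    (fun d => by simp [skewCoeff_apply, SkewMonoidAlgebra.single_mul_single, h.smul_self])
    (fun d => by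
      simp [skewCoeff_apply, SkewMonoidAlgebra.single_mul_single, h.inv_smul_self, mul_comm])
    (by simp [skewCoeff_apply, SkewMonoidAlgebra.single_mul_single])
    (by simp [skewCoeff_apply, SkewMonoidAlgebra.single_mul_single, h.smul_self])

@[simp] lemma factorHom_base (h : IsShiftEmbedding σ ι) (l : Fin n) (d : D) :
    factorHom a h l (GWA.base a σ d) = SkewMonoidAlgebra.single 1 (ι l d) :=
  GWA.lift_base _ _ _ _ _ _ _ _

@[simp] lemma factorHom_Xp (h : IsShiftEmbedding σ ι) (l : Fin n) :
    factorHom a h l (GWA.Xp a σ) = SkewMonoidAlgebra.single (shiftGen l) 1 :=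
  GWA.lift_Xp _ _ _ _ _ _ _

@[simp] lemma factorHom_Xm (h : IsShiftEmbedding σ ι) (l : Fin n) :
    factorHom a h l (GWA.Xm a σ) = SkewMonoidAlgebra.single (shiftGen l)⁻¹ (ι l a) :=
  GWA.lift_Xm _ _ _ _ _ _ _

/-- The images of the factors lie in the following subalgebra. -/
lemma factorHom_induction (h : IsShiftEmbedding σ ι) (l : Fin n)
    (U : Subalgebra k (SkewMonoidAlgebra D' (Multiplicative (Fin n → ℤ))))
    (h1 : ∀ d, SkewMonoidAlgebra.single 1 (ι l d) ∈ U)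
    (h2 : SkewMonoidAlgebra.single (shiftGen l) 1 ∈ U)
    (h3 : SkewMonoidAlgebra.single (shiftGen l)⁻¹ (ι l a) ∈ U) (x : GWA a σ) :
    factorHom a h l x ∈ U := by
  have : U.comap (factorHom a h l) = ⊤ := by
    refine GWA.eq_top_of_gen_mem _ ?_
    rintro (d | _ | _)
    · change factorHom a h l (GWA.base a σ d) ∈ U
      rw [factorHom_base]
      exact h1 d
    · change factorHom a h l (GWA.Xp a σ) ∈ U
      rw [factorHom_Xp]
      exact h2
    · change factorHom a h l (GWA.Xm a σ) ∈ U
      rw [factorHom_Xm]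
      exact h3
  have hx : x ∈ U.comap (factorHom a h l) := by rw [this]; trivial
  exact hx

/-- The elements commuting with a given one form a subalgebra, so it suffices to compare generators,
first in one factor and then in the other. -/
lemma factorHom_commute (h : IsShiftEmbedding σ ι) {i j : Fin n} (hij : i ≠ j) (x y : GWA a σ) :
    Commute (factorHom a h i x) (factorHom a h j y) := by
  have key : ∀ z : SkewMonoidAlgebra D' (Multiplicative (Fin n → ℤ)),
      (∀ d, Commute (SkewMonoidAlgebra.single 1 (ι i d)) z) →
      Commute (SkewMonoidAlgebra.single (shiftGen i) 1) z →
      Commute (SkewMonoidAlgebra.single (shiftGen i)⁻¹ (ι i a)) z →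
      ∀ x : GWA a σ, Commute (factorHom a h i x) z := fun z h1 h2 h3 x =>
    (Subalgebra.mem_centralizer_iff k).1 (factorHom_induction h i
      (Subalgebra.centralizer k {z})
      (fun d => (Subalgebra.mem_centralizer_iff k).2 fun w hw => by
        rw [Set.mem_singleton_iff.1 hw]; exact (h1 d).eq.symm)
      ((Subalgebra.mem_centralizer_iff k).2 fun w hw => by
        rw [Set.mem_singleton_iff.1 hw]; exact h2.eq.symm)
      ((Subalgebra.mem_centralizer_iff k).2 fun w hw => by
        rw [Set.mem_singleton_iff.1 hw]; exact h3.eq.symm) x) z rfl |>.symm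
  have key' : ∀ z : SkewMonoidAlgebra D' (Multiplicative (Fin n → ℤ)),
      (∀ d, Commute (SkewMonoidAlgebra.single 1 (ι j d)) z) →
      Commute (SkewMonoidAlgebra.single (shiftGen j) 1) z →
      Commute (SkewMonoidAlgebra.single (shiftGen j)⁻¹ (ι j a)) z →
      ∀ y : GWA a σ, Commute (factorHom a h j y) z := fun z h1 h2 h3 x =>
    (Subalgebra.mem_centralizer_iff k).1 (factorHom_induction h j
      (Subalgebra.centralizer k {z})
      (fun d => (Subalgebra.mem_centralizer_iff k).2 fun w hw => by
        rw [Set.mem_singleton_iff.1 hw]; exact (h1 d).eq.symm)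
      ((Subalgebra.mem_centralizer_iff k).2 fun w hw => by
        rw [Set.mem_singleton_iff.1 hw]; exact h2.eq.symm)
      ((Subalgebra.mem_centralizer_iff k).2 fun w hw => by
        rw [Set.mem_singleton_iff.1 hw]; exact h3.eq.symm) x) z rfl |>.symm
  refine key _ (fun d => ?_) ?_ ?_ x <;> refine (key' _ (fun e => ?_) ?_ ?_ y).symm <;>
    simp only [Commute, SemiconjBy, SkewMonoidAlgebra.single_mul_single, one_smul, mul_one, one_mul,
      smul_one, h.smul_of_ne _ _ _ hij, h.smul_of_ne _ _ _ hij.symm, h.inv_smul_of_ne _ _ _ hij,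
      h.inv_smul_of_ne _ _ _ hij.symm, mul_comm]

/-- The embedding of `D(a, σ)^{⊗ n}` into a skew group ring. -/
def gwaEmb (a : D) (h : IsShiftEmbedding σ ι) :
    (⨂[k] _ : Fin n, GWA a σ) →ₐ[k] SkewMonoidAlgebra D' (Multiplicative (Fin n → ℤ)) :=
  prodHom (factorHom a h) fun _ _ hij x y => factorHom_commute h hij x y

lemma gwaEmb_single (h : IsShiftEmbedding σ ι) (l : Fin n) (x : GWA a σ) :
    gwaEmb a h (PiTensorProduct.singleAlgHom l x) = factorHom a h l x :=
  prodHom_single _ _ _ _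

/-- The powers of `X⁻` pick up coefficients a·σ⁻¹(a)·σ⁻²(a)⋯, nonzero since `D` is a domain. The
same `A` serves every factor. -/
lemma factorHom_Xz [IsDomain D] (ha : a ≠ 0) (h : IsShiftEmbedding σ ι) (j : ℤ) :
    ∃ A : D, A ≠ 0 ∧ ∀ l, factorHom a h l (GWA.Xz a σ j) =
      SkewMonoidAlgebra.single (shiftGen l ^ j) (ι l A) := by
  cases j with
  | ofNat j =>
    refine ⟨1, one_ne_zero, fun l => ?_⟩
    rw [GWA.Xz, map_pow, factorHom_Xp, Int.ofNat_eq_natCast, zpow_natCast, map_one]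
    induction j with
    | zero => simp
    | succ j ih => rw [pow_succ', ih, SkewMonoidAlgebra.single_mul_single, pow_succ']; simp
  | negSucc j =>
    simp only [GWA.Xz, map_pow, factorHom_Xm, zpow_negSucc]
    induction j with
    | zero => exact ⟨a, ha, fun l => by simp⟩
    | succ j ih =>
      obtain ⟨A, hA, h'⟩ := ih
      refine ⟨a * σ.symm A, mul_ne_zero ha (by simpa using hA), fun l => ?_⟩
      rw [pow_succ', h', SkewMonoidAlgebra.single_mul_single, h.inv_smul_self, map_mul,
        pow_succ _ (j + 1), mul_inv_rev]

lemma prod_shiftGen_zpow (j : Fin n → ℤ) : ∏ i, shiftGen i ^ j i = Multiplicative.ofAdd j := by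
  apply Multiplicative.toAdd.injective
  rw [toAdd_prod, toAdd_ofAdd]
  conv_rhs => rw [← Finset.univ_sum_single j]
  refine Finset.sum_congr rfl fun i _ => ?_
  rw [toAdd_zpow, shiftGen, toAdd_ofAdd, ← Pi.single_smul]
  simp

/-- A linear map is injective if it sends a spanning family to an independent one. The spanning
products of basis elements and powers of `X⁺`, `X⁻` go to single terms, sorted by exponent, whose
coefficients are independent up to a common nonzero factor. -/
theorem gwaEmb_injective [IsDomain D] [IsDomain D'] (ha : a ≠ 0) (h : IsShiftEmbedding σ ι)
    {κ : Type*} (b : Module.Basis κ k D)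
    (hind : LinearIndependent k fun i : Fin n → κ => ∏ l, ι l (b (i l))) :
    Function.Injective (gwaEmb a h) := by
  choose A hA hAX using factorHom_Xz ha h
  have hval : ∀ s : Fin n → κ × ℤ, gwaEmb a h
      (PiTensorProduct.tprod k fun l => GWA.base a σ (b (s l).1) * GWA.Xz a σ (s l).2) =
      SkewMonoidAlgebra.single (Multiplicative.ofAdd fun l => (s l).2)
        ((∏ l, ι l (b (s l).1)) * ∏ l, ι l (A (s l).2)) := by
    intro s
    rw [gwaEmb, prodHom_tprod, ← prod_shiftGen_zpow, ← Finset.prod_mul_distrib]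
    simp only [← map_mul]
    refine Eq.trans ?_ (list_prod_ofFn_single id Function.injective_id (fun l => (s l).2)
      (fun l => b (s l).1 * A (s l).2) h)
    congr 2
    funext l
    rw [map_mul, factorHom_base, hAX, SkewMonoidAlgebra.single_mul_single, one_mul, one_smul,
      id, map_mul]
  refine LinearMap.injective_of_linearIndependent (f := (gwaEmb a h).toLinearMap)
    (PiTensorProduct.submodule_span_eq_top (ι := Fin n) (M := fun _ => GWA a σ)
      (γ := fun _ => κ × ℤ) (g := fun _ x => GWA.base a σ (b x.1) * GWA.Xz a σ x.2)
      fun _ => GWA.span_basis_mul_Xz b) ?_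
  have h2 := (linearIndependent_single_mul _ hind
    (fun g : Multiplicative (Fin n → ℤ) => ∏ l, ι l (A (Multiplicative.toAdd g l)))
    (fun g => Finset.prod_ne_zero_iff.2 fun l _ =>
      (map_ne_zero_iff _ (h.injective l)).2 (hA _))).comp
    (fun s : Fin n → κ × ℤ => (Multiplicative.ofAdd fun l => (s l).2, fun l => (s l).1)) (by
        intro s s' hss
        have h3 := congrArg (fun x => Multiplicative.toAdd x.1) hss
        have h4 := congrArg Prod.snd hss
        funext l
        exact Prod.ext (congrFun h4 l) (congrFun h3 l))
  have h5 : ((gwaEmb a h).toLinearMap ∘ fun j : Fin n → κ × ℤ => PiTensorProduct.tprod k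
      fun i => GWA.base a σ (b (j i).1) * GWA.Xz a σ (j i).2) = _ := funext hval
  rw [h5]
  exact h2

end Embedding

/-! ### The base ring of classical type: polynomials with the action of `ℤⁿ` by translations -/

section Classical

/-- The polynomial ring `k[h₁, …, hₙ]` on which `ℤⁿ` acts by `hᵢ ↦ hᵢ - λᵢ`. -/
def ShiftPoly (k : Type*) [Field k] (n : ℕ) : Type _ := MvPolynomial (Fin n) k

variable {k : Type*} [Field k] {n : ℕ}

instance : CommRing (ShiftPoly k n) := inferInstanceAs (CommRing (MvPolynomial (Fin n) k))
instance : Algebra k (ShiftPoly k n) := inferInstanceAs (Algebra k (MvPolynomial (Fin n) k))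
instance : IsDomain (ShiftPoly k n) := inferInstanceAs (IsDomain (MvPolynomial (Fin n) k))

/-- Translation of the variables. -/
def shiftHom (k : Type*) [Field k] {n : ℕ} (g : Multiplicative (Fin n → ℤ)) :
    MvPolynomial (Fin n) k →ₐ[k] MvPolynomial (Fin n) k :=
  MvPolynomial.aeval fun i => MvPolynomial.X i - MvPolynomial.C (Multiplicative.toAdd g i : k)

lemma shiftHom_X (g : Multiplicative (Fin n → ℤ)) (i : Fin n) :
    shiftHom k g (MvPolynomial.X i) =
      MvPolynomial.X i - MvPolynomial.C (Multiplicative.toAdd g i : k) :=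
  MvPolynomial.aeval_X _ _

lemma shiftHom_one : shiftHom k (1 : Multiplicative (Fin n → ℤ)) = AlgHom.id k _ := by
  ext i
  simp [shiftHom]

lemma shiftHom_mul (g g' : Multiplicative (Fin n → ℤ)) :
    shiftHom k (g * g') = (shiftHom k g).comp (shiftHom k g') := by
  apply MvPolynomial.algHom_ext
  intro i
  rw [AlgHom.comp_apply, shiftHom_X, shiftHom_X, map_sub, shiftHom_X, MvPolynomial.algHom_C,
    toAdd_mul, Pi.add_apply, Int.cast_add, MvPolynomial.C_add, MvPolynomial.algebraMap_eq]
  ring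

instance : MulSemiringAction (Multiplicative (Fin n → ℤ)) (ShiftPoly k n) where
  smul g f := shiftHom k g f
  one_smul f := DFunLike.congr_fun shiftHom_one f
  mul_smul g g' f := DFunLike.congr_fun (shiftHom_mul g g') f
  smul_zero g := map_zero (shiftHom k g)
  smul_add g := map_add (shiftHom k g)
  smul_one g := map_one (shiftHom k g)
  smul_mul g := map_mul (shiftHom k g)

lemma shiftPoly_smul_def (g : Multiplicative (Fin n → ℤ)) (f : ShiftPoly k n) :
    g • f = shiftHom k g f := rfl

instance : SMulCommClass (Multiplicative (Fin n → ℤ)) k (ShiftPoly k n) where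
  smul_comm g c f := map_smul (shiftHom k g) c f

/-- The `l`-th variable. -/
def ShiftPoly.var (k : Type*) [Field k] {n : ℕ} (l : Fin n) : ShiftPoly k n := MvPolynomial.X (R := k) l

/-- The embedding of `k[h]` with image `k[hₗ]`. -/
def shiftEmb (k : Type*) [Field k] {n : ℕ} (l : Fin n) : k[X] →ₐ[k] ShiftPoly k n :=
  Polynomial.aeval (ShiftPoly.var k l)

lemma shiftGen_smul_var (l j : Fin n) : shiftGen l • ShiftPoly.var k j =
    if l = j then ShiftPoly.var k j - 1 else ShiftPoly.var k j := by
  rw [shiftPoly_smul_def]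
  refine (shiftHom_X (k := k) _ _).trans ?_
  rw [shiftGen, toAdd_ofAdd]
  split_ifs with h
  · subst h
    rw [Pi.single_eq_same, Int.cast_one, MvPolynomial.C_1]
    rfl
  · rw [Pi.single_eq_of_ne (Ne.symm h), Int.cast_zero, MvPolynomial.C_0, sub_zero]
    rfl

theorem isShiftEmbedding_classical (σ : k[X] ≃ₐ[k] k[X]) (hσ : σ X = X - 1) :
    IsShiftEmbedding (n := n) σ (shiftEmb k) where
  smul_self l d := by
    have : (MulSemiringAction.toAlgHom k (ShiftPoly k n) (shiftGen l)).comp (shiftEmb k l) =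
        (shiftEmb k l).comp σ.toAlgHom := by
      apply Polynomial.algHom_ext
      change shiftGen l • shiftEmb k l X = shiftEmb k l (σ X)
      rw [hσ, map_sub, map_one, shiftEmb, Polynomial.aeval_X, shiftGen_smul_var, if_pos rfl]
    exact DFunLike.congr_fun this d
  smul_of_ne l j d hlj := by
    have : (MulSemiringAction.toAlgHom k (ShiftPoly k n) (shiftGen l)).comp (shiftEmb k j) =
        shiftEmb k j := by
      apply Polynomial.algHom_ext
      change shiftGen l • shiftEmb k j X = shiftEmb k j X
      rw [shiftEmb, Polynomial.aeval_X, shiftGen_smul_var, if_neg hlj]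
    exact DFunLike.congr_fun this d
  injective l := by
    -- The embedding is a renaming of the single variable of a one-variable `MvPolynomial`.
    have h : Function.Injective ((MvPolynomial.rename (R := k) (fun _ : Unit => l)).comp
        (MvPolynomial.uniqueAlgEquiv k Unit).symm.toAlgHom) :=
      (MvPolynomial.rename_injective _ (fun _ _ _ => rfl)).comp
        (MvPolynomial.uniqueAlgEquiv k Unit).symm.injective
    have h2 : (shiftEmb k l : k[X] →ₐ[k] MvPolynomial (Fin n) k) =
        (MvPolynomial.rename (R := k) (fun _ : Unit => l)).comp
        (MvPolynomial.uniqueAlgEquiv k Unit).symm.toAlgHom := by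
      apply Polynomial.algHom_ext
      change aeval (ShiftPoly.var k l) X = MvPolynomial.rename (R := k) (fun _ : Unit => l)
        ((MvPolynomial.uniqueAlgEquiv k Unit).symm X)
      rw [Polynomial.aeval_X, MvPolynomial.uniqueAlgEquiv_symm_apply]
      simp [ShiftPoly.var]
      rfl
    exact h2 ▸ h

lemma linearIndependent_shiftEmb : LinearIndependent k fun i : Fin n → ℕ =>
    ∏ l, shiftEmb k l (Polynomial.basisMonomials k (i l)) := by
  have h := (MvPolynomial.basisMonomials (Fin n) k).linearIndependent.comp
    (Finsupp.equivFunOnFinite (α := Fin n) (M := ℕ)).symm (Equiv.injective _)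
  have e : (fun i : Fin n → ℕ => ∏ l, shiftEmb k l (Polynomial.basisMonomials k (i l))) =
      (MvPolynomial.basisMonomials (Fin n) k) ∘ Finsupp.equivFunOnFinite.symm := ?_
  · rw [e]
    exact h
  funext i
  rw [Function.comp_apply, MvPolynomial.coe_basisMonomials]
  refine Eq.trans ?_ (MvPolynomial.monomial_eq (a := (1 : k))).symm
  rw [map_one,
    one_mul, Finsupp.prod_fintype _ _ (fun _ => pow_zero _)]
  refine Finset.prod_congr rfl fun l _ => ?_
  rw [Polynomial.coe_basisMonomials]
  simp only [Polynomial.monomial_one_right_eq_X_pow, shiftEmb, map_pow, Polynomial.aeval_X]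
  rfl

/-- Translations do not raise degrees, so the degree filtration is stable under ℤⁿ. -/
lemma degreeOf_shiftHom_le (g : Multiplicative (Fin n → ℤ)) (f : MvPolynomial (Fin n) k)
    (i : Fin n) : (shiftHom k g f).degreeOf i ≤ f.degreeOf i := by
  rw [shiftHom, MvPolynomial.aeval_def, MvPolynomial.eval₂_eq']
  refine (MvPolynomial.degreeOf_sum_le _ _ _).trans (Finset.sup_le fun s hs => ?_)
  refine le_trans ?_ (MvPolynomial.monomial_le_degreeOf i hs)
  refine (MvPolynomial.degreeOf_mul_le _ _ _).trans ?_
  rw [MvPolynomial.algebraMap_eq, MvPolynomial.degreeOf_C, zero_add]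
  refine (MvPolynomial.degreeOf_prod_le _ _ _).trans ?_
  calc ∑ j, MvPolynomial.degreeOf i ((MvPolynomial.X j -
          MvPolynomial.C (Multiplicative.toAdd g j : k)) ^ s j)
      ≤ ∑ j, if j = i then s j else 0 := by
        refine Finset.sum_le_sum fun j _ => (MvPolynomial.degreeOf_pow_le _ _ _).trans ?_
        have h1 : MvPolynomial.degreeOf i (MvPolynomial.X j -
            MvPolynomial.C (Multiplicative.toAdd g j : k)) ≤ if j = i then 1 else 0 := by
          rw [sub_eq_add_neg, ← MvPolynomial.C_neg]
          refine (MvPolynomial.degreeOf_add_le _ _ _).trans ?_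
          rw [MvPolynomial.degreeOf_C, MvPolynomial.degreeOf_X]
          simp [eq_comm]
        split_ifs at h1 ⊢
        · nlinarith
        · nlinarith
    _ = s i := by simp

/-- Filter by the degree in each variable separately; there are (N+1)ⁿ monomials with all degrees at
most N. -/
theorem classical_hasPolyGrowth (k : Type*) [Field k] (n : ℕ) :
    HasPolyGrowth k (SkewMonoidAlgebra (ShiftPoly k n) (Multiplicative (Fin n → ℤ))) := by
  let W : ℕ → Submodule k (MvPolynomial (Fin n) k) := fun N =>
    { carrier := {f | ∀ i, f.degreeOf i ≤ N}
      zero_mem' := fun i => by simp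
      add_mem' := fun {f f'} hf hf' i =>
        (MvPolynomial.degreeOf_add_le i f f').trans (max_le (hf i) (hf' i))
      smul_mem' := fun c f hf i => by
        rw [MvPolynomial.smul_eq_C_mul]
        exact (MvPolynomial.degreeOf_C_mul_le f i c).trans (hf i) }
  let v : ∀ N, (Fin n → Fin (N + 1)) → MvPolynomial (Fin n) k := fun N s =>
    MvPolynomial.monomial (Finsupp.equivFunOnFinite.symm fun i => (s i : ℕ)) 1
  have hW : ∀ N, W N ≤ Submodule.span k (Set.range (v N)) := fun N f hf => by
    rw [f.as_sum]
    refine Submodule.sum_mem _ fun s hs => ?_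
    have : MvPolynomial.monomial s (f.coeff s) = (f.coeff s) • v N fun i =>
        ⟨s i, Nat.lt_succ_of_le ((MvPolynomial.monomial_le_degreeOf i hs).trans (hf i))⟩ := by
      rw [MvPolynomial.smul_monomial, smul_eq_mul, mul_one]
      congr 1
      ext i
      simp
    rw [this]
    exact Submodule.smul_mem _ _ (Submodule.subset_span ⟨_, rfl⟩)
  refine skew_hasPolyGrowth (D := ShiftPoly k n) W ?_ ?_ ?_ ?_ 1 n ?_ ?_
  · exact fun i j hij f hf l => (hf l).trans hij
  · exact fun i j x hx y hy l =>
      (MvPolynomial.degreeOf_mul_le l x y).trans (add_le_add (hx l) (hy l))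
  · exact fun x => ⟨∑ l, MvPolynomial.degreeOf l (R := k) x, fun l =>
      Finset.single_le_sum (f := fun l => MvPolynomial.degreeOf l (R := k) x)
        (fun _ _ => Nat.zero_le _) (Finset.mem_univ l)⟩
  · intro i
    have : FiniteDimensional k (Submodule.span k (Set.range (v i))) :=
      FiniteDimensional.span_of_finite k (Set.finite_range (v i))
    have h : FiniteDimensional k (W i) := Submodule.finiteDimensional_of_le (hW i)
    exact h
  · intro i
    have : FiniteDimensional k (Submodule.span k (Set.range (v i))) :=
      FiniteDimensional.span_of_finite k (Set.finite_range (v i))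
    refine (Submodule.finrank_mono (hW i)).trans ((finrank_range_le_card _).trans ?_)
    simp
  · exact fun g i x hx l => (degreeOf_shiftHom_le g x l).trans (hx l)

end Classical

/-! ### The base ring of quantum type: Laurent polynomials with the action of `ℤⁿ` by scaling -/

section Quantum

/-- The Laurent polynomial ring `k[h₁^{±1}, …, hₙ^{±1}]` on which the `i`-th generator of `ℤⁿ`
acts by `hᵢ ↦ qᵢ hᵢ`. -/
def ScaleLaurent {k : Type*} [Field k] {n : ℕ} (_ : Fin n → kˣ) : Type _ :=
  AddMonoidAlgebra k (Fin n → ℤ)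

variable {k : Type*} [Field k] {n : ℕ} {q : Fin n → kˣ}

instance : CommRing (ScaleLaurent q) := inferInstanceAs (CommRing (AddMonoidAlgebra k (Fin n → ℤ)))
instance : Algebra k (ScaleLaurent q) :=
  inferInstanceAs (Algebra k (AddMonoidAlgebra k (Fin n → ℤ)))
instance : IsDomain (ScaleLaurent q) :=
  inferInstanceAs (IsDomain (AddMonoidAlgebra k (Fin n → ℤ)))

/-- The pairing `(λ, μ) ↦ ∏ qᵢ ^ (λᵢ μᵢ)`. -/
def scalePairing (q : Fin n → kˣ) (g : Multiplicative (Fin n → ℤ)) (μ : Fin n → ℤ) : kˣ :=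
  ∏ i, q i ^ (Multiplicative.toAdd g i * μ i)

lemma scalePairing_add (g : Multiplicative (Fin n → ℤ)) (μ ν : Fin n → ℤ) :
    scalePairing q g (μ + ν) = scalePairing q g μ * scalePairing q g ν := by
  simp [scalePairing, mul_add, zpow_add, Finset.prod_mul_distrib]

lemma scalePairing_mul (g g' : Multiplicative (Fin n → ℤ)) (μ : Fin n → ℤ) :
    scalePairing q (g * g') μ = scalePairing q g μ * scalePairing q g' μ := by
  simp [scalePairing, add_mul, zpow_add, Finset.prod_mul_distrib]

/-- Scaling of the variables. -/
def scaleLaurentHom (q : Fin n → kˣ) (g : Multiplicative (Fin n → ℤ)) :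
    AddMonoidAlgebra k (Fin n → ℤ) →ₐ[k] AddMonoidAlgebra k (Fin n → ℤ) :=
  AddMonoidAlgebra.lift k _ (Fin n → ℤ)
    { toFun := fun μ => AddMonoidAlgebra.single (Multiplicative.toAdd μ)
        (scalePairing q g (Multiplicative.toAdd μ) : k)
      map_one' := by simp [scalePairing, AddMonoidAlgebra.one_def]
      map_mul' := fun μ ν => by
        rw [AddMonoidAlgebra.single_mul_single, toAdd_mul, scalePairing_add, Units.val_mul] }

lemma scaleLaurentHom_single (g : Multiplicative (Fin n → ℤ)) (μ : Fin n → ℤ) (c : k) :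
    scaleLaurentHom q g (AddMonoidAlgebra.single μ c) =
      AddMonoidAlgebra.single μ (c * scalePairing q g μ) := by
  simp [scaleLaurentHom, AddMonoidAlgebra.lift_single]

lemma scaleLaurentHom_one : scaleLaurentHom q 1 = AlgHom.id k _ := by
  refine AlgHom.ext fun f => ?_
  induction f using AddMonoidAlgebra.induction_linear with
  | zero => simp
  | add f g hf hg => rw [map_add, hf, hg, map_add]
  | single μ c => simp [scaleLaurentHom_single, scalePairing]

lemma scaleLaurentHom_mul (g g' : Multiplicative (Fin n → ℤ)) :
    scaleLaurentHom q (g * g') = (scaleLaurentHom q g).comp (scaleLaurentHom q g') := by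
  refine AlgHom.ext fun f => ?_
  induction f using AddMonoidAlgebra.induction_linear with
  | zero => simp
  | add f g hf hg => rw [map_add, hf, hg, map_add]
  | single μ c =>
    rw [AlgHom.comp_apply, scaleLaurentHom_single, scaleLaurentHom_single, scaleLaurentHom_single,
      scalePairing_mul, Units.val_mul]
    congr 1
    ring

instance : MulSemiringAction (Multiplicative (Fin n → ℤ)) (ScaleLaurent q) where
  smul g f := scaleLaurentHom q g f
  one_smul f := DFunLike.congr_fun scaleLaurentHom_one f
  mul_smul g g' f := DFunLike.congr_fun (scaleLaurentHom_mul g g') f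
  smul_zero g := map_zero (scaleLaurentHom q g)
  smul_add g := map_add (scaleLaurentHom q g)
  smul_one g := map_one (scaleLaurentHom q g)
  smul_mul g := map_mul (scaleLaurentHom q g)

instance : SMulCommClass (Multiplicative (Fin n → ℤ)) k (ScaleLaurent q) where
  smul_comm g c f := map_smul (scaleLaurentHom q g) c f

/-- A monomial. -/
def ScaleLaurent.monomial (q : Fin n → kˣ) (μ : Fin n → ℤ) : ScaleLaurent q :=
  AddMonoidAlgebra.single (R := k) μ 1

lemma ScaleLaurent.monomial_mul (μ ν : Fin n → ℤ) :
    monomial q μ * monomial q ν = monomial q (μ + ν) :=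
  (AddMonoidAlgebra.single_mul_single (R := k) μ ν 1 1).trans (by rw [mul_one]; rfl)

lemma ScaleLaurent.monomial_zero : monomial q 0 = 1 := rfl

lemma ScaleLaurent.smul_monomial (g : Multiplicative (Fin n → ℤ)) (μ : Fin n → ℤ) :
    g • monomial q μ = (scalePairing q g μ : k) • monomial q μ := by
  refine (scaleLaurentHom_single g μ 1).trans ?_
  refine Eq.trans ?_ (AddMonoidAlgebra.smul_single (scalePairing q g μ : k) μ (1 : k)).symm
  simp

/-- The embedding of `k[h^{±1}]` with image `k[hₗ^{±1}]`. -/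
def scaleEmb (q : Fin n → kˣ) (l : Fin n) : k[T;T⁻¹] →ₐ[k] ScaleLaurent q :=
  AddMonoidAlgebra.mapDomainAlgHom k k (AddMonoidHom.single (fun _ : Fin n => ℤ) l)

lemma scaleEmb_T (l : Fin n) (j : ℤ) :
    scaleEmb q l (LaurentPolynomial.T j) = ScaleLaurent.monomial q (Pi.single l j) :=
  AddMonoidAlgebra.mapDomain_single

/-- The integral powers of `T 1` are powers of a unit, so their images are determined by that of `T
1`. -/
lemma scaleEmb_induction {B : Type*} [Ring B] [Algebra k B] {f g : k[T;T⁻¹] →ₐ[k] B}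
    (h : f (LaurentPolynomial.T 1) = g (LaurentPolynomial.T 1)) : f = g := by
  have hu : ∀ j : ℤ, (LaurentPolynomial.T j : k[T;T⁻¹]) =
      (((LaurentPolynomial.isUnit_T 1).unit ^ j : (k[T;T⁻¹])ˣ) : k[T;T⁻¹]) := by
    intro j
    induction j using Int.induction_on with
    | zero => rw [zpow_zero, LaurentPolynomial.T_zero, Units.val_one]
    | succ j ih => rw [zpow_add_one, Units.val_mul, ← ih, LaurentPolynomial.T_add, IsUnit.unit_spec]
    | pred j ih =>
      rw [zpow_sub_one, Units.val_mul, ← ih, Units.eq_mul_inv_iff_mul_eq, IsUnit.unit_spec,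
        ← LaurentPolynomial.T_add, sub_add_cancel]
  have hT : ∀ j : ℤ, f (LaurentPolynomial.T j) = g (LaurentPolynomial.T j) := fun j => by
    have h1 : Units.map (f : k[T;T⁻¹] →* B) (LaurentPolynomial.isUnit_T 1).unit =
        Units.map (g : k[T;T⁻¹] →* B) (LaurentPolynomial.isUnit_T 1).unit := Units.ext h
    have h2 := congrArg (fun u : Bˣ => (u ^ j : Bˣ)) h1
    simp only [← map_zpow] at h2
    rw [hu]
    exact congrArg Units.val h2
  refine AlgHom.ext fun x => ?_
  induction x using LaurentPolynomial.induction_on' with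
  | add p q hp hq => rw [map_add, map_add, hp, hq]
  | C_mul_T j c =>
    rw [map_mul, map_mul, hT]
    exact congrArg (· * _) ((f.commutes c).trans (g.commutes c).symm)

lemma scaleEmb_smul_monomial (l j : Fin n) (i : ℤ) :
    shiftGen l • ScaleLaurent.monomial q (Pi.single j i) =
      if l = j then ((q l : k) ^ i) • ScaleLaurent.monomial q (Pi.single j i)
      else ScaleLaurent.monomial q (Pi.single j i) := by
  rw [ScaleLaurent.smul_monomial, scalePairing, shiftGen, toAdd_ofAdd]
  split_ifs with h
  · subst h
    rw [Finset.prod_eq_single l]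
    · simp
    · intro b _ hb
      simp [hb]
    · simp
  · rw [Finset.prod_eq_one]
    · simp
    · intro b _
      by_cases hb : b = l
      · subst hb; simp [h]
      · simp [hb]

theorem isShiftEmbedding_quantum (σ : k[T;T⁻¹] ≃ₐ[k] k[T;T⁻¹]) (q₀ : kˣ)
    (hσ : σ (LaurentPolynomial.T 1) = (q₀ : k) • LaurentPolynomial.T 1) :
    IsShiftEmbedding σ (scaleEmb fun _ : Fin n => q₀) where
  smul_self l d := by
    have : (MulSemiringAction.toAlgHom k (ScaleLaurent fun _ : Fin n => q₀) (shiftGen l)).comp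
        (scaleEmb (fun _ => q₀) l) = (scaleEmb (fun _ => q₀) l).comp σ.toAlgHom := by
      apply scaleEmb_induction
      change shiftGen l • scaleEmb (fun _ => q₀) l (LaurentPolynomial.T 1) =
        scaleEmb (fun _ => q₀) l (σ (LaurentPolynomial.T 1))
      rw [hσ, map_smul, scaleEmb_T, scaleEmb_smul_monomial, if_pos rfl, zpow_one]
    exact DFunLike.congr_fun this d
  smul_of_ne l j d hlj := by
    have : (MulSemiringAction.toAlgHom k (ScaleLaurent fun _ : Fin n => q₀) (shiftGen l)).comp
        (scaleEmb (fun _ => q₀) j) = scaleEmb (fun _ => q₀) j := by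
      apply scaleEmb_induction
      change shiftGen l • scaleEmb (fun _ => q₀) j (LaurentPolynomial.T 1) =
        scaleEmb (fun _ => q₀) j (LaurentPolynomial.T 1)
      rw [scaleEmb_T, scaleEmb_smul_monomial, if_neg hlj]
    exact DFunLike.congr_fun this d
  injective l := AddMonoidAlgebra.mapDomain_injective fun x y h =>
    Pi.single_injective (M := fun _ : Fin n => ℤ) l h

lemma linearIndependent_monomial : LinearIndependent k (ScaleLaurent.monomial q) :=
  (AddMonoidAlgebra.basis (Fin n → ℤ) k).linearIndependent

lemma span_monomial : Submodule.span k (Set.range (ScaleLaurent.monomial q)) = ⊤ :=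
  (AddMonoidAlgebra.basis (Fin n → ℤ) k).span_eq

lemma prod_scaleEmb (i : Fin n → ℤ) :
    ∏ l, scaleEmb q l (LaurentPolynomial.T (i l)) = ScaleLaurent.monomial q i := by
  simp only [scaleEmb_T]
  have : ∀ s : Finset (Fin n), ∏ l ∈ s, ScaleLaurent.monomial q (Pi.single l (i l)) =
      ScaleLaurent.monomial q (∑ l ∈ s, Pi.single l (i l)) := by
    intro s
    induction s using Finset.induction_on with
    | empty => rfl
    | insert l s hl ih =>
      rw [Finset.prod_insert hl, Finset.sum_insert hl, ih, ScaleLaurent.monomial_mul]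
  rw [this, Finset.univ_sum_single]

lemma linearIndependent_scaleEmb : LinearIndependent k fun i : Fin n → ℤ =>
    ∏ l, scaleEmb q l (AddMonoidAlgebra.basis ℤ k (i l)) := by
  convert linearIndependent_monomial (q := q) using 1
  funext i
  exact prod_scaleEmb i

/-- The group acts diagonally on monomials, so the span of the monomials with exponents in [-N, N]ⁿ
is stable. The constant comes from (2N+1)ⁿ ≤ 2ⁿ(N+1)ⁿ. -/
theorem quantum_hasPolyGrowth (q : Fin n → kˣ) :
    HasPolyGrowth k (SkewMonoidAlgebra (ScaleLaurent q) (Multiplicative (Fin n → ℤ))) := by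
  classical
  let box : ℕ → Finset (Fin n → ℤ) := fun N => Finset.Icc (fun _ => -(N : ℤ)) (fun _ => (N : ℤ))
  have hbox : ∀ (N : ℕ) (v : Fin n → ℤ), v ∈ box N ↔ ∀ i, |v i| ≤ (N : ℤ) := fun N v => by
    simp only [box, Finset.mem_Icc, Pi.le_def, abs_le, forall_and]
  let v : ∀ N, box N → ScaleLaurent q := fun N μ => ScaleLaurent.monomial q μ
  let W : ℕ → Submodule k (ScaleLaurent q) := fun N => Submodule.span k (Set.range (v N))
  have hv : ∀ (N : ℕ) (μ : Fin n → ℤ), (∀ i, |μ i| ≤ (N : ℤ)) → ScaleLaurent.monomial q μ ∈ W N := fun N μ h =>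
    Submodule.subset_span ⟨⟨μ, (hbox N μ).2 h⟩, rfl⟩
  refine skew_hasPolyGrowth W ?_ ?_ ?_ ?_ (2 ^ n) n ?_ ?_
  · intro i j hij
    refine Submodule.span_le.2 ?_
    rintro _ ⟨⟨μ, hμ⟩, rfl⟩
    exact hv _ _ fun l => ((hbox _ _).1 hμ l).trans (by exact_mod_cast hij)
  · intro i j x hx y hy
    have h1 : W i * W j ≤ W (i + j) := by
      rw [Submodule.span_mul_span]
      refine Submodule.span_le.2 ?_
      rintro _ ⟨_, ⟨⟨μ, hμ⟩, rfl⟩, _, ⟨⟨ν, hν⟩, rfl⟩, rfl⟩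
      change ScaleLaurent.monomial q μ * ScaleLaurent.monomial q ν ∈ W (i + j)
      rw [ScaleLaurent.monomial_mul]
      refine hv _ _ fun l => ?_
      rw [Nat.cast_add]
      exact (abs_add_le _ _).trans (add_le_add ((hbox _ _).1 hμ l) ((hbox _ _).1 hν l))
    exact h1 (Submodule.mul_mem_mul hx hy)
  · intro x
    have hx := span_monomial (q := q) ▸ Submodule.mem_top (x := x)
    induction hx using Submodule.span_induction with
    | mem x hx =>
      obtain ⟨μ, rfl⟩ := hx
      refine ⟨∑ l, (μ l).natAbs, hv _ _ fun l => ?_⟩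
      rw [Int.abs_eq_natAbs]
      exact_mod_cast Finset.single_le_sum (f := fun l => (μ l).natAbs)
        (fun _ _ => Nat.zero_le _) (Finset.mem_univ l)
    | zero => exact ⟨0, zero_mem _⟩
    | add x y _ _ hx hy =>
      obtain ⟨i, hi⟩ := hx
      obtain ⟨j, hj⟩ := hy
      have hm : Monotone W := by
        intro i j hij
        refine Submodule.span_le.2 ?_
        rintro _ ⟨⟨μ, hμ⟩, rfl⟩
        exact hv _ _ fun l => ((hbox _ _).1 hμ l).trans (by exact_mod_cast hij)
      exact ⟨i + j, add_mem (hm (Nat.le_add_right i j) hi) (hm (Nat.le_add_left j i) hj)⟩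
    | smul c x _ hx =>
      obtain ⟨i, hi⟩ := hx
      exact ⟨i, Submodule.smul_mem _ _ hi⟩
  · exact fun i => FiniteDimensional.span_of_finite k (Set.finite_range (v i))
  · intro i
    refine (finrank_range_le_card _).trans ?_
    have hc : (box i).card = (2 * i + 1) ^ n := by
      simp only [box, Pi.card_Icc, Int.card_Icc, Finset.prod_const, Finset.card_univ,
        Fintype.card_fin]
      congr 1
      omega
    rw [Fintype.card_coe, hc, ← mul_pow]
    gcongr
    omega
  · intro g i x hx
    have h1 : W i ≤ (W i).comap (scaleLaurentHom q g).toLinearMap := by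
      refine Submodule.span_le.2 ?_
      rintro _ ⟨⟨μ, hμ⟩, rfl⟩
      change g • ScaleLaurent.monomial q μ ∈ W i
      rw [ScaleLaurent.smul_monomial]
      exact Submodule.smul_mem _ _ (hv _ _ ((hbox _ _).1 hμ))
    exact h1 hx

end Quantum

/-! ### Polynomials in commuting elements of a noncommutative algebra -/

section CommEval

variable {k B ι : Type*} [Field k] [Ring B] [Algebra k B]

open scoped IsMulCommutative in
/-- Evaluation of polynomials at pairwise commuting elements of a noncommutative algebra. -/
def commEval (x : ι → B) (h : ∀ i j, Commute (x i) (x j)) : MvPolynomial ι k →ₐ[k] B :=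
  have : IsMulCommutative (Algebra.adjoin k (Set.range x)) := Algebra.isMulCommutative_adjoin k (by
    rintro _ ⟨i, rfl⟩ _ ⟨j, rfl⟩
    exact h i j)
  (Algebra.adjoin k (Set.range x)).val.comp (MvPolynomial.aeval fun i =>
    (⟨x i, Algebra.subset_adjoin ⟨i, rfl⟩⟩ : Algebra.adjoin k (Set.range x)))

open scoped IsMulCommutative in
lemma commEval_X (x : ι → B) (h : ∀ i j, Commute (x i) (x j)) (i : ι) :
    commEval (k := k) x h (MvPolynomial.X i) = x i := by
  have : IsMulCommutative (Algebra.adjoin k (Set.range x)) := Algebra.isMulCommutative_adjoin k (by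
    rintro _ ⟨i, rfl⟩ _ ⟨j, rfl⟩
    exact h i j)
  change (Algebra.adjoin k (Set.range x)).val (MvPolynomial.aeval (fun i =>
    (⟨x i, Algebra.subset_adjoin ⟨i, rfl⟩⟩ : Algebra.adjoin k (Set.range x))) (MvPolynomial.X i)) = _
  rw [MvPolynomial.aeval_X]
  rfl

lemma commEval_commute_of_commute (x : ι → B) (h : ∀ i j, Commute (x i) (x j)) {z : B}
    (hz : ∀ i, Commute z (x i)) (f : MvPolynomial ι k) : Commute z (commEval x h f) := by
  induction f using MvPolynomial.induction_on with
  | C c =>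
    rw [← MvPolynomial.algebraMap_eq, AlgHom.commutes]
    exact (Algebra.commutes c z).symm
  | add p q hp hq => rw [map_add]; exact hp.add_right hq
  | mul_X p i hp => rw [map_mul, commEval_X]; exact hp.mul_right (hz i)

/-- The commutator with `z` is a derivation which kills every `x j` except `x i`. As `c` commutes
with all the `x j`, the Leibniz rule gives `c` times the partial derivative. -/
lemma commEval_mul_sub_mul (x : ι → B) (h : ∀ i j, Commute (x i) (x j)) {z : B} {i : ι} {c : B}
    (hc : ∀ j, Commute c (x j)) (h1 : z * x i - x i * z = c)
    (h2 : ∀ j, j ≠ i → Commute z (x j)) (f : MvPolynomial ι k) :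
    z * commEval x h f - commEval x h f * z = c * commEval x h (MvPolynomial.pderiv i f) := by
  classical
  induction f using MvPolynomial.induction_on with
  | C r =>
    rw [MvPolynomial.pderiv_C, map_zero, mul_zero, ← MvPolynomial.algebraMap_eq, AlgHom.commutes,
      ← Algebra.commutes r z, sub_self]
  | add p q hp hq => rw [map_add, map_add, map_add, mul_add, mul_add, add_mul, ← hp, ← hq]; abel
  | mul_X p j hp =>
    rw [MvPolynomial.pderiv_mul, map_mul, map_add, map_mul, map_mul, commEval_X, mul_add,
      ← mul_assoc c, ← hp]
    by_cases hj : j = i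
    · subst hj
      rw [MvPolynomial.pderiv_X_self, map_one, mul_one, ← h1,
        (commEval_commute_of_commute x h (z := z * x j - x j * z) (h1 ▸ hc) p).eq]
      noncomm_ring
    · rw [MvPolynomial.pderiv_X_of_ne hj, map_zero, mul_zero, mul_zero, add_zero, sub_mul, mul_assoc,
        mul_assoc, mul_assoc, (h2 j hj).eq]

end CommEval

/-! ### Submodules of polynomial rings stable under derivations -/

/-- By induction on the degree all partial derivatives of an element of `K` vanish, so in
characteristic zero the element is a constant. A nonzero constant would put 1 in `K`. -/
lemma eq_zero_of_mem_of_pderiv_mem {k ι : Type*} [Field k] [CharZero k]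
    (K : Submodule k (MvPolynomial ι k)) (h1 : 1 ∉ K)
    (hd : ∀ i, ∀ f ∈ K, MvPolynomial.pderiv i f ∈ K) (f : MvPolynomial ι k) (hf : f ∈ K) : f = 0 := by
  classical
  have key : ∀ d : ℕ, ∀ f ∈ K, (∀ m : ι →₀ ℕ, d ≤ m.degree → f.coeff m = 0) → f = 0 := by
    intro d
    induction d with
    | zero =>
      intro f _ h
      ext m
      exact h m (Nat.zero_le _)
    | succ d ih =>
      intro f hf h
      have hp : ∀ i, MvPolynomial.pderiv i f = 0 := fun i => ih _ (hd i f hf) fun m hm => by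
        rw [MvPolynomial.coeff_pderiv, h, zero_mul]
        rw [map_add, Finsupp.degree_single]
        omega
      have hC : f = MvPolynomial.C (f.coeff 0) := by
        ext m
        rw [MvPolynomial.coeff_C]
        split_ifs with hm
        · rw [hm]
        · obtain ⟨i, hi⟩ : ∃ i, m i ≠ 0 := by
            by_contra! hcon
            exact hm (Finsupp.ext fun i => (hcon i).symm)
          -- The coefficient of `f` at `m` reappears in the derivative with the factor `m i`,
          -- nonzero in characteristic zero.
          have := MvPolynomial.coeff_pderiv (i := i) f (m - Finsupp.single i 1)
          rw [hp, MvPolynomial.coeff_zero, tsub_add_cancel_of_le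
            (Finsupp.single_le_iff.2 (Nat.one_le_iff_ne_zero.2 hi)), eq_comm, mul_eq_zero] at this
          exact this.resolve_right (Nat.cast_add_one_ne_zero _)
      by_contra hne
      have hc : f.coeff 0 ≠ 0 := fun h0 => hne (by rw [hC, h0, MvPolynomial.C_0])
      refine h1 ?_
      have := K.smul_mem (f.coeff 0)⁻¹ hf
      rw [hC, MvPolynomial.smul_eq_C_mul, ← MvPolynomial.C_mul, MvPolynomial.coeff_C, if_pos rfl,
        inv_mul_cancel₀ hc, MvPolynomial.C_1] at this
      exact this
  refine key (f.support.sup Finsupp.degree + 1) f hf fun m hm => ?_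
  by_contra hcon
  have := Finset.le_sup (f := Finsupp.degree) (MvPolynomial.mem_support_iff.2 hcon)
  omega

/-! ### Weyl algebras -/

namespace WeylAlgebra

variable {k : Type*} [Field k] {n : ℕ}

/-- The quotient map from the free algebra. -/
def mk (k : Type*) [Field k] (n : ℕ) : FreeAlgebra k (Fin n ⊕ Fin n) →ₐ[k] WeylAlgebra k n :=
  RingQuot.mkAlgHom k (WeylRel k n)

lemma mk_rel {x y : FreeAlgebra k (Fin n ⊕ Fin n)} (h : WeylRel k n x y) : mk k n x = mk k n y :=
  RingQuot.mkAlgHom_rel k h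

/-- The generators `xᵢ`. -/
def x (k : Type*) [Field k] {n : ℕ} (i : Fin n) : WeylAlgebra k n := mk k n (FreeAlgebra.ι k (.inl i))

/-- The generators `yᵢ`. -/
def y (k : Type*) [Field k] {n : ℕ} (i : Fin n) : WeylAlgebra k n := mk k n (FreeAlgebra.ι k (.inr i))

lemma x_comm (i j : Fin n) : Commute (x k i) (x k j) := by
  simpa [x, Commute, SemiconjBy] using mk_rel (WeylRel.xx (k := k) i j)

lemma y_comm (i j : Fin n) : Commute (y k i) (y k j) := by
  simpa [y, Commute, SemiconjBy] using mk_rel (WeylRel.yy (k := k) i j)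

lemma y_mul_x (i j : Fin n) : y k i * x k j = x k j * y k i + if i = j then 1 else 0 := by
  have := mk_rel (WeylRel.yx (k := k) i j)
  split_ifs with h <;> simpa [x, y, h] using this

/-- The universal property of the Weyl algebra. -/
def lift {B : Type*} [Ring B] [Algebra k B] (u v : Fin n → B) (hu : ∀ i j, Commute (u i) (u j))
    (hv : ∀ i j, Commute (v i) (v j)) (huv : ∀ i j, v i * u j = u j * v i + if i = j then 1 else 0) :
    WeylAlgebra k n →ₐ[k] B :=
  RingQuot.liftAlgHom k (s := WeylRel k n) ⟨FreeAlgebra.lift k (Sum.elim u v), by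
    intro x y h
    cases h with
    | xx i j => simpa using (hu i j).eq
    | yy i j => simpa using (hv i j).eq
    | yx i j =>
      have := huv i j
      split_ifs at this ⊢ <;> simpa using this⟩

section

variable {B : Type*} [Ring B] [Algebra k B] (u v : Fin n → B) (hu : ∀ i j, Commute (u i) (u j))
    (hv : ∀ i j, Commute (v i) (v j)) (huv : ∀ i j, v i * u j = u j * v i + if i = j then 1 else 0)

lemma lift_x (i : Fin n) : lift (k := k) u v hu hv huv (x k i) = u i :=
  (RingQuot.liftAlgHom_mkAlgHom_apply k _ _ _).trans (FreeAlgebra.lift_ι_apply _ _)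

lemma lift_y (i : Fin n) : lift (k := k) u v hu hv huv (y k i) = v i :=
  (RingQuot.liftAlgHom_mkAlgHom_apply k _ _ _).trans (FreeAlgebra.lift_ι_apply _ _)

end

lemma eq_top_of_gen_mem (U : Subalgebra k (WeylAlgebra k n)) (hx : ∀ i, x k i ∈ U)
    (hy : ∀ i, y k i ∈ U) : U = ⊤ := by
  rw [eq_top_iff]
  rintro z -
  obtain ⟨z, rfl⟩ := RingQuot.mkAlgHom_surjective k (WeylRel k n) z
  change mk k n z ∈ U
  induction z using FreeAlgebra.induction with
  | grade0 r => rw [AlgHom.commutes]; exact U.algebraMap_mem r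
  | grade1 i => rcases i with i | i; exacts [hx i, hy i]
  | mul y z hy hz => rw [map_mul]; exact mul_mem hy hz
  | add y z hy hz => rw [map_add]; exact add_mem hy hz

/-- Polynomials in the `xᵢ`. -/
def evalX (k : Type*) [Field k] (n : ℕ) : MvPolynomial (Fin n) k →ₐ[k] WeylAlgebra k n :=
  commEval (x k) x_comm

/-- Polynomials in the `yᵢ`. -/
def evalY (k : Type*) [Field k] (n : ℕ) : MvPolynomial (Fin n) k →ₐ[k] WeylAlgebra k n :=
  commEval (y k) y_comm

lemma y_mul_evalX (i : Fin n) (f : MvPolynomial (Fin n) k) :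
    y k i * evalX k n f = evalX k n f * y k i + evalX k n (MvPolynomial.pderiv i f) := by
  have := commEval_mul_sub_mul (k := k) (x k) x_comm (z := y k i) (i := i) (c := 1)
    (fun j => Commute.one_left _) (by rw [y_mul_x, if_pos rfl]; abel)
    (fun j hj => by rw [Commute, SemiconjBy, y_mul_x, if_neg hj.symm, add_zero]) f
  rw [one_mul, sub_eq_iff_eq_add'] at this
  exact this

lemma evalY_mul_x (i : Fin n) (f : MvPolynomial (Fin n) k) :
    evalY k n f * x k i = x k i * evalY k n f + evalY k n (MvPolynomial.pderiv i f) := by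
  have := commEval_mul_sub_mul (k := k) (y k) y_comm (z := x k i) (i := i) (c := -1)
    (fun j => (Commute.one_left _).neg_left) (by rw [y_mul_x, if_pos rfl]; abel)
    (fun j hj => by rw [Commute, SemiconjBy, y_mul_x, if_neg hj, add_zero]) f
  rw [neg_one_mul, sub_eq_iff_eq_add] at this
  change x k i * evalY k n f = _ at this
  rw [this]
  change _ = -(evalY k n _) + _ + _
  abel

/-- The ordering map, from polynomials to the Weyl algebra. -/
def ordered (k : Type*) [Field k] (n : ℕ) :
    MvPolynomial (Fin n) k ⊗[k] MvPolynomial (Fin n) k →ₗ[k] WeylAlgebra k n :=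
  LinearMap.mul' k _ ∘ₗ TensorProduct.map (evalX k n).toLinearMap (evalY k n).toLinearMap

lemma ordered_tmul (f g : MvPolynomial (Fin n) k) :
    ordered k n (f ⊗ₜ g) = evalX k n f * evalY k n g := rfl

/-- The ordered products f(x)g(y) are stable under left multiplication by generators, since yᵢ f = f
yᵢ + ∂ᵢf. -/
lemma ordered_surjective : Function.Surjective (ordered k n) := by
  let V := LinearMap.range (ordered k n)
  let U : Subalgebra k (WeylAlgebra k n) :=
    { carrier := {a | ∀ t, a * ordered k n t ∈ V}
      mul_mem' := fun {a b} ha hb t => by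
        obtain ⟨s, hs⟩ := hb t
        rw [mul_assoc, ← hs]
        exact ha s
      add_mem' := fun {a b} ha hb t => by
        rw [add_mul]
        exact add_mem (ha t) (hb t)
      algebraMap_mem' := fun c t => by
        rw [← Algebra.smul_def]
        exact V.smul_mem c ⟨t, rfl⟩ }
  have hext : ∀ a, (∀ f g, a * ordered k n (f ⊗ₜ g) ∈ V) → a ∈ U := fun a h t => by
    induction t using TensorProduct.induction_on with
    | zero => rw [map_zero, mul_zero]; exact zero_mem _
    | tmul f g => exact h f g
    | add s t hs ht => rw [map_add, mul_add]; exact add_mem hs ht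
  have hU : U = ⊤ := eq_top_of_gen_mem U
    (fun i => hext _ fun f g => ⟨(MvPolynomial.X i * f) ⊗ₜ g, by
      rw [ordered_tmul, ordered_tmul, map_mul, evalX, commEval_X, mul_assoc]⟩)
    (fun i => hext _ fun f g =>
      ⟨f ⊗ₜ (MvPolynomial.X i * g) + MvPolynomial.pderiv i f ⊗ₜ g, by
        rw [map_add, ordered_tmul, ordered_tmul, ordered_tmul, map_mul, ← mul_assoc (y k i),
          y_mul_evalX, add_mul, mul_assoc]
        congr 3
        exact commEval_X _ _ _⟩)
  intro a
  have ha : a ∈ U := hU ▸ trivial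
  have := ha (1 ⊗ₜ 1)
  rw [ordered_tmul, map_one, map_one, mul_one, mul_one] at this
  exact this

lemma tensorEquivSum_tmul (f g : MvPolynomial (Fin n) k) :
    MvPolynomial.tensorEquivSum k (Fin n) (Fin n) k (f ⊗ₜ g) =
      MvPolynomial.rename Sum.inl f * MvPolynomial.rename Sum.inr g := by
  have h1 : (MvPolynomial.tensorEquivSum k (Fin n) (Fin n) k).toAlgHom.comp
      Algebra.TensorProduct.includeLeft = MvPolynomial.rename Sum.inl := by
    apply MvPolynomial.algHom_ext
    intro i
    rw [MvPolynomial.rename_X]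
    exact MvPolynomial.tensorEquivSum_X_tmul_one i
  have h2 : (MvPolynomial.tensorEquivSum k (Fin n) (Fin n) k).toAlgHom.comp
      Algebra.TensorProduct.includeRight = MvPolynomial.rename Sum.inr := by
    apply MvPolynomial.algHom_ext
    intro i
    rw [MvPolynomial.rename_X]
    exact MvPolynomial.tensorEquivSum_one_tmul_X i
  rw [← h1, ← h2, ← mul_one f, ← one_mul g, ← Algebra.TensorProduct.tmul_mul_tmul, map_mul, mul_one,
    one_mul]
  rfl

/-- In characteristic zero every homomorphism from the Weyl algebra to a nontrivial algebra is
injective. -/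
theorem injective_of_nontrivial [CharZero k] {B : Type*} [Ring B] [Algebra k B] [Nontrivial B]
    (f : WeylAlgebra k n →ₐ[k] B) : Function.Injective f := by
  classical
  let e := MvPolynomial.tensorEquivSum k (Fin n) (Fin n) k
  -- On ordered polynomials in 2n variables the commutators with `y i` and `x i` act as the partial
  -- derivatives, which makes the Weyl algebra simple.
  have hx : ∀ (i : Fin n) t, y k i * ordered k n t - ordered k n t * y k i =
      ordered k n (e.symm (MvPolynomial.pderiv (Sum.inl i) (e t))) := fun i t => by
    induction t using TensorProduct.induction_on with
    | zero => simp
    | add s t hs ht => simp only [map_add, mul_add, add_mul, ← hs, ← ht]; abel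
    | tmul f g =>
      have h0 : MvPolynomial.pderiv (Sum.inl i : Fin n ⊕ Fin n)
          (MvPolynomial.rename Sum.inr g : MvPolynomial (Fin n ⊕ Fin n) k) = 0 :=
        MvPolynomial.pderiv_eq_zero_of_notMem_vars fun h => by
          obtain ⟨j, -, hj⟩ := Finset.mem_image.1 (MvPolynomial.vars_rename Sum.inr g h)
          exact Sum.inr_ne_inl hj
      have h : MvPolynomial.pderiv (Sum.inl i) (e (f ⊗ₜ g)) = e (MvPolynomial.pderiv i f ⊗ₜ g) := by
        rw [tensorEquivSum_tmul, tensorEquivSum_tmul, MvPolynomial.pderiv_mul,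
          MvPolynomial.pderiv_rename Sum.inl_injective, h0, mul_zero, add_zero]
      rw [h, AlgEquiv.symm_apply_apply, ordered_tmul, ordered_tmul, ← mul_assoc, y_mul_evalX,
        add_mul, mul_assoc, mul_assoc,
        show y k i * evalY k n g = evalY k n g * y k i from
          commEval_commute_of_commute (k := k) (y k) y_comm (fun j => y_comm i j) g]
      exact add_sub_cancel_left _ _
  have hy : ∀ (i : Fin n) t, ordered k n t * x k i - x k i * ordered k n t =
      ordered k n (e.symm (MvPolynomial.pderiv (Sum.inr i) (e t))) := fun i t => by
    induction t using TensorProduct.induction_on with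
    | zero => simp
    | add s t hs ht => simp only [map_add, mul_add, add_mul, ← hs, ← ht]; abel
    | tmul f g =>
      have h0 : MvPolynomial.pderiv (Sum.inr i : Fin n ⊕ Fin n)
          (MvPolynomial.rename Sum.inl f : MvPolynomial (Fin n ⊕ Fin n) k) = 0 :=
        MvPolynomial.pderiv_eq_zero_of_notMem_vars fun h => by
          obtain ⟨j, -, hj⟩ := Finset.mem_image.1 (MvPolynomial.vars_rename Sum.inl f h)
          exact Sum.inl_ne_inr hj
      have h : MvPolynomial.pderiv (Sum.inr i) (e (f ⊗ₜ g)) = e (f ⊗ₜ MvPolynomial.pderiv i g) := by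
        rw [tensorEquivSum_tmul, tensorEquivSum_tmul, MvPolynomial.pderiv_mul,
          MvPolynomial.pderiv_rename Sum.inr_injective, h0, zero_mul, zero_add]
      rw [h, AlgEquiv.symm_apply_apply, ordered_tmul, ordered_tmul, mul_assoc, evalY_mul_x,
        mul_add, ← mul_assoc, ← mul_assoc,
        ← show x k i * evalX k n f = evalX k n f * x k i from
          commEval_commute_of_commute (k := k) (x k) x_comm (fun j => x_comm i j) f]
      exact add_sub_cancel_left _ _
  let Φ : MvPolynomial (Fin n ⊕ Fin n) k →ₗ[k] B :=
    f.toLinearMap ∘ₗ ordered k n ∘ₗ e.symm.toLinearMap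
  have hΦ : ∀ F, Φ F = f (ordered k n (e.symm F)) := fun F => rfl
  -- The kernel of `f` is an ideal, hence closed under commutators, and it misses 1 because `B` is
  -- nontrivial.
  have hK := eq_zero_of_mem_of_pderiv_mem (LinearMap.ker Φ) (by
    rw [LinearMap.mem_ker, hΦ, map_one]
    have : ordered k n 1 = 1 := by
      rw [Algebra.TensorProduct.one_def, ordered_tmul, map_one, map_one, one_mul]
    rw [this, map_one]
    exact one_ne_zero) (by
    rintro (i | i) F hF
    · have := congrArg f (hx i (e.symm F))
      rw [LinearMap.mem_ker, hΦ] at hF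
      rw [AlgEquiv.apply_symm_apply, map_sub, map_mul, map_mul, hF, mul_zero, zero_mul,
        sub_zero] at this
      exact this.symm
    · have := congrArg f (hy i (e.symm F))
      rw [LinearMap.mem_ker, hΦ] at hF
      rw [AlgEquiv.apply_symm_apply, map_sub, map_mul, map_mul, hF, mul_zero, zero_mul,
        sub_zero] at this
      exact this.symm)
  rw [injective_iff_map_eq_zero]
  intro w hw
  obtain ⟨t, rfl⟩ := ordered_surjective w
  have := hK (e t) (by rw [LinearMap.mem_ker, hΦ, AlgEquiv.symm_apply_apply]; exact hw)
  rw [(map_eq_zero_iff e e.injective).1 this, map_zero]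

end WeylAlgebra

/-- The Weyl algebra over a field of characteristic zero is an Ore domain. -/
theorem weylAlgebra_isOreDomain (k : Type*) [Field k] [CharZero k] (n : ℕ) :
    IsOreDomain (WeylAlgebra k n) := by
  -- With g the shift, x ↦ g and y ↦ h g⁻¹ give yx = h and xy = h - 1, hence the Weyl relation.
  let H : Fin n → SkewMonoidAlgebra (ShiftPoly k n) (Multiplicative (Fin n → ℤ)) := fun i =>
    SkewMonoidAlgebra.single (shiftGen i) 1
  let D : Fin n → SkewMonoidAlgebra (ShiftPoly k n) (Multiplicative (Fin n → ℤ)) := fun i =>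
    SkewMonoidAlgebra.single (shiftGen i)⁻¹ (ShiftPoly.var k i)
  have hinv : ∀ i j : Fin n, (shiftGen i)⁻¹ • ShiftPoly.var k j =
      if i = j then ShiftPoly.var k j + 1 else ShiftPoly.var k j := fun i j => by
    rw [inv_smul_eq_iff]
    split_ifs with h
    · rw [smul_add, smul_one, shiftGen_smul_var, if_pos h, sub_add_cancel]
    · rw [shiftGen_smul_var, if_neg h]
  refine HasPolyGrowth.isOreDomain_of_injective (classical_hasPolyGrowth k n)
    (WeylAlgebra.lift H D ?_ ?_ ?_) (WeylAlgebra.injective_of_nontrivial _)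
  · intro i j
    simp only [H, Commute, SemiconjBy, SkewMonoidAlgebra.single_mul_single, smul_one, mul_one,
      mul_comm]
  · intro i j
    simp only [D, Commute, SemiconjBy, SkewMonoidAlgebra.single_mul_single, hinv]
    by_cases h : i = j
    · subst h; rfl
    · rw [if_neg h, if_neg (Ne.symm h), mul_comm, mul_comm (ShiftPoly.var k i)]
  · intro i j
    simp only [H, D, SkewMonoidAlgebra.single_mul_single, smul_one, mul_one, one_mul,
      shiftGen_smul_var]
    by_cases h : i = j
    · subst h
      rw [if_pos rfl, if_pos rfl, inv_mul_cancel, mul_inv_cancel, SkewMonoidAlgebra.one_def,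
        ← SkewMonoidAlgebra.single_add, sub_add_cancel]
    · rw [if_neg h, if_neg (Ne.symm h), add_zero, mul_comm]

/-! ### Quantum planes -/

namespace QuantumPlane

variable {k : Type*} [Field k] {q : k}

/-- The quotient map from the free algebra. -/
def mk (q : k) : FreeAlgebra k Bool →ₐ[k] QuantumPlane k q :=
  RingQuot.mkAlgHom k (QuantumPlaneRel k q)

lemma mk_rel {x y : FreeAlgebra k Bool} (h : QuantumPlaneRel k q x y) : mk q x = mk q y :=
  RingQuot.mkAlgHom_rel k h

/-- The generator `x`. -/
def x (q : k) : QuantumPlane k q := mk q (FreeAlgebra.ι k false)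

/-- The generator `y`. -/
def y (q : k) : QuantumPlane k q := mk q (FreeAlgebra.ι k true)

lemma y_mul_x : y q * x q = q • (x q * y q) := by
  simpa [x, y] using mk_rel (QuantumPlaneRel.yx (k := k) (q := q))

/-- The universal property of the quantum plane. -/
def lift {B : Type*} [Ring B] [Algebra k B] (u v : B) (h : v * u = q • (u * v)) :
    QuantumPlane k q →ₐ[k] B :=
  RingQuot.liftAlgHom k (s := QuantumPlaneRel k q) ⟨FreeAlgebra.lift k fun b => bif b then v else u, by
    intro x y hxy
    cases hxy with
    | yx => simpa using h⟩

lemma lift_x {B : Type*} [Ring B] [Algebra k B] (u v : B) (h : v * u = q • (u * v)) :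
    lift u v h (x q) = u :=
  (RingQuot.liftAlgHom_mkAlgHom_apply k _ _ _).trans (FreeAlgebra.lift_ι_apply _ _)

lemma lift_y {B : Type*} [Ring B] [Algebra k B] (u v : B) (h : v * u = q • (u * v)) :
    lift u v h (y q) = v :=
  (RingQuot.liftAlgHom_mkAlgHom_apply k _ _ _).trans (FreeAlgebra.lift_ι_apply _ _)

lemma eq_top_of_gen_mem (U : Subalgebra k (QuantumPlane k q)) (hx : x q ∈ U) (hy : y q ∈ U) :
    U = ⊤ := by
  rw [eq_top_iff]
  rintro z -
  obtain ⟨z, rfl⟩ := RingQuot.mkAlgHom_surjective k (QuantumPlaneRel k q) z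
  change mk q z ∈ U
  induction z using FreeAlgebra.induction with
  | grade0 r => rw [AlgHom.commutes]; exact U.algebraMap_mem r
  | grade1 i => cases i; exacts [hx, hy]
  | mul y z hy hz => rw [map_mul]; exact mul_mem hy hz
  | add y z hy hz => rw [map_add]; exact add_mem hy hz

lemma commute_lift {B : Type*} [Ring B] [Algebra k B] {u v : B} (h : v * u = q • (u * v)) {z : B}
    (hu : Commute z u) (hv : Commute z v) (w : QuantumPlane k q) : Commute z (lift u v h w) := by
  have : (Subalgebra.centralizer k {z}).comap (lift u v h) = ⊤ := by
    refine eq_top_of_gen_mem _ ?_ ?_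
    · rw [Subalgebra.mem_comap, lift_x, Subalgebra.mem_centralizer_iff]
      rintro _ rfl
      exact hu
    · rw [Subalgebra.mem_comap, lift_y, Subalgebra.mem_centralizer_iff]
      rintro _ rfl
      exact hv
  have hw : w ∈ (Subalgebra.centralizer k {z}).comap (lift u v h) := this ▸ trivial
  exact (Subalgebra.mem_centralizer_iff k).1 hw z rfl

/-- The monomials `x ^ a * y ^ b`. -/
def mono (q : k) (s : ℕ × ℕ) : QuantumPlane k q := x q ^ s.1 * y q ^ s.2

lemma y_mul_mono (s : ℕ × ℕ) : y q * mono q s = q ^ s.1 • (mono q s * y q) := by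
  have h : ∀ a : ℕ, y q * x q ^ a = q ^ a • (x q ^ a * y q) := fun a => by
    induction a with
    | zero => simp
    | succ a ih =>
      rw [pow_succ (x q), ← mul_assoc, ih, smul_mul_assoc, mul_assoc, y_mul_x, mul_smul_comm,
        smul_smul, mul_assoc, pow_succ]
  rw [mono, ← mul_assoc, h, smul_mul_assoc, mul_assoc, mul_assoc, ← pow_succ, ← pow_succ']

lemma mono_mul_x (s : ℕ × ℕ) : mono q s * x q = q ^ s.2 • (x q * mono q s) := by
  have h : ∀ b : ℕ, y q ^ b * x q = q ^ b • (x q * y q ^ b) := fun b => by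
    induction b with
    | zero => simp
    | succ b ih =>
      rw [pow_succ' (y q), mul_assoc, ih, mul_smul_comm, ← mul_assoc, y_mul_x, smul_mul_assoc,
        smul_smul, mul_assoc, pow_succ]
  rw [mono, mul_assoc, h, mul_smul_comm, ← mul_assoc, ← mul_assoc, ← pow_succ, ← pow_succ']

lemma span_mono : Submodule.span k (Set.range (mono q)) = ⊤ := by
  let V := Submodule.span k (Set.range (mono q))
  have hV : ∀ s, mono q s ∈ V := fun s => Submodule.subset_span ⟨s, rfl⟩
  let U : Subalgebra k (QuantumPlane k q) :=
    { carrier := {a | ∀ t ∈ V, a * t ∈ V}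
      mul_mem' := fun {a b} ha hb t ht => by
        rw [mul_assoc]
        exact ha _ (hb t ht)
      add_mem' := fun {a b} ha hb t ht => by
        rw [add_mul]
        exact add_mem (ha t ht) (hb t ht)
      algebraMap_mem' := fun c t ht => by
        rw [← Algebra.smul_def]
        exact V.smul_mem c ht }
  have hext : ∀ a, (∀ s, a * mono q s ∈ V) → a ∈ U := fun a h t ht => by
    induction ht using Submodule.span_induction with
    | mem t ht => obtain ⟨s, rfl⟩ := ht; exact h s
    | zero => rw [mul_zero]; exact zero_mem _
    | add s t _ _ hs ht => rw [mul_add]; exact add_mem hs ht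
    | smul c t _ ht => rw [mul_smul_comm]; exact V.smul_mem c ht
  have hU : U = ⊤ := eq_top_of_gen_mem U
    (hext _ fun s => by
      rw [mono, ← mul_assoc, ← pow_succ']
      exact hV (s.1 + 1, s.2))
    (hext _ fun s => by
      rw [y_mul_mono, mono, mul_assoc, ← pow_succ]
      exact V.smul_mem _ (hV (s.1, s.2 + 1)))
  rw [eq_top_iff]
  rintro a -
  have ha : a ∈ U := hU ▸ trivial
  have h1 : (1 : QuantumPlane k q) ∈ V := by simpa [mono] using hV (0, 0)
  simpa using ha 1 h1

end QuantumPlane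

/-- Simultaneous eigenvectors with different systems of eigenvalues are linearly independent. -/
lemma linearIndependent_of_simultaneous_eigenvectors {k V I J : Type*} [Field k] [AddCommGroup V]
    [Module k V] (w : I → V) (hw : ∀ i, w i ≠ 0) (T : J → V →ₗ[k] V) (χ : J → I → k)
    (hT : ∀ j i, T j (w i) = χ j i • w i) (hχ : ∀ i i', (∀ j, χ j i = χ j i') → i = i') :
    LinearIndependent k w := by
  classical
  rw [linearIndependent_iff']
  intro s
  induction s using Finset.induction_on with
  | empty => simp
  | insert i₀ s hi₀ ih =>
    intro c hc
    rw [Finset.sum_insert hi₀] at hc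
    have h1 : ∀ i ∈ s, c i = 0 := fun i hi => by
      -- Applying `T j` and subtracting `χ j i₀` times the relation removes the term of `i₀` and
      -- leaves every other coefficient multiplied by a difference of eigenvalues.
      obtain ⟨j, hj⟩ : ∃ j, χ j i ≠ χ j i₀ := by
        by_contra! hcon
        exact hi₀ (hχ i i₀ hcon ▸ hi)
      have h2 := congrArg (T j) hc
      rw [map_add, map_smul, hT, map_zero, map_sum] at h2
      have h3 : ∑ i ∈ s, (c i * (χ j i - χ j i₀)) • w i = 0 := by
        have h4 := congrArg (χ j i₀ • ·) hc
        simp only [smul_add, smul_zero, Finset.smul_sum] at h4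
        rw [← sub_eq_zero.2 (h2.trans h4.symm), smul_smul, smul_smul, mul_comm,
          add_sub_add_left_eq_sub, ← Finset.sum_sub_distrib]
        refine Finset.sum_congr rfl fun i _ => ?_
        rw [map_smul, hT, smul_smul, smul_smul, ← sub_smul]
        congr 1
        ring
      exact (mul_eq_zero.1 (ih _ h3 i hi)).resolve_right (sub_ne_zero.2 hj)
    have h2 : c i₀ = 0 := by
      rw [Finset.sum_eq_zero fun i hi => by rw [h1 i hi, zero_smul], add_zero] at hc
      exact (smul_eq_zero.1 hc).resolve_right (hw i₀)
    intro i hi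
    rcases Finset.mem_insert.1 hi with rfl | hi
    exacts [h2, h1 i hi]

lemma tprod_eq_prod_single {k B : Type*} [Field k] [Ring B] [Algebra k B] {n : ℕ} (x : Fin n → B) :
    PiTensorProduct.tprod k x =
      (List.ofFn fun i => (PiTensorProduct.singleAlgHom i (x i) : ⨂[k] _ : Fin n, B)).prod := by
  rw [← prodHom_tprod (fun i => PiTensorProduct.singleAlgHom i)
    fun i j hij x y => single_commute hij x y]
  have : prodHom (fun i => PiTensorProduct.singleAlgHom i)
      (fun i j hij x y => single_commute hij x y) = AlgHom.id k (⨂[k] _ : Fin n, B) :=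
    PiTensorProduct.algHom_ext fun i => AlgHom.ext fun x =>
      prodHom_single (fun i => PiTensorProduct.singleAlgHom i)
        (fun i j hij x y => single_commute hij x y) i x
  rw [this]
  rfl

lemma pow_injective_of_not_root {k : Type*} [Field k] {r : k} (h0 : r ≠ 0)
    (h : ∀ j : ℕ, 1 ≤ j → r ^ j ≠ 1) : Function.Injective fun j : ℕ => r ^ j := by
  have key : ∀ a b : ℕ, a ≤ b → r ^ a = r ^ b → a = b := fun a b hab hr => by
    by_contra hne
    refine h (b - a) (by omega) ?_
    have := pow_ne_zero a h0
    rw [← Nat.sub_add_cancel hab, pow_add] at hr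
    exact mul_right_cancel₀ this (by rw [one_mul, ← hr])
  intro a b hab
  rcases le_total a b with h | h
  exacts [key a b h hab, (key b a h hab.symm).symm]

/-! ### Tensor products of quantum planes. -/

section QuantumTarget

variable {k : Type*} [Field k] {r₀ r : k} {N : ℕ}

/-- The monomials in `k_{r₀}[x,y] ⊗ k_r[x,y]^{⊗ N}`. -/
def quantumMono (r₀ r : k) (s : (ℕ × ℕ) × (Fin N → ℕ × ℕ)) :
    QuantumPlane k r₀ ⊗[k] (⨂[k] _ : Fin N, QuantumPlane k r) :=
  QuantumPlane.mono r₀ s.1 ⊗ₜ PiTensorProduct.tprod k fun l => QuantumPlane.mono r (s.2 l)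

lemma span_quantumMono : Submodule.span k (Set.range (quantumMono (N := N) r₀ r)) = ⊤ := by
  rw [eq_top_iff]
  rintro z -
  induction z using TensorProduct.induction_on with
  | zero => exact zero_mem _
  | add x y hx hy => exact add_mem hx hy
  | tmul u v =>
    have hu : u ∈ Submodule.span k (Set.range (QuantumPlane.mono r₀)) := by
      rw [QuantumPlane.span_mono]; trivial
    have hv : v ∈ Submodule.span k (Set.range fun s : Fin N → ℕ × ℕ =>
        PiTensorProduct.tprod k fun l => QuantumPlane.mono r (s l)) := by
      rw [PiTensorProduct.submodule_span_eq_top (ι := Fin N) (M := fun _ => QuantumPlane k r)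
        (γ := fun _ => ℕ × ℕ) (g := fun _ => QuantumPlane.mono r)
        fun _ => QuantumPlane.span_mono]
      trivial
    induction hu using Submodule.span_induction with
    | zero => rw [TensorProduct.zero_tmul]; exact zero_mem _
    | add x y _ _ hx hy => rw [TensorProduct.add_tmul]; exact add_mem hx hy
    | smul c x _ hx => rw [← TensorProduct.smul_tmul']; exact Submodule.smul_mem _ _ hx
    | mem u hu =>
      obtain ⟨s, rfl⟩ := hu
      induction hv using Submodule.span_induction with
      | zero => rw [TensorProduct.tmul_zero]; exact zero_mem _
      | add x y _ _ hx hy => rw [TensorProduct.tmul_add]; exact add_mem hx hy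
      | smul c x _ hx => rw [TensorProduct.tmul_smul]; exact Submodule.smul_mem _ _ hx
      | mem v hv =>
        obtain ⟨t, rfl⟩ := hv
        exact Submodule.subset_span ⟨(s, t), rfl⟩

/-- The generators of `k_{r₀}[x,y] ⊗ k_r[x,y]^{⊗ N}`. -/
def quantumGen (r₀ r : k) : Option (Fin N) × Bool →
    QuantumPlane k r₀ ⊗[k] (⨂[k] _ : Fin N, QuantumPlane k r)
  | (none, false) => QuantumPlane.x r₀ ⊗ₜ 1
  | (none, true) => QuantumPlane.y r₀ ⊗ₜ 1
  | (some l, false) => 1 ⊗ₜ PiTensorProduct.singleAlgHom l (QuantumPlane.x r)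
  | (some l, true) => 1 ⊗ₜ PiTensorProduct.singleAlgHom l (QuantumPlane.y r)

/-- The eigenvalues of the conjugations by the generators. -/
def quantumChar (r₀ r : k) : Option (Fin N) × Bool → (ℕ × ℕ) × (Fin N → ℕ × ℕ) → k
  | (none, false), s => (r₀ ^ s.1.2)⁻¹
  | (none, true), s => r₀ ^ s.1.1
  | (some l, false), s => (r ^ (s.2 l).2)⁻¹
  | (some l, true), s => r ^ (s.2 l).1

/-- Only the `l`-th slot changes, and multilinearity takes the scalar out of it. -/
lemma single_mul_tprod {B : Type*} [Ring B] [Algebra k B] (l : Fin N) (z : B) (m : Fin N → B) (c : k)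
    (h : z * m l = c • (m l * z)) :
    PiTensorProduct.singleAlgHom l z * PiTensorProduct.tprod k m =
      c • (PiTensorProduct.tprod k m * PiTensorProduct.singleAlgHom l z) := by
  classical
  rw [PiTensorProduct.singleAlgHom_apply, PiTensorProduct.tprod_mul_tprod,
    PiTensorProduct.tprod_mul_tprod]
  have h1 : (Pi.mulSingle l z : Fin N → B) * m =
      Function.update (m * Pi.mulSingle l z) l (c • (m l * z)) := by
    funext i
    by_cases hi : i = l
    · subst hi
      rw [Pi.mul_apply, Pi.mulSingle_eq_same, Function.update_self, h]
    · rw [Pi.mul_apply, Pi.mulSingle_eq_of_ne hi, Function.update_of_ne hi, Pi.mul_apply,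
        Pi.mulSingle_eq_of_ne hi, one_mul, mul_one]
  change PiTensorProduct.tprod k ((Pi.mulSingle l z : Fin N → B) * m) =
    c • PiTensorProduct.tprod k (m * (Pi.mulSingle l z : Fin N → B))
  rw [h1, MultilinearMap.map_update_smul]
  congr 2
  rw [Function.update_eq_self_iff, Pi.mul_apply, Pi.mulSingle_eq_same]

lemma quantumGen_mul_quantumMono (h0 : r₀ ≠ 0) (h : r ≠ 0) (j : Option (Fin N) × Bool)
    (s : (ℕ × ℕ) × (Fin N → ℕ × ℕ)) :
    quantumGen r₀ r j * quantumMono r₀ r s =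
      quantumChar r₀ r j s • (quantumMono r₀ r s * quantumGen r₀ r j) := by
  have hx : ∀ {q : k} (_ : q ≠ 0) (t : ℕ × ℕ), QuantumPlane.x q * QuantumPlane.mono q t =
      (q ^ t.2)⁻¹ • (QuantumPlane.mono q t * QuantumPlane.x q) := fun hq t => by
    rw [QuantumPlane.mono_mul_x, smul_smul, inv_mul_cancel₀ (pow_ne_zero _ hq), one_smul]
  match j with
  | (none, false) =>
    simp only [quantumGen, quantumMono, quantumChar, Algebra.TensorProduct.tmul_mul_tmul, one_mul,
      mul_one]
    rw [hx h0, TensorProduct.smul_tmul']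
  | (none, true) =>
    simp only [quantumGen, quantumMono, quantumChar, Algebra.TensorProduct.tmul_mul_tmul, one_mul,
      mul_one]
    rw [QuantumPlane.y_mul_mono, TensorProduct.smul_tmul']
  | (some l, false) =>
    simp only [quantumGen, quantumMono, quantumChar, Algebra.TensorProduct.tmul_mul_tmul, one_mul,
      mul_one]
    rw [single_mul_tprod l _ _ _ (hx h _), TensorProduct.tmul_smul]
  | (some l, true) =>
    simp only [quantumGen, quantumMono, quantumChar, Algebra.TensorProduct.tmul_mul_tmul, one_mul,
      mul_one]
    rw [single_mul_tprod l _ _ _ (QuantumPlane.y_mul_mono _), TensorProduct.tmul_smul]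

lemma isUnit_quantumMono {B : Type*} [Ring B] [Algebra k B]
    (f : QuantumPlane k r₀ ⊗[k] (⨂[k] _ : Fin N, QuantumPlane k r) →ₐ[k] B)
    (hf : ∀ j, IsUnit (f (quantumGen r₀ r j))) (s : (ℕ × ℕ) × (Fin N → ℕ × ℕ)) :
    IsUnit (f (quantumMono r₀ r s)) := by
  have h1 : IsUnit ((f.comp Algebra.TensorProduct.includeLeft) (QuantumPlane.mono r₀ s.1)) := by
    rw [QuantumPlane.mono, map_mul, map_pow, map_pow]
    exact ((hf (none, false)).pow _).mul ((hf (none, true)).pow _)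
  have h2 : IsUnit ((f.comp Algebra.TensorProduct.includeRight)
      (PiTensorProduct.tprod k fun l => QuantumPlane.mono r (s.2 l))) := by
    rw [tprod_eq_prod_single, map_list_prod]
    refine List.prod_isUnit fun z hz => ?_
    obtain ⟨w, hw, rfl⟩ := List.mem_map.1 hz
    obtain ⟨l, rfl⟩ := List.mem_ofFn.1 hw
    simp only [QuantumPlane.mono, map_mul, map_pow]
    exact ((hf (some l, false)).pow _).mul ((hf (some l, true)).pow _)
  have h3 := h1.mul h2
  rw [AlgHom.comp_apply, AlgHom.comp_apply, ← map_mul] at h3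
  simpa [quantumMono] using h3

/-- A homomorphism to a nontrivial algebra mapping the generators to units is injective. -/
theorem quantumTarget_injective {B : Type*} [Ring B] [Algebra k B] [Nontrivial B]
    (h0 : r₀ ≠ 0) (h0' : ∀ j : ℕ, 1 ≤ j → r₀ ^ j ≠ 1) (h : r ≠ 0) (h' : ∀ j : ℕ, 1 ≤ j → r ^ j ≠ 1)
    (f : QuantumPlane k r₀ ⊗[k] (⨂[k] _ : Fin N, QuantumPlane k r) →ₐ[k] B)
    (hf : ∀ j, IsUnit (f (quantumGen r₀ r j))) : Function.Injective f := by
  refine LinearMap.injective_of_linearIndependent (f := f.toLinearMap) span_quantumMono ?_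
  have hi0 := pow_injective_of_not_root h0 h0'
  have hi := pow_injective_of_not_root h h'
  refine linearIndependent_of_simultaneous_eigenvectors _
    (fun s => (isUnit_quantumMono f hf s).ne_zero)
    -- The operators are conjugations by the images of the generators. Their eigenvalues on a
    -- monomial are powers of `r₀` and `r` which reveal all its exponents, as neither parameter is a
    -- root of unity.
    (fun j => LinearMap.mulRight k (((hf j).unit⁻¹ : Bˣ) : B) ∘ₗ LinearMap.mulLeft k (hf j).unit)
    (quantumChar r₀ r) ?_ ?_
  · intro j s
    change f (quantumGen r₀ r j) * f (quantumMono r₀ r s) * (((hf j).unit⁻¹ : Bˣ) : B) =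
      quantumChar r₀ r j s • f (quantumMono r₀ r s)
    rw [← map_mul, quantumGen_mul_quantumMono h0 h, map_smul, map_mul, smul_mul_assoc, mul_assoc,
      IsUnit.mul_val_inv, mul_one]
  · intro s t hst
    refine Prod.ext (Prod.ext ?_ ?_) (funext fun l => Prod.ext ?_ ?_)
    · exact hi0 (hst (none, true))
    · exact hi0 (inv_injective (hst (none, false)))
    · exact hi (hst (some l, true))
    · exact hi (inv_injective (hst (some l, false)))

lemma commute_prodHom {B S : Type*} [Ring B] [Algebra k B] [Ring S] [Algebra k S]
    (φ : Fin N → B →ₐ[k] S) (h : ∀ i j, i ≠ j → ∀ x y, Commute (φ i x) (φ j y)) {z : S}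
    (hz : ∀ i x, Commute z (φ i x)) (w : ⨂[k] _ : Fin N, B) : Commute z (prodHom φ h w) := by
  have := tensor_induction ((Subalgebra.centralizer k {z}).comap (prodHom φ h)) fun i x => by
    rw [Subalgebra.mem_comap, prodHom_single, Subalgebra.mem_centralizer_iff]
    rintro _ rfl
    exact hz i x
  have hw : w ∈ (Subalgebra.centralizer k {z}).comap (prodHom φ h) := this ▸ trivial
  exact (Subalgebra.mem_centralizer_iff k).1 hw z rfl

section Lift

variable {B : Type*} [Ring B] [Algebra k B]

/-- Pairs of elements of an algebra satisfying the relations of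
`k_{r₀}[x,y] ⊗ k_r[x,y]^{⊗ N}`. -/
structure IsQuantumFamily (r₀ r : k) (u₀ v₀ : B) (u v : Fin N → B) : Prop where
  rel₀ : v₀ * u₀ = r₀ • (u₀ * v₀)
  rel : ∀ l, v l * u l = r • (u l * v l)
  uu : ∀ i j, i ≠ j → Commute (u i) (u j)
  uv : ∀ i j, i ≠ j → Commute (u i) (v j)
  vv : ∀ i j, i ≠ j → Commute (v i) (v j)
  u₀u : ∀ l, Commute u₀ (u l)
  u₀v : ∀ l, Commute u₀ (v l)
  v₀u : ∀ l, Commute v₀ (u l)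
  v₀v : ∀ l, Commute v₀ (v l)

variable {u₀ v₀ : B} {u v : Fin N → B}

lemma IsQuantumFamily.commute (h : IsQuantumFamily r₀ r u₀ v₀ u v) (i j : Fin N) (hij : i ≠ j)
    (x y : QuantumPlane k r) : Commute (QuantumPlane.lift (u i) (v i) (h.rel i) x)
      (QuantumPlane.lift (u j) (v j) (h.rel j) y) :=
  QuantumPlane.commute_lift _
    (QuantumPlane.commute_lift _ (h.uu j i hij.symm) (h.uv j i hij.symm) x).symm
    (QuantumPlane.commute_lift _ (h.uv i j hij).symm (h.vv j i hij.symm) x).symm y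

/-- The homomorphism from `k_{r₀}[x,y] ⊗ k_r[x,y]^{⊗ N}` given by `N + 1` pairs of elements. -/
def IsQuantumFamily.lift (h : IsQuantumFamily r₀ r u₀ v₀ u v) :
    QuantumPlane k r₀ ⊗[k] (⨂[k] _ : Fin N, QuantumPlane k r) →ₐ[k] B :=
  Algebra.TensorProduct.lift (QuantumPlane.lift u₀ v₀ h.rel₀)
    (prodHom (fun l => QuantumPlane.lift (u l) (v l) (h.rel l)) h.commute)
    fun x y => commute_prodHom _ h.commute (fun i z => QuantumPlane.commute_lift _
      (QuantumPlane.commute_lift _ (h.u₀u i).symm (h.v₀u i).symm x).symm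
      (QuantumPlane.commute_lift _ (h.u₀v i).symm (h.v₀v i).symm x).symm z) y

lemma IsQuantumFamily.lift_gen (h : IsQuantumFamily r₀ r u₀ v₀ u v) :
    ∀ j, h.lift (quantumGen r₀ r j) = match j with
      | (none, false) => u₀
      | (none, true) => v₀
      | (some l, false) => u l
      | (some l, true) => v l
  | (none, false) => by
    rw [quantumGen, IsQuantumFamily.lift, Algebra.TensorProduct.lift_tmul, QuantumPlane.lift_x,
      map_one, mul_one]
  | (none, true) => by
    rw [quantumGen, IsQuantumFamily.lift, Algebra.TensorProduct.lift_tmul, QuantumPlane.lift_y,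
      map_one, mul_one]
  | (some l, false) => by
    rw [quantumGen, IsQuantumFamily.lift, Algebra.TensorProduct.lift_tmul, prodHom_single,
      QuantumPlane.lift_x, map_one, one_mul]
  | (some l, true) => by
    rw [quantumGen, IsQuantumFamily.lift, Algebra.TensorProduct.lift_tmul, prodHom_single,
      QuantumPlane.lift_y, map_one, one_mul]

end Lift

lemma quantumTarget_eq_top
    (U : Subalgebra k (QuantumPlane k r₀ ⊗[k] (⨂[k] _ : Fin N, QuantumPlane k r)))
    (h : ∀ j, quantumGen r₀ r j ∈ U) : U = ⊤ := by
  have h1 : U.comap Algebra.TensorProduct.includeLeft = ⊤ :=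
    QuantumPlane.eq_top_of_gen_mem _ (h (none, false)) (h (none, true))
  have h2 : U.comap Algebra.TensorProduct.includeRight = ⊤ := by
    refine tensor_induction _ fun l x => ?_
    have : (U.comap Algebra.TensorProduct.includeRight).comap
        (PiTensorProduct.singleAlgHom l) = ⊤ :=
      QuantumPlane.eq_top_of_gen_mem _ (h (some l, false)) (h (some l, true))
    have hx : x ∈ (U.comap Algebra.TensorProduct.includeRight).comap
        (PiTensorProduct.singleAlgHom l) := this ▸ trivial
    exact hx
  rw [eq_top_iff]
  rintro z -
  induction z using TensorProduct.induction_on with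
  | zero => exact zero_mem _
  | add x y hx hy => exact add_mem hx hy
  | tmul x y =>
    have hx : x ∈ U.comap Algebra.TensorProduct.includeLeft := h1 ▸ trivial
    have hy : y ∈ U.comap Algebra.TensorProduct.includeRight := h2 ▸ trivial
    have := mul_mem (show _ ∈ U from hx) (show _ ∈ U from hy)
    simpa using this

/-- The target embeds in the quantum torus with parameter `r₀` in place 0 and `r` elsewhere, with x
a coordinate and y the corresponding shift. These are units, so injectivity is automatic. -/
theorem quantumTarget_isOreDomain
    (h0 : r₀ ≠ 0) (h0' : ∀ j : ℕ, 1 ≤ j → r₀ ^ j ≠ 1) (h : r ≠ 0) (h' : ∀ j : ℕ, 1 ≤ j → r ^ j ≠ 1) :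
    IsOreDomain (QuantumPlane k r₀ ⊗[k] (⨂[k] _ : Fin N, QuantumPlane k r)) := by
  let q : Fin (N + 1) → kˣ := Fin.cons (Units.mk0 r₀ h0) fun _ => Units.mk0 r h
  let X : Fin (N + 1) → SkewMonoidAlgebra (ScaleLaurent q) (Multiplicative (Fin (N + 1) → ℤ)) :=
    fun i => SkewMonoidAlgebra.single 1 (ScaleLaurent.monomial q (Pi.single i 1))
  let Y : Fin (N + 1) → SkewMonoidAlgebra (ScaleLaurent q) (Multiplicative (Fin (N + 1) → ℤ)) :=
    fun i => SkewMonoidAlgebra.single (shiftGen i) 1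
  have hXX : ∀ i j, Commute (X i) (X j) := fun i j => by
    simp only [X, Commute, SemiconjBy, SkewMonoidAlgebra.single_mul_single, one_smul, mul_one,
      mul_comm]
  have hYY : ∀ i j, Commute (Y i) (Y j) := fun i j => by
    simp only [Y, Commute, SemiconjBy, SkewMonoidAlgebra.single_mul_single, smul_one, mul_one,
      mul_comm]
  have hXY : ∀ i j, i ≠ j → Commute (X i) (Y j) := fun i j hij => by
    simp only [X, Y, Commute, SemiconjBy, SkewMonoidAlgebra.single_mul_single, one_smul, mul_one,
      one_mul, scaleEmb_smul_monomial, if_neg hij.symm]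
  have hYX : ∀ i, Y i * X i = (q i : k) • (X i * Y i) := fun i => by
    simp only [X, Y, SkewMonoidAlgebra.single_mul_single, one_smul, mul_one,
      one_mul, scaleEmb_smul_monomial, if_true, zpow_one, SkewMonoidAlgebra.smul_single]
  have hX : ∀ i, IsUnit (X i) := fun i => by
    refine isUnit_iff_exists.2 ⟨SkewMonoidAlgebra.single 1
      (ScaleLaurent.monomial q (Pi.single i (-1))), ?_, ?_⟩ <;>
    · simp only [X, SkewMonoidAlgebra.single_mul_single, one_smul, ScaleLaurent.monomial_mul, mul_one]
      rw [← Pi.single_add]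
      simp [ScaleLaurent.monomial_zero]
  have hY : ∀ i, IsUnit (Y i) := fun i => by
    refine isUnit_iff_exists.2 ⟨SkewMonoidAlgebra.single (shiftGen i)⁻¹ 1, ?_, ?_⟩ <;>
    simp [Y, SkewMonoidAlgebra.single_mul_single]
  have hne : ∀ l : Fin N, (0 : Fin (N + 1)) ≠ l.succ := fun l => (Fin.succ_ne_zero l).symm
  have hF : IsQuantumFamily r₀ r (X 0) (Y 0) (fun l : Fin N => X l.succ) (fun l => Y l.succ) :=
    { rel₀ := hYX 0
      rel := fun l => hYX l.succ
      uu := fun i j _ => hXX _ _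
      uv := fun i j hij => hXY _ _ fun h => hij (Fin.succ_injective N h)
      vv := fun i j _ => hYY _ _
      u₀u := fun l => hXX _ _
      u₀v := fun l => hXY _ _ (hne l)
      v₀u := fun l => (hXY _ _ (hne l).symm).symm
      v₀v := fun l => hYY _ _ }
  refine HasPolyGrowth.isOreDomain_of_injective (quantum_hasPolyGrowth q) hF.lift
    (quantumTarget_injective h0 h0' h h' _ ?_)
  intro j
  rw [hF.lift_gen]
  match j with
  | (none, false) => exact hX _
  | (none, true) => exact hY _
  | (some l, false) => exact hX _
  | (some l, true) => exact hY _

end QuantumTarget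

/-! ### Monomials and the groups `G(m,p,n)` -/

section Groups

variable {k : Type*} [Field k] {n : ℕ}

lemma finite_complexReflectionGroup (m p : ℕ) (hm : 1 ≤ m) :
    Finite (complexReflectionGroup k m p n) := by
  have : NeZero m := ⟨by omega⟩
  let f : complexReflectionGroup k m p n → (Fin n → rootsOfUnity m k) × Equiv.Perm (Fin n) :=
    fun g => (fun i => ⟨g.1.left i, g.2.1 i⟩, g.1.right)
  refine Finite.of_injective f fun g g' h => Subtype.ext (SemidirectProduct.ext ?_ ?_)
  · funext i
    exact congrArg Subtype.val (congrFun (congrArg Prod.fst h) i)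
  · exact congrArg Prod.snd h

/-- If the character of `A(m,p,n)` with exponents `lam` is trivial, then `lam` is an integral
combination of `m e₁, …, m eₙ` and `(m/p)(e₁ + ⋯ + eₙ)`. -/
lemma exponents_of_trivial_character [IsAlgClosed k] [CharZero k] (m p : ℕ) (hm : 1 ≤ m)
    (hp : p ∣ m) (lam : Fin n → ℤ)
    (h : ∀ ζ : Fin n → kˣ, (∀ i, ζ i ^ m = 1) → (∏ i, ζ i) ^ (m / p) = 1 → ∏ i, ζ i ^ lam i = 1) :
    ∃ (j : ℤ) (ν : Fin n → ℤ), ∀ i, lam i = j * (m / p : ℕ) + ν i * m := by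
  have : NeZero m := ⟨by omega⟩
  have : NeZero (m : k) := ⟨by exact_mod_cast (by omega : m ≠ 0)⟩
  obtain ⟨ω', hω'⟩ := HasEnoughRootsOfUnity.exists_primitiveRoot k m
  obtain ⟨ω, rfl⟩ := hω'.isUnit (by omega)
  have hω : IsPrimitiveRoot ω m := IsPrimitiveRoot.coe_units_iff.1 hω'
  obtain ⟨r, rfl⟩ := hp
  have hp0 : 0 < p := Nat.pos_of_ne_zero fun h => by simp [h] at hm
  rw [Nat.mul_div_cancel_left r hp0] at h ⊢
  -- Test the character on ω in place `i` and ω⁻¹ in place `j`: the product of the entries is 1, so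
  -- the vector lies in A(m,p,n).
  have h1 : ∀ i j, ((p * r : ℕ) : ℤ) ∣ lam i - lam j := fun i j => by
    rw [← hω.zpow_eq_one_iff_dvd]
    have := h (Pi.mulSingle i ω * (Pi.mulSingle j ω)⁻¹) (fun l => by
      rw [← Pi.pow_apply, mul_pow, inv_pow, ← Pi.mulSingle_pow, ← Pi.mulSingle_pow, hω.pow_eq_one]
      simp) (by
      simp only [Pi.mul_apply, Pi.inv_apply, Finset.prod_mul_distrib, Finset.prod_inv_distrib]
      simp [Finset.prod_pi_mulSingle'])
    simp only [Pi.mul_apply, Pi.inv_apply, mul_zpow, inv_zpow, Finset.prod_mul_distrib,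
      Finset.prod_inv_distrib] at this
    have hs : ∀ l, ∏ i, (Pi.mulSingle l ω : Fin n → kˣ) i ^ lam i = ω ^ lam l := fun l => by
      rw [Finset.prod_eq_single l]
      · simp
      · intro b _ hb
        simp [hb]
      · simp
    rw [hs, hs] at this
    rw [zpow_sub, this]
  -- Test on ωᵖ in place `i` alone, which is admissible because the exponent `m / p` is `r`.
  have h2 : ∀ i, (r : ℤ) ∣ lam i := fun i => by
    have := h (Pi.mulSingle i (ω ^ p)) (fun l => by
      rw [← Pi.pow_apply, ← Pi.mulSingle_pow, ← pow_mul, mul_comm, pow_mul, hω.pow_eq_one]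
      simp) (by
      rw [Finset.prod_eq_single i (fun b _ hb => by simp [hb]) (by simp), Pi.mulSingle_eq_same,
        ← pow_mul, hω.pow_eq_one])
    rw [Finset.prod_eq_single i (fun b _ hb => by simp [hb]) (by simp), Pi.mulSingle_eq_same,
      ← zpow_natCast, ← zpow_mul, hω.zpow_eq_one_iff_dvd, Nat.cast_mul] at this
    exact Int.dvd_of_mul_dvd_mul_left (by exact_mod_cast hp0.ne') this
  rcases Nat.eq_zero_or_pos n with rfl | hn
  · exact ⟨0, fun _ => 0, fun i => i.elim0⟩
  · obtain ⟨j, hj⟩ := h2 ⟨0, hn⟩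
    -- The common multiple of `m / p` is read off from coordinate 0; the other exponents differ from
    -- it by multiples of `m`.
    choose ν hν using fun i => h1 i ⟨0, hn⟩
    refine ⟨j, ν, fun i => ?_⟩
    have := hν i
    rw [hj] at this
    linarith

end Groups

/-! ### The skew field of fractions and its monomials -/

/-- A division ring `E` containing elements `hᵢ` and a subfield `L` containing elements `xᵢ`,
with an action of the monomial group. -/
structure Frame (k L E : Type*) [Field k] [Field L] [Algebra k L] [DivisionRing E] [Algebra k E]
    (n : ℕ) where
  /-- the embedding of `L` -/
  ι : L →ₐ[k] E
  /-- the elements `xᵢ` -/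
  x : Fin n → L
  /-- the elements `hᵢ` -/
  h : Fin n → E
  /-- the action of the monomial group -/
  γ : MonomialGroup k n → E →ₐ[k] E
  /-- the action of the monomial group on `L` -/
  γL : MonomialGroup k n → L →ₐ[k] L
  x_ne : ∀ i, x i ≠ 0
  γ_mul : ∀ g g' e, γ (g * g') e = γ g (γ g' e)
  ι_γL : ∀ g l, ι (γL g l) = γ g (ι l)
  γL_x : ∀ g i, γL g (x i) = (g.left (g.right i) : k) • x (g.right i)
  γ_h : ∀ g i, γ g (h i) = h (g.right i)
  h_comm : ∀ i j, Commute (h i) (h j)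
  h_x : ∀ i j, i ≠ j → Commute (h i) (ι (x j))

namespace Frame

variable {k L E : Type*} [Field k] [Field L] [Algebra k L] [DivisionRing E] [Algebra k E] {n : ℕ}
  (F : Frame k L E n)

lemma ι_injective : Function.Injective F.ι := F.ι.toRingHom.injective

lemma ι_commute (a b : L) : Commute (F.ι a) (F.ι b) := (Commute.all a b).map F.ι

lemma γL_mul (g g' : MonomialGroup k n) (l : L) : F.γL (g * g') l = F.γL g (F.γL g' l) :=
  F.ι_injective (by rw [ι_γL, γ_mul, ι_γL, ι_γL])

/-- Laurent monomials in the `xᵢ`. -/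
def xm (lam : Fin n → ℤ) : L := ∏ i, F.x i ^ lam i

lemma xm_add (lam mu : Fin n → ℤ) : F.xm (lam + mu) = F.xm lam * F.xm mu := by
  rw [xm, xm, xm, ← Finset.prod_mul_distrib]
  exact Finset.prod_congr rfl fun i _ => zpow_add₀ (F.x_ne i) _ _

lemma xm_single (i : Fin n) (j : ℤ) : F.xm (Pi.single i j) = F.x i ^ j := by
  rw [xm, Finset.prod_eq_single i]
  · rw [Pi.single_eq_same]
  · intro b _ hb
    rw [Pi.single_eq_of_ne hb, zpow_zero]
  · simp

lemma γL_xm_left (ζ : Fin n → kˣ) (lam : Fin n → ℤ) :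
    F.γL (SemidirectProduct.inl ζ) (F.xm lam) = ((∏ i, ζ i ^ lam i : kˣ) : k) • F.xm lam := by
  rw [xm, map_prod, Units.coe_prod, ← Finset.prod_smul]
  refine Finset.prod_congr rfl fun i _ => ?_
  rw [map_zpow₀, γL_x, Units.val_zpow_eq_zpow_val]
  simp [Algebra.smul_def, mul_zpow]

/-- The elements `tᵢ = xᵢ ^ m`. -/
def t (m : ℕ) (i : Fin n) : L := F.x i ^ m

lemma t_ne (m : ℕ) (i : Fin n) : F.t m i ≠ 0 := pow_ne_zero _ (F.x_ne i)

lemma γL_t {m p : ℕ} {g : MonomialGroup k n} (hg : g ∈ complexReflectionGroup k m p n) (i : Fin n) :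
    F.γL g (F.t m i) = F.t m (g.right i) := by
  rw [t, map_pow, γL_x, _root_.smul_pow, ← Units.val_pow_eq_pow_val, hg.1, Units.val_one, one_smul, t]

/-- The element `(x₁ ⋯ xₙ) ^ r`. -/
def y (r : ℕ) : L := (∏ i, F.x i) ^ r

lemma y_ne (r : ℕ) : F.y r ≠ 0 := pow_ne_zero _ (Finset.prod_ne_zero_iff.2 fun i _ => F.x_ne i)

lemma γL_y {m p : ℕ} {g : MonomialGroup k n} (hg : g ∈ complexReflectionGroup k m p n) :
    F.γL g (F.y (m / p)) = F.y (m / p) := by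
  have h1 : F.γL g (∏ i, F.x i) = ((∏ i, g.left i : kˣ) : k) • ∏ i, F.x i := by
    rw [map_prod, Units.coe_prod, ← Finset.prod_smul]
    simp only [γL_x]
    exact Equiv.prod_comp g.right fun i => (g.left i : k) • F.x i
  rw [y, map_pow, h1, _root_.smul_pow, ← Units.val_pow_eq_pow_val, hg.2, Units.val_one, one_smul]

/-- Conditions on a skew subfield of `E`. -/
structure IsGood (T : Subfield E) (m p : ℕ) : Prop where
  algebraMap_mem : ∀ c : k, algebraMap k E c ∈ T
  y_mem : F.ι (F.y (m / p)) ∈ T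
  esymm_mem : ∀ d, F.ι (MvPolynomial.aeval (F.t m) (MvPolynomial.esymm (Fin n) k d)) ∈ T
  fixed : ∀ g ∈ complexReflectionGroup k m p n, ∀ e ∈ T, F.γ g e = e

section Average

variable {F} {T : Subfield E} {m p : ℕ}

/-- By the fundamental theorem on symmetric polynomials the elementary ones suffice. -/
lemma IsGood.symm_mem (hT : F.IsGood T m p) (f : MvPolynomial (Fin n) k) (hf : f.IsSymmetric) :
    F.ι (MvPolynomial.aeval (F.t m) f) ∈ T := by
  let TL : Subalgebra k L :=
    { (T.comap F.ι.toRingHom).toSubring with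
      algebraMap_mem' := fun c => by
        change F.ι (algebraMap k L c) ∈ T
        rw [AlgHom.commutes]
        exact hT.algebraMap_mem c }
  obtain ⟨g, hg⟩ := MvPolynomial.esymmAlgHom_surjective (σ := Fin n) k (n := n)
    (Fintype.card_fin n).le ⟨f, hf⟩
  have h1 : f = MvPolynomial.aeval (fun i : Fin n => MvPolynomial.esymm (Fin n) k (i + 1)) g := by
    rw [← MvPolynomial.esymmAlgHom_apply, hg]
  have h2 : MvPolynomial.aeval (F.t m) f = MvPolynomial.aeval (fun i : Fin n =>
      MvPolynomial.aeval (F.t m) (MvPolynomial.esymm (Fin n) k (i + 1))) g := by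
    rw [h1, ← AlgHom.comp_apply, MvPolynomial.comp_aeval]
  rw [h2]
  have h3 : ∀ g : MvPolynomial (Fin n) k, MvPolynomial.aeval (fun i : Fin n =>
      MvPolynomial.aeval (F.t m) (MvPolynomial.esymm (Fin n) k (i + 1))) g ∈ TL := fun g => by
    induction g using MvPolynomial.induction_on with
    | C c => rw [MvPolynomial.aeval_C]; exact TL.algebraMap_mem c
    | add p q hp hq => rw [map_add]; exact add_mem hp hq
    | mul_X p i hp =>
      rw [map_mul, MvPolynomial.aeval_X]
      exact mul_mem hp (hT.esymm_mem _)
  exact h3 g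

/-- A nontrivial character of A(m,p,n) on the monomial makes the sum equal to itself times a scalar
different from 1, hence zero. If the character is trivial, the monomial is a power of y times a
monomial in the tᵢ; y is invariant, and summing symmetrizes the rest. -/
theorem IsGood.sum_monomial_mem [IsAlgClosed k] [CharZero k] (hT : F.IsGood T m p) (hm : 1 ≤ m)
    (hp : p ∣ m) [Fintype (complexReflectionGroup k m p n)] (lam : Fin n → ℤ) :
    F.ι (∑ g : complexReflectionGroup k m p n, F.γL g (F.xm lam)) ∈ T := by
  by_cases h : ∀ ζ : Fin n → kˣ, (∀ i, ζ i ^ m = 1) → (∏ i, ζ i) ^ (m / p) = 1 →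
      ∏ i, ζ i ^ lam i = 1
  · obtain ⟨j, ν, hν⟩ := exponents_of_trivial_character m p hm hp lam h
    have hp0 : p ≠ 0 := fun h0 => by rw [h0, zero_dvd_iff] at hp; omega
    -- The shift `s` makes the exponents of the tᵢ nonnegative, so that the symmetrization is a
    -- polynomial.
    obtain ⟨s, hs⟩ : ∃ s : ℕ, ∀ i, 0 ≤ ν i + s := by
      refine ⟨∑ i, (ν i).natAbs, fun i => ?_⟩
      have h1 := Finset.single_le_sum (f := fun i => (ν i).natAbs) (fun _ _ => Nat.zero_le _)
        (Finset.mem_univ i)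
      have h2 : (ν i).natAbs ≤ ∑ i, (ν i).natAbs := h1
      zify at h2
      have := neg_abs_le (ν i)
      push_cast
      linarith
    choose μ hμ using fun i => Int.eq_ofNat_of_zero_le (hs i)
    -- The product of all tᵢ is yᵖ, so raising all exponents by `s` is paid for by y^{-ps}.
    have hxm : F.xm lam = F.y (m / p) ^ (j - p * s) * ∏ i, F.t m i ^ μ i := by
      rw [xm, y, ← zpow_natCast, ← zpow_mul, ← Finset.prod_zpow, ← Finset.prod_mul_distrib]
      refine Finset.prod_congr rfl fun i _ => ?_
      rw [t, ← pow_mul, ← zpow_natCast, ← zpow_add₀ (F.x_ne i), hν]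
      congr 1
      rw [Nat.cast_mul, ← hμ]
      have : (m : ℤ) = (m / p : ℕ) * p := by exact_mod_cast (Nat.div_mul_cancel hp).symm
      linear_combination (-(s : ℤ)) * this
    let f : MvPolynomial (Fin n) k := ∑ g : complexReflectionGroup k m p n,
      MvPolynomial.rename g.1.right (∏ i, MvPolynomial.X i ^ μ i)
    have hf : f.IsSymmetric := fun e => by
      let g₀ : complexReflectionGroup k m p n := ⟨SemidirectProduct.inr e, by
        constructor <;> simp⟩
      rw [map_sum]
      refine Fintype.sum_equiv (Equiv.mulLeft g₀) _ _ fun g => ?_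
      rw [MvPolynomial.rename_rename]
      rfl
    have hsum : ∑ g : complexReflectionGroup k m p n, F.γL g (F.xm lam) =
        F.y (m / p) ^ (j - p * s) * MvPolynomial.aeval (F.t m) f := by
      rw [map_sum, Finset.mul_sum]
      refine Finset.sum_congr rfl fun g _ => ?_
      rw [hxm, map_mul, map_zpow₀, F.γL_y g.2, map_prod, MvPolynomial.aeval_rename, map_prod]
      congr 1
      refine Finset.prod_congr rfl fun i _ => ?_
      rw [map_pow, F.γL_t g.2, map_pow, MvPolynomial.aeval_X, Function.comp_apply]
    rw [hsum, map_mul, map_zpow₀]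
    exact mul_mem (zpow_mem hT.y_mem _) (hT.symm_mem f hf)
  · push Not at h
    obtain ⟨ζ, h1, h2, h3⟩ := h
    let g₀ : complexReflectionGroup k m p n := ⟨SemidirectProduct.inl ζ, by
      constructor
      · simpa using h1
      · simpa using h2⟩
    -- Reindexing by right translation with `g₀` multiplies the monomial inside by the value of the
    -- character at ζ.
    have h4 : ∑ g : complexReflectionGroup k m p n, F.γL g (F.xm lam) =
        ((∏ i, ζ i ^ lam i : kˣ) : k) •
          ∑ g : complexReflectionGroup k m p n, F.γL g (F.xm lam) := by
      rw [Finset.smul_sum]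
      refine (Fintype.sum_equiv (Equiv.mulRight g₀) _ _ fun g => ?_).symm
      change _ = F.γL (g.1 * SemidirectProduct.inl ζ) _
      rw [F.γL_mul, F.γL_xm_left, map_smul]
    have h5 : ∑ g : complexReflectionGroup k m p n, F.γL g (F.xm lam) = 0 := by
      rw [← sub_eq_zero, ← one_smul k (∑ g : complexReflectionGroup k m p n, F.γL g (F.xm lam)),
        smul_smul, mul_one] at h4
      rw [← sub_smul] at h4
      refine (smul_eq_zero.1 h4).resolve_left (sub_ne_zero.2 fun h => h3 ?_)
      exact Units.ext h.symm
    rw [h5, map_zero]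
    exact zero_mem _

/-- The right `T`-span of the Laurent monomials. -/
def monoSpan (F : Frame k L E n) (T : Subfield E) : Submodule k E :=
  Submodule.span k {e | ∃ lam : Fin n → ℤ, ∃ τ ∈ T, e = F.ι (F.xm lam) * τ}

lemma mem_monoSpan (lam : Fin n → ℤ) {τ : E} (hτ : τ ∈ T) :
    F.ι (F.xm lam) * τ ∈ F.monoSpan T := Submodule.subset_span ⟨lam, τ, hτ, rfl⟩

lemma mul_mem_monoSpan {e τ : E} (he : e ∈ F.monoSpan T) (hτ : τ ∈ T) : e * τ ∈ F.monoSpan T := by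
  induction he using Submodule.span_induction with
  | mem e he =>
    obtain ⟨lam, τ', hτ', rfl⟩ := he
    rw [mul_assoc]
    exact mem_monoSpan lam (mul_mem hτ' hτ)
  | zero => rw [zero_mul]; exact zero_mem _
  | add e e' _ _ he he' => rw [add_mul]; exact add_mem he he'
  | smul c e _ he => rw [smul_mul_assoc]; exact Submodule.smul_mem _ _ he

lemma mem_monoSpan_of_mem {τ : E} (hτ : τ ∈ T) : τ ∈ F.monoSpan T := by
  have := mem_monoSpan (F := F) 0 hτ
  simpa [xm] using this

lemma xm_mul_mem_monoSpan (lam : Fin n → ℤ) {e : E} (he : e ∈ F.monoSpan T) :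
    F.ι (F.xm lam) * e ∈ F.monoSpan T := by
  induction he using Submodule.span_induction with
  | mem e he =>
    obtain ⟨lam', τ', hτ', rfl⟩ := he
    rw [← mul_assoc, ← map_mul, ← xm_add]
    exact mem_monoSpan _ hτ'
  | zero => rw [mul_zero]; exact zero_mem _
  | add e e' _ _ he he' => rw [mul_add]; exact add_mem he he'
  | smul c e _ he => rw [mul_smul_comm]; exact Submodule.smul_mem _ _ he

/-- The elements of `E` stabilizing `monoSpan`. -/
def stab (F : Frame k L E n) (T : Subfield E) : Subalgebra k E where
  carrier := {a | ∀ e ∈ F.monoSpan T, a * e ∈ F.monoSpan T}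
  mul_mem' := fun {a b} ha hb e he => by rw [mul_assoc]; exact ha _ (hb e he)
  add_mem' := fun {a b} ha hb e he => by rw [add_mul]; exact add_mem (ha e he) (hb e he)
  algebraMap_mem' := fun c e he => by rw [← Algebra.smul_def]; exact Submodule.smul_mem _ c he

lemma xm_mem_stab (lam : Fin n → ℤ) : F.ι (F.xm lam) ∈ F.stab T :=
  fun _ he => xm_mul_mem_monoSpan lam he

lemma mem_monoSpan_of_mem_stab {a : E} (ha : a ∈ F.stab T) : a ∈ F.monoSpan T := by
  simpa using ha 1 (mem_monoSpan_of_mem (one_mem T))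

/-- The affine rule for passing a monomial covers derivations (c = 1) and automorphisms (d = 0)
alike. It moves `a` past the monomial, after which only `a ∈ monoSpan` is needed. -/
lemma mem_stab_of_mem_monoSpan {a : E}
    (ha : a ∈ F.monoSpan T)
    (hst : ∀ lam : Fin n → ℤ, ∃ c d : k, a * F.ι (F.xm lam) = F.ι (F.xm lam) * (c • a + d • 1)) :
    a ∈ F.stab T := by
  intro e he
  induction he using Submodule.span_induction with
  | mem e he =>
    obtain ⟨lam, τ, hτ, rfl⟩ := he
    obtain ⟨c, d, hcd⟩ := hst lam
    rw [← mul_assoc, hcd, mul_assoc]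
    refine xm_mul_mem_monoSpan lam (mul_mem_monoSpan ?_ hτ)
    exact add_mem (Submodule.smul_mem _ c ha)
      (Submodule.smul_mem _ d (mem_monoSpan_of_mem (one_mem T)))
  | zero => rw [mul_zero]; exact zero_mem _
  | add e e' _ _ he he' => rw [mul_add]; exact add_mem he he'
  | smul c e _ he => rw [mul_smul_comm]; exact Submodule.smul_mem _ _ he

/-- The invariants in `monoSpan` lie in `T`. -/
theorem IsGood.mem_of_fixed [IsAlgClosed k] [CharZero k] (hT : F.IsGood T m p) (hm : 1 ≤ m)
    (hp : p ∣ m) {e : E} (he : e ∈ F.monoSpan T)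
    (hfix : ∀ g ∈ complexReflectionGroup k m p n, F.γ g e = e) : e ∈ T := by
  have := finite_complexReflectionGroup (k := k) (n := n) m p hm
  let := Fintype.ofFinite (complexReflectionGroup k m p n)
  -- As `T` is fixed pointwise, its elements come out of the sum on the right and only the sums of
  -- monomials remain.
  have key : ∀ e ∈ F.monoSpan T, ∑ g : complexReflectionGroup k m p n, F.γ g e ∈ T := by
    intro e he
    induction he using Submodule.span_induction with
    | mem e he =>
      obtain ⟨lam, τ, hτ, rfl⟩ := he
      have : ∑ g : complexReflectionGroup k m p n, F.γ g (F.ι (F.xm lam) * τ) =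
          F.ι (∑ g : complexReflectionGroup k m p n, F.γL g (F.xm lam)) * τ := by
        rw [map_sum, Finset.sum_mul]
        refine Finset.sum_congr rfl fun g _ => ?_
        rw [map_mul, hT.fixed g g.2 τ hτ, ι_γL]
      rw [this]
      exact mul_mem (hT.sum_monomial_mem hm hp lam) hτ
    | zero => simp only [map_zero, Finset.sum_const_zero]; exact zero_mem _
    | add e e' _ _ he he' =>
      simp only [map_add, Finset.sum_add_distrib]; exact add_mem he he'
    | smul c e _ he =>
      simp only [map_smul, ← Finset.smul_sum]
      rw [Algebra.smul_def]
      exact mul_mem (hT.algebraMap_mem c) he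
  have h1 := key e he
  -- For an invariant the sum is the order of the group times the element, and the order is
  -- invertible in `k`.
  rw [Finset.sum_congr rfl fun g _ => hfix g.1 g.2, Finset.sum_const, Finset.card_univ,
    ← Nat.cast_smul_eq_nsmul k] at h1
  have h2 : ((Fintype.card (complexReflectionGroup k m p n) : ℕ) : k) ≠ 0 :=
    Nat.cast_ne_zero.2 Fintype.card_ne_zero
  have h3 := mul_mem (hT.algebraMap_mem (Fintype.card (complexReflectionGroup k m p n) : k)⁻¹) h1
  rwa [← Algebra.smul_def, smul_smul, inv_mul_cancel₀ h2, one_smul] at h3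

end Average

end Frame

/-! ### Double commutants in division rings -/

section Bicomm

variable {k E : Type*} [Field k] [DivisionRing E] [Algebra k E]

/-- The double commutant of a set, as a subfield. -/
def bicomm (s : Set E) : Subfield E where
  carrier := {a | ∀ c, (∀ x ∈ s, Commute c x) → Commute a c}
  mul_mem' ha hb c hc := (ha c hc).mul_left (hb c hc)
  one_mem' c _ := Commute.one_left c
  add_mem' ha hb c hc := (ha c hc).add_left (hb c hc)
  zero_mem' c _ := Commute.zero_left c
  neg_mem' ha c hc := (ha c hc).neg_left
  inv_mem' _ ha c hc := (ha c hc).inv_left₀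

lemma subset_bicomm (s : Set E) : s ⊆ bicomm s := fun x hx _ hc => (hc x hx).symm

lemma algebraMap_mem_bicomm (s : Set E) (c : k) : algebraMap k E c ∈ bicomm s :=
  fun e _ => Algebra.commutes c e

lemma bicomm_commute {s : Set E} (hs : ∀ x ∈ s, ∀ y ∈ s, Commute x y) {a b : E}
    (ha : a ∈ bicomm s) (hb : b ∈ bicomm s) : Commute a b :=
  ha b fun x hx => hb x fun y hy => hs x hx y hy

/-- Conjugation by `u` rescales the elements of `s`, so u⁻¹cu commutes with `s` whenever `c` does.
Elements of the double commutant commute with all such u⁻¹cu. -/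
lemma conj_mem_bicomm {s : Set E} {u : E} (hu : u ≠ 0)
    (h : ∀ x ∈ s, ∃ c : k, u * x = c • (x * u)) {a : E} (ha : a ∈ bicomm s) :
    u * a * u⁻¹ ∈ bicomm s := by
  intro c hc
  have h1 : Commute a (u⁻¹ * c * u) := ha _ fun x hx => by
    obtain ⟨r, hr⟩ := h x hx
    have h2 : Commute c (u * x * u⁻¹) := by
      rw [hr, smul_mul_assoc, mul_assoc, mul_inv_cancel₀ hu, mul_one]
      exact (hc x hx).smul_right r
    have h3 : u⁻¹ * (c * (u * x * u⁻¹)) * u = u⁻¹ * ((u * x * u⁻¹) * c) * u := by rw [h2.eq]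
    have e1 : u⁻¹ * (c * (u * x * u⁻¹)) * u = u⁻¹ * c * u * x * (u⁻¹ * u) := by noncomm_ring
    have e2 : u⁻¹ * ((u * x * u⁻¹) * c) * u = (u⁻¹ * u) * (x * (u⁻¹ * c * u)) := by noncomm_ring
    rw [e1, e2, inv_mul_cancel₀ hu, mul_one, one_mul] at h3
    exact h3
  have h2 : u * (a * (u⁻¹ * c * u)) * u⁻¹ = u * ((u⁻¹ * c * u) * a) * u⁻¹ := by rw [h1.eq]
  have e1 : u * (a * (u⁻¹ * c * u)) * u⁻¹ = u * a * u⁻¹ * c * (u * u⁻¹) := by noncomm_ring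
  have e2 : u * ((u⁻¹ * c * u) * a) * u⁻¹ = (u * u⁻¹) * (c * (u * a * u⁻¹)) := by noncomm_ring
  rw [e1, e2, mul_inv_cancel₀ hu, mul_one, one_mul] at h2
  exact h2

/-- Infinitesimal form of the preceding argument: by the Jacobi identity the commutator with `u`
preserves the commutant of `s`, hence the double commutant. -/
lemma lie_mem_bicomm {s : Set E} {u : E} (h : ∀ x ∈ s, ∃ c : k, u * x - x * u = c • x)
    {a : E} (ha : a ∈ bicomm s) : u * a - a * u ∈ bicomm s := by
  intro c hc
  have h1 : Commute a (u * c - c * u) := ha _ fun x hx => by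
    obtain ⟨r, hr⟩ := h x hx
    have h2 : c * (u * x - x * u) = (u * x - x * u) * c := by
      rw [hr, mul_smul_comm, smul_mul_assoc, (hc x hx).eq]
    have h3 := (hc x hx).eq
    have e : (u * c - c * u) * x - x * (u * c - c * u) = u * (c * x - x * c) -
      (c * x - x * c) * u - (c * (u * x - x * u) - (u * x - x * u) * c) := by noncomm_ring
    rw [h2, h3, sub_self, sub_self, mul_zero, zero_mul, sub_self, sub_self] at e
    exact sub_eq_zero.1 e
  have h2 := (ha c hc).eq
  have h3 := h1.eq
  have e : (u * a - a * u) * c - c * (u * a - a * u) = u * (a * c - c * a) -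
      (a * c - c * a) * u - (a * (u * c - c * u) - (u * c - c * u) * a) := by noncomm_ring
  rw [h2, h3, sub_self, sub_self, mul_zero, zero_mul, sub_self, sub_self] at e
  exact sub_eq_zero.1 e

end Bicomm

/-! ### Skew fields of fractions of tensor powers of generalized Weyl algebras -/

lemma ringHom_skewFrac_ext (k : Type*) {R E : Type*} [Field k] [Ring R] [Algebra k R]
    [IsOreDomain R] [DivisionRing E] {f g : SkewFrac R →+* E}
    (h : ∀ r, f (toFrac k R r) = g (toFrac k R r)) : f = g := by
  refine RingHom.ext fun e => ?_
  obtain ⟨r, s, hs, rfl⟩ := exists_div_eq (k := k) e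
  rw [map_mul, map_mul, map_inv₀, map_inv₀, h, h]

section GWAFrame

variable {k D : Type*} [Field k] [CommRing D] [Algebra k D] (a : D) (σ : D ≃ₐ[k] D) (n : ℕ)

/-- The tensor power `D(a, σ)^{⊗ n}`. -/
abbrev GWATensor : Type _ := ⨂[k] _ : Fin n, GWA a σ

variable {a σ n}

lemma monomialAction_single (g : MonomialGroup k n) (i : Fin n) (z : GWA a σ) :
    monomialAction n (GWA.scale a σ) g (PiTensorProduct.singleAlgHom i z) =
      PiTensorProduct.singleAlgHom (g.right i) (GWA.scale a σ (g.left (g.right i)) z) := by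
  have h : monomialAction n (GWA.scale a σ) g =
      torusAction n (GWA.scale a σ) g.left * permAction n g.right := rfl
  rw [h, AlgEquiv.mul_apply]
  change tensorEquiv n (fun i => GWA.scale a σ (g.left i)) (permEquiv n g.right _) = _
  rw [PiTensorProduct.singleAlgHom_apply, permEquiv_tprod, tensorEquiv_tprod,
    PiTensorProduct.singleAlgHom_apply]
  congr 1
  funext j
  by_cases hj : j = g.right i
  · subst hj
    change _ = (Pi.mulSingle (g.right i) _ : Fin n → GWA a σ) (g.right i)
    rw [Pi.mulSingle_eq_same, Equiv.symm_apply_apply]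
    change GWA.scale a σ _ ((Pi.mulSingle i z : Fin n → GWA a σ) i) = _
    rw [Pi.mulSingle_eq_same]
  · change GWA.scale a σ _ ((Pi.mulSingle i z : Fin n → GWA a σ) _) =
      (Pi.mulSingle (g.right i) _ : Fin n → GWA a σ) j
    rw [Pi.mulSingle_eq_of_ne hj, Pi.mulSingle_eq_of_ne, map_one]
    intro h
    exact hj (by rw [← h, Equiv.apply_symm_apply])

variable (a σ n) [IsOreDomain (GWATensor a σ n)]

/-- The skew field of fractions of `D(a, σ)^{⊗ n}`. -/
abbrev GWAFrac : Type _ := SkewFrac (GWATensor a σ n)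

/-- The element `Xᵢ⁺` of the skew field of fractions. -/
def GWAFrac.X (i : Fin n) : GWAFrac a σ n :=
  toFrac k _ (PiTensorProduct.singleAlgHom i (GWA.Xp a σ))

/-- The elements of the `i`-th copy of `D` in the skew field of fractions. -/
def GWAFrac.base (i : Fin n) : D →ₐ[k] GWAFrac a σ n :=
  (toFrac k _).comp ((PiTensorProduct.singleAlgHom i).comp (GWA.baseHom a σ))

lemma GWAFrac.X_commute (i j : Fin n) : Commute (GWAFrac.X a σ n i) (GWAFrac.X a σ n j) := by
  by_cases hij : i = j
  · subst hij
    exact Commute.refl _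
  · exact (single_commute hij _ _).map (toFrac k _)

lemma GWAFrac.X_base (i : Fin n) (d : D) : GWAFrac.X a σ n i * GWAFrac.base a σ n i d =
    GWAFrac.base a σ n i (σ d) * GWAFrac.X a σ n i := by
  simp only [GWAFrac.X, GWAFrac.base, AlgHom.comp_apply, ← map_mul, GWA.baseHom_apply, GWA.Xp_base]

lemma GWAFrac.base_commute (i j : Fin n) (d e : D) :
    Commute (GWAFrac.base a σ n i d) (GWAFrac.base a σ n j e) := by
  by_cases hij : i = j
  · subst hij
    exact (Commute.all d e).map (GWAFrac.base a σ n i)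
  · exact (single_commute hij _ _).map (toFrac k _)

lemma GWAFrac.base_X (i j : Fin n) (hij : i ≠ j) (d : D) :
    Commute (GWAFrac.base a σ n i d) (GWAFrac.X a σ n j) :=
  (single_commute hij _ _).map (toFrac k _)

/-- The action of the monomial group on the skew field of fractions. -/
def GWAFrac.act (g : MonomialGroup k n) : GWAFrac a σ n →ₐ[k] GWAFrac a σ n :=
  fracLift ((toFrac k (GWATensor a σ n)).comp
      (monomialAction n (GWA.scale a σ) g : GWATensor a σ n →ₐ[k] GWATensor a σ n))
    ((toFrac_injective (k := k) (R := GWATensor a σ n)).comp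
      (monomialAction n (GWA.scale a σ) g).injective)

lemma GWAFrac.act_toFrac (g : MonomialGroup k n) (z : GWATensor a σ n) :
    GWAFrac.act a σ n g (toFrac k _ z) = toFrac k _ (monomialAction n (GWA.scale a σ) g z) :=
  fracLift_toFrac _ _ _

lemma GWAFrac.act_mul (g g' : MonomialGroup k n) (e : GWAFrac a σ n) :
    GWAFrac.act a σ n (g * g') e = GWAFrac.act a σ n g (GWAFrac.act a σ n g' e) := by
  have : (GWAFrac.act a σ n (g * g')).toRingHom =
      ((GWAFrac.act a σ n g).comp (GWAFrac.act a σ n g')).toRingHom := by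
    refine ringHom_skewFrac_ext k fun z => ?_
    change GWAFrac.act a σ n (g * g') _ = GWAFrac.act a σ n g (GWAFrac.act a σ n g' _)
    rw [act_toFrac, act_toFrac, act_toFrac, map_mul]
    rfl
  exact DFunLike.congr_fun this e

lemma GWAFrac.act_one (e : GWAFrac a σ n) : GWAFrac.act a σ n 1 e = e := by
  have : (GWAFrac.act a σ n 1).toRingHom = RingHom.id _ := by
    refine ringHom_skewFrac_ext k fun z => ?_
    change GWAFrac.act a σ n 1 _ = _
    rw [act_toFrac, map_one]
    rfl
  exact DFunLike.congr_fun this e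

lemma GWAFrac.act_X (g : MonomialGroup k n) (i : Fin n) : GWAFrac.act a σ n g (GWAFrac.X a σ n i) =
    (g.left (g.right i) : k) • GWAFrac.X a σ n (g.right i) := by
  rw [X, act_toFrac, monomialAction_single]
  have : GWA.scale a σ (g.left (g.right i)) (GWA.Xp a σ) =
    (g.left (g.right i) : k) • GWA.Xp a σ := GWA.scaleHom_gen _ _
  rw [this, map_smul, map_smul, X]

lemma GWAFrac.act_base (g : MonomialGroup k n) (i : Fin n) (d : D) :
    GWAFrac.act a σ n g (GWAFrac.base a σ n i d) = GWAFrac.base a σ n (g.right i) d := by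
  change GWAFrac.act a σ n g (toFrac k _ (PiTensorProduct.singleAlgHom i (GWA.base a σ d))) =
    toFrac k _ (PiTensorProduct.singleAlgHom (g.right i) (GWA.base a σ d))
  rw [act_toFrac, monomialAction_single]
  have : GWA.scale a σ (g.left (g.right i)) (GWA.base a σ d) = GWA.base a σ d := GWA.scaleHom_gen _ _
  rw [this]

/-- The commutative subfield generated by the `Xᵢ⁺`, up to double commutants. -/
def GWAField : Type _ := bicomm (Set.range (GWAFrac.X a σ n))

instance : DivisionRing (GWAField a σ n) :=
  inferInstanceAs (DivisionRing (bicomm (Set.range (GWAFrac.X a σ n))))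

instance : Field (GWAField a σ n) :=
  { (inferInstance : DivisionRing (GWAField a σ n)) with
    mul_comm := fun u v => Subtype.ext (bicomm_commute (by
      rintro _ ⟨i, rfl⟩ _ ⟨j, rfl⟩
      exact GWAFrac.X_commute a σ n i j) u.2 v.2) }

instance : Algebra k (GWAField a σ n) :=
  RingHom.toAlgebra
    { toFun := fun c => ⟨algebraMap k (GWAFrac a σ n) c, algebraMap_mem_bicomm _ c⟩
      map_one' := Subtype.ext (map_one _)
      map_mul' := fun c d => Subtype.ext (map_mul _ c d)
      map_zero' := Subtype.ext (map_zero _)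
      map_add' := fun c d => Subtype.ext (map_add _ c d) }

/-- The inclusion of the commutative subfield. -/
def GWAField.val : GWAField a σ n →ₐ[k] GWAFrac a σ n :=
  { (bicomm (Set.range (GWAFrac.X a σ n))).subtype with commutes' := fun _ => rfl }

/-- The group permutes the `X i` up to scalars, so it preserves their commutant and then their
double commutant. -/
lemma GWAFrac.act_mem_bicomm (g : MonomialGroup k n) {e : GWAFrac a σ n}
    (he : e ∈ bicomm (Set.range (GWAFrac.X a σ n))) :
    GWAFrac.act a σ n g e ∈ bicomm (Set.range (GWAFrac.X a σ n)) := by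
  intro c hc
  have h1 : Commute e (GWAFrac.act a σ n g⁻¹ c) := he _ (by
    rintro _ ⟨i, rfl⟩
    have h2 := (hc _ ⟨g.right i, rfl⟩).smul_right (g.left (g.right i) : k)
    rw [← GWAFrac.act_X] at h2
    have h3 := h2.map (GWAFrac.act a σ n g⁻¹)
    rwa [← GWAFrac.act_mul, inv_mul_cancel, GWAFrac.act_one] at h3)
  have h4 := h1.map (GWAFrac.act a σ n g)
  rwa [← GWAFrac.act_mul, mul_inv_cancel, GWAFrac.act_one] at h4

/-- The action of the monomial group on the commutative subfield. -/
def GWAField.act (g : MonomialGroup k n) : GWAField a σ n →ₐ[k] GWAField a σ n where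
  toFun u := ⟨GWAFrac.act a σ n g u.1, GWAFrac.act_mem_bicomm a σ n g u.2⟩
  map_one' := Subtype.ext (map_one _)
  map_mul' _ _ := Subtype.ext (map_mul (GWAFrac.act a σ n g) _ _)
  map_zero' := Subtype.ext (map_zero _)
  map_add' _ _ := Subtype.ext (map_add (GWAFrac.act a σ n g) _ _)
  commutes' c := Subtype.ext ((GWAFrac.act a σ n g).commutes c)

/-- The frame of a tensor power of generalized Weyl algebras. -/
def gwaFrame (hX : ∀ i, GWAFrac.X a σ n i ≠ 0) (d : D) :
    Frame k (GWAField a σ n) (GWAFrac a σ n) n where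
  ι := GWAField.val a σ n
  x i := ⟨GWAFrac.X a σ n i, subset_bicomm _ ⟨i, rfl⟩⟩
  h i := GWAFrac.base a σ n i d
  γ := GWAFrac.act a σ n
  γL := GWAField.act a σ n
  x_ne i h := hX i (congrArg Subtype.val h)
  γ_mul := GWAFrac.act_mul a σ n
  ι_γL _ _ := rfl
  γL_x g i := Subtype.ext ((GWAFrac.act_X a σ n g i).trans (Algebra.smul_def _ _))
  γ_h g i := GWAFrac.act_base a σ n g i d
  h_comm i j := GWAFrac.base_commute a σ n i j d d
  h_x i j hij := GWAFrac.base_X a σ n i j hij d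

/-- The skew field generated by the invariants. -/
def GWAFrac.invariantField (m p : ℕ) : Subfield (GWAFrac a σ n) :=
  skewAdjoin k (Set.range ((toFrac k (GWATensor a σ n)).comp (GWAInvariants m p n a σ).val))

variable {a σ n}

lemma GWAFrac.mem_invariantField {m p : ℕ} {e : GWAFrac a σ n} (he : e ∈ (toFrac k _).range)
    (h : ∀ g ∈ complexReflectionGroup k m p n, GWAFrac.act a σ n g e = e) :
    e ∈ GWAFrac.invariantField a σ n m p := by
  obtain ⟨z, rfl⟩ := he
  refine subset_skewAdjoin _ ⟨⟨z, fun g hg => ?_⟩, rfl⟩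
  have := h g hg
  change GWAFrac.act a σ n g (toFrac k _ z) = toFrac k _ z at this
  rw [GWAFrac.act_toFrac] at this
  exact toFrac_injective this

/-- Once `X⁺` is invertible, `X⁻` is redundant: it equals `(X⁺)⁻¹ σ(a)`. -/
lemma toFrac_mem_of_base_mem (hX : ∀ i, GWAFrac.X a σ n i ≠ 0)
    (U : Subalgebra k (GWAFrac a σ n)) (h1 : ∀ i d, GWAFrac.base a σ n i d ∈ U)
    (h2 : ∀ i, GWAFrac.X a σ n i ∈ U) (h3 : ∀ i, (GWAFrac.X a σ n i)⁻¹ ∈ U)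
    (z : GWATensor a σ n) : toFrac k _ z ∈ U := by
  have : U.comap (toFrac k (GWATensor a σ n)) = ⊤ := by
    refine tensor_induction _ fun i w => ?_
    have hw : (U.comap (toFrac k (GWATensor a σ n))).comap (PiTensorProduct.singleAlgHom i) = ⊤ := by
      refine GWA.eq_top_of_gen_mem _ ?_
      rintro (d | _ | _)
      · exact h1 i d
      · exact h2 i
      · change toFrac k _ (PiTensorProduct.singleAlgHom i (GWA.Xm a σ)) ∈ U
        have e : GWAFrac.X a σ n i * toFrac k _ (PiTensorProduct.singleAlgHom i (GWA.Xm a σ)) =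
            GWAFrac.base a σ n i (σ a) := by
          rw [GWAFrac.X, ← map_mul, ← map_mul, GWA.Xp_Xm]
          rfl
        rw [← eq_inv_mul_iff_mul_eq₀ (hX i)] at e
        rw [e]
        exact mul_mem (h3 i) (h1 i _)
    have : w ∈ (U.comap (toFrac k (GWATensor a σ n))).comap (PiTensorProduct.singleAlgHom i) :=
      hw ▸ trivial
    exact this
  have hz : z ∈ U.comap (toFrac k (GWATensor a σ n)) := this ▸ trivial
  exact hz

/-- Comparison of the skew field generated by the invariants with a given subfield. -/
theorem GWAFrac.invariantField_eq [IsAlgClosed k] [CharZero k] (hX : ∀ i, GWAFrac.X a σ n i ≠ 0)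
    (d₀ : D) {m p : ℕ} (hm : 1 ≤ m) (hp : p ∣ m) {s : Set (GWAFrac a σ n)}
    (hT : (gwaFrame a σ n hX d₀).IsGood (skewAdjoin k s) m p)
    (hst : ∀ i d, GWAFrac.base a σ n i d ∈ (gwaFrame a σ n hX d₀).stab (skewAdjoin k s))
    (hs : s ⊆ GWAFrac.invariantField a σ n m p) :
    GWAFrac.invariantField a σ n m p = skewAdjoin k s := by
  refine le_antisymm (skewAdjoin_le (algebraMap_mem_skewAdjoin s) ?_) (skewAdjoin_le_skewAdjoin hs)
  rintro _ ⟨z, rfl⟩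
  have hx : ∀ i (j : ℤ), (GWAFrac.X a σ n i) ^ j ∈ (gwaFrame a σ n hX d₀).stab (skewAdjoin k s) :=
    fun i j => by
      have := Frame.xm_mem_stab (F := gwaFrame a σ n hX d₀) (T := skewAdjoin k s) (Pi.single i j)
      rw [Frame.xm_single, map_zpow₀] at this
      exact this
  -- An element built from base elements and powers of the xᵢ stabilizes the span; applied to 1 it
  -- lies in the span, where averaging takes over.
  refine hT.mem_of_fixed hm hp (Frame.mem_monoSpan_of_mem_stab (toFrac_mem_of_base_mem hX _ hst
    (fun i => ?_) (fun i => ?_) z.1)) ?_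
  · simpa using hx i 1
  · simpa using hx i (-1)
  · intro g hg
    refine (GWAFrac.act_toFrac a σ n g z.1).trans ?_
    rw [z.2 g hg]
    rfl

end GWAFrame

/-! ### Lagrange interpolation -/

section Lagrange

variable {L : Type*} [Field L] {n : ℕ} (t : Fin n → L)

/-- The polynomial `∏_{j ≠ i} (X - tⱼ)`. -/
def nodalErase (i : Fin n) : L[X] := ∏ j ∈ Finset.univ.erase i, (X - C (t j))

/-- The scalar `∏_{j ≠ i} (tᵢ - tⱼ)⁻¹`. -/
def lagCoef (i : Fin n) : L := ∏ j ∈ Finset.univ.erase i, (t i - t j)⁻¹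

lemma X_sub_C_mul_nodalErase (i : Fin n) :
    (X - C (t i)) * nodalErase t i = ∏ j, (X - C (t j)) :=
  Finset.mul_prod_erase _ (fun j => X - C (t j)) (Finset.mem_univ i)

lemma natDegree_nodalErase_lt (i : Fin n) : (nodalErase t i).natDegree < n := by
  rw [nodalErase, natDegree_prod_of_monic _ _ fun j _ => monic_X_sub_C _]
  simp only [natDegree_X_sub_C, Finset.sum_const, smul_eq_mul, mul_one]
  rw [Finset.card_erase_of_mem (Finset.mem_univ i), Finset.card_univ, Fintype.card_fin]
  have := i.pos
  omega

variable {t}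

lemma lagCoef_ne (ht : Function.Injective t) (i : Fin n) : lagCoef t i ≠ 0 :=
  Finset.prod_ne_zero_iff.2 fun _ hj =>
    inv_ne_zero (sub_ne_zero.2 fun h => Finset.ne_of_mem_erase hj (ht h.symm))

lemma eval_nodalErase (i j : Fin n) :
    (nodalErase t i).eval (t j) = if i = j then (lagCoef t i)⁻¹ else 0 := by
  rw [nodalErase, eval_prod]
  split_ifs with h
  · subst h
    simp [lagCoef]
  · exact Finset.prod_eq_zero (Finset.mem_erase.2 ⟨Ne.symm h, Finset.mem_univ j⟩) (by simp)

/-- With `sum_pow_mul_lagCoef_mul_coeff` this says that the coefficient matrix of the nodal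
polynomials, normalized by `lagCoef`, is inverse to the Vandermonde matrix. -/
lemma sum_coeff_nodalErase_mul_pow (i j : Fin n) :
    ∑ e : Fin n, (nodalErase t i).coeff e * t j ^ (e : ℕ) =
      if i = j then (lagCoef t i)⁻¹ else 0 := by
  rw [← eval_nodalErase, eval_eq_sum_range' (natDegree_nodalErase_lt t i),
    Finset.sum_range]

lemma sum_nodalErase (ht : Function.Injective t) (f : L[X]) (hf : f.degree < n) :
    ∑ i, C (f.eval (t i) * lagCoef t i) * nodalErase t i = f := by
  conv_rhs => rw [Lagrange.eq_interpolate (s := Finset.univ) (v := t) ht.injOn (f := f)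
    (by simpa using hf), Lagrange.interpolate_apply]
  refine Finset.sum_congr rfl fun i _ => ?_
  rw [C_mul, mul_assoc]
  congr 1
  rw [Lagrange.basis, nodalErase, lagCoef, map_prod, ← Finset.prod_mul_distrib]
  rfl

/-- Lagrange interpolation reproduces X^d, of degree below `n`; compare coefficients in degree `e`.
-/
lemma sum_pow_mul_lagCoef_mul_coeff (ht : Function.Injective t) (d e : Fin n) :
    ∑ i, t i ^ (d : ℕ) * lagCoef t i * (nodalErase t i).coeff e = if d = e then 1 else 0 := by
  have h := congrArg (fun f => coeff f (e : ℕ)) (sum_nodalErase ht (X ^ (d : ℕ)) (by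
    rw [degree_X_pow]; exact_mod_cast d.2))
  simp only [finsetSum_coeff, coeff_C_mul, eval_pow, eval_X, coeff_X_pow] at h
  rw [h]
  simp [Fin.ext_iff, eq_comm]

end Lagrange

/-! ### Derivatives of the coefficients of ∏ (X - tⱼ). -/

section Derivation

variable {k L : Type*} [Field k] [Field L] [Algebra k L] {n : ℕ} {t : Fin n → L}
  (D : Derivation k L L)

lemma derivation_coeff_prod {s : Finset (Fin n)} (h : ∀ j ∈ s, D (t j) = 0) (e : ℕ) :
    D ((∏ j ∈ s, (X - C (t j))).coeff e) = 0 := by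
  classical
  induction s using Finset.induction_on generalizing e with
  | empty =>
    rw [Finset.prod_empty, coeff_one]
    split_ifs
    · exact D.map_one_eq_zero
    · exact map_zero D
  | insert i s hi ih =>
    have ih := ih fun j hj => h j (Finset.mem_insert_of_mem hj)
    rw [Finset.prod_insert hi, sub_mul, coeff_sub, coeff_C_mul, map_sub, D.leibniz, ih,
      h i (Finset.mem_insert_self i s)]
    cases e with
    | zero => simp
    | succ e => rw [coeff_X_mul, ih]; simp

/-- Split off the factor X - tᵢ: the derivation kills the coefficients of the other factor, so only
-D(tᵢ) = -1 contributes. -/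
lemma derivation_coeff_nodal (i : Fin n) (h1 : D (t i) = 1) (h : ∀ j, j ≠ i → D (t j) = 0) (e : ℕ) :
    D ((∏ j, (X - C (t j))).coeff e) = -(nodalErase t i).coeff e := by
  have h0 : ∀ e, D ((nodalErase t i).coeff e) = 0 :=
    derivation_coeff_prod D fun j hj => h j (Finset.ne_of_mem_erase hj)
  rw [← X_sub_C_mul_nodalErase t i, sub_mul, coeff_sub, coeff_C_mul, map_sub, D.leibniz, h0, h1]
  cases e with
  | zero => simp
  | succ e => rw [coeff_X_mul, h0]; simp

end Derivation

namespace Frame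

variable {k L E : Type*} [Field k] [Field L] [Algebra k L] [DivisionRing E] [Algebra k E] {n : ℕ}
  (F : Frame k L E n)

/-! ### Symmetric functions in a frame -/

lemma γL_lagCoef {m p : ℕ} {g : MonomialGroup k n} (hg : g ∈ complexReflectionGroup k m p n)
    (i : Fin n) : F.γL g (lagCoef (F.t m) i) = lagCoef (F.t m) (g.right i) := by
  rw [lagCoef, lagCoef, map_prod]
  simp only [map_inv₀, map_sub, F.γL_t hg]
  refine Finset.prod_equiv g.right (fun j => ?_) fun j _ => rfl
  simp

lemma γL_coeff_nodal {m p : ℕ} {g : MonomialGroup k n} (hg : g ∈ complexReflectionGroup k m p n)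
    (e : ℕ) : F.γL g ((∏ j, (X - C (F.t m j))).coeff e) = (∏ j, (X - C (F.t m j))).coeff e := by
  have : (∏ j, (X - C (F.t m j))).map (F.γL g).toRingHom = ∏ j, (X - C (F.t m j)) := by
    rw [Polynomial.map_prod]
    refine Eq.trans (Finset.prod_congr rfl fun j _ => ?_)
      (Equiv.prod_comp g.right fun j => X - C (F.t m j))
    rw [Polynomial.map_sub, Polynomial.map_X, Polynomial.map_C, ← F.γL_t hg]
    rfl
  conv_rhs => rw [← this, coeff_map]
  rfl

lemma coeff_prod_mem (A : Subalgebra k L) {m : ℕ} (hA : ∀ i, F.x i ∈ A) (s : Finset (Fin n)) (e : ℕ) :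
    (∏ j ∈ s, (X - C (F.t m j))).coeff e ∈ A := by
  classical
  induction s using Finset.induction_on generalizing e with
  | empty =>
    rw [Finset.prod_empty, coeff_one]
    split_ifs
    exacts [one_mem _, zero_mem _]
  | insert i s hi ih =>
    rw [Finset.prod_insert hi, sub_mul, coeff_sub, coeff_C_mul]
    refine sub_mem ?_ (mul_mem (pow_mem (hA i) m) (ih e))
    cases e with
    | zero => simp
    | succ e => rw [coeff_X_mul]; exact ih e

/-- The subalgebra of Laurent polynomials in the `xᵢ`. -/
def laurent : Subalgebra k L where
  carrier := Submodule.span k (Set.range F.xm)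
  mul_mem' := fun {a b} ha hb => by
    have h : Submodule.span k (Set.range F.xm) * Submodule.span k (Set.range F.xm) ≤
        Submodule.span k (Set.range F.xm) := by
      rw [Submodule.span_mul_span]
      refine Submodule.span_mono ?_
      rintro _ ⟨_, ⟨l, rfl⟩, _, ⟨l', rfl⟩, rfl⟩
      exact ⟨l + l', F.xm_add l l'⟩
    exact h (Submodule.mul_mem_mul ha hb)
  add_mem' := fun {a b} ha hb => Submodule.add_mem _ ha hb
  algebraMap_mem' := fun c => by
    rw [Algebra.algebraMap_eq_smul_one]
    exact Submodule.smul_mem _ _ (Submodule.subset_span ⟨0, by simp [xm]⟩)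

lemma x_mem_laurent (i : Fin n) : F.x i ∈ F.laurent :=
  Submodule.subset_span ⟨Pi.single i 1, by rw [xm_single, zpow_one]⟩

lemma laurent_mul_mem_monoSpan {T : Subfield E} {l : L} (hl : l ∈ F.laurent) {τ : E} (hτ : τ ∈ T) :
    F.ι l * τ ∈ F.monoSpan T := by
  replace hl : l ∈ Submodule.span k (Set.range F.xm) := hl
  induction hl using Submodule.span_induction with
  | mem l hl' => obtain ⟨lam, rfl⟩ := hl'; exact mem_monoSpan lam hτ
  | zero => rw [map_zero, zero_mul]; exact zero_mem _
  | add l l' h h' ih ih' => rw [map_add, add_mul]; exact add_mem ih ih'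
  | smul c l h ih => rw [map_smul, smul_mul_assoc]; exact Submodule.smul_mem _ _ ih

lemma γL_coeff_nodalErase {m p : ℕ} {g : MonomialGroup k n}
    (hg : g ∈ complexReflectionGroup k m p n) (i : Fin n) (e : ℕ) :
    F.γL g ((nodalErase (F.t m) i).coeff e) = (nodalErase (F.t m) (g.right i)).coeff e := by
  have : (nodalErase (F.t m) i).map (F.γL g).toRingHom = nodalErase (F.t m) (g.right i) := by
    rw [nodalErase, nodalErase, Polynomial.map_prod]
    refine Finset.prod_equiv g.right (fun j => by simp) fun j _ => ?_
    rw [Polynomial.map_sub, Polynomial.map_X, Polynomial.map_C, ← F.γL_t hg]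
    rfl
  rw [← this, coeff_map]
  rfl

/-- The elementary symmetric polynomials in the `tᵢ` are coefficients of `∏ (X - tᵢ)`. -/
lemma aeval_esymm_mem (A : Subfield E) {m : ℕ}
    (hA : ∀ e, F.ι ((∏ j, (X - C (F.t m j))).coeff e) ∈ A) (d : ℕ) :
    F.ι (MvPolynomial.aeval (F.t m) (MvPolynomial.esymm (Fin n) k d)) ∈ A := by
  rw [MvPolynomial.aeval_esymm_eq_multiset_esymm]
  by_cases hd : d ≤ n
  -- Vieta's formula; its sign is removed by multiplying with the same power of -1 once more.
  · have h := Multiset.prod_X_sub_C_coeff (Finset.univ.val.map (F.t m)) (k := n - d) (by simp)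
    have h2 : (∏ j, (X - C (F.t m j))) =
        (Multiset.map (fun t => X - C t) (Finset.univ.val.map (F.t m))).prod := by
      rw [Multiset.map_map]; rfl
    rw [← h2] at h
    have h3 := hA (n - d)
    rw [h, map_mul, map_pow, map_neg, map_one] at h3
    have hc : (Finset.univ.val.map (F.t m)).card - (n - d) = d := by
      simp only [Multiset.card_map, Finset.card_val, Finset.card_univ, Fintype.card_fin]
      omega
    rw [hc] at h3
    have h4 := mul_mem (pow_mem (neg_mem (one_mem A)) d) h3
    rwa [← mul_assoc, ← pow_add, Even.neg_one_pow ⟨d, rfl⟩, one_mul] at h4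
  · rw [Multiset.esymm, Multiset.powersetCard_eq_empty _ (by simpa using hd)]
    simp

lemma γ_fixed_of_gens {s : Set E} (g : MonomialGroup k n) (h : ∀ e ∈ s, F.γ g e = e) :
    ∀ e ∈ skewAdjoin k s, F.γ g e = e := by
  have : skewAdjoin k s ≤ RingHom.eqLocusField (F.γ g).toRingHom (RingHom.id E) :=
    skewAdjoin_le (fun c => (F.γ g).commutes c) h
  exact fun e he => this he

/-- The square of the Vandermonde determinant of the `tᵢ`, up to sign. -/
def discr (m : ℕ) : L := ∏ i, ∏ j ∈ Finset.univ.erase i, (F.t m i - F.t m j)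

lemma discr_ne {m : ℕ} (ht : Function.Injective (F.t m)) : F.discr m ≠ 0 :=
  Finset.prod_ne_zero_iff.2 fun _ _ => Finset.prod_ne_zero_iff.2 fun _ hj =>
    sub_ne_zero.2 fun h => Finset.ne_of_mem_erase hj (ht h.symm)

lemma γL_discr {m p : ℕ} {g : MonomialGroup k n} (hg : g ∈ complexReflectionGroup k m p n) :
    F.γL g (F.discr m) = F.discr m := by
  rw [discr, map_prod]
  refine Eq.trans (Finset.prod_congr rfl fun i _ => ?_)
    (Equiv.prod_comp g.right fun i => ∏ j ∈ Finset.univ.erase i, (F.t m i - F.t m j))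
  rw [map_prod]
  simp only [map_sub, F.γL_t hg]
  exact Finset.prod_equiv g.right (fun j => by simp) fun j _ => rfl

/-- The denominator of `lagCoef` is one of the factors of `discr`. -/
lemma discr_mul_lagCoef_mem (A : Subalgebra k L) {m : ℕ} (hA : ∀ i, F.x i ∈ A)
    (ht : Function.Injective (F.t m)) (i : Fin n) : F.discr m * lagCoef (F.t m) i ∈ A := by
  have hmem : ∀ i j, F.t m i - F.t m j ∈ A := fun i j =>
    sub_mem (pow_mem (hA i) m) (pow_mem (hA j) m)
  have h : F.discr m * lagCoef (F.t m) i = ∏ i' ∈ Finset.univ.erase i,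
      ∏ j ∈ Finset.univ.erase i', (F.t m i' - F.t m j) := by
    rw [discr, ← Finset.mul_prod_erase _ _ (Finset.mem_univ i), lagCoef, Finset.prod_inv_distrib,
      mul_right_comm, mul_inv_cancel₀, one_mul]
    exact Finset.prod_ne_zero_iff.2 fun _ hj =>
      sub_ne_zero.2 fun h => Finset.ne_of_mem_erase hj (ht h.symm)
  rw [h]
  exact prod_mem fun i' _ => prod_mem fun j _ => hmem _ _

/-- The element `∑ tᵢ^d cᵢ δᵢ`, where `cᵢ = ∏_{j ≠ i} (tᵢ - tⱼ)⁻¹`. -/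
def symm (m : ℕ) (δ : Fin n → E) (d : ℕ) : E :=
  ∑ i, F.ι (F.t m i ^ d * lagCoef (F.t m) i) * δ i

lemma γ_sum_lagCoef {m p : ℕ} {g : MonomialGroup k n} (hg : g ∈ complexReflectionGroup k m p n)
    {w : Fin n → L} (hw : ∀ i, F.γL g (w i) = w (g.right i)) {δ : Fin n → E}
    (hδ : ∀ i, F.γ g (δ i) = δ (g.right i)) :
    F.γ g (∑ i, F.ι (w i * lagCoef (F.t m) i) * δ i) = ∑ i, F.ι (w i * lagCoef (F.t m) i) * δ i := by
  rw [map_sum]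
  refine Eq.trans (Finset.sum_congr rfl fun i _ => ?_)
    (Equiv.sum_comp g.right fun i => F.ι (w i * lagCoef (F.t m) i) * δ i)
  rw [map_mul, hδ, ← ι_γL, map_mul, hw, F.γL_lagCoef hg]

lemma γ_symm {m p : ℕ} {g : MonomialGroup k n} (hg : g ∈ complexReflectionGroup k m p n)
    {δ : Fin n → E} (hδ : ∀ i, F.γ g (δ i) = δ (g.right i)) (d : ℕ) :
    F.γ g (F.symm m δ d) = F.symm m δ d :=
  F.γ_sum_lagCoef hg (w := fun i => F.t m i ^ d) (fun i => by rw [map_pow, F.γL_t hg]) hδ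

/-- A subfield containing the invariants of a subalgebra contains the symmetric elements. -/
lemma sum_lagCoef_mem_of_fixed_mem {m p : ℕ} (ht : Function.Injective (F.t m)) {w : Fin n → L}
    (hw : ∀ g ∈ complexReflectionGroup k m p n, ∀ i, F.γL g (w i) = w (g.right i)) {δ : Fin n → E}
    (hδ : ∀ g ∈ complexReflectionGroup k m p n, ∀ i, F.γ g (δ i) = δ (g.right i))
    (R : Subalgebra k E) (K : Subfield E)
    (hK : ∀ e ∈ R, (∀ g ∈ complexReflectionGroup k m p n, F.γ g e = e) → e ∈ K)
    (hx : ∀ i, F.ι (F.x i) ∈ R) (hwR : ∀ i, F.ι (w i) ∈ R)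
    (hδR : ∀ i, F.ι (F.t m i) * δ i ∈ R) :
    ∑ i, F.ι (w i * lagCoef (F.t m) i) * δ i ∈ K := by
  let A : Subalgebra k L := R.comap F.ι
  have htA : ∀ i, F.t m i ∈ A := fun i => pow_mem (show F.x i ∈ A from hx i) m
  have hP : F.ι (∏ i, F.t m i) ∈ K := by
    refine hK _ (show (∏ i, F.t m i) ∈ A from prod_mem fun i _ => htA i) fun g hg => ?_
    rw [← ι_γL, map_prod]
    congr 1
    refine Eq.trans (Finset.prod_congr rfl fun i _ => F.γL_t hg i)
      (Equiv.prod_comp g.right fun i => F.t m i)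
  have hV : F.ι (F.discr m) ∈ K := by
    refine hK _ (show F.discr m ∈ A from prod_mem fun i _ => prod_mem fun j _ =>
      sub_mem (htA i) (htA j)) fun g hg => ?_
    rw [← ι_γL, F.γL_discr hg]
  -- Both multipliers are nonzero invariants lying in `K`. The multiplied sum has no denominators,
  -- so it is an invariant in `R`; dividing inside `K` gives the claim.
  have hD : F.ι (F.discr m) * F.ι (∏ i, F.t m i) *
      (∑ i, F.ι (w i * lagCoef (F.t m) i) * δ i) ∈ K := by
    refine hK _ ?_ fun g hg => ?_
    · rw [Finset.mul_sum]
      refine sum_mem fun i _ => ?_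
      -- The i-th factor of ∏ t is kept next to `δ i`, for which only `t i * δ i` is known to lie in
      -- `R`.
      have e : F.ι (F.discr m) * F.ι (∏ i, F.t m i) *
          (F.ι (w i * lagCoef (F.t m) i) * δ i) =
          F.ι (F.discr m * lagCoef (F.t m) i * (w i * ∏ j ∈ Finset.univ.erase i, F.t m j)) *
          (F.ι (F.t m i) * δ i) := by
        rw [← mul_assoc, ← mul_assoc, ← map_mul, ← map_mul, ← map_mul,
          ← Finset.mul_prod_erase _ _ (Finset.mem_univ i)]
        congr 2
        ring
      rw [e]
      refine mul_mem ?_ (hδR i)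
      exact show _ ∈ A from mul_mem (F.discr_mul_lagCoef_mem A hx ht i)
        (mul_mem (show w i ∈ A from hwR i) (prod_mem fun j _ => htA j))
    · rw [map_mul, map_mul, F.γ_sum_lagCoef hg (hw g hg) (hδ g hg), ← ι_γL, ← ι_γL, F.γL_discr hg, map_prod]
      congr 3
      refine Eq.trans (Finset.prod_congr rfl fun i _ => F.γL_t hg i)
        (Equiv.prod_comp g.right fun i => F.t m i)
  have hne : F.ι (F.discr m) * F.ι (∏ i, F.t m i) ≠ 0 := by
    rw [← map_mul]
    exact (map_ne_zero F.ι).2 (mul_ne_zero (F.discr_ne ht)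
      (Finset.prod_ne_zero_iff.2 fun i _ => F.t_ne m i))
  have := mul_mem (inv_mem (mul_mem hV hP)) hD
  rwa [← mul_assoc, inv_mul_cancel₀ hne, one_mul] at this

lemma symm_mem_of_fixed_mem {m p : ℕ} (ht : Function.Injective (F.t m)) {δ : Fin n → E}
    (hδ : ∀ g ∈ complexReflectionGroup k m p n, ∀ i, F.γ g (δ i) = δ (g.right i))
    (R : Subalgebra k E) (K : Subfield E)
    (hK : ∀ e ∈ R, (∀ g ∈ complexReflectionGroup k m p n, F.γ g e = e) → e ∈ K)
    (hx : ∀ i, F.ι (F.x i) ∈ R) (hδR : ∀ i, F.ι (F.t m i) * δ i ∈ R) (d : ℕ) :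
    F.symm m δ d ∈ K :=
  F.sum_lagCoef_mem_of_fixed_mem ht (w := fun i => F.t m i ^ d)
    (fun g hg i => by rw [map_pow, F.γL_t hg]) hδ R K hK hx
    (fun i => by rw [t, map_pow, map_pow]; exact pow_mem (pow_mem (hx i) m) d) hδR

end Frame

/-- A subfield containing the scalars, as a subalgebra. -/
def subfieldAlg {k E : Type*} [Field k] [DivisionRing E] [Algebra k E] (K : Subfield E)
    (hK : ∀ c : k, algebraMap k E c ∈ K) : Subalgebra k E :=
  { K.toSubring with algebraMap_mem' := hK }

namespace Frame

variable {k L E : Type*} [Field k] [Field L] [Algebra k L] [DivisionRing E] [Algebra k E] {n : ℕ}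
  (F : Frame k L E n)

/-! ### Frames of classical type -/

/-- A frame in which `hᵢ` acts on `L` as the derivation `xᵢ ∂/∂xᵢ`. -/
structure IsClassical : Prop where
  h_x_self : ∀ i, F.h i * F.ι (F.x i) = F.ι (F.x i) * F.h i + F.ι (F.x i)
  exists_lie : ∀ i l, ∃ l', F.h i * F.ι l - F.ι l * F.h i = F.ι l'

variable {F} (hF : F.IsClassical)

/-- The derivation induced by `hᵢ`. -/
def IsClassical.euler (i : Fin n) : Derivation k L L :=
  Derivation.mk'
    { toFun := fun l => Classical.choose (hF.exists_lie i l)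
      map_add' := fun l l' => F.ι_injective (by
        rw [← Classical.choose_spec (hF.exists_lie i _), map_add, map_add,
          ← Classical.choose_spec (hF.exists_lie i l), ← Classical.choose_spec (hF.exists_lie i l')]
        noncomm_ring)
      map_smul' := fun c l => F.ι_injective (by
        rw [← Classical.choose_spec (hF.exists_lie i _), map_smul, RingHom.id_apply, map_smul,
          ← Classical.choose_spec (hF.exists_lie i l), mul_smul_comm, smul_mul_assoc, smul_sub]) }
    fun l l' => F.ι_injective (by
      change F.ι (Classical.choose (hF.exists_lie i (l * l'))) =
        F.ι (l * Classical.choose (hF.exists_lie i l') + l' * Classical.choose (hF.exists_lie i l))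
      rw [← Classical.choose_spec (hF.exists_lie i _), mul_comm l', map_add, map_mul, map_mul, map_mul,
        ← Classical.choose_spec (hF.exists_lie i l), ← Classical.choose_spec (hF.exists_lie i l')]
      noncomm_ring)

lemma IsClassical.ι_euler (i : Fin n) (l : L) :
    F.ι (hF.euler i l) = F.h i * F.ι l - F.ι l * F.h i :=
  (Classical.choose_spec (hF.exists_lie i l)).symm

lemma IsClassical.euler_x (i j : Fin n) : hF.euler i (F.x j) = if i = j then F.x j else 0 := by
  refine F.ι_injective ?_
  rw [hF.ι_euler]
  split_ifs with h
  · subst h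
    rw [hF.h_x_self, add_sub_cancel_left]
  · rw [(F.h_x i j h).eq, sub_self, map_zero]

lemma IsClassical.euler_xm (i : Fin n) (lam : Fin n → ℤ) :
    hF.euler i (F.xm lam) = (lam i : k) • F.xm lam := by
  have h : ∀ s : Finset (Fin n), hF.euler i (∏ j ∈ s, F.x j ^ lam j) =
      (if i ∈ s then (lam i : k) else 0) • ∏ j ∈ s, F.x j ^ lam j := fun s => by
    induction s using Finset.induction_on with
    | empty => simp
    | insert j s hj ih =>
      rw [Finset.prod_insert hj, Derivation.leibniz, ih, Derivation.leibniz_zpow, hF.euler_x]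
      by_cases hij : i = j
      · subst hij
        rw [if_neg hj, if_pos rfl, if_pos (Finset.mem_insert_self i s), zero_smul, smul_zero,
          zero_add, smul_eq_mul, smul_eq_mul, ← zpow_add_one₀ (F.x_ne i),
          sub_add_cancel, ← Int.cast_smul_eq_zsmul k, mul_smul_comm, mul_comm]
      · rw [if_neg hij, smul_zero, smul_zero, smul_zero, add_zero, smul_eq_mul, mul_smul_comm]
        simp [hij]
  rw [xm, h, if_pos (Finset.mem_univ i)]

lemma IsClassical.h_mul_xm (hF : F.IsClassical) (i : Fin n) (lam : Fin n → ℤ) :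
    F.h i * F.ι (F.xm lam) = F.ι (F.xm lam) * ((1 : k) • F.h i + (lam i : k) • 1) := by
  have h := hF.ι_euler i (F.xm lam)
  rw [hF.euler_xm, map_smul] at h
  rw [one_smul, mul_add, mul_smul_comm, mul_one, h]
  abel

section Partial

variable (m : ℕ)

/-- The partial derivatives with respect to the `tᵢ`. -/
def IsClassical.pd (i : Fin n) : Derivation k L L := ((m : L)⁻¹ * (F.t m i)⁻¹) • hF.euler i

/-- The elements of `E` inducing the partial derivatives with respect to the `tᵢ`. -/
def pdElt (F : Frame k L E n) (m : ℕ) (i : Fin n) : E := F.ι ((m : L)⁻¹ * (F.t m i)⁻¹) * F.h i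

lemma IsClassical.ι_pd (i : Fin n) (l : L) :
    F.ι (hF.pd m i l) = F.pdElt m i * F.ι l - F.ι l * F.pdElt m i := by
  rw [pd, Derivation.smul_apply, smul_eq_mul, map_mul, hF.ι_euler, pdElt, mul_sub, ← mul_assoc,
    ← mul_assoc, ← mul_assoc, (F.ι_commute _ l).eq]

variable {m}

lemma IsClassical.euler_t (i j : Fin n) :
    hF.euler i (F.t m j) = if i = j then (m : L) * F.t m j else 0 := by
  rw [t, Derivation.leibniz_pow, hF.euler_x]
  split_ifs with h
  · rcases Nat.eq_zero_or_pos m with rfl | hm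
    · simp
    · rw [smul_eq_mul, ← pow_succ, Nat.sub_add_cancel hm, nsmul_eq_mul]
  · simp

lemma IsClassical.pd_t [CharZero L] (hm : 1 ≤ m) (i j : Fin n) :
    hF.pd m i (F.t m j) = if i = j then 1 else 0 := by
  have h0 : (m : L) ≠ 0 := Nat.cast_ne_zero.2 (by omega)
  rw [pd, Derivation.smul_apply, smul_eq_mul, hF.euler_t]
  split_ifs with h
  · subst h
    have := F.t_ne m i
    field_simp
  · rw [mul_zero]

/-- If tᵢ = tⱼ with i ≠ j, the derivative ∂/∂tᵢ of this element would be both 1 and 0. -/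
lemma IsClassical.t_injective [CharZero L] (hF : F.IsClassical) (hm : 1 ≤ m) : Function.Injective (F.t m) := by
  intro i j hij
  by_contra hne
  have h := hF.pd_t hm i i
  rw [hij, hF.pd_t hm, if_neg hne, if_pos rfl] at h
  exact zero_ne_one h

/-- For i ≠ j the derivation of hᵢ kills the coefficient 1/(m tⱼ), so every factor of one element
commutes with every factor of the other. -/
lemma IsClassical.pdElt_commute (hF : F.IsClassical) (i j : Fin n) :
    Commute (F.pdElt m i) (F.pdElt m j) := by
  by_cases hij : i = j
  · subst hij
    exact Commute.refl _
  · have h : ∀ i j, i ≠ j → Commute (F.h i) (F.ι ((m : L)⁻¹ * (F.t m j)⁻¹)) := fun i j hij => by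
      have h := hF.ι_euler i ((m : L)⁻¹ * (F.t m j)⁻¹)
      rw [Derivation.leibniz, Derivation.leibniz_inv, Derivation.leibniz_inv, hF.euler_t, if_neg hij,
        Derivation.map_natCast, smul_zero, smul_zero, smul_zero, smul_zero, add_zero, map_zero] at h
      exact (sub_eq_zero.1 h.symm)
    exact (((F.ι_commute _ _).mul_right (h j i (Ne.symm hij)).symm).mul_left
      ((h i j hij).mul_right (F.h_comm i j)))

/-- The derivation with given coefficients. -/
def IsClassical.field (m : ℕ) (w : Fin n → L) : Derivation k L L := ∑ i, w i • hF.pd m i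

/-- The element of `E` inducing the derivation with given coefficients. -/
def fieldElt (F : Frame k L E n) (m : ℕ) (w : Fin n → L) : E := ∑ i, F.ι (w i) * F.pdElt m i

lemma IsClassical.field_apply (w : Fin n → L) (l : L) :
    hF.field m w l = ∑ i, w i * hF.pd m i l := by
  change Derivation.coeFnAddMonoidHom (∑ i, w i • hF.pd m i) l = _
  rw [map_sum, Finset.sum_apply]
  rfl

lemma IsClassical.ι_field (w : Fin n → L) (l : L) :
    F.ι (hF.field m w l) = F.fieldElt m w * F.ι l - F.ι l * F.fieldElt m w := by
  rw [hF.field_apply, map_sum, fieldElt, Finset.sum_mul, Finset.mul_sum, ← Finset.sum_sub_distrib]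
  refine Finset.sum_congr rfl fun i _ => ?_
  rw [map_mul, hF.ι_pd, mul_sub, ← mul_assoc, ← mul_assoc, ← mul_assoc, (F.ι_commute _ l).eq]

/-- First-order operators multiply to a second-order part plus a field. The second-order part is
symmetric because the partial derivatives commute, so it drops out of the bracket. -/
lemma IsClassical.fieldElt_lie (w w' : Fin n → L) :
    F.fieldElt m w * F.fieldElt m w' - F.fieldElt m w' * F.fieldElt m w =
      F.fieldElt m fun j => hF.field m w (w' j) - hF.field m w' (w j) := by
  have h1 : ∀ w w' : Fin n → L, F.fieldElt m w * F.fieldElt m w' =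
      ∑ j, ∑ i, F.ι (w i * w' j) * (F.pdElt m i * F.pdElt m j) +
        F.fieldElt m fun j => hF.field m w (w' j) := fun w w' => by
    rw [fieldElt, fieldElt, fieldElt, Finset.mul_sum, ← Finset.sum_add_distrib]
    refine Finset.sum_congr rfl fun j _ => ?_
    have h := hF.ι_field (m := m) w (w' j)
    rw [eq_sub_iff_add_eq, fieldElt] at h
    rw [← mul_assoc, ← h, add_mul, add_comm]
    congr 1
    rw [Finset.mul_sum, Finset.sum_mul]
    refine Finset.sum_congr rfl fun i _ => ?_
    rw [mul_comm (w i), map_mul]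
    noncomm_ring
  rw [h1, h1, Finset.sum_comm]
  have h2 : ∑ i, ∑ j, F.ι (w i * w' j) * (F.pdElt m i * F.pdElt m j) =
      ∑ i, ∑ j, F.ι (w' j * w i) * (F.pdElt m j * F.pdElt m i) :=
    Finset.sum_congr rfl fun i _ => Finset.sum_congr rfl fun j _ => by
      rw [mul_comm, (hF.pdElt_commute i j).eq]
  rw [h2, add_sub_add_left_eq_sub, fieldElt, fieldElt, fieldElt, ← Finset.sum_sub_distrib]
  refine Finset.sum_congr rfl fun i _ => ?_
  rw [map_sub, sub_mul]

/-- The coefficients of `∏ (X - tᵢ)`. -/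
def nodalCoeff (F : Frame k L E n) (m : ℕ) (e : ℕ) : L := (∏ j, (X - C (F.t m j))).coeff e

lemma IsClassical.pd_nodalCoeff [CharZero L] (hm : 1 ≤ m) (i : Fin n) (e : ℕ) :
    hF.pd m i (F.nodalCoeff m e) = -(nodalErase (F.t m) i).coeff e :=
  derivation_coeff_nodal _ i (by rw [hF.pd_t hm, if_pos rfl])
    (fun j hj => by rw [hF.pd_t hm, if_neg hj.symm]) e

/-- The values of the field on the coefficients of ∏(X - tᵢ) are, up to sign, the coefficients of ∑
wᵢ ∏_{j≠i}(X - tⱼ). Evaluating this polynomial at tⱼ isolates wⱼ times a nonzero factor. -/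
lemma IsClassical.eq_zero_of_field_eq_zero [CharZero L] (hm : 1 ≤ m) (w : Fin n → L)
    (h : ∀ e : Fin n, hF.field m w (F.nodalCoeff m e) = 0) : w = 0 := by
  have ht := hF.t_injective hm
  funext j
  have h1 : ∑ e : Fin n, (∑ i, w i * (nodalErase (F.t m) i).coeff e) * F.t m j ^ (e : ℕ) = 0 :=
    Finset.sum_eq_zero fun e _ => by
      have := h e
      simp only [hF.field_apply, hF.pd_nodalCoeff hm, mul_neg, Finset.sum_neg_distrib,
        neg_eq_zero] at this
      rw [this, zero_mul]
  simp only [Finset.sum_mul, mul_assoc] at h1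
  rw [Finset.sum_comm] at h1
  simp only [← Finset.mul_sum, sum_coeff_nodalErase_mul_pow] at h1
  rw [Finset.sum_eq_single j (fun i _ hi => by rw [if_neg hi, mul_zero]) (by simp), if_pos rfl,
    mul_eq_zero] at h1
  exact h1.resolve_right (inv_ne_zero (lagCoef_ne ht j))

/-- Duality of fields and coordinates; as ∂pₑ/∂tᵢ is minus a coefficient of a nodal polynomial, this
is the inverse Vandermonde identity. -/
lemma IsClassical.field_symm [CharZero L] (hm : 1 ≤ m) (d e : Fin n) :
    hF.field m (fun i => F.t m i ^ (d : ℕ) * lagCoef (F.t m) i) (F.nodalCoeff m e) =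
      if d = e then -1 else 0 := by
  simp only [hF.field_apply, hF.pd_nodalCoeff hm, mul_neg, Finset.sum_neg_distrib]
  rw [sum_pow_mul_lagCoef_mul_coeff (hF.t_injective hm)]
  split_ifs <;> simp

/-- Inverting the Vandermonde matrix recovers each ∂/∂tᵢ from symmetric elements with coefficients
polynomial in the tⱼ. This is what later places hᵢ in the span of monomials. -/
lemma IsClassical.pdElt_eq [CharZero L] (hF : F.IsClassical) (hm : 1 ≤ m) (i : Fin n) :
    F.pdElt m i =
      ∑ e : Fin n, F.ι ((nodalErase (F.t m) i).coeff e) * F.symm m (F.pdElt m) e := by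
  have ht := hF.t_injective hm
  simp only [symm, Finset.mul_sum, ← mul_assoc, ← map_mul]
  rw [Finset.sum_comm]
  simp only [← Finset.sum_mul, ← map_sum, sum_coeff_nodalErase_mul_pow]
  rw [Finset.sum_eq_single i (fun j _ hj => by rw [if_neg hj.symm, zero_mul, map_zero, zero_mul])
    (by simp), if_pos rfl, inv_mul_cancel₀ (lagCoef_ne ht i), map_one, one_mul]

end Partial

/-! ### The Weyl algebra inside a frame of classical type -/

section Weyl

variable {N : ℕ} {F : Frame k L E (N + 1)} (hF : F.IsClassical) (m p : ℕ)

/-- The elements `y, p₁, …, p_N`. -/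
def weylX (F : Frame k L E (N + 1)) (m p : ℕ) : Fin (N + 1) → L :=
  Fin.cons (F.y (m / p)) fun d => F.nodalCoeff m d.succ

/-- The vector fields dual to the elements `y, p₁, …, p_N`. -/
def IsClassical.weylField : Fin (N + 1) → Fin (N + 1) → L :=
  Fin.cons (fun i => (hF.field m (fun i => lagCoef (F.t m) i) (F.y (m / p)))⁻¹ * lagCoef (F.t m) i)
    fun d i => -(F.t m i ^ (d.succ : ℕ) * lagCoef (F.t m) i)

variable {m p}

/-- This relation lets y replace the constant coefficient as a coordinate. -/
lemma y_pow (F : Frame k L E (N + 1)) (hp : p ∣ m) :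
    F.y (m / p) ^ p = (-1) ^ (N + 1) * F.nodalCoeff m 0 := by
  rw [y, ← pow_mul, Nat.div_mul_cancel hp, nodalCoeff, coeff_zero_prod]
  simp only [coeff_sub, coeff_X_zero, coeff_C_zero, zero_sub, Finset.prod_neg, Finset.card_univ,
    Fintype.card_fin]
  rw [← mul_assoc, ← pow_add, Even.neg_one_pow ⟨_, rfl⟩, one_mul, ← Finset.prod_pow]
  rfl

/-- The chain rule for the relation between y and the constant coefficient. -/
lemma field_y_pow (D : Derivation k L L) (F : Frame k L E (N + 1)) (hp : p ∣ m) :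
    (p : L) * F.y (m / p) ^ (p - 1) * D (F.y (m / p)) = (-1) ^ (N + 1) * D (F.nodalCoeff m 0) := by
  have h := congrArg D (y_pow F hp)
  rw [Derivation.leibniz_pow, Derivation.leibniz, Derivation.leibniz_pow, map_neg,
    Derivation.map_one_eq_zero, neg_zero, smul_zero, smul_zero, smul_zero, add_zero, smul_eq_mul,
    smul_eq_mul, nsmul_eq_mul, ← mul_assoc] at h
  exact h

variable [CharZero L]

lemma p_ne (hm : 1 ≤ m) (hp : p ∣ m) : (p : L) ≠ 0 :=
  Nat.cast_ne_zero.2 fun h0 => by rw [h0, zero_dvd_iff] at hp; omega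

/-- The derivative of `y` with respect to `p₀`, up to sign. -/
lemma IsClassical.field_lagCoef_y (hm : 1 ≤ m) (hp : p ∣ m) :
    hF.field m (fun i => lagCoef (F.t m) i) (F.y (m / p)) =
      ((p : L) * F.y (m / p) ^ (p - 1))⁻¹ * (-1) ^ N := by
  have h := field_y_pow (hF.field m fun i => lagCoef (F.t m) i) F hp
  have h2 := hF.field_symm hm 0 0
  simp only [Fin.val_zero, pow_zero, one_mul, if_true] at h2
  rw [h2, pow_succ, mul_assoc ((-1) ^ N), neg_one_mul, neg_neg, mul_one] at h
  rw [← h, inv_mul_cancel_left₀]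
  exact mul_ne_zero (p_ne hm hp) (pow_ne_zero _ (F.y_ne _))

/-- The duality `field_symm`, adapted to y. The fields with positive index kill the constant
coefficient and therefore y; the zeroth is divided by its value on y, and the sign is absorbed in
the others. -/
lemma IsClassical.field_weylField (hm : 1 ≤ m) (hp : p ∣ m) (i j : Fin (N + 1)) :
    hF.field m (hF.weylField m p i) (F.weylX m p j) = if i = j then 1 else 0 := by
  have hf := hF.field_lagCoef_y hm hp
  have hfne : hF.field m (fun i => lagCoef (F.t m) i) (F.y (m / p)) ≠ 0 := by
    rw [hf]
    exact mul_ne_zero (inv_ne_zero (mul_ne_zero (p_ne hm hp) (pow_ne_zero _ (F.y_ne _))))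
      (pow_ne_zero _ (neg_ne_zero.2 one_ne_zero))
  have hmul : ∀ (c : L) (w : Fin (N + 1) → L) l, hF.field m (fun i => c * w i) l =
      c * hF.field m w l := fun c w l => by
    simp only [hF.field_apply, Finset.mul_sum, mul_assoc]
  have hneg : ∀ (w : Fin (N + 1) → L) l, hF.field m (fun i => -w i) l = -hF.field m w l :=
    fun w l => by simp only [hF.field_apply, neg_mul, Finset.sum_neg_distrib]
  refine Fin.cases ?_ (fun i => ?_) i <;> refine Fin.cases ?_ (fun j => ?_) j
  · simp only [weylField, weylX, Fin.cons_zero, hmul, if_true]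
    exact inv_mul_cancel₀ hfne
  · simp only [weylField, weylX, Fin.cons_zero, Fin.cons_succ, hmul]
    have h2 := hF.field_symm hm 0 j.succ
    simp only [Fin.val_zero, pow_zero, one_mul] at h2
    rw [h2, if_neg (Fin.succ_ne_zero j).symm, mul_zero, if_neg (Fin.succ_ne_zero j).symm]
  · simp only [weylField, weylX, Fin.cons_zero, Fin.cons_succ, hneg]
    have h := field_y_pow (hF.field m fun l => F.t m l ^ (i.succ : ℕ) * lagCoef (F.t m) l) F hp
    have h2 := hF.field_symm hm i.succ 0
    rw [if_neg (Fin.succ_ne_zero i)] at h2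
    rw [show F.nodalCoeff m 0 = F.nodalCoeff m ((0 : Fin (N + 1)) : ℕ) from rfl, h2, mul_zero,
      mul_eq_zero] at h
    rw [h.resolve_left (mul_ne_zero (p_ne hm hp) (pow_ne_zero _ (F.y_ne _))), neg_zero,
      if_neg (Fin.succ_ne_zero i)]
  · simp only [weylField, weylX, Fin.cons_succ, hneg]
    rw [hF.field_symm hm i.succ j.succ]
    simp only [Fin.succ_inj]
    split_ifs <;> simp

/-- A derivation killing y kills the constant coefficient as well, and then all the coefficients. -/
lemma IsClassical.eq_zero_of_field_weylX (hF : F.IsClassical) (hm : 1 ≤ m) (hp : p ∣ m)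
    (w : Fin (N + 1) → L) (h : ∀ j, hF.field m w (F.weylX m p j) = 0) : w = 0 := by
  refine hF.eq_zero_of_field_eq_zero hm w fun e => ?_
  refine Fin.cases ?_ (fun e => ?_) e
  · have h1 := field_y_pow (hF.field m w) F hp
    have h2 := h 0
    rw [weylX, Fin.cons_zero] at h2
    rw [h2, mul_zero, eq_comm, mul_eq_zero] at h1
    exact h1.resolve_left (pow_ne_zero _ (neg_ne_zero.2 one_ne_zero))
  · exact h e.succ

/-- The homomorphism from the Weyl algebra to a frame of classical type. -/
def IsClassical.weylHom (hm : 1 ≤ m) (hp : p ∣ m) : WeylAlgebra k (N + 1) →ₐ[k] E :=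
  WeylAlgebra.lift (fun j => F.ι (F.weylX m p j)) (fun i => F.fieldElt m (hF.weylField m p i))
    (fun i j => F.ι_commute _ _)
    (fun i j => sub_eq_zero.1 (by
      rw [hF.fieldElt_lie]
      -- The dual fields take constant values on the coordinates, so their bracket kills every
      -- coordinate and is zero.
      have : (fun l => hF.field m (hF.weylField m p i) (hF.weylField m p j l) -
          hF.field m (hF.weylField m p j) (hF.weylField m p i l)) = 0 := by
        refine hF.eq_zero_of_field_weylX hm hp _ fun l => F.ι_injective ?_
        rw [hF.ι_field, ← hF.fieldElt_lie, map_zero]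
        have h : ∀ i, F.fieldElt m (hF.weylField m p i) * F.ι (F.weylX m p l) =
            F.ι (F.weylX m p l) * F.fieldElt m (hF.weylField m p i) + if i = l then 1 else 0 :=
          fun i => by
            have := hF.ι_field (m := m) (hF.weylField m p i) (F.weylX m p l)
            rw [hF.field_weylField hm hp, eq_sub_iff_add_eq] at this
            rw [← this, add_comm]
            split_ifs <;> simp
        have hc : ∀ i e, Commute (if i = l then 1 else 0 : E) e := fun i e => by
          split_ifs
          exacts [Commute.one_left e, Commute.zero_left e]
        rw [sub_mul, mul_assoc, mul_assoc, h i, h j, mul_add, mul_add, ← mul_assoc, ← mul_assoc,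
          h i, h j, mul_sub, add_mul, add_mul, (hc i _).eq, (hc j _).eq]
        noncomm_ring
      rw [this]
      simp [fieldElt]))
    fun i j => by
      have := hF.ι_field (m := m) (hF.weylField m p i) (F.weylX m p j)
      rw [hF.field_weylField hm hp, eq_sub_iff_add_eq] at this
      rw [← this, add_comm]
      split_ifs <;> simp

lemma IsClassical.weylHom_x (hm : 1 ≤ m) (hp : p ∣ m) (j : Fin (N + 1)) :
    hF.weylHom hm hp (WeylAlgebra.x k j) = F.ι (F.weylX m p j) :=
  WeylAlgebra.lift_x _ _ _ _ _ _

lemma IsClassical.weylHom_y (hm : 1 ≤ m) (hp : p ∣ m) (j : Fin (N + 1)) :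
    hF.weylHom hm hp (WeylAlgebra.y k j) = F.fieldElt m (hF.weylField m p j) :=
  WeylAlgebra.lift_y _ _ _ _ _ _

end Weyl

end Frame

namespace Frame

section Weyl

variable {k L E : Type*} [Field k] [Field L] [Algebra k L] [DivisionRing E] [Algebra k E] {N : ℕ}
  {F : Frame k L E (N + 1)} {m p : ℕ}

lemma γ_pdElt {n : ℕ} (F : Frame k L E n) {g : MonomialGroup k n}
    (hg : g ∈ complexReflectionGroup k m p n) (i : Fin n) :
    F.γ g (F.pdElt m i) = F.pdElt m (g.right i) := by
  rw [pdElt, map_mul, ← ι_γL, map_mul, map_inv₀, map_inv₀, F.γL_t hg, map_natCast, γ_h, pdElt]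

lemma IsClassical.fieldElt_weylField_zero (hF : F.IsClassical) :
    F.fieldElt m (hF.weylField m p 0) =
      F.ι (hF.field m (fun i => lagCoef (F.t m) i) (F.y (m / p)))⁻¹ * F.symm m (F.pdElt m) 0 := by
  simp only [fieldElt, weylField, Fin.cons_zero, symm, Finset.mul_sum, map_mul, pow_zero, one_mul,
    mul_assoc]

lemma IsClassical.fieldElt_weylField_succ (hF : F.IsClassical) (d : Fin N) :
    F.fieldElt m (hF.weylField m p d.succ) = -F.symm m (F.pdElt m) d.succ := by
  simp only [fieldElt, weylField, Fin.cons_succ, symm, map_neg, neg_mul, Finset.sum_neg_distrib]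

variable [CharZero L]

lemma IsClassical.γ_weylHom (hF : F.IsClassical) (hm : 1 ≤ m) (hp : p ∣ m)
    {g : MonomialGroup k (N + 1)} (hg : g ∈ complexReflectionGroup k m p (N + 1))
    (w : WeylAlgebra k (N + 1)) : F.γ g (hF.weylHom hm hp w) = hF.weylHom hm hp w := by
  have hy : F.γ g (F.ι (F.y (m / p))) = F.ι (F.y (m / p)) := by rw [← ι_γL, F.γL_y hg]
  have : AlgHom.equalizer ((F.γ g).comp (hF.weylHom hm hp)) (hF.weylHom hm hp) = ⊤ := by
    refine WeylAlgebra.eq_top_of_gen_mem _ (fun i => ?_) (fun i => ?_)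
    · change F.γ g (hF.weylHom hm hp _) = hF.weylHom hm hp _
      rw [hF.weylHom_x]
      refine Fin.cases hy (fun d => ?_) i
      rw [weylX, Fin.cons_succ, ← ι_γL]
      exact congrArg F.ι (F.γL_coeff_nodal hg _)
    · change F.γ g (hF.weylHom hm hp _) = hF.weylHom hm hp _
      rw [hF.weylHom_y]
      refine Fin.cases ?_ (fun d => ?_) i
      · rw [hF.fieldElt_weylField_zero, map_mul, F.γ_symm hg (fun i => F.γ_pdElt hg i),
          hF.field_lagCoef_y hm hp]
        congr 1
        simp only [map_mul, map_inv₀, map_pow, map_natCast, map_neg, map_one, hy]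
      · rw [hF.fieldElt_weylField_succ, map_neg, F.γ_symm hg (fun i => F.γ_pdElt hg i)]
  have hw : w ∈ AlgHom.equalizer ((F.γ g).comp (hF.weylHom hm hp)) (hF.weylHom hm hp) :=
    this ▸ trivial
  exact hw

lemma IsClassical.nodalCoeff_mem (hF : F.IsClassical) (hm : 1 ≤ m) (hp : p ∣ m) (e : ℕ) :
    F.ι (F.nodalCoeff m e) ∈ skewAdjoin k (Set.range (hF.weylHom hm hp)) := by
  have hT := fun i => subset_skewAdjoin (k := k) (Set.range (hF.weylHom hm hp))
    ⟨WeylAlgebra.x k i, hF.weylHom_x hm hp i⟩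
  rcases lt_or_ge e (N + 1) with he | he
  · cases e with
    | zero =>
      have h := y_pow F hp
      have h2 := pow_mem (hT 0) p
      rw [weylX, Fin.cons_zero, ← map_pow, h, map_mul, map_pow, map_neg, map_one] at h2
      have h3 := mul_mem (pow_mem (neg_mem (one_mem (skewAdjoin k
        (Set.range (hF.weylHom hm hp))))) (N + 1)) h2
      rwa [← mul_assoc, ← pow_add, Even.neg_one_pow ⟨_, rfl⟩, one_mul] at h3
    | succ e => exact hT (Fin.succ ⟨e, by omega⟩)
  -- Beyond the chosen coordinates only the leading coefficient 1 and zeros remain.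
  · have hmon : (∏ j, (X - C (F.t m j))).Monic := monic_prod_of_monic _ _ fun j _ => monic_X_sub_C _
    have hdeg : (∏ j, (X - C (F.t m j))).natDegree = N + 1 := by
      rw [natDegree_prod_of_monic _ _ fun j _ => monic_X_sub_C _]
      simp
    rw [nodalCoeff]
    rcases he.eq_or_lt with rfl | he
    · have := hmon.coeff_natDegree
      rw [hdeg] at this
      rw [this, map_one]
      exact one_mem _
    · rw [coeff_eq_zero_of_natDegree_lt (by rw [hdeg]; exact he), map_zero]
      exact zero_mem _

lemma IsClassical.symm_mem (hF : F.IsClassical) (hm : 1 ≤ m) (hp : p ∣ m) (d : Fin (N + 1)) :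
    F.symm m (F.pdElt m) d ∈ skewAdjoin k (Set.range (hF.weylHom hm hp)) := by
  have hT := fun i => subset_skewAdjoin (k := k) (Set.range (hF.weylHom hm hp))
    ⟨WeylAlgebra.y k i, hF.weylHom_y hm hp i⟩
  have hy := subset_skewAdjoin (k := k) (Set.range (hF.weylHom hm hp))
    ⟨WeylAlgebra.x k 0, hF.weylHom_x hm hp 0⟩
  rw [weylX, Fin.cons_zero] at hy
  refine Fin.cases ?_ (fun d => ?_) d
  · have h := hT 0
    rw [hF.fieldElt_weylField_zero, map_inv₀] at h
    have hf : F.ι (hF.field m (fun i => lagCoef (F.t m) i) (F.y (m / p))) ∈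
        skewAdjoin k (Set.range (hF.weylHom hm hp)) := by
      rw [hF.field_lagCoef_y hm hp]
      simp only [map_mul, map_inv₀, map_pow, map_natCast, map_neg, map_one]
      exact mul_mem (inv_mem (mul_mem (natCast_mem _ p) (pow_mem hy _)))
        (pow_mem (neg_mem (one_mem _)) _)
    have hne : F.ι (hF.field m (fun i => lagCoef (F.t m) i) (F.y (m / p))) ≠ 0 := by
      rw [hF.field_lagCoef_y hm hp]
      exact (_root_.map_ne_zero F.ι).2 (mul_ne_zero (inv_ne_zero (mul_ne_zero (p_ne hm hp)
        (pow_ne_zero _ (F.y_ne _)))) (pow_ne_zero _ (neg_ne_zero.2 one_ne_zero)))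
    have h2 := mul_mem hf h
    rwa [mul_inv_cancel_left₀ hne] at h2
  · have h := neg_mem (hT d.succ)
    rwa [hF.fieldElt_weylField_succ, neg_neg] at h

theorem IsClassical.isGood (hF : F.IsClassical) (hm : 1 ≤ m) (hp : p ∣ m) :
    F.IsGood (skewAdjoin k (Set.range (hF.weylHom hm hp))) m p where
  algebraMap_mem := algebraMap_mem_skewAdjoin _
  y_mem := subset_skewAdjoin _ ⟨WeylAlgebra.x k 0, hF.weylHom_x hm hp 0⟩
  esymm_mem := F.aeval_esymm_mem _ (hF.nodalCoeff_mem hm hp)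
  fixed g hg := F.γ_fixed_of_gens g (by
    rintro _ ⟨w, rfl⟩
    exact hF.γ_weylHom hm hp hg w)

/-- Write hᵢ = m tᵢ ∂/∂tᵢ and expand ∂/∂tᵢ in the symmetric elements, which lie in the generated
field; the coefficients are polynomials in the xⱼ. -/
theorem IsClassical.h_mem_stab (hF : F.IsClassical) (hm : 1 ≤ m) (hp : p ∣ m) (i : Fin (N + 1)) :
    F.h i ∈ F.stab (skewAdjoin k (Set.range (hF.weylHom hm hp))) := by
  refine mem_stab_of_mem_monoSpan ?_ fun lam => ⟨1, lam i, hF.h_mul_xm i lam⟩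
  have h0 : (m : L) ≠ 0 := Nat.cast_ne_zero.2 (by omega)
  have h1 : F.h i = F.ι (m * F.t m i) * F.pdElt m i := by
    rw [pdElt, ← mul_assoc, ← map_mul, ← mul_inv, mul_inv_cancel₀ (mul_ne_zero h0 (F.t_ne m i)),
      map_one, one_mul]
  rw [h1, hF.pdElt_eq hm, Finset.mul_sum]
  refine sum_mem fun e _ => ?_
  rw [← mul_assoc, ← map_mul]
  refine F.laurent_mul_mem_monoSpan ?_ (hF.symm_mem hm hp e)
  exact mul_mem (mul_mem (natCast_mem _ m) (pow_mem (F.x_mem_laurent i) m))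
    (F.coeff_prod_mem _ F.x_mem_laurent _ _)

/-- With `R` the image of the tensor power and `K` the field generated by its invariants, this is
the easy inclusion: the generators of the Weyl algebra become quotients of invariants after clearing
denominators. -/
theorem IsClassical.weylHom_mem (hF : F.IsClassical) (hm : 1 ≤ m) (hp : p ∣ m) (R : Subalgebra k E)
    (K : Subfield E) (hKk : ∀ c : k, algebraMap k E c ∈ K)
    (hK : ∀ e ∈ R, (∀ g ∈ complexReflectionGroup k m p (N + 1), F.γ g e = e) → e ∈ K)
    (hx : ∀ i, F.ι (F.x i) ∈ R) (hh : ∀ i, F.h i ∈ R) (w : WeylAlgebra k (N + 1)) :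
    hF.weylHom hm hp w ∈ K := by
  have h0 : (m : L) ≠ 0 := Nat.cast_ne_zero.2 (by omega)
  have hyR : F.y (m / p) ∈ R.comap F.ι :=
    pow_mem (prod_mem fun i _ => show F.x i ∈ R.comap F.ι from hx i) _
  have hy : F.ι (F.y (m / p)) ∈ K := hK _ hyR fun g hg => by rw [← ι_γL, F.γL_y hg]
  -- The elements ∂/∂tᵢ have a denominator, but tᵢ ∂/∂tᵢ = hᵢ/m lies in `R`.
  have hs : ∀ d, F.symm m (F.pdElt m) d ∈ K := F.symm_mem_of_fixed_mem (hF.t_injective hm)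
    (fun g hg i => F.γ_pdElt hg i) R K hK hx fun i => by
      rw [pdElt, ← mul_assoc, ← map_mul, mul_comm (m : L)⁻¹, mul_inv_cancel_left₀ (F.t_ne m i),
        map_inv₀, map_natCast]
      have h1 : ((m : E))⁻¹ = algebraMap k E (m : k)⁻¹ := by rw [map_inv₀, map_natCast]
      rw [h1]
      exact mul_mem (R.algebraMap_mem _) (hh i)
  have : (subfieldAlg K hKk).comap (hF.weylHom hm hp) = ⊤ := by
    refine WeylAlgebra.eq_top_of_gen_mem _ (fun i => ?_) (fun i => ?_)
    · change hF.weylHom hm hp _ ∈ K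
      rw [hF.weylHom_x]
      refine Fin.cases hy (fun d => ?_) i
      refine hK _ (show F.nodalCoeff m (d.succ : ℕ) ∈ R.comap F.ι from F.coeff_prod_mem (R.comap F.ι) hx _ _) fun g hg => ?_
      rw [← ι_γL]
      exact congrArg F.ι (F.γL_coeff_nodal hg _)
    · change hF.weylHom hm hp _ ∈ K
      rw [hF.weylHom_y]
      refine Fin.cases ?_ (fun d => ?_) i
      · rw [hF.fieldElt_weylField_zero, hF.field_lagCoef_y hm hp]
        refine mul_mem ?_ (hs 0)
        simp only [map_mul, map_inv₀, map_pow, map_natCast, map_neg, map_one]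
        exact inv_mem (mul_mem (inv_mem (mul_mem (natCast_mem _ p) (pow_mem hy _)))
          (pow_mem (neg_mem (one_mem _)) _))
      · rw [hF.fieldElt_weylField_succ]
        exact neg_mem (hs _)
  have hw : w ∈ (subfieldAlg K hKk).comap (hF.weylHom hm hp) := this ▸ trivial
  exact hw

end Weyl

end Frame

/-! ### Conclusion of the classical case. -/

section Assembly

variable {k D D' : Type*} [Field k] [CommRing D] [Algebra k D] [CommRing D'] [Algebra k D']
  {n : ℕ} [MulSemiringAction (Multiplicative (Fin n → ℤ)) D']
  [SMulCommClass (Multiplicative (Fin n → ℤ)) k D'] [IsDomain D'] {a : D} {σ : D ≃ₐ[k] D}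
  {ι : Fin n → D →ₐ[k] D'}

lemma GWAFrac.X_ne [IsOreDomain (GWATensor a σ n)] (h : IsShiftEmbedding σ ι) (i : Fin n) :
    GWAFrac.X a σ n i ≠ 0 := by
  intro h0
  have h1 : (PiTensorProduct.singleAlgHom i (GWA.Xp a σ) : GWATensor a σ n) = 0 :=
    toFrac_injective (k := k) (h0.trans (map_zero _).symm)
  have h2 := congrArg (gwaEmb a h) h1
  rw [gwaEmb_single, factorHom_Xp, map_zero] at h2
  have h3 := congrArg (fun f => f.coeff (shiftGen i)) h2
  simp at h3

end Assembly

/-- The skew field generated by the image of the Weyl algebra satisfies the conditions for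
averaging, so it coincides with the one generated by the invariants. -/
theorem classical_fracIsomorphic {k : Type*} [Field k] [IsAlgClosed k] [CharZero k]
    {n m p : ℕ} (hn : 1 ≤ n) (hm : 1 ≤ m) (hp : p ∣ m) (a : k[X]) (σ : k[X] ≃ₐ[k] k[X]) (ha : a ≠ 0)
    (hσ : σ X = X - 1) : FracIsomorphic k (GWAInvariants m p n a σ) (WeylAlgebra k n) := by
  obtain ⟨N, rfl⟩ : ∃ N, n = N + 1 := ⟨n - 1, by omega⟩
  have hι := isShiftEmbedding_classical (n := N + 1) σ hσ
  have hinj := gwaEmb_injective ha hι (Polynomial.basisMonomials k) linearIndependent_shiftEmb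
  have hgr := classical_hasPolyGrowth k (N + 1)
  have : IsOreDomain (GWATensor a σ (N + 1)) := hgr.isOreDomain_of_injective _ hinj
  have : IsOreDomain (GWAInvariants m p (N + 1) a σ) := hgr.isOreDomain_of_injective
    ((gwaEmb a hι).comp (GWAInvariants m p (N + 1) a σ).val) (hinj.comp Subtype.val_injective)
  have := weylAlgebra_isOreDomain k (N + 1)
  have hX := GWAFrac.X_ne (a := a) hι
  have : CharZero (GWAField a σ (N + 1)) :=
    charZero_of_injective_algebraMap (algebraMap k _).injective
  have hself : ∀ i, GWAFrac.base a σ (N + 1) i X * GWAFrac.X a σ (N + 1) i =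
      GWAFrac.X a σ (N + 1) i * GWAFrac.base a σ (N + 1) i X + GWAFrac.X a σ (N + 1) i := fun i => by
    rw [GWAFrac.X_base, hσ, map_sub, map_one, sub_mul, one_mul, sub_add_cancel]
  -- Each commutator of hᵢ with an xⱼ is a scalar multiple of xⱼ, so commutation with hᵢ preserves
  -- the double commutant and induces a derivation of it.
  have hF : (gwaFrame a σ (N + 1) hX X).IsClassical :=
    { h_x_self := hself
      exists_lie := fun i l => by
        have := lie_mem_bicomm (k := k) (s := Set.range (GWAFrac.X a σ (N + 1)))
          (u := GWAFrac.base a σ (N + 1) i X) (by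
            rintro _ ⟨j, rfl⟩
            by_cases hij : i = j
            · subst hij
              exact ⟨1, by rw [hself, add_sub_cancel_left, one_smul]⟩
            · exact ⟨0, by rw [(GWAFrac.base_X a σ (N + 1) i j hij X).eq, sub_self, zero_smul]⟩) l.2
        exact ⟨⟨_, this⟩, rfl⟩ }
  refine fracIsomorphic_of_skewAdjoin_eq
    ((toFrac k (GWATensor a σ (N + 1))).comp (GWAInvariants m p (N + 1) a σ).val)
    ((toFrac_injective (k := k) (R := GWATensor a σ (N + 1))).comp Subtype.val_injective) (hF.weylHom hm hp)
    (WeylAlgebra.injective_of_nontrivial _) ?_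
  refine GWAFrac.invariantField_eq hX X hm hp (hF.isGood hm hp) (fun i d => ?_) ?_
  · have h := hF.h_mem_stab hm hp i
    have e : GWAFrac.base a σ (N + 1) i =
        Polynomial.aeval (GWAFrac.base a σ (N + 1) i X) := Polynomial.algHom_ext (by simp)
    rw [e]
    induction d using Polynomial.induction_on' with
    | add f g hf hg => rw [map_add]; exact add_mem hf hg
    | monomial j c =>
      rw [aeval_monomial]
      exact mul_mem (Subalgebra.algebraMap_mem _ c) (pow_mem h j)
  · rintro _ ⟨w, rfl⟩
    refine hF.weylHom_mem hm hp (toFrac k (GWATensor a σ (N + 1))).range _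
      (algebraMap_mem_skewAdjoin _) (fun e he h => GWAFrac.mem_invariantField he h)
      (fun i => ⟨_, rfl⟩) (fun i => ⟨_, rfl⟩) w

/-! ### Polynomials over a noncommutative algebra and their values at scalars -/

section EvalScalar

variable {k E : Type*} [Field k] [DivisionRing E] [Algebra k E]

/-- Evaluation of a polynomial at a scalar. -/
def evalScalar (z : k) : E[X] →+* E :=
  eval₂RingHom' (RingHom.id E) (algebraMap k E z) fun a => (Algebra.commutes z a).symm

@[simp] lemma evalScalar_C (z : k) (a : E) : evalScalar z (C a) = a := eval₂_C _ _

@[simp] lemma evalScalar_X (z : k) : evalScalar z (X : E[X]) = algebraMap k E z := eval₂_X _ _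

lemma evalScalar_eq_sum (z : k) (p : E[X]) :
    evalScalar z p = ∑ i ∈ Finset.range (p.natDegree + 1), z ^ i • p.coeff i := by
  change eval₂ _ _ p = _
  rw [eval₂_eq_sum_range]
  refine Finset.sum_congr rfl fun i _ => ?_
  rw [RingHom.id_apply, ← map_pow, ← Algebra.commutes, Algebra.smul_def]

lemma evalScalar_zero (p : E[X]) : evalScalar (0 : k) p = p.coeff 0 := by
  rw [evalScalar_eq_sum, Finset.sum_range_succ']
  simp

lemma evalScalar_X_mul (z : k) (p : E[X]) : evalScalar z (X * p) = z • evalScalar z p := by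
  rw [map_mul, evalScalar_X, Algebra.smul_def]

/-- Apply a linear functional to the coefficients: the resulting ordinary polynomial vanishes on the
infinite field `k`, and functionals separate the elements of `E`. -/
lemma eq_zero_of_evalScalar [Infinite k] {p : E[X]} (h : ∀ z : k, evalScalar z p = 0) : p = 0 := by
  ext i
  rw [coeff_zero]
  refine (Module.forall_dual_apply_eq_zero_iff k _).1 fun φ => ?_
  let f : k[X] := ∑ i ∈ Finset.range (p.natDegree + 1), Polynomial.monomial i (φ (p.coeff i))
  have hf : f = 0 := by
    refine Polynomial.funext fun z => ?_
    have h1 := congrArg φ (h z)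
    rw [evalScalar_eq_sum, map_sum, map_zero] at h1
    rw [eval_zero, eval_finsetSum, ← h1]
    refine Finset.sum_congr rfl fun i _ => ?_
    rw [eval_monomial, map_smul, smul_eq_mul, mul_comm]
  by_cases hi : i < p.natDegree + 1
  · have h2 := congrArg (fun f => f.coeff i) hf
    simp only [f, finsetSum_coeff, coeff_monomial, coeff_zero] at h2
    rwa [Finset.sum_ite_eq' , if_pos (Finset.mem_range.2 hi)] at h2
  · rw [coeff_eq_zero_of_natDegree_lt (by omega), map_zero]

/-- Multiplication by X makes the value at 0 vanish for free. -/
lemma eq_zero_of_evalScalar_of_ne [Infinite k] {p : E[X]}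
    (h : ∀ z : k, z ≠ 0 → evalScalar z p = 0) : p = 0 := by
  have : X * p = 0 := eq_zero_of_evalScalar (k := k) fun z => by
    rw [evalScalar_X_mul]
    by_cases hz : z = 0
    · rw [hz, zero_smul]
    · rw [h z hz, smul_zero]
  exact (mul_eq_zero.1 this).resolve_left X_ne_zero

/-- A relation between the values at all scalars is a polynomial identity, so it holds for the
coefficients. -/
lemma commute_coeff_of_evalScalar [Infinite k] {p : E[X]} {u : E}
    (h : ∀ z : k, Commute (evalScalar z p) u) (i : ℕ) : Commute (p.coeff i) u := by
  have : p * C u - C u * p = 0 := eq_zero_of_evalScalar (k := k) fun z => by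
    rw [map_sub, map_mul, map_mul, evalScalar_C, (h z).eq, sub_self]
  have h2 := congrArg (fun f => f.coeff i) this
  simp only [coeff_sub, coeff_mul_C, coeff_C_mul, coeff_zero] at h2
  exact sub_eq_zero.1 h2

lemma commute_evalScalar_of_ne [Infinite k] {p : E[X]} {u : E}
    (h : ∀ z : k, z ≠ 0 → Commute (evalScalar z p) u) (z : k) : Commute (evalScalar z p) u := by
  have : p * C u - C u * p = 0 := eq_zero_of_evalScalar_of_ne (k := k) fun z hz => by
    rw [map_sub, map_mul, map_mul, evalScalar_C, (h z hz).eq, sub_self]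
  have h2 := congrArg (evalScalar z) this
  rw [map_sub, map_mul, map_mul, evalScalar_C, map_zero] at h2
  exact sub_eq_zero.1 h2

lemma commute_evalScalar_of_coeff {p : E[X]} {u : E} (h : ∀ i, Commute (p.coeff i) u) (z : k) :
    Commute (evalScalar z p) u := by
  rw [evalScalar_eq_sum]
  exact Commute.sum_left _ _ _ fun i _ => (h i).smul_left _

end EvalScalar

/-! ### Pairs of polynomials satisfying exchange relations -/

section Exchange

variable {k E : Type*} [Field k] [DivisionRing E] [Algebra k E]

/-- The polynomial `b⁻¹ Q`, where `b` is the coefficient of `Q` in degree `n`. -/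
def monicPart (n : ℕ) (Q : E[X]) : E[X] := C (Q.coeff n)⁻¹ * Q

/-- The first component of the reduction of a pair. -/
def reduceP (n : ℕ) (P Q : E[X]) : E[X] := P - C (P.coeff (n + 1)) * (X * monicPart n Q)

/-- The second component of the reduction of a pair. -/
def reduceQ (n : ℕ) (P Q : E[X]) : E[X] :=
  (monicPart n Q - reduceP n P Q * C ((monicPart n Q).coeff 0)).divX

/-- The leading coefficients of all the reductions of a pair are nonzero. -/
def IsNondegenerate : ℕ → E[X] → E[X] → Prop
  | 0, _, _ => True
  | n + 1, P, Q => P.coeff (n + 1) ≠ 0 ∧ Q.coeff n ≠ 0 ∧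
      IsNondegenerate n (reduceP n P Q) (reduceQ n P Q)

/-- The exchange relations of a pair of polynomials of degrees `≤ n` and `< n`. -/
structure IsExchange (q : k) (n : ℕ) (P Q : E[X]) : Prop where
  coeff_P : ∀ i, n < i → P.coeff i = 0
  coeff_Q : ∀ i, n ≤ i → Q.coeff i = 0
  coeff_P_zero : P.coeff 0 = 1
  PP : ∀ z w : k, Commute (evalScalar z P) (evalScalar w P)
  QQ : ∀ z w : k, Commute (evalScalar z Q) (evalScalar w Q)
  QP : ∀ z w : k, (z - w) • (evalScalar z Q * evalScalar w P) =
    (z - q * w) • (evalScalar w P * evalScalar z Q) -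
      ((1 - q) * w) • (evalScalar z P * evalScalar w Q)

namespace IsExchange

lemma coeff_monicPart {n : ℕ} {Q : E[X]} (hb : Q.coeff n ≠ 0) : (monicPart n Q).coeff n = 1 := by
  rw [monicPart, coeff_C_mul, inv_mul_cancel₀ hb]

lemma coeff_zero_reduceP {q : k} {n : ℕ} {P Q : E[X]} (h : IsExchange q (n + 1) P Q) : (reduceP n P Q).coeff 0 = 1 := by
  rw [reduceP, coeff_sub, coeff_C_mul, coeff_X_mul_zero, mul_zero, sub_zero, h.coeff_P_zero]

lemma coeff_monicPart_eq_zero {q : k} {n : ℕ} {P Q : E[X]} (h : IsExchange q (n + 1) P Q) {i : ℕ}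
    (hi : n < i) : (monicPart n Q).coeff i = 0 := by
  rw [monicPart, coeff_C_mul, h.coeff_Q i (by omega), mul_zero]

lemma evalScalar_monicPart (n : ℕ) (Q : E[X]) (z : k) :
    evalScalar z (monicPart n Q) = (Q.coeff n)⁻¹ * evalScalar z Q := by
  rw [monicPart, map_mul, evalScalar_C]

lemma evalScalar_reduceP (n : ℕ) (P Q : E[X]) (z : k) : evalScalar z (reduceP n P Q) =
    evalScalar z P - z • (P.coeff (n + 1) * evalScalar z (monicPart n Q)) := by
  rw [reduceP, map_sub, map_mul, evalScalar_C, evalScalar_X_mul, mul_smul_comm]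

lemma coeff_mul_monicPart {n : ℕ} {Q : E[X]} (hb : Q.coeff n ≠ 0) (z : k) :
    Q.coeff n * evalScalar z (monicPart n Q) = evalScalar z Q := by
  rw [evalScalar_monicPart, mul_inv_cancel_left₀ hb]

lemma X_mul_reduceQ {q : k} {n : ℕ} {P Q : E[X]} (h : IsExchange q (n + 1) P Q) : X * reduceQ n P Q =
    monicPart n Q - reduceP n P Q * C ((monicPart n Q).coeff 0) := by
  rw [reduceQ]
  have := X_mul_divX_add (monicPart n Q - reduceP n P Q * C ((monicPart n Q).coeff 0))
  rw [coeff_sub, coeff_mul_C, h.coeff_zero_reduceP, one_mul, sub_self, C_0, add_zero] at this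
  exact this

lemma evalScalar_monicPart_eq {q : k} {n : ℕ} {P Q : E[X]} (h : IsExchange q (n + 1) P Q) (z : k) :
    evalScalar z (monicPart n Q) = evalScalar z (reduceP n P Q) * (monicPart n Q).coeff 0 +
      evalScalar z (X * reduceQ n P Q) := by
  rw [h.X_mul_reduceQ, map_sub, map_mul, evalScalar_C, add_sub_cancel]

variable [Infinite k] {q : k} {n : ℕ} {P Q : E[X]}

lemma commute_coeff_P (h : IsExchange q n P Q) (i : ℕ) (w : k) :
    Commute (P.coeff i) (evalScalar w P) :=
  commute_coeff_of_evalScalar (fun z => h.PP z w) i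

lemma commute_coeff_Q (h : IsExchange q n P Q) (i : ℕ) (w : k) :
    Commute (Q.coeff i) (evalScalar w Q) :=
  commute_coeff_of_evalScalar (fun z => h.QQ z w) i

/-- This is the coefficient of z^{n+1} in the relation `QP`, read as a polynomial identity in z. -/
lemma coeff_mul_P (h : IsExchange q (n + 1) P Q) (w : k) :
    Q.coeff n * evalScalar w P = evalScalar w P * Q.coeff n -
      ((1 - q) * w) • (P.coeff (n + 1) * evalScalar w Q) := by
  have h0 : (X - C (algebraMap k E w)) * (Q * C (evalScalar w P)) -
      ((X - C (algebraMap k E (q * w))) * (C (evalScalar w P) * Q) -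
      C (algebraMap k E ((1 - q) * w)) * (P * C (evalScalar w Q))) = 0 :=
    eq_zero_of_evalScalar (k := k) fun z => by
      simp only [map_sub, map_mul, evalScalar_X, evalScalar_C]
      have := h.QP z w
      simp only [Algebra.smul_def, map_sub, map_mul, map_one] at this
      rw [this, map_one (algebraMap k E), sub_self]
  have h1 := congrArg (fun f => f.coeff (n + 1)) h0
  simp only [sub_mul, coeff_sub, coeff_X_mul, coeff_C_mul, coeff_mul_C,
    h.coeff_Q (n + 1) le_rfl, coeff_zero, mul_zero, zero_mul, sub_zero] at h1
  rw [sub_eq_zero.1 h1, Algebra.smul_def, sub_mul]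

/-- This is the coefficient of w^{n+2} in the relation `QP`; the last term does not reach that
degree, since `Q` has degree at most n. -/
lemma Q_mul_coeff (h : IsExchange q (n + 1) P Q) (z : k) :
    evalScalar z Q * P.coeff (n + 1) = q • (P.coeff (n + 1) * evalScalar z Q) := by
  have h0 : (C (algebraMap k E z) - X) * (C (evalScalar z Q) * P) -
      ((C (algebraMap k E z) - C (algebraMap k E q) * X) * (P * C (evalScalar z Q)) -
      C (algebraMap k E (1 - q)) * (X * (C (evalScalar z P) * Q))) = 0 :=
    eq_zero_of_evalScalar (k := k) fun w => by
      simp only [map_sub, map_mul, evalScalar_X, evalScalar_C]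
      have := h.QP z w
      simp only [Algebra.smul_def, map_sub, map_mul, map_one] at this
      rw [this]
      simp only [mul_assoc, map_one, sub_self]
  have h1 := congrArg (fun f => f.coeff (n + 2)) h0
  simp only [sub_mul, mul_assoc, coeff_sub, coeff_X_mul, coeff_C_mul, coeff_mul_C,
    h.coeff_Q (n + 1) le_rfl, h.coeff_P (n + 2) (by omega), coeff_zero, mul_zero, zero_mul,
    sub_zero, zero_sub] at h1
  rw [Algebra.smul_def]
  exact (neg_inj.1 (sub_eq_zero.1 h1))

lemma coeff_mul_coeff (h : IsExchange q (n + 1) P Q) :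
    Q.coeff n * P.coeff (n + 1) = q • (P.coeff (n + 1) * Q.coeff n) := by
  have h0 : Q * C (P.coeff (n + 1)) - C (algebraMap k E q) * (C (P.coeff (n + 1)) * Q) = 0 :=
    eq_zero_of_evalScalar (k := k) fun z => by
      simp only [map_sub, map_mul, evalScalar_C]
      rw [h.Q_mul_coeff, Algebra.smul_def, sub_self]
  have h1 := congrArg (fun f => f.coeff n) h0
  simp only [coeff_sub, coeff_C_mul, coeff_mul_C, coeff_zero] at h1
  rw [sub_eq_zero.1 h1, Algebra.smul_def]

lemma commute_coeff_Q_monicPart (h : IsExchange q (n + 1) P Q) (z : k) :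
    Commute (Q.coeff n) (evalScalar z (monicPart n Q)) := by
  rw [evalScalar_monicPart]
  exact ((Commute.refl _).inv_right₀).mul_right (h.commute_coeff_Q n z)

lemma monicPart_commute (h : IsExchange q (n + 1) P Q) (z w : k) :
    Commute (evalScalar z (monicPart n Q)) (evalScalar w (monicPart n Q)) := by
  have h1 := h.commute_coeff_Q_monicPart w
  rw [evalScalar_monicPart n Q z]
  refine h1.inv_left₀.mul_left ?_
  rw [evalScalar_monicPart]
  exact (h.commute_coeff_Q n z).symm.inv_right₀.mul_right (h.QQ z w)

/-- Moving a = `P.coeff (n + 1)` past `Q` and past b = `Q.coeff n` costs the same factor q, which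
cancels in b⁻¹Q. -/
lemma commute_coeff_P_monicPart (h : IsExchange q (n + 1) P Q) (hb : Q.coeff n ≠ 0) (z : k) :
    Commute (P.coeff (n + 1)) (evalScalar z (monicPart n Q)) := by
  have h1 := h.Q_mul_coeff z
  have h2 := h.coeff_mul_coeff
  refine mul_left_cancel₀ hb ?_
  rw [← mul_assoc, h2, ← mul_assoc, coeff_mul_monicPart hb, h1, smul_mul_assoc, mul_assoc,
    coeff_mul_monicPart hb]

lemma commute_coeff_P_reduceP (h : IsExchange q (n + 1) P Q) (hb : Q.coeff n ≠ 0) (z : k) :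
    Commute (P.coeff (n + 1)) (evalScalar z (reduceP n P Q)) := by
  rw [evalScalar_reduceP]
  exact (h.commute_coeff_P _ z).sub_right
    (((Commute.refl _).mul_right (h.commute_coeff_P_monicPart hb z)).smul_right z)

/-- The subtracted term a X b⁻¹Q is chosen so that its failure to commute with b cancels the
correction term of `coeff_mul_P`. -/
lemma commute_coeff_Q_reduceP (h : IsExchange q (n + 1) P Q) (hb : Q.coeff n ≠ 0) (z : k) :
    Commute (Q.coeff n) (evalScalar z (reduceP n P Q)) := by
  rw [evalScalar_reduceP]
  change _ * _ = _ * _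
  have h1 := (h.commute_coeff_Q_monicPart z).eq
  have h2 := h.coeff_mul_P z
  rw [mul_sub, sub_mul, h2, mul_smul_comm, smul_mul_assoc, ← mul_assoc, h.coeff_mul_coeff, mul_assoc,
    ← h1, smul_mul_assoc, mul_assoc, coeff_mul_monicPart hb]
  module

/-- The exchange relation for `P - a X b⁻¹ Q` and `b⁻¹ Q`. -/
lemma monicPart_reduceP (h : IsExchange q (n + 1) P Q) (hb : Q.coeff n ≠ 0) (z w : k) :
    (z - w) • (evalScalar z (monicPart n Q) * evalScalar w (reduceP n P Q)) =
    (z - q * w) • (evalScalar w (reduceP n P Q) * evalScalar z (monicPart n Q)) -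
      ((1 - q) * w) • (evalScalar z (reduceP n P Q) * evalScalar w (monicPart n Q)) := by
  have hQ := fun z => coeff_mul_monicPart (Q := Q) (n := n) (k := k) hb z
  have hN := fun z => (h.commute_coeff_Q_reduceP hb z).eq
  have hR := fun z => (h.commute_coeff_Q_monicPart z).eq
  have e1 : Q.coeff n * (evalScalar z (monicPart n Q) * evalScalar w (reduceP n P Q)) =
      evalScalar z Q * evalScalar w P - (w * q) • (P.coeff (n + 1) *
        (evalScalar z Q * evalScalar w (monicPart n Q))) := by
    rw [← mul_assoc, hQ, evalScalar_reduceP, mul_sub, mul_smul_comm, ← mul_assoc, h.Q_mul_coeff,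
      smul_mul_assoc, smul_smul, mul_assoc]
  have e2 : ∀ z w, Q.coeff n * (evalScalar w (reduceP n P Q) * evalScalar z (monicPart n Q)) =
      evalScalar w P * evalScalar z Q - w • (P.coeff (n + 1) *
        (evalScalar w (monicPart n Q) * evalScalar z Q)) := fun z w => by
    rw [← mul_assoc, hN, mul_assoc, hQ, evalScalar_reduceP, sub_mul, smul_mul_assoc, mul_assoc]
  have e3 : evalScalar w (monicPart n Q) * evalScalar z Q =
      evalScalar z Q * evalScalar w (monicPart n Q) := by
    rw [← hQ z, ← mul_assoc, ← hR, mul_assoc, mul_assoc, (h.monicPart_commute z w).eq]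
  have e4 : evalScalar z (monicPart n Q) * evalScalar w Q =
      evalScalar z Q * evalScalar w (monicPart n Q) := by
    rw [← hQ w, ← mul_assoc, ← hR, hQ z]
  -- Multiplying by b on the left turns one b⁻¹Q into Q in each term; the terms containing a cancel
  -- and `QP` remains.
  refine mul_left_cancel₀ hb ?_
  rw [mul_smul_comm, mul_sub, mul_smul_comm, mul_smul_comm, e1, e2, e2, e3, e4]
  have := h.QP z w
  linear_combination (norm := module) this

/-- Write R = b⁻¹Q and N = P - aXR. The exchange relation at (z, w) and at (w, z) gives z[R(z),
N(w)] = w[R(w), N(z)], which is exactly what separates [N(z), N(w)] from [P(z), P(w)] = 0. -/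
lemma reduceP_commute (h : IsExchange q (n + 1) P Q) (hb : Q.coeff n ≠ 0) (z w : k) :
    Commute (evalScalar z (reduceP n P Q)) (evalScalar w (reduceP n P Q)) := by
  by_cases hzw : z = w
  · rw [hzw]
  have h1 := h.monicPart_reduceP hb z w
  have h2 := h.monicPart_reduceP hb w z
  have h3 : (z - w) • (z • (evalScalar z (monicPart n Q) * evalScalar w (reduceP n P Q) -
      evalScalar w (reduceP n P Q) * evalScalar z (monicPart n Q)) -
      w • (evalScalar w (monicPart n Q) * evalScalar z (reduceP n P Q) -
      evalScalar z (reduceP n P Q) * evalScalar w (monicPart n Q))) = 0 := by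
    linear_combination (norm := module) z • h1 + w • h2
  have h4 := (smul_eq_zero.1 h3).resolve_left (sub_ne_zero.2 hzw)
  have h5 := (h.PP z w).eq
  have e : ∀ z : k, evalScalar z P = evalScalar z (reduceP n P Q) +
      z • (P.coeff (n + 1) * evalScalar z (monicPart n Q)) := fun z => by
    rw [evalScalar_reduceP, sub_add_cancel]
  have hN := fun z : k => (h.commute_coeff_P_reduceP hb z).eq
  have hR := fun z : k => (h.commute_coeff_P_monicPart hb z).eq
  have hRR := (h.monicPart_commute z w).eq
  have e5 : ∀ z w : k, evalScalar z P * evalScalar w P =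
      evalScalar z (reduceP n P Q) * evalScalar w (reduceP n P Q) +
      P.coeff (n + 1) * (w • (evalScalar z (reduceP n P Q) * evalScalar w (monicPart n Q)) +
      z • (evalScalar z (monicPart n Q) * evalScalar w (reduceP n P Q)) +
      (z * w) • (P.coeff (n + 1) * (evalScalar z (monicPart n Q) * evalScalar w (monicPart n Q)))) :=
    fun z w => by
      rw [e z, e w]
      simp only [mul_add, add_mul, smul_mul_assoc, mul_smul_comm, smul_smul, smul_add, ← mul_assoc, hN]
      rw [mul_assoc (P.coeff (n + 1)) (evalScalar z (monicPart n Q)) (P.coeff (n + 1)), ← hR z,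
        ← mul_assoc]
      abel_nf
      module
  rw [e5, e5, hRR] at h5
  have h6 := congrArg (P.coeff (n + 1) * ·) h4
  simp only [mul_sub, mul_add, mul_smul_comm, mul_zero] at h6 h5
  change _ * _ = _ * _
  linear_combination (norm := module) h5 - h6

/-- Put z = 0 in the exchange relation of R = b⁻¹Q and N, using N(0) = 1. At w = 0 the division by w
fails, but there the claim is immediate. -/
lemma coeff_zero_mul_reduceP (h : IsExchange q (n + 1) P Q) (hb : Q.coeff n ≠ 0) (w : k) :
    (monicPart n Q).coeff 0 * evalScalar w (reduceP n P Q) =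
      evalScalar w (reduceP n P Q) * (monicPart n Q).coeff 0 +
        (1 - q) • evalScalar w (X * reduceQ n P Q) := by
  by_cases hw : w = 0
  · rw [hw, evalScalar_zero, evalScalar_zero, h.coeff_zero_reduceP, coeff_X_mul_zero]
    simp
  · have h1 := h.monicPart_reduceP hb 0 w
    rw [evalScalar_zero, evalScalar_zero, h.coeff_zero_reduceP, one_mul,
      h.evalScalar_monicPart_eq] at h1
    refine (smul_right_injective E hw) ?_
    dsimp only
    linear_combination (norm := module) -h1

/-- Substitute R = N·R(0) + XS, with S the new second component, in the commutation of R(0) and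
R(w). -/
lemma coeff_zero_mul_reduceQ (h : IsExchange q (n + 1) P Q) (hb : Q.coeff n ≠ 0) (w : k) :
    (monicPart n Q).coeff 0 * evalScalar w (X * reduceQ n P Q) =
      q • (evalScalar w (X * reduceQ n P Q) * (monicPart n Q).coeff 0) := by
  have h1 := (h.monicPart_commute 0 w).eq
  rw [evalScalar_zero, h.evalScalar_monicPart_eq, mul_add, ← mul_assoc,
    h.coeff_zero_mul_reduceP hb, add_mul, add_mul, smul_mul_assoc] at h1
  linear_combination (norm := module) h1

/-- Substitute R = N·R(0) + XS in the exchange relation and move R(0) to the right. The terms with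
R(0) cancel because the values of N commute, and the correction changes the factor w of the last
term into z. -/
lemma X_mul_reduceQ_reduceP (h : IsExchange q (n + 1) P Q) (hb : Q.coeff n ≠ 0) (z w : k) :
    (z - w) • (evalScalar z (X * reduceQ n P Q) * evalScalar w (reduceP n P Q)) =
    (z - q * w) • (evalScalar w (reduceP n P Q) * evalScalar z (X * reduceQ n P Q)) -
      ((1 - q) * z) • (evalScalar z (reduceP n P Q) * evalScalar w (X * reduceQ n P Q)) := by
  have h1 := h.monicPart_reduceP hb z w
  have h2 := (h.reduceP_commute hb z w).eq
  rw [h.evalScalar_monicPart_eq, h.evalScalar_monicPart_eq, add_mul, mul_assoc,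
    h.coeff_zero_mul_reduceP hb, mul_add, mul_add, mul_add, ← mul_assoc, ← mul_assoc,
    ← h2, mul_smul_comm] at h1
  linear_combination (norm := module) h1

/-- Expand [R(z), R(w)] = 0 with R(0) moved to the right. The mixed terms in N and XS are symmetric
in z and w, by adding the previous relation at (z, w) and at (w, z), so the pure XS terms must
commute. -/
lemma X_mul_reduceQ_commute (h : IsExchange q (n + 1) P Q) (hb : Q.coeff n ≠ 0) (z w : k) :
    Commute (evalScalar z (X * reduceQ n P Q)) (evalScalar w (X * reduceQ n P Q)) := by
  by_cases hzw : z = w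
  · rw [hzw]
  have h1 := (h.monicPart_commute z w).eq
  have h2 := (h.reduceP_commute hb z w).eq
  have e : ∀ z w : k, evalScalar z (monicPart n Q) * evalScalar w (monicPart n Q) =
      evalScalar z (reduceP n P Q) * evalScalar w (reduceP n P Q) *
        ((monicPart n Q).coeff 0 * (monicPart n Q).coeff 0) +
      (evalScalar z (reduceP n P Q) * evalScalar w (X * reduceQ n P Q) +
        evalScalar z (X * reduceQ n P Q) * evalScalar w (reduceP n P Q)) * (monicPart n Q).coeff 0 +
      evalScalar z (X * reduceQ n P Q) * evalScalar w (X * reduceQ n P Q) := fun z w => by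
    have hN := h.coeff_zero_mul_reduceP hb w
    have hS := h.coeff_zero_mul_reduceQ hb w
    rw [h.evalScalar_monicPart_eq z, h.evalScalar_monicPart_eq w]
    generalize (monicPart n Q).coeff 0 = c at *
    generalize evalScalar w (reduceP n P Q) = A at *
    generalize evalScalar z (reduceP n P Q) = B at *
    generalize evalScalar w (X * reduceQ n P Q) = A' at *
    generalize evalScalar z (X * reduceQ n P Q) = B' at *
    have e1 : (B * c + B') * (A * c + A') = B * (c * A) * c + B * (c * A') + B' * A * c + B' * A' := by
      noncomm_ring
    rw [e1, hN, hS]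
    simp only [mul_add, add_mul, mul_smul_comm, smul_mul_assoc, ← mul_assoc]
    module
  have h3 := h.X_mul_reduceQ_reduceP hb z w
  have h4 := h.X_mul_reduceQ_reduceP hb w z
  rw [e, e, h2] at h1
  have h5 : (z - w) • (evalScalar z (reduceP n P Q) * evalScalar w (X * reduceQ n P Q) +
        evalScalar z (X * reduceQ n P Q) * evalScalar w (reduceP n P Q)) =
      (z - w) • (evalScalar w (reduceP n P Q) * evalScalar z (X * reduceQ n P Q) +
        evalScalar w (X * reduceQ n P Q) * evalScalar z (reduceP n P Q)) := by
    linear_combination (norm := module) h3 + h4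
  have h6 := smul_right_injective E (sub_ne_zero.2 hzw) h5
  rw [h6] at h1
  exact add_left_cancel h1

/-- Dividing by z proves the relation for z ≠ 0; as a polynomial identity in z it extends to z = 0.
-/
lemma reduceQ_reduceP (h : IsExchange q (n + 1) P Q) (hb : Q.coeff n ≠ 0) (z w : k) :
    (z - w) • (evalScalar z (reduceQ n P Q) * evalScalar w (reduceP n P Q)) =
    (z - q * w) • (evalScalar w (reduceP n P Q) * evalScalar z (reduceQ n P Q)) -
      ((1 - q) * w) • (evalScalar z (reduceP n P Q) * evalScalar w (reduceQ n P Q)) := by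
  have h0 : (X - C (algebraMap k E w)) * (reduceQ n P Q * C (evalScalar w (reduceP n P Q))) -
      ((X - C (algebraMap k E (q * w))) * (C (evalScalar w (reduceP n P Q)) * reduceQ n P Q) -
      C (algebraMap k E ((1 - q) * w)) *
        (reduceP n P Q * C (evalScalar w (reduceQ n P Q)))) = 0 :=
    eq_zero_of_evalScalar_of_ne (k := k) fun z hz => by
      have h1 := h.X_mul_reduceQ_reduceP hb z w
      simp only [evalScalar_X_mul, smul_mul_assoc, mul_smul_comm] at h1
      simp only [map_sub, map_mul, evalScalar_X, evalScalar_C]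
      simp only [← map_mul, ← map_sub, ← Algebra.smul_def]
      refine smul_right_injective E hz ?_
      dsimp only
      linear_combination (norm := module) h1
  have h1 := congrArg (evalScalar z) h0
  simp only [map_sub, map_mul, evalScalar_X, evalScalar_C, map_zero] at h1
  simp only [← map_mul, ← map_sub, ← Algebra.smul_def] at h1
  exact sub_eq_zero.1 h1

lemma reduceQ_commute (h : IsExchange q (n + 1) P Q) (hb : Q.coeff n ≠ 0) (z w : k) :
    Commute (evalScalar z (reduceQ n P Q)) (evalScalar w (reduceQ n P Q)) := by
  refine commute_evalScalar_of_ne (fun z hz => Commute.symm ?_) z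
  refine commute_evalScalar_of_ne (fun w hw => ?_) w
  have h1 := h.X_mul_reduceQ_commute hb w z
  rw [evalScalar_X_mul, evalScalar_X_mul] at h1
  have h2 := (h1.smul_left w⁻¹).smul_right z⁻¹
  rwa [inv_smul_smul₀ hw, inv_smul_smul₀ hz] at h2

/-- The reduction of a pair satisfies the exchange relations. -/
theorem reduce (h : IsExchange q (n + 1) P Q) (hb : Q.coeff n ≠ 0) :
    IsExchange q n (reduceP n P Q) (reduceQ n P Q) where
  coeff_P i hi := by
    obtain ⟨i, rfl⟩ : ∃ j, i = j + 1 := ⟨i - 1, by omega⟩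
    rw [reduceP, coeff_sub, coeff_C_mul, coeff_X_mul]
    rcases (Nat.lt_succ_iff.1 hi).eq_or_lt with rfl | hi
    · rw [coeff_monicPart hb, mul_one, sub_self]
    · rw [h.coeff_P (i + 1) (by omega), h.coeff_monicPart_eq_zero hi, mul_zero, sub_zero]
  coeff_Q i hi := by
    rw [← coeff_X_mul, h.X_mul_reduceQ, coeff_sub, coeff_mul_C, reduceP, coeff_sub, coeff_C_mul,
      coeff_X_mul]
    rw [h.coeff_monicPart_eq_zero (show n < i + 1 by omega)]
    rcases hi.eq_or_lt with rfl | hi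
    · rw [coeff_monicPart hb, mul_one, sub_self, zero_mul, sub_zero]
    · rw [h.coeff_P (i + 1) (by omega), h.coeff_monicPart_eq_zero hi, mul_zero, sub_zero, zero_mul,
        sub_zero]
  coeff_P_zero := h.coeff_zero_reduceP
  PP := h.reduceP_commute hb
  QQ := h.reduceQ_commute hb
  QP := h.reduceQ_reduceP hb

end IsExchange

end Exchange

/-! ### From exchange relations to q-commuting pairs. -/

section Pairs

variable {k E : Type*} [Field k] [DivisionRing E] [Algebra k E]

/-- The centralizer of an element of a division ring, as a subfield. -/
def commSubfield (u : E) : Subfield E where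
  carrier := {x | Commute x u}
  mul_mem' := Commute.mul_left
  one_mem' := Commute.one_left u
  add_mem' := Commute.add_left
  zero_mem' := Commute.zero_left u
  neg_mem' := Commute.neg_left
  inv_mem' _ := Commute.inv_left₀

/-- Families of pairwise commuting `q`-commuting pairs of nonzero elements. -/
structure IsQPairs (q : k) {n : ℕ} (u v : Fin n → E) : Prop where
  u_ne : ∀ i, u i ≠ 0
  v_ne : ∀ i, v i ≠ 0
  rel : ∀ i, v i * u i = q • (u i * v i)
  uu : ∀ i j, i ≠ j → Commute (u i) (u j)
  uv : ∀ i j, i ≠ j → Commute (u i) (v j)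
  vv : ∀ i j, i ≠ j → Commute (v i) (v j)

/-- A subfield contains the coefficients of both polynomials of a pair. -/
def CoeffsMem (K : Subfield E) (P Q : E[X]) : Prop := ∀ i, P.coeff i ∈ K ∧ Q.coeff i ∈ K

variable {n : ℕ} {P Q : E[X]} {K : Subfield E}

lemma coeff_monicPart_mem (h : ∀ i, Q.coeff i ∈ K) (i : ℕ) : (monicPart n Q).coeff i ∈ K := by
  rw [monicPart, coeff_C_mul]
  exact mul_mem (inv_mem (h n)) (h i)

lemma coeff_reduceP_mem (hP : ∀ i, P.coeff i ∈ K) (hR : ∀ i, (monicPart n Q).coeff i ∈ K) (i : ℕ) :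
    (reduceP n P Q).coeff i ∈ K := by
  rw [reduceP, coeff_sub, coeff_C_mul]
  refine sub_mem (hP i) (mul_mem (hP _) ?_)
  cases i with
  | zero => rw [coeff_X_mul_zero]; exact zero_mem K
  | succ i => rw [coeff_X_mul]; exact hR i

lemma coeff_reduceQ_mem (hN : ∀ i, (reduceP n P Q).coeff i ∈ K)
    (hR : ∀ i, (monicPart n Q).coeff i ∈ K) (i : ℕ) : (reduceQ n P Q).coeff i ∈ K := by
  rw [reduceQ, coeff_divX, coeff_sub, coeff_mul_C]
  exact sub_mem (hR _) (mul_mem (hN _) (hR 0))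

lemma CoeffsMem.reduce (h : CoeffsMem K P Q) : CoeffsMem K (reduceP n P Q) (reduceQ n P Q) := by
  have hR := coeff_monicPart_mem (n := n) fun i => (h i).2
  have hN := coeff_reduceP_mem (n := n) (fun i => (h i).1) hR
  exact fun i => ⟨hN i, coeff_reduceQ_mem hN hR i⟩

variable {q : k}

lemma IsNondegenerate.coeff_ne {n : ℕ} {P Q : E[X]} (hnd : IsNondegenerate n P Q)
    (h : IsExchange q n P Q) : P.coeff n ≠ 0 := by
  cases n with
  | zero => rw [h.coeff_P_zero]; exact one_ne_zero
  | succ n => exact hnd.1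

/-- The reduction seems to lose R(0), where R = b⁻¹Q. It is recovered in degree n: R has coefficient
1 there, and the coefficient of the reduced P multiplying R(0) is nonzero by nondegeneracy. -/
lemma IsExchange.coeff_monicPart_mem_of_reduce [Infinite k] (h : IsExchange q (n + 1) P Q)
    (hnd : IsNondegenerate (n + 1) P Q)
    (hK : CoeffsMem K (reduceP n P Q) (reduceQ n P Q)) (i : ℕ) : (monicPart n Q).coeff i ∈ K := by
  have h1 := coeff_monicPart hnd.2.1
  have h2 := hnd.2.2.coeff_ne (h.reduce hnd.2.1)
  have h3 : monicPart n Q = X * reduceQ n P Q + reduceP n P Q * C ((monicPart n Q).coeff 0) := by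
    rw [h.X_mul_reduceQ, sub_add_cancel]
  have hX : ∀ i, (X * reduceQ n P Q).coeff i ∈ K := fun i => by
    cases i with
    | zero => rw [coeff_X_mul_zero]; exact zero_mem K
    | succ i => rw [coeff_X_mul]; exact (hK i).2
  have h4 : (monicPart n Q).coeff 0 ∈ K := by
    have h5 : (reduceP n P Q).coeff n * (monicPart n Q).coeff 0 =
        1 - (X * reduceQ n P Q).coeff n := by
      rw [h.X_mul_reduceQ, coeff_sub, coeff_mul_C, h1, sub_sub_cancel]
    rw [← eq_inv_mul_iff_mul_eq₀ h2] at h5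
    rw [h5]
    exact mul_mem (inv_mem (hK n).1) (sub_mem (one_mem K) (hX n))
  rw [h3, coeff_add, coeff_mul_C]
  exact add_mem (hX i) (mul_mem (hK i).1 h4)

lemma IsExchange.coeffsMem_of_reduce [Infinite k] (h : IsExchange q (n + 1) P Q)
    (hnd : IsNondegenerate (n + 1) P Q)
    (hK : CoeffsMem K (reduceP n P Q) (reduceQ n P Q)) (ha : P.coeff (n + 1) ∈ K)
    (hb : Q.coeff n ∈ K) : CoeffsMem K P Q := by
  have hR := h.coeff_monicPart_mem_of_reduce hnd hK
  refine fun i => ⟨?_, ?_⟩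
  · have : P = reduceP n P Q + C (P.coeff (n + 1)) * (X * monicPart n Q) := by
      rw [reduceP, sub_add_cancel]
    rw [this, coeff_add, coeff_C_mul]
    refine add_mem (hK i).1 (mul_mem ha ?_)
    cases i with
    | zero => rw [coeff_X_mul_zero]; exact zero_mem K
    | succ i => rw [coeff_X_mul]; exact hR i
  · have : Q = C (Q.coeff n) * monicPart n Q := by
      rw [monicPart, ← mul_assoc, ← C_mul, mul_inv_cancel₀ hnd.2.1, C_1, one_mul]
    rw [this, coeff_C_mul]
    exact mul_mem hb (hR i)

/-- The centralizer of `x` is a subfield. If it contains the coefficients of the reduced P and of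
b⁻¹Q, it contains those of the reduced pair and all that they generate. -/
lemma IsExchange.commute_of_mem [Infinite k] (h : IsExchange q (n + 1) P Q) {e x : E}
    (he : ∀ K : Subfield E, CoeffsMem K (reduceP n P Q) (reduceQ n P Q) → e ∈ K)
    (h1 : ∀ z : k, Commute x (evalScalar z (reduceP n P Q)))
    (h2 : ∀ z : k, Commute x (evalScalar z (monicPart n Q))) : Commute x e := by
  refine Commute.symm (he (commSubfield x) fun i =>
    ⟨commute_coeff_of_evalScalar (fun z => (h1 z).symm) i, ?_⟩)
  rw [← coeff_X_mul]
  refine commute_coeff_of_evalScalar (k := k) (fun z => Commute.symm ?_) _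
  have h3 := h2 0
  rw [evalScalar_zero] at h3
  rw [h.X_mul_reduceQ, map_sub, map_mul, evalScalar_C]
  exact (h2 z).sub_right ((h1 z).mul_right h3)

/-- A nondegenerate pair satisfying exchange relations yields `q`-commuting pairs generating the
same skew field. -/
theorem IsExchange.exists_pairs [Infinite k] {n : ℕ} {P Q : E[X]} (h : IsExchange q n P Q)
    (hnd : IsNondegenerate n P Q) : ∃ u v : Fin n → E, IsQPairs q u v ∧
      (∀ K : Subfield E, CoeffsMem K P Q → ∀ i, u i ∈ K ∧ v i ∈ K) ∧
      ∀ K : Subfield E, (∀ i, u i ∈ K ∧ v i ∈ K) → CoeffsMem K P Q := by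
  induction n generalizing P Q with
  | zero =>
    refine ⟨Fin.elim0, Fin.elim0, ⟨fun i => i.elim0, fun i => i.elim0, fun i => i.elim0,
      fun i => i.elim0, fun i => i.elim0, fun i => i.elim0⟩, fun K _ i => i.elim0, fun K _ i => ?_⟩
    rw [h.coeff_Q i (Nat.zero_le i)]
    refine ⟨?_, zero_mem K⟩
    cases i with
    | zero => rw [h.coeff_P_zero]; exact one_mem K
    | succ i => rw [h.coeff_P _ (Nat.succ_pos i)]; exact zero_mem K
  | succ n ih =>
    have hb := hnd.2.1
    have h' := h.reduce hb
    obtain ⟨u, v, huv, hK1, hK2⟩ := ih h' hnd.2.2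
    have hRS : ∀ x : E, (∀ z : k, Commute x (evalScalar z (reduceP n P Q))) →
        (∀ z : k, Commute x (evalScalar z (monicPart n Q))) →
        ∀ i, Commute x (u i) ∧ Commute x (v i) := fun x h1 h2 i =>
      ⟨h.commute_of_mem (fun K hK => (hK1 K hK i).1) h1 h2,
        h.commute_of_mem (fun K hK => (hK1 K hK i).2) h1 h2⟩
    -- The leading coefficients a and b commute with the whole reduced pair, so they form a new pair
    -- independent of those found by induction.
    have hau := hRS _ (h.commute_coeff_P_reduceP hb) (h.commute_coeff_P_monicPart hb)
    have hbu := hRS _ (h.commute_coeff_Q_reduceP hb) h.commute_coeff_Q_monicPart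
    refine ⟨Fin.cons (P.coeff (n + 1)) u, Fin.cons (Q.coeff n) v,
      ⟨Fin.cases hnd.1 huv.u_ne, Fin.cases hb huv.v_ne, Fin.cases h.coeff_mul_coeff huv.rel,
        Fin.cases (Fin.cases (fun h => absurd rfl h) fun j _ => (hau j).1)
          fun i => Fin.cases (fun _ => (hau i).1.symm) fun j hij => huv.uu i j fun h => hij (by rw [h]),
        Fin.cases (Fin.cases (fun h => absurd rfl h) fun j _ => (hau j).2)
          fun i => Fin.cases (fun _ => (hbu i).1.symm) fun j hij => huv.uv i j fun h => hij (by rw [h]),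
        Fin.cases (Fin.cases (fun h => absurd rfl h) fun j _ => (hbu j).2)
          fun i => Fin.cases (fun _ => (hbu i).2.symm) fun j hij => huv.vv i j fun h => hij (by rw [h])⟩,
      fun K hK => Fin.cases ⟨(hK _).1, (hK _).2⟩ (hK1 K hK.reduce), fun K hK => ?_⟩
    exact h.coeffsMem_of_reduce hnd (hK2 K fun i => hK i.succ) (hK 0).1 (hK 0).2

/-- A left factor of Q disappears in b⁻¹Q, so it does not affect any later step. -/
lemma IsNondegenerate.of_C_mul {n : ℕ} {P Q : E[X]} {u : E} (hu : u ≠ 0)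
    (h : IsNondegenerate n P (C u * Q)) : IsNondegenerate n P Q := by
  cases n with
  | zero => trivial
  | succ n =>
    have h1 := h.2.1
    rw [coeff_C_mul] at h1
    have e : monicPart n (C u * Q) = monicPart n Q := by
      rw [monicPart, monicPart, coeff_C_mul, mul_inv_rev, ← mul_assoc, ← C_mul, mul_assoc,
        inv_mul_cancel₀ hu, mul_one]
    have h2 := h.2.2
    rw [reduceQ, reduceP, e] at h2
    exact ⟨h.1, right_ne_zero_of_mul h1, h2⟩

end Pairs

/-! ### Systems of shift operators -/

section ShiftSystem

variable {k L E : Type*} [Field k] [Field L] [Algebra k L] [DivisionRing E] [Algebra k E]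

/-- Elements `tᵢ` of a field and commuting elements `hᵢ` inducing endomorphisms `τᵢ` of the field
with `τᵢ(tᵢ) = q⁻¹ tᵢ` and `τᵢ(tⱼ) = tⱼ` for `j ≠ i`. -/
structure IsShiftSystem (q : k) (ι : L →ₐ[k] E) {n : ℕ} (t : Fin n → L) (h : Fin n → E)
    (τ : Fin n → L →ₐ[k] L) : Prop where
  q_ne : q ≠ 0
  t_ne : ∀ i, t i ≠ 0
  h_ne : ∀ i, h i ≠ 0
  h_comm : ∀ i j, Commute (h i) (h j)
  h_mul : ∀ i l, h i * ι l = ι (τ i l) * h i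
  τ_self : ∀ i, τ i (t i) = q⁻¹ • t i
  τ_of_ne : ∀ i j, i ≠ j → τ i (t j) = t j
  injective : Function.Injective t
  smul_ne : ∀ i j, i ≠ j → q⁻¹ • t i ≠ t j

variable {n : ℕ}

/-- The polynomial `∏ (1 - X / tⱼ)`. -/
def revNodal (t : Fin n → L) : L[X] := C (∏ j, -(t j)⁻¹) * ∏ j, (X - C (t j))

/-- The polynomial `∑ gⱼ ∏_{i ≠ j} (X - tᵢ) hⱼ`. -/
def shiftPoly (ι : L →ₐ[k] E) (t g : Fin n → L) (h : Fin n → E) : E[X] :=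
  ∑ j, (C (g j) * nodalErase t j).map ι * C (h j)

lemma evalScalar_map (ι : L →ₐ[k] E) (p : L[X]) (z : k) :
    evalScalar z (p.map (ι : L →+* E)) = ι (p.eval (algebraMap k L z)) := by
  have : (evalScalar z).comp (mapRingHom (ι : L →+* E)) =
      (ι : L →+* E).comp (evalRingHom (algebraMap k L z)) := by
    refine Polynomial.ringHom_ext (fun a => ?_) ?_ <;> simp
  exact DFunLike.congr_fun this p

lemma evalScalar_shiftPoly (ι : L →ₐ[k] E) (t g : Fin n → L) (h : Fin n → E) (z : k) :
    evalScalar z (shiftPoly ι t g h) =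
      ∑ j, ι (g j * (nodalErase t j).eval (algebraMap k L z)) * h j := by
  simp only [shiftPoly, map_sum, map_mul, evalScalar_C, evalScalar_map, eval_mul, eval_C]

lemma coeff_shiftPoly (ι : L →ₐ[k] E) (t g : Fin n → L) (h : Fin n → E) (e : ℕ) :
    (shiftPoly ι t g h).coeff e = ∑ j, ι (g j * (nodalErase t j).coeff e) * h j := by
  simp only [shiftPoly, finsetSum_coeff, coeff_mul_C, coeff_map, coeff_C_mul]
  rfl

/-- Isolates the single factor which the i-th shift moves. -/
lemma revNodal_eq (t : Fin n → L) (ht : ∀ j, t j ≠ 0) (i : Fin n) :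
    revNodal t = C (∏ j ∈ Finset.univ.erase i, -(t j)⁻¹) * ((1 - C (t i)⁻¹ * X) * nodalErase t i) := by
  rw [revNodal, ← Finset.mul_prod_erase _ _ (Finset.mem_univ i), ← X_sub_C_mul_nodalErase t i]
  have : (1 : L[X]) = C (t i)⁻¹ * C (t i) := by rw [← C_mul, inv_mul_cancel₀ (ht i), C_1]
  rw [this, C_mul, C_neg]
  ring

lemma coeff_nodalErase_pred {n : ℕ} (t : Fin (n + 1) → L) (i : Fin (n + 1)) :
    (nodalErase t i).coeff n = 1 := by
  have hm : (nodalErase t i).Monic := monic_prod_of_monic _ _ fun j _ => monic_X_sub_C _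
  have hd : (nodalErase t i).natDegree = n := by
    rw [nodalErase, natDegree_prod_of_monic _ _ fun j _ => monic_X_sub_C _]
    simp
  have := hm.coeff_natDegree
  rwa [hd] at this

lemma natDegree_nodal (t : Fin n → L) : (∏ j, (X - C (t j))).natDegree = n := by
  rw [natDegree_prod_of_monic _ _ fun j _ => monic_X_sub_C _]
  simp

lemma coeff_revNodal (t : Fin n → L) : (revNodal t).coeff n = ∏ j, -(t j)⁻¹ := by
  have hm : (∏ j, (X - C (t j))).Monic := monic_prod_of_monic _ _ fun j _ => monic_X_sub_C _
  have := hm.coeff_natDegree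
  rw [natDegree_nodal] at this
  rw [revNodal, coeff_C_mul, this, mul_one]

lemma coeff_revNodal_eq_zero (t : Fin n → L) {i : ℕ} (hi : n < i) : (revNodal t).coeff i = 0 := by
  rw [revNodal, coeff_C_mul, coeff_eq_zero_of_natDegree_lt (by rwa [natDegree_nodal]), mul_zero]

lemma coeff_zero_revNodal (t : Fin n → L) (ht : ∀ j, t j ≠ 0) : (revNodal t).coeff 0 = 1 := by
  rw [revNodal, coeff_C_mul, coeff_zero_prod, ← Finset.prod_mul_distrib]
  refine Finset.prod_eq_one fun j _ => ?_
  simp [ht j]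

namespace IsShiftSystem

variable {q : k} {ι : L →ₐ[k] E} {t : Fin n → L} {h : Fin n → E} {τ : Fin n → L →ₐ[k] L}
  (hs : IsShiftSystem q ι t h τ)

lemma comp (hs : IsShiftSystem q ι t h τ) {m : ℕ} (e : Fin m → Fin n) (he : Function.Injective e) :
    IsShiftSystem q ι (t ∘ e) (h ∘ e) (τ ∘ e) where
  q_ne := hs.q_ne
  t_ne _ := hs.t_ne _
  h_ne _ := hs.h_ne _
  h_comm _ _ := hs.h_comm _ _
  h_mul _ := hs.h_mul _
  τ_self _ := hs.τ_self _
  τ_of_ne _ _ hij := hs.τ_of_ne _ _ (he.ne hij)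
  injective := hs.injective.comp he
  smul_ne _ _ hij := hs.smul_ne _ _ (he.ne hij)

lemma τ_eval_revNodal (hs : IsShiftSystem q ι t h τ) (i : Fin n) (w : k) :
    τ i ((revNodal t).eval (algebraMap k L w)) =
      (∏ j ∈ Finset.univ.erase i, -(t j)⁻¹) *
      ((1 - q • ((t i)⁻¹ * algebraMap k L w)) * (nodalErase t i).eval (algebraMap k L w)) := by
  rw [revNodal_eq t hs.t_ne i, eval_mul, eval_C, map_mul]
  congr 1
  · rw [map_prod]
    exact Finset.prod_congr rfl fun j hj => by
      rw [map_neg, map_inv₀, hs.τ_of_ne i j (Finset.ne_of_mem_erase hj).symm]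
  · simp only [eval_mul, eval_C, eval_sub, eval_one, eval_X, map_mul, map_sub, map_one, map_inv₀,
      hs.τ_self, AlgHom.commutes]
    congr 1
    · rw [smul_inv₀, inv_inv, smul_mul_assoc]
    · rw [nodalErase, eval_prod, map_prod]
      refine Finset.prod_congr rfl fun j hj => ?_
      simp only [eval_sub, eval_X, eval_C, map_sub, AlgHom.commutes,
        hs.τ_of_ne i j (Finset.ne_of_mem_erase hj).symm]

/-- After moving each hᵢ to the right the relation splits into its terms of index i, where it is an
identity of rational functions in z, w and tᵢ. The coefficients `g` play no role. -/
lemma QP (hs : IsShiftSystem q ι t h τ) (g : Fin n → L) (z w : k) :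
    (z - w) • (evalScalar z (shiftPoly ι t g h) *
      evalScalar w ((revNodal t).map (ι : L →+* E))) =
    (z - q * w) • (evalScalar w ((revNodal t).map (ι : L →+* E)) *
      evalScalar z (shiftPoly ι t g h)) - ((1 - q) * w) •
      (evalScalar z ((revNodal t).map (ι : L →+* E)) * evalScalar w (shiftPoly ι t g h)) := by
  simp only [evalScalar_map, evalScalar_shiftPoly, Finset.sum_mul, Finset.mul_sum, Finset.smul_sum,
    ← Finset.sum_sub_distrib]
  refine Finset.sum_congr rfl fun i _ => ?_
  rw [mul_assoc, hs.h_mul, ← mul_assoc, ← mul_assoc, ← mul_assoc, ← map_mul, ← map_mul, ← map_mul,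
    ← smul_mul_assoc, ← smul_mul_assoc, ← smul_mul_assoc, ← map_smul, ← map_smul, ← map_smul,
    ← sub_mul, ← map_sub]
  congr 2
  rw [hs.τ_eval_revNodal, revNodal_eq t hs.t_ne i]
  simp only [eval_mul, eval_C, eval_sub, eval_one, eval_X, Algebra.smul_def, map_sub, map_mul,
    map_one]
  ring

/-- The antisymmetry behind the commutativity of the values of `shiftPoly`. -/
lemma antisymm (hs : IsShiftSystem q ι t h τ) {i j : Fin n} (hij : i ≠ j) (z w : k) :
    lagCoef t i * (nodalErase t i).eval (algebraMap k L z) *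
      τ i (lagCoef t j * (nodalErase t j).eval (algebraMap k L w)) -
    lagCoef t i * (nodalErase t i).eval (algebraMap k L w) *
      τ i (lagCoef t j * (nodalErase t j).eval (algebraMap k L z)) =
    (algebraMap k L z - algebraMap k L w) * (t i - t j)⁻¹ *
      ((∏ l ∈ (Finset.univ.erase i).erase j, (t i - t l)⁻¹) *
      (∏ l ∈ (Finset.univ.erase i).erase j, (t j - t l)⁻¹) *
      (∏ l ∈ (Finset.univ.erase i).erase j, (algebraMap k L z - t l)) *
      ∏ l ∈ (Finset.univ.erase i).erase j, (algebraMap k L w - t l)) := by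
  have hj : j ∈ Finset.univ.erase i := Finset.mem_erase.2 ⟨hij.symm, Finset.mem_univ j⟩
  have hi : i ∈ Finset.univ.erase j := Finset.mem_erase.2 ⟨hij, Finset.mem_univ i⟩
  have hl : ∀ l ∈ (Finset.univ.erase i).erase j, τ i (t l) = t l := fun l hl =>
    hs.τ_of_ne i l (Finset.ne_of_mem_erase (Finset.mem_of_mem_erase hl)).symm
  have e1 : ∀ z, (nodalErase t i).eval (algebraMap k L z) = (algebraMap k L z - t j) *
      ∏ l ∈ (Finset.univ.erase i).erase j, (algebraMap k L z - t l) := fun z => by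
    rw [nodalErase, eval_prod, ← Finset.mul_prod_erase _ _ hj]
    simp
  have e2 : ∀ z, τ i ((nodalErase t j).eval (algebraMap k L z)) =
      (algebraMap k L z - q⁻¹ • t i) *
      ∏ l ∈ (Finset.univ.erase i).erase j, (algebraMap k L z - t l) := fun z => by
    rw [nodalErase, eval_prod, ← Finset.mul_prod_erase _ _ hi, Finset.erase_right_comm, map_mul,
      map_prod]
    simp only [eval_sub, eval_X, eval_C, map_sub, AlgHom.commutes, hs.τ_self]
    congr 1
    exact Finset.prod_congr rfl fun l hl' => by rw [hl l hl']
  have e3 : lagCoef t i = (t i - t j)⁻¹ * ∏ l ∈ (Finset.univ.erase i).erase j, (t i - t l)⁻¹ := by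
    rw [lagCoef, ← Finset.mul_prod_erase _ _ hj]
  have e4 : τ i (lagCoef t j) = (t j - q⁻¹ • t i)⁻¹ *
      ∏ l ∈ (Finset.univ.erase i).erase j, (t j - t l)⁻¹ := by
    rw [lagCoef, ← Finset.mul_prod_erase _ _ hi, Finset.erase_right_comm, map_mul, map_prod]
    simp only [map_inv₀, map_sub, hs.τ_self, hs.τ_of_ne i j hij]
    congr 1
    exact Finset.prod_congr rfl fun l hl' => by rw [hl l hl']
  have h1 : t j - q⁻¹ • t i ≠ 0 := sub_ne_zero.2 (hs.smul_ne i j hij).symm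
  rw [map_mul, map_mul, e1, e1, e2, e2, e3, e4]
  -- Since (z - tⱼ)(w - s) - (w - tⱼ)(z - s) = (z - w)(tⱼ - s), the shifted denominator tⱼ - s
  -- cancels.
  generalize q⁻¹ • t i = s at *
  field_simp
  ring

/-- Expand the commutator as a double sum over i and j. The terms (i, j) and (j, i) cancel: hᵢ and
hⱼ commute, and by `antisymm` the coefficient changes sign when i and j are exchanged. -/
lemma QQ [CharZero k] (hs : IsShiftSystem q ι t h τ) (z w : k) :
    Commute (evalScalar z (shiftPoly ι t (lagCoef t) h))
      (evalScalar w (shiftPoly ι t (lagCoef t) h)) := by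
  have e : ∀ z w : k, evalScalar z (shiftPoly ι t (lagCoef t) h) *
      evalScalar w (shiftPoly ι t (lagCoef t) h) = ∑ i, ∑ j,
      ι (lagCoef t i * (nodalErase t i).eval (algebraMap k L z) *
        τ i (lagCoef t j * (nodalErase t j).eval (algebraMap k L w))) * (h i * h j) := fun z w => by
    rw [evalScalar_shiftPoly, evalScalar_shiftPoly, Finset.sum_mul]
    refine Finset.sum_congr rfl fun i _ => ?_
    rw [Finset.mul_sum]
    refine Finset.sum_congr rfl fun j _ => ?_
    rw [map_mul ι (_ * _) (τ i _), mul_assoc, ← mul_assoc (h i), hs.h_mul]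
    simp only [mul_assoc]
  let f : Fin n → Fin n → E := fun i j =>
      ι (lagCoef t i * (nodalErase t i).eval (algebraMap k L z) *
        τ i (lagCoef t j * (nodalErase t j).eval (algebraMap k L w)) -
      lagCoef t i * (nodalErase t i).eval (algebraMap k L w) *
        τ i (lagCoef t j * (nodalErase t j).eval (algebraMap k L z))) * (h i * h j)
  have hf : ∀ i j, f i j + f j i = 0 := fun i j => by
    by_cases hij : i = j
    · subst hij
      have h1 : ∀ z : k, τ i ((nodalErase t i).eval (algebraMap k L z)) =
          (nodalErase t i).eval (algebraMap k L z) := fun z => by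
        rw [nodalErase, eval_prod, map_prod]
        refine Finset.prod_congr rfl fun j hj => ?_
        simp only [eval_sub, eval_X, eval_C, map_sub, AlgHom.commutes,
          hs.τ_of_ne i j (Finset.ne_of_mem_erase hj).symm]
      have h2 : f i i = 0 := by
        simp only [f]
        rw [map_mul, map_mul, h1, h1]
        have : lagCoef t i * (nodalErase t i).eval (algebraMap k L z) *
          (τ i (lagCoef t i) * (nodalErase t i).eval (algebraMap k L w)) -
          lagCoef t i * (nodalErase t i).eval (algebraMap k L w) *
          (τ i (lagCoef t i) * (nodalErase t i).eval (algebraMap k L z)) = 0 := by ring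
        rw [this, map_zero, zero_mul]
      rw [h2, add_zero]
    · simp only [f]
      rw [hs.antisymm hij, hs.antisymm (Ne.symm hij), (hs.h_comm j i).eq, ← add_mul, ← map_add,
        Finset.erase_right_comm, ← neg_sub (t i) (t j), inv_neg]
      have : ∀ a b c d e f : L, a * b * (c * d * e * f) + a * -b * (d * c * e * f) = 0 := by
        intros; ring
      rw [this, map_zero, zero_mul]
  have hsum : ∑ i, ∑ j, f i j = 0 := by
    have h1 : (2 : k) • ∑ i, ∑ j, f i j = 0 := by
      rw [two_smul]
      nth_rewrite 2 [Finset.sum_comm]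
      rw [← Finset.sum_add_distrib]
      refine Finset.sum_eq_zero fun i _ => ?_
      rw [← Finset.sum_add_distrib]
      exact Finset.sum_eq_zero fun j _ => hf i j
    exact (smul_eq_zero.1 h1).resolve_left two_ne_zero
  rw [Commute, SemiconjBy, e, e, ← sub_eq_zero, ← hsum, ← Finset.sum_sub_distrib]
  refine Finset.sum_congr rfl fun i _ => ?_
  rw [← Finset.sum_sub_distrib]
  refine Finset.sum_congr rfl fun j _ => ?_
  simp only [f]
  rw [map_sub, sub_mul]

theorem isExchange [CharZero k] (hs : IsShiftSystem q ι t h τ) :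
    IsExchange q n ((revNodal t).map (ι : L →+* E)) (shiftPoly ι t (lagCoef t) h) where
  coeff_P i hi := by rw [coeff_map, coeff_revNodal_eq_zero t hi, map_zero]
  coeff_Q i hi := by
    rw [coeff_shiftPoly]
    refine Finset.sum_eq_zero fun j _ => ?_
    rw [coeff_eq_zero_of_natDegree_lt ((natDegree_nodalErase_lt t j).trans_le hi), mul_zero,
      map_zero, zero_mul]
  coeff_P_zero := by rw [coeff_map, coeff_zero_revNodal t hs.t_ne, map_one]
  PP z w := by
    rw [evalScalar_map, evalScalar_map]
    exact (Commute.all _ _).map ι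
  QQ := hs.QQ
  QP := hs.QP _

end IsShiftSystem

end ShiftSystem

namespace Frame

variable {k L E : Type*} [Field k] [Field L] [Algebra k L] [DivisionRing E] [Algebra k E] {n : ℕ}

/-! ### Frames of quantum type -/

/-- A frame in which `hᵢ` acts on `L` by the automorphism scaling `xᵢ` by `q⁻¹`. -/
structure IsQuantum (F : Frame k L E n) (q : k) : Prop where
  q_ne : q ≠ 0
  not_root : ∀ j : ℕ, 1 ≤ j → q ^ j ≠ 1
  h_ne : ∀ i, F.h i ≠ 0
  h_x_self : ∀ i, F.h i * F.ι (F.x i) = q⁻¹ • (F.ι (F.x i) * F.h i)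
  exists_conj : ∀ i l, ∃ l', F.h i * F.ι l = F.ι l' * F.h i

namespace IsQuantum

section

variable {F : Frame k L E n} {q : k} (hF : F.IsQuantum q) {m p : ℕ}

lemma eq_of_mul_h (hF : F.IsQuantum q) {i : Fin n} {l l' : L}
    (h : F.ι l * F.h i = F.ι l' * F.h i) : l = l' :=
  F.ι_injective (mul_right_cancel₀ (hF.h_ne i) h)

/-- The automorphism of `L` induced by `hᵢ`. -/
def conj (i : Fin n) : L →ₐ[k] L where
  toFun l := Classical.choose (hF.exists_conj i l)
  map_one' := hF.eq_of_mul_h (i := i) (by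
    rw [← Classical.choose_spec (hF.exists_conj i 1), map_one, mul_one, one_mul])
  map_mul' l l' := hF.eq_of_mul_h (i := i)
    ((Classical.choose_spec (hF.exists_conj i (l * l'))).symm.trans (by
      rw [map_mul, map_mul, mul_assoc _ _ (F.h i), ← Classical.choose_spec (hF.exists_conj i l'),
        ← mul_assoc, ← mul_assoc, ← Classical.choose_spec (hF.exists_conj i l)]))
  map_zero' := hF.eq_of_mul_h (i := i) (by
    rw [← Classical.choose_spec (hF.exists_conj i 0), map_zero, mul_zero, zero_mul])
  map_add' l l' := hF.eq_of_mul_h (i := i) (by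
    rw [← Classical.choose_spec (hF.exists_conj i (l + l')), map_add, map_add, mul_add, add_mul,
      ← Classical.choose_spec (hF.exists_conj i l), ← Classical.choose_spec (hF.exists_conj i l')])
  commutes' c := hF.eq_of_mul_h (i := i) (by
    rw [← Classical.choose_spec (hF.exists_conj i (algebraMap k L c)), AlgHom.commutes,
      Algebra.commutes])

lemma h_mul (i : Fin n) (l : L) : F.h i * F.ι l = F.ι (hF.conj i l) * F.h i :=
  Classical.choose_spec (hF.exists_conj i l)

lemma conj_x (i j : Fin n) : hF.conj i (F.x j) = if i = j then q⁻¹ • F.x j else F.x j := by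
  refine hF.eq_of_mul_h (i := i) ?_
  rw [← hF.h_mul]
  split_ifs with h
  · subst h
    rw [hF.h_x_self, map_smul, smul_mul_assoc]
  · exact (F.h_x i j h).eq

lemma conj_xm (i : Fin n) (lam : Fin n → ℤ) :
    hF.conj i (F.xm lam) = (q⁻¹ ^ lam i) • F.xm lam := by
  rw [xm, map_prod, ← Finset.mul_prod_erase _ _ (Finset.mem_univ i),
    ← Finset.mul_prod_erase _ _ (Finset.mem_univ i), ← smul_mul_assoc]
  congr 1
  · rw [map_zpow₀, hF.conj_x, if_pos rfl, Algebra.smul_def, Algebra.smul_def, mul_zpow, map_zpow₀]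
  · refine Finset.prod_congr rfl fun j hj => ?_
    rw [map_zpow₀, hF.conj_x, if_neg (Finset.ne_of_mem_erase hj).symm]

lemma h_mul_xm (hF : F.IsQuantum q) (i : Fin n) (lam : Fin n → ℤ) :
    F.h i * F.ι (F.xm lam) = F.ι (F.xm lam) * (q⁻¹ ^ lam i • F.h i + (0 : k) • 1) := by
  rw [hF.h_mul, hF.conj_xm, zero_smul, add_zero, map_smul, smul_mul_assoc, mul_smul_comm]

lemma inv_h_mul_xm (hF : F.IsQuantum q) (i : Fin n) (lam : Fin n → ℤ) :
    (F.h i)⁻¹ * F.ι (F.xm lam) = F.ι (F.xm lam) * (q ^ lam i • (F.h i)⁻¹ + (0 : k) • 1) := by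
  rw [zero_smul, add_zero]
  refine mul_left_cancel₀ (hF.h_ne i) ?_
  rw [mul_inv_cancel_left₀ (hF.h_ne i), ← mul_assoc, hF.h_mul_xm, zero_smul, add_zero, mul_assoc,
    smul_mul_smul_comm, mul_inv_cancel₀ (hF.h_ne i), ← mul_zpow, inv_mul_cancel₀ hF.q_ne, one_zpow,
    one_smul, mul_one]

lemma conj_t (m : ℕ) (i j : Fin n) :
    hF.conj i (F.t m j) = if i = j then (q ^ m)⁻¹ • F.t m j else F.t m j := by
  rw [t, map_pow, hF.conj_x]
  split_ifs with h
  · rw [_root_.smul_pow, inv_pow]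
  · rfl

lemma conj_y (r : ℕ) (i : Fin n) : hF.conj i (F.y r) = (q ^ r)⁻¹ • F.y r := by
  have h := hF.conj_xm i (fun _ => 1)
  simp only [xm, zpow_one] at h
  rw [y, map_pow, h, _root_.smul_pow, inv_pow]

/-- As q^m ≠ 1, the i-th shift moves tᵢ and fixes the others; a coincidence between tᵢ, or its
shift, and tⱼ would contradict this. -/
lemma shiftSystem (hm : 1 ≤ m) : IsShiftSystem (q ^ m) F.ι (F.t m) F.h hF.conj := by
  have hne : ∀ i, (q ^ m)⁻¹ • F.t m i ≠ F.t m i := fun i h => by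
    have h1 : ((q ^ m)⁻¹ - 1) • F.t m i = 0 := by rw [sub_smul, one_smul, h, sub_self]
    have h2 := (smul_eq_zero.1 h1).resolve_right (F.t_ne m i)
    exact hF.not_root m hm (inv_eq_one.1 (sub_eq_zero.1 h2))
  have hi : Function.Injective (F.t m) := fun i j hij => by
    by_contra h
    have h1 := hF.conj_t m i j
    rw [if_neg h, ← hij, hF.conj_t, if_pos rfl] at h1
    exact hne i h1
  exact
    { q_ne := pow_ne_zero _ hF.q_ne
      t_ne := F.t_ne m
      h_ne := hF.h_ne
      h_comm := F.h_comm
      h_mul := hF.h_mul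
      τ_self := fun i => by rw [hF.conj_t, if_pos rfl]
      τ_of_ne := fun i j hij => by rw [hF.conj_t, if_neg hij]
      injective := hi
      smul_ne := fun i j hij h => by
        have h1 := hF.conj_t m j j
        rw [← h, map_smul, hF.conj_t, if_neg (Ne.symm hij), if_pos rfl, h] at h1
        exact hne j h1.symm }

lemma t_injective (hF : F.IsQuantum q) (hm : 1 ≤ m) : Function.Injective (F.t m) :=
  (hF.shiftSystem hm).injective

end

section

/-- The polynomial `∏ (1 - X / tⱼ)` over `E`. -/
def _root_.GWANoether.Frame.exchangeP (F : Frame k L E n) (m : ℕ) : E[X] :=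
  (revNodal (F.t m)).map (F.ι : L →+* E)

/-- The polynomial interpolating the `hᵢ` at the `tᵢ`. -/
def _root_.GWANoether.Frame.exchangeQ (F : Frame k L E n) (m : ℕ) : E[X] :=
  shiftPoly F.ι (F.t m) (lagCoef (F.t m)) F.h

variable {F : Frame k L E n} {q : k} {m p : ℕ}

lemma isExchange [CharZero k] (hF : F.IsQuantum q) (hm : 1 ≤ m) :
    IsExchange (q ^ m) n (F.exchangeP m) (F.exchangeQ m) := (hF.shiftSystem hm).isExchange

lemma coeff_exchangeP (e : ℕ) : (F.exchangeP m).coeff e =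
    F.ι (∏ j, -(F.t m j)⁻¹) * F.ι ((∏ j, (X - C (F.t m j))).coeff e) := by
  rw [exchangeP, coeff_map, revNodal, coeff_C_mul, map_mul]
  rfl

lemma coeff_exchangeQ (e : ℕ) : (F.exchangeQ m).coeff e =
    ∑ i, F.ι ((nodalErase (F.t m) i).coeff e * lagCoef (F.t m) i) * F.h i := by
  rw [exchangeQ, coeff_shiftPoly]
  simp only [mul_comm]

lemma prod_neg_inv (hp : p ∣ m) :
    ∏ j, -(F.t m j)⁻¹ = (-1) ^ n * (F.y (m / p) ^ p)⁻¹ := by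
  rw [Finset.prod_neg, Finset.card_univ, Fintype.card_fin, Finset.prod_inv_distrib, y, ← pow_mul,
    Nat.div_mul_cancel hp, ← Finset.prod_pow]
  rfl

lemma γL_prod_neg_inv {g : MonomialGroup k n} (hg : g ∈ complexReflectionGroup k m p n)
    (hp : p ∣ m) : F.γL g (∏ j, -(F.t m j)⁻¹) = ∏ j, -(F.t m j)⁻¹ := by
  rw [prod_neg_inv hp]
  simp only [map_mul, map_pow, map_neg, map_one, map_inv₀, F.γL_y hg]

lemma coeffsMem_fixed {g : MonomialGroup k n} (hg : g ∈ complexReflectionGroup k m p n)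
    (hp : p ∣ m) : CoeffsMem (RingHom.eqLocusField (F.γ g).toRingHom (RingHom.id E))
      (F.exchangeP m) (F.exchangeQ m) := by
  refine fun e => ⟨?_, ?_⟩
  · change F.γ g _ = _
    rw [coeff_exchangeP, ← map_mul, ← ι_γL, map_mul, γL_prod_neg_inv hg hp, F.γL_coeff_nodal hg]
    rfl
  · change F.γ g _ = _
    rw [coeff_exchangeQ]
    exact F.γ_sum_lagCoef hg (fun i => F.γL_coeff_nodalErase hg i e) fun i => F.γ_h g i

lemma coeffsMem_of_fixed_mem (hF : F.IsQuantum q) (hm : 1 ≤ m) (hp : p ∣ m) (R : Subalgebra k E)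
    (K : Subfield E)
    (hK : ∀ e ∈ R, (∀ g ∈ complexReflectionGroup k m p n, F.γ g e = e) → e ∈ K)
    (hx : ∀ i, F.ι (F.x i) ∈ R) (hh : ∀ i, F.h i ∈ R) (hy : F.ι (F.y (m / p)) ∈ K) :
    CoeffsMem K (F.exchangeP m) (F.exchangeQ m) := by
  refine fun e => ⟨?_, ?_⟩
  · rw [coeff_exchangeP, prod_neg_inv hp]
    refine mul_mem ?_ ?_
    · simp only [map_mul, map_inv₀, map_pow, map_neg, map_one]
      exact mul_mem (pow_mem (neg_mem (one_mem K)) _) (inv_mem (pow_mem hy _))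
    · refine hK _ (show _ ∈ R.comap F.ι from F.coeff_prod_mem (R.comap F.ι) hx _ _) fun g hg => ?_
      rw [← ι_γL, F.γL_coeff_nodal hg]
  · rw [coeff_exchangeQ]
    exact F.sum_lagCoef_mem_of_fixed_mem (hF.t_injective hm)
      (fun g hg i => F.γL_coeff_nodalErase hg i e) (fun g _ i => F.γ_h g i) R K hK hx
      (fun i => F.coeff_prod_mem (R.comap F.ι) hx _ _)
      fun i => mul_mem (pow_mem (show F.x i ∈ R.comap F.ι from hx i) m) (hh i)

theorem _root_.GWANoether.Frame.isGood_of_coeffsMem (F : Frame k L E n) (hp : p ∣ m) {s : Set E}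
    (hs : ∀ g ∈ complexReflectionGroup k m p n, ∀ e ∈ s, F.γ g e = e)
    (hT : CoeffsMem (skewAdjoin k s) (F.exchangeP m) (F.exchangeQ m))
    (hy : F.ι (F.y (m / p)) ∈ skewAdjoin k s) : F.IsGood (skewAdjoin k s) m p where
  algebraMap_mem := algebraMap_mem_skewAdjoin _
  y_mem := hy
  esymm_mem := F.aeval_esymm_mem _ fun e => by
    have h1 := (hT e).1
    rw [coeff_exchangeP, prod_neg_inv hp] at h1
    have h2 : F.ι ((-1) ^ n * (F.y (m / p) ^ p)⁻¹) ∈ skewAdjoin k s := by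
      simp only [map_mul, map_inv₀, map_pow, map_neg, map_one]
      exact mul_mem (pow_mem (neg_mem (one_mem _)) _) (inv_mem (pow_mem hy _))
    have h3 : F.ι ((-1) ^ n * (F.y (m / p) ^ p)⁻¹) ≠ 0 := (_root_.map_ne_zero F.ι).2
      (mul_ne_zero (pow_ne_zero _ (neg_ne_zero.2 one_ne_zero))
        (inv_ne_zero (pow_ne_zero _ (F.y_ne _))))
    have h4 := mul_mem (inv_mem h2) h1
    rwa [inv_mul_cancel_left₀ h3] at h4
  fixed g hg := F.γ_fixed_of_gens g (hs g hg)

/-- Lagrange interpolation recovers hᵢ as the value of Q at tᵢ, the powers of tᵢ being written on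
the left of the coefficients of Q. -/
lemma h_mem_stab (hF : F.IsQuantum q) (hm : 1 ≤ m) {T : Subfield E}
    (hT : CoeffsMem T (F.exchangeP m) (F.exchangeQ m)) (i : Fin n) : F.h i ∈ F.stab T := by
  refine mem_stab_of_mem_monoSpan ?_ fun lam => ⟨_, _, hF.h_mul_xm i lam⟩
  have ht := hF.t_injective hm
  have e : F.h i = ∑ e : Fin n, F.ι (F.t m i ^ (e : ℕ)) * (F.exchangeQ m).coeff e := by
    simp only [coeff_exchangeQ, Finset.mul_sum, ← mul_assoc, ← map_mul]
    rw [Finset.sum_comm]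
    simp only [← Finset.sum_mul, ← map_sum]
    simp only [mul_comm (F.t m i ^ _), sum_coeff_nodalErase_mul_pow]
    rw [Finset.sum_eq_single i (fun j _ hj => by rw [if_neg hj, zero_mul, map_zero, zero_mul])
      (by simp), if_pos rfl, inv_mul_cancel₀ (lagCoef_ne ht i), map_one, one_mul]
  rw [e]
  exact sum_mem fun e _ => F.laurent_mul_mem_monoSpan
    (pow_mem (pow_mem (F.x_mem_laurent i) m) _) (hT e).2

end

end IsQuantum

end Frame

namespace Frame

/-! ### The inverses of the hᵢ. -/

section InvMem

variable {k L E : Type*} [Field k] [Field L] [Algebra k L] [DivisionRing E] [Algebra k E] {n : ℕ}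
  {F : Frame k L E n} {q : k} {m p : ℕ} {T : Subfield E}

lemma commEval_prod_ne (hh : ∀ i, F.h i ≠ 0) (s : Finset (Fin n)) :
    commEval (k := k) F.h F.h_comm (∏ i ∈ s, MvPolynomial.X i) ≠ 0 := by
  classical
  induction s using Finset.induction_on with
  | empty => rw [Finset.prod_empty, map_one]; exact one_ne_zero
  | insert i s hi ih =>
    rw [Finset.prod_insert hi, map_mul, commEval_X]
    exact mul_ne_zero (hh i) ih

lemma γ_commEval (F : Frame k L E n) (g : MonomialGroup k n) (f : MvPolynomial (Fin n) k) :
    F.γ g (commEval F.h F.h_comm f) =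
      commEval F.h F.h_comm (MvPolynomial.rename g.right f) := by
  have : (F.γ g).comp (commEval F.h F.h_comm) =
      (commEval F.h F.h_comm).comp (MvPolynomial.rename g.right) := by
    refine MvPolynomial.algHom_ext fun i => ?_
    rw [AlgHom.comp_apply, AlgHom.comp_apply, MvPolynomial.rename_X, commEval_X, commEval_X, γ_h]
  exact DFunLike.congr_fun this f

lemma commEval_mem_stab (hh : ∀ i, F.h i ∈ F.stab T) (f : MvPolynomial (Fin n) k) :
    commEval F.h F.h_comm f ∈ F.stab T := by
  induction f using MvPolynomial.induction_on with
  | C c =>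
    rw [← MvPolynomial.algebraMap_eq, AlgHom.commutes]
    exact Subalgebra.algebraMap_mem _ c
  | add f g hf hg => rw [map_add]; exact add_mem hf hg
  | mul_X f i hf => rw [map_mul, commEval_X]; exact mul_mem hf (hh i)

/-- The product of all the hⱼ is invariant, so it lies in `T` together with its inverse; hᵢ⁻¹ is the
product of the other hⱼ times that inverse. -/
lemma IsQuantum.inv_h_mem_stab [IsAlgClosed k] [CharZero k] (hF : F.IsQuantum q) (hm : 1 ≤ m)
    (hp : p ∣ m) (hT : F.IsGood T m p) (hh : ∀ i, F.h i ∈ F.stab T) (i : Fin n) :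
    (F.h i)⁻¹ ∈ F.stab T := by
  refine mem_stab_of_mem_monoSpan ?_ fun lam => ⟨_, _, hF.inv_h_mul_xm i lam⟩
  have h1 : commEval (k := k) F.h F.h_comm (∏ i, MvPolynomial.X i) ∈ T := by
    refine hT.mem_of_fixed hm hp (mem_monoSpan_of_mem_stab (commEval_mem_stab hh _)) fun g _ => ?_
    rw [γ_commEval, map_prod]
    simp only [MvPolynomial.rename_X]
    rw [Equiv.prod_comp g.right (fun i => (MvPolynomial.X i : MvPolynomial (Fin n) k))]
  have h2 := commEval_prod_ne hF.h_ne Finset.univ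
  have h3 : F.h i * commEval (k := k) F.h F.h_comm (∏ j ∈ Finset.univ.erase i, MvPolynomial.X j) =
      commEval (k := k) F.h F.h_comm (∏ i, MvPolynomial.X i) := by
    rw [← Finset.mul_prod_erase _ _ (Finset.mem_univ i), map_mul, commEval_X]
  have h4 : (F.h i)⁻¹ =
      commEval (k := k) F.h F.h_comm (∏ j ∈ Finset.univ.erase i, MvPolynomial.X j) *
        (commEval (k := k) F.h F.h_comm (∏ i, MvPolynomial.X i))⁻¹ := by
    refine (eq_inv_of_mul_eq_one_right ?_).symm
    rw [← mul_assoc, h3, mul_inv_cancel₀ h2]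
  rw [h4]
  exact mul_mem_monoSpan (mem_monoSpan_of_mem_stab (commEval_mem_stab hh _)) (inv_mem h1)

end InvMem

/-! ### Quantum planes inside a frame of quantum type. -/

section QuantumHom

variable {k L E : Type*} [Field k] [Field L] [Algebra k L] [DivisionRing E] [Algebra k E] {N : ℕ}
  {F : Frame k L E (N + 1)} {q : k} {m p : ℕ}

lemma coeff_exchangeP_top (hp : p ∣ m) : (F.exchangeP m).coeff (N + 1) =
    F.ι ((-1) ^ (N + 1) * (F.y (m / p) ^ p)⁻¹) := by
  rw [exchangeP, coeff_map, coeff_revNodal, IsQuantum.prod_neg_inv hp]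
  rfl

/-- Every hᵢ rescales y by the same factor, so each coefficient of Q does too. -/
lemma IsQuantum.coeff_exchangeQ_mul_y (hF : F.IsQuantum q) (r e : ℕ) :
    (F.exchangeQ m).coeff e * F.ι (F.y r) =
      (q ^ r)⁻¹ • (F.ι (F.y r) * (F.exchangeQ m).coeff e) := by
  rw [IsQuantum.coeff_exchangeQ, Finset.sum_mul, Finset.mul_sum, Finset.smul_sum]
  refine Finset.sum_congr rfl fun i _ => ?_
  rw [mul_assoc, hF.h_mul, hF.conj_y, map_smul, smul_mul_assoc, mul_smul_comm, ← mul_assoc,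
    ← mul_assoc, (F.ι_commute _ _).eq]

lemma IsQuantum.y_commute_coeff_monicPart (hF : F.IsQuantum q) (r e : ℕ) :
    Commute ((monicPart N (F.exchangeQ m)).coeff e) (F.ι (F.y r)) := by
  by_cases hb : (F.exchangeQ m).coeff N = 0
  · rw [monicPart, hb, inv_zero, C_0, zero_mul, coeff_zero]
    exact Commute.zero_left _
  have hq : (q ^ r)⁻¹ ≠ 0 := inv_ne_zero (pow_ne_zero _ hF.q_ne)
  have h1 := hF.coeff_exchangeQ_mul_y (m := m) r N
  have h2 := hF.coeff_exchangeQ_mul_y (m := m) r e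
  rw [monicPart, coeff_C_mul]
  refine mul_left_cancel₀ hb (smul_right_injective E hq ?_)
  dsimp only
  generalize (F.exchangeQ m).coeff N = b at *
  generalize (F.exchangeQ m).coeff e = c at *
  generalize F.ι (F.y r) = y at *
  rw [mul_assoc, h2, ← mul_assoc b y, h1, smul_mul_assoc, mul_assoc y b,
    mul_inv_cancel_left₀ hb, mul_inv_cancel_left₀ hb]

lemma IsQuantum.y_commute_coeff_exchangeP (F : Frame k L E (N + 1)) (m r e : ℕ) :
    Commute ((F.exchangeP m).coeff e) (F.ι (F.y r)) := by
  rw [IsQuantum.coeff_exchangeP, ← map_mul]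
  exact F.ι_commute _ _

/-- The skew field generated by `y` and the coefficients of the pair of polynomials contains an
image of a tensor product of quantum planes generating it. -/
theorem IsQuantum.exists_hom [CharZero k] (hF : F.IsQuantum q) (hm : 1 ≤ m) (hp : p ∣ m)
    (hnd : IsNondegenerate (N + 1) (F.exchangeP m) (F.exchangeQ m)) :
    ∃ f : QuantumPlane k (q ^ (m / p)) ⊗[k] (⨂[k] _ : Fin N, QuantumPlane k (q ^ m)) →ₐ[k] E,
      Function.Injective f ∧ (∀ K : Subfield E, (∀ c : k, algebraMap k E c ∈ K) →
        F.ι (F.y (m / p)) ∈ K → CoeffsMem K (F.exchangeP m) (F.exchangeQ m) → ∀ w, f w ∈ K) ∧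
      F.ι (F.y (m / p)) ∈ skewAdjoin k (Set.range f) ∧
      CoeffsMem (skewAdjoin k (Set.range f)) (F.exchangeP m) (F.exchangeQ m) := by
  have h := hF.isExchange (n := N + 1) hm
  have hb := hnd.2.1
  -- Only the reduced pair is decomposed. The first pair a, b is replaced by b and y, where a =
  -- ±y⁻ᵖ, and this changes its parameter from q^m to q^{m/p}.
  obtain ⟨u, v, huv, hK1, hK2⟩ := (h.reduce hb).exists_pairs hnd.2.2
  have hr : 1 ≤ m / p := Nat.div_pos (Nat.le_of_dvd (by omega) hp)
    (Nat.pos_of_ne_zero fun h0 => by rw [h0, zero_dvd_iff] at hp; omega)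
  have hbu : ∀ i, Commute ((F.exchangeQ m).coeff N) (u i) ∧
      Commute ((F.exchangeQ m).coeff N) (v i) := fun i =>
    ⟨h.commute_of_mem (fun K hK => (hK1 K hK i).1) (h.commute_coeff_Q_reduceP hb)
      h.commute_coeff_Q_monicPart, h.commute_of_mem (fun K hK => (hK1 K hK i).2)
      (h.commute_coeff_Q_reduceP hb) h.commute_coeff_Q_monicPart⟩
  have hyR : ∀ z : k, Commute (F.ι (F.y (m / p))) (evalScalar z (monicPart N (F.exchangeQ m))) :=
    fun z => (commute_evalScalar_of_coeff (fun e => hF.y_commute_coeff_monicPart _ e) z).symm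
  have hyP : ∀ z : k, Commute (F.ι (F.y (m / p)))
      (evalScalar z (reduceP N (F.exchangeP m) (F.exchangeQ m))) := fun z => by
    rw [IsExchange.evalScalar_reduceP]
    refine (commute_evalScalar_of_coeff (fun e => ?_) z).symm.sub_right
      (((Commute.symm ?_).mul_right (hyR z)).smul_right z)
    · exact IsQuantum.y_commute_coeff_exchangeP F m _ e
    · exact IsQuantum.y_commute_coeff_exchangeP F m _ _
  have hyu : ∀ i, Commute (F.ι (F.y (m / p))) (u i) ∧ Commute (F.ι (F.y (m / p))) (v i) := fun i =>
    ⟨h.commute_of_mem (fun K hK => (hK1 K hK i).1) hyP hyR,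
      h.commute_of_mem (fun K hK => (hK1 K hK i).2) hyP hyR⟩
  have hq : ∀ j, q ^ j ≠ 0 := fun j => pow_ne_zero j hF.q_ne
  have hroot : ∀ i, 1 ≤ i → ∀ j : ℕ, 1 ≤ j → (q ^ i) ^ j ≠ 1 := fun i hi j hj => by
    rw [← pow_mul]
    exact hF.not_root _ (Nat.mul_pos hi hj)
  have hfam : IsQuantumFamily (q ^ (m / p)) (q ^ m) ((F.exchangeQ m).coeff N) (F.ι (F.y (m / p)))
      u v :=
    { rel₀ := by rw [hF.coeff_exchangeQ_mul_y, smul_inv_smul₀ (hq _)]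
      rel := huv.rel
      uu := huv.uu
      uv := huv.uv
      vv := huv.vv
      u₀u := fun i => (hbu i).1
      u₀v := fun i => (hbu i).2
      v₀u := fun i => (hyu i).1
      v₀v := fun i => (hyu i).2 }
  have hmem : ∀ j, hfam.lift (quantumGen _ _ j) ∈ skewAdjoin k (Set.range hfam.lift) := fun j =>
    subset_skewAdjoin _ ⟨_, rfl⟩
  have hy : F.ι (F.y (m / p)) ∈ skewAdjoin k (Set.range hfam.lift) := by
    have := hmem (none, true)
    rwa [hfam.lift_gen] at this
  refine ⟨hfam.lift, ?_, fun K hKk hyK hK w => ?_, hy, ?_⟩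
  · refine quantumTarget_injective (hq _) (hroot _ hr) (hq _) (hroot _ hm) _ fun j => ?_
    rw [hfam.lift_gen]
    match j with
    | (none, false) => exact IsUnit.mk0 _ hb
    | (none, true) => exact IsUnit.mk0 _ ((_root_.map_ne_zero F.ι).2 (F.y_ne _))
    | (some l, false) => exact IsUnit.mk0 _ (huv.u_ne l)
    | (some l, true) => exact IsUnit.mk0 _ (huv.v_ne l)
  · have : (subfieldAlg K hKk).comap hfam.lift = ⊤ := by
      refine quantumTarget_eq_top _ fun j => ?_
      change hfam.lift _ ∈ K
      rw [hfam.lift_gen]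
      match j with
      | (none, false) => exact (hK N).2
      | (none, true) => exact hyK
      | (some l, false) => exact (hK1 K hK.reduce l).1
      | (some l, true) => exact (hK1 K hK.reduce l).2
    have hw : w ∈ (subfieldAlg K hKk).comap hfam.lift := this ▸ trivial
    exact hw
  · refine h.coeffsMem_of_reduce hnd (hK2 _ fun i => ⟨?_, ?_⟩) ?_ ?_
    · have := hmem (some i, false)
      rwa [hfam.lift_gen] at this
    · have := hmem (some i, true)
      rwa [hfam.lift_gen] at this
    -- The leading coefficient of P, given up in favour of y, is recovered as ±y⁻ᵖ.
    · rw [coeff_exchangeP_top hp]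
      simp only [map_mul, map_inv₀, map_pow, map_neg, map_one]
      exact mul_mem (pow_mem (neg_mem (one_mem _)) _) (inv_mem (pow_mem hy _))
    · have := hmem (none, false)
      rwa [hfam.lift_gen] at this

end QuantumHom

end Frame

/-! ### Limits along embeddings into Laurent series -/

section Limits

variable {E E' : Type*} [DivisionRing E] [DivisionRing E']

/-- The element `x` is mapped to a power series with constant coefficient `θ(y)`. -/
def HasLimit (Ψ : E →+* LaurentSeries E') (θ : E →+* E') (x y : E) : Prop :=
  ∃ f : PowerSeries E', Ψ x = HahnSeries.ofPowerSeries ℤ E' f ∧ PowerSeries.constantCoeff f = θ y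

/-- The elements mapped to constant series. -/
def constSubfield (Ψ : E →+* LaurentSeries E') (θ : E →+* E') : Subfield E :=
  RingHom.eqLocusField Ψ (HahnSeries.C.comp θ)

variable {Ψ : E →+* LaurentSeries E'} {θ : E →+* E'}

lemma mem_constSubfield {x : E} : x ∈ constSubfield Ψ θ ↔ Ψ x = HahnSeries.C (θ x) := Iff.rfl

namespace HasLimit

lemma of_mem {x : E} (h : x ∈ constSubfield Ψ θ) : HasLimit Ψ θ x x :=
  ⟨PowerSeries.C (θ x), by rw [mem_constSubfield.1 h, HahnSeries.ofPowerSeries_C],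
    PowerSeries.constantCoeff_C _⟩

lemma zero : HasLimit Ψ θ 0 0 := of_mem (zero_mem _)

lemma one : HasLimit Ψ θ 1 1 := of_mem (one_mem _)

variable {x y x' y' : E}

lemma add (h : HasLimit Ψ θ x y) (h' : HasLimit Ψ θ x' y') : HasLimit Ψ θ (x + x') (y + y') := by
  obtain ⟨f, h1, h2⟩ := h
  obtain ⟨g, h3, h4⟩ := h'
  exact ⟨f + g, by rw [map_add, map_add, h1, h3], by rw [map_add, map_add, h2, h4]⟩

lemma sub (h : HasLimit Ψ θ x y) (h' : HasLimit Ψ θ x' y') : HasLimit Ψ θ (x - x') (y - y') := by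
  obtain ⟨f, h1, h2⟩ := h
  obtain ⟨g, h3, h4⟩ := h'
  exact ⟨f - g, by rw [map_sub, map_sub, h1, h3], by rw [map_sub, map_sub, h2, h4]⟩

lemma mul (h : HasLimit Ψ θ x y) (h' : HasLimit Ψ θ x' y') : HasLimit Ψ θ (x * x') (y * y') := by
  obtain ⟨f, h1, h2⟩ := h
  obtain ⟨g, h3, h4⟩ := h'
  exact ⟨f * g, by rw [map_mul, map_mul, h1, h3], by rw [map_mul, map_mul, h2, h4]⟩

lemma ne_zero (h : HasLimit Ψ θ x y) (hy : y ≠ 0) : x ≠ 0 := by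
  rintro rfl
  obtain ⟨f, h1, h2⟩ := h
  rw [map_zero] at h1
  have : f = 0 := HahnSeries.ofPowerSeries_injective (h1.symm.trans (map_zero _).symm)
  rw [this, map_zero] at h2
  exact hy ((_root_.map_eq_zero θ).1 h2.symm)

lemma inv (h : HasLimit Ψ θ x y) (hy : y ≠ 0) : HasLimit Ψ θ x⁻¹ y⁻¹ := by
  have hx := h.ne_zero hy
  obtain ⟨f, h1, h2⟩ := h
  have hθ : θ y ≠ 0 := (_root_.map_ne_zero θ).2 hy
  refine ⟨PowerSeries.invOfUnit f (Units.mk0 _ hθ), ?_, ?_⟩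
  · have h3 := PowerSeries.mul_invOfUnit f (Units.mk0 _ hθ) h2
    have h4 : Ψ x⁻¹ * Ψ x = 1 := by rw [← map_mul, inv_mul_cancel₀ hx, map_one]
    have h5 := congrArg (HahnSeries.ofPowerSeries ℤ E') h3
    rw [map_mul, map_one, ← h1] at h5
    exact left_inv_eq_right_inv h4 h5
  · rw [PowerSeries.constantCoeff_invOfUnit, map_inv₀]
    rfl

lemma sum {ι : Type*} (s : Finset ι) {x y : ι → E} (h : ∀ i ∈ s, HasLimit Ψ θ (x i) (y i)) :
    HasLimit Ψ θ (∑ i ∈ s, x i) (∑ i ∈ s, y i) := by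
  classical
  induction s using Finset.induction_on with
  | empty => exact zero
  | insert i s hi ih =>
    rw [Finset.sum_insert hi, Finset.sum_insert hi]
    exact (h i (Finset.mem_insert_self i s)).add
      (ih fun j hj => h j (Finset.mem_insert_of_mem hj))

/-- An element mapped to `c X⁻¹` has an inverse tending to zero. -/
lemma inv_of_single (hx : Ψ x = HahnSeries.single (-1) (θ x)) (h0 : x ≠ 0) :
    HasLimit Ψ θ x⁻¹ 0 := by
  refine ⟨PowerSeries.C (θ x)⁻¹ * PowerSeries.X, ?_, ?_⟩
  · have h4 : Ψ x⁻¹ * Ψ x = 1 := by rw [← map_mul, inv_mul_cancel₀ h0, map_one]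
    refine left_inv_eq_right_inv h4 ?_
    rw [hx, map_mul, HahnSeries.ofPowerSeries_C, HahnSeries.ofPowerSeries_X, HahnSeries.C_apply,
      HahnSeries.single_mul_single, HahnSeries.single_mul_single, mul_one,
      mul_inv_cancel₀ ((_root_.map_ne_zero θ).2 h0)]
    rfl
  · rw [map_mul, PowerSeries.constantCoeff_X, mul_zero, map_zero]

end HasLimit

/-- The coefficients of a polynomial have limits. -/
def PolyHasLimit (Ψ : E →+* LaurentSeries E') (θ : E →+* E') (P Q : E[X]) : Prop :=
  ∀ e, HasLimit Ψ θ (P.coeff e) (Q.coeff e)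

namespace PolyHasLimit

variable {P Q P' Q' : E[X]}

lemma C {x y : E} (h : HasLimit Ψ θ x y) : PolyHasLimit Ψ θ (C x) (C y) := fun e => by
  rw [coeff_C, coeff_C]
  split_ifs
  · exact h
  · exact HasLimit.zero

lemma X : PolyHasLimit Ψ θ (X : E[X]) X := fun e => by
  rw [coeff_X]
  split_ifs
  · exact HasLimit.one
  · exact HasLimit.zero

lemma add (h : PolyHasLimit Ψ θ P Q) (h' : PolyHasLimit Ψ θ P' Q') :
    PolyHasLimit Ψ θ (P + P') (Q + Q') := fun e => by
  rw [coeff_add, coeff_add]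
  exact (h e).add (h' e)

lemma sub (h : PolyHasLimit Ψ θ P Q) (h' : PolyHasLimit Ψ θ P' Q') :
    PolyHasLimit Ψ θ (P - P') (Q - Q') := fun e => by
  rw [coeff_sub, coeff_sub]
  exact (h e).sub (h' e)

lemma mul (h : PolyHasLimit Ψ θ P Q) (h' : PolyHasLimit Ψ θ P' Q') :
    PolyHasLimit Ψ θ (P * P') (Q * Q') := fun e => by
  rw [coeff_mul, coeff_mul]
  exact HasLimit.sum _ fun x _ => (h x.1).mul (h' x.2)

lemma divX (h : PolyHasLimit Ψ θ P Q) : PolyHasLimit Ψ θ P.divX Q.divX := fun e => by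
  rw [coeff_divX, coeff_divX]
  exact h (e + 1)

lemma monicPart {n : ℕ} (h : PolyHasLimit Ψ θ P Q) (hb : Q.coeff n ≠ 0) :
    PolyHasLimit Ψ θ (monicPart n P) (monicPart n Q) :=
  (C ((h n).inv hb)).mul h

lemma reduceP {n : ℕ} (h : PolyHasLimit Ψ θ P P') (h' : PolyHasLimit Ψ θ Q Q')
    (hb : Q'.coeff n ≠ 0) : PolyHasLimit Ψ θ (reduceP n P Q) (reduceP n P' Q') :=
  h.sub ((C (h (n + 1))).mul (X.mul (h'.monicPart hb)))

lemma reduceQ {n : ℕ} (h : PolyHasLimit Ψ θ P P') (h' : PolyHasLimit Ψ θ Q Q')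
    (hb : Q'.coeff n ≠ 0) : PolyHasLimit Ψ θ (reduceQ n P Q) (reduceQ n P' Q') :=
  ((h'.monicPart hb).sub ((h.reduceP h' hb).mul (C (h'.monicPart hb 0)))).divX

/-- The reduction uses ring operations and the inversion of one leading coefficient, so it passes to
limits as long as the limiting leading coefficient is nonzero; nonvanishing then lifts back. -/
lemma isNondegenerate {n : ℕ} {P Q P' Q' : E[X]} (h : PolyHasLimit Ψ θ P P')
    (h' : PolyHasLimit Ψ θ Q Q') (hnd : IsNondegenerate n P' Q') : IsNondegenerate n P Q := by
  induction n generalizing P Q P' Q' with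
  | zero => trivial
  | succ n ih =>
    exact ⟨(h _).ne_zero hnd.1, (h' _).ne_zero hnd.2.1,
      ih (h.reduceP h' hnd.2.1) (h.reduceQ h' hnd.2.1) hnd.2.2⟩

end PolyHasLimit

end Limits

/-! ### Nondegeneracy of systems of shift operators -/

section Nondegenerate

variable {k L E E' : Type*} [Field k] [Field L] [Algebra k L] [DivisionRing E] [Algebra k E]
  [DivisionRing E']

/-- Embeddings into Laurent series along which exactly one of the `hᵢ` has a pole. -/
structure IsPoleSystem {n : ℕ} (ι : L →ₐ[k] E) (t : Fin n → L) (h : Fin n → E)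
    (Ψ : Fin n → E →+* LaurentSeries E') (θ : E →+* E') : Prop where
  t_mem : ∀ i j, ι (t j) ∈ constSubfield (Ψ i) θ
  h_mem : ∀ i j, i ≠ j → h j ∈ constSubfield (Ψ i) θ
  h_self : ∀ i, Ψ i (h i) = HahnSeries.single (-1) (θ (h i))

lemma coeff_prod_X_sub_C_mem {κ : Type*} (K : Subfield L) (t : κ → L) (ht : ∀ i, t i ∈ K)
    (s : Finset κ) (e : ℕ) : (∏ j ∈ s, (X - C (t j))).coeff e ∈ K := by
  classical
  induction s using Finset.induction_on generalizing e with
  | empty =>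
    rw [Finset.prod_empty, coeff_one]
    split_ifs
    · exact one_mem K
    · exact zero_mem K
  | insert i s hi ih =>
    rw [Finset.prod_insert hi, sub_mul, coeff_sub, coeff_C_mul]
    refine sub_mem ?_ (mul_mem (ht i) (ih e))
    cases e with
    | zero => rw [coeff_X_mul_zero]; exact zero_mem K
    | succ e => rw [coeff_X_mul]; exact ih e

lemma nodalErase_zero {n : ℕ} (t : Fin (n + 1) → L) :
    nodalErase t 0 = ∏ l : Fin n, (X - C (t l.succ)) := by
  rw [nodalErase, Fin.univ_succ, Finset.erase_cons, Finset.prod_map]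
  rfl

lemma nodalErase_succ {n : ℕ} (t : Fin (n + 1) → L) (l : Fin n) :
    nodalErase t l.succ = (X - C (t 0)) * nodalErase (t ∘ Fin.succ) l := by
  have h1 := X_sub_C_mul_nodalErase t l.succ
  have h2 := X_sub_C_mul_nodalErase (t ∘ Fin.succ) l
  rw [Fin.prod_univ_succ] at h1
  refine mul_left_cancel₀ (X_sub_C_ne_zero (t l.succ)) ?_
  rw [h1, mul_left_comm]
  congr 1
  exact h2.symm

lemma revNodal_mul_coeff_zero {n : ℕ} (t : Fin n → L) (ht : ∀ j, t j ≠ 0) (l : Fin n) :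
    revNodal t * C ((nodalErase t l).coeff 0) = (1 - C (t l)⁻¹ * X) * nodalErase t l := by
  have h1 : (∏ j ∈ Finset.univ.erase l, -(t j)⁻¹) * (nodalErase t l).coeff 0 = 1 := by
    rw [nodalErase, coeff_zero_prod, ← Finset.prod_mul_distrib]
    refine Finset.prod_eq_one fun j _ => ?_
    simp [ht j]
  rw [revNodal_eq t ht l, mul_right_comm, ← C_mul, h1, C_1, one_mul]

end Nondegenerate

section Nondegenerate

variable {k L E E' : Type*} [Field k] [Field L] [Algebra k L] [DivisionRing E] [Algebra k E]
  [DivisionRing E']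

lemma PolyHasLimit.map_of_mem {Ψ : E →+* LaurentSeries E'} {θ : E →+* E'} {ι : L →ₐ[k] E}
    {p : L[X]} (h : ∀ e, ι (p.coeff e) ∈ constSubfield Ψ θ) :
    PolyHasLimit Ψ θ (p.map (ι : L →+* E)) (p.map (ι : L →+* E)) := fun e => by
  rw [coeff_map]
  exact HasLimit.of_mem (h e)

namespace IsShiftSystem

variable {q : k} {ι : L →ₐ[k] E}

section

variable {n : ℕ} {t : Fin n → L} {h : Fin n → E} {τ : Fin n → L →ₐ[k] L}

lemma C_h_mul_map (hs : IsShiftSystem q ι t h τ) (i : Fin n) (p : L[X]) :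
    C (h i) * p.map (ι : L →+* E) = (p.map (τ i : L →+* L)).map (ι : L →+* E) * C (h i) := by
  ext e
  simp only [coeff_C_mul, coeff_mul_C, coeff_map]
  exact hs.h_mul i _

end

variable {n : ℕ} {t : Fin (n + 1) → L} {h : Fin (n + 1) → E} {τ : Fin (n + 1) → L →ₐ[k] L}

/-- Dropping the factor 1 - X/t₀ changes P by the leading coefficient times X ∏_{j≠0}(X - tⱼ), the
form of the term subtracted by the reduction. -/
lemma revNodal_succ (t : Fin (n + 1) → L) (ht : t 0 ≠ 0) : revNodal t = revNodal (t ∘ Fin.succ) +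
    C (∏ j, -(t j)⁻¹) * (X * nodalErase t 0) := by
  have h1 : C (t 0)⁻¹ * C (t 0) = (1 : L[X]) := by rw [← C_mul, inv_mul_cancel₀ ht, C_1]
  rw [revNodal, revNodal, nodalErase_zero, Fin.prod_univ_succ, Fin.prod_univ_succ, C_mul, C_neg]
  simp only [Function.comp_apply]
  linear_combination (C (∏ i : Fin n, -(t i.succ)⁻¹) * ∏ i : Fin n, (X - C (t i.succ))) * h1

lemma map_τ_zero (hs : IsShiftSystem q ι t h τ) :
    (nodalErase t 0).map (τ 0 : L →+* L) = nodalErase t 0 := by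
  rw [nodalErase_zero, Polynomial.map_prod]
  refine Finset.prod_congr rfl fun l _ => ?_
  rw [Polynomial.map_sub, map_X, map_C]
  congr 2
  exact hs.τ_of_ne _ _ (Fin.succ_ne_zero l).symm

lemma nodalErase_sub_map_τ (hs : IsShiftSystem q ι t h τ) (l : Fin n) :
    nodalErase t l.succ - (nodalErase t 0).map (τ l.succ : L →+* L) =
      C (q⁻¹ • t l.succ - t 0) * nodalErase (t ∘ Fin.succ) l := by
  have h1 : (nodalErase (t ∘ Fin.succ) l).map (τ l.succ : L →+* L) =
      nodalErase (t ∘ Fin.succ) l := by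
    rw [nodalErase, Polynomial.map_prod]
    refine Finset.prod_congr rfl fun j hj => ?_
    rw [Polynomial.map_sub, map_X, map_C]
    congr 2
    exact hs.τ_of_ne _ _ fun h => Finset.ne_of_mem_erase hj (Fin.succ_injective _ h).symm
  have h2 : nodalErase t 0 = (X - C (t l.succ)) * nodalErase (t ∘ Fin.succ) l := by
    rw [nodalErase_zero]
    exact (X_sub_C_mul_nodalErase (t ∘ Fin.succ) l).symm
  rw [h2, nodalErase_succ, Polynomial.map_mul, h1, Polynomial.map_sub, map_X, map_C]
  have h3 : (τ l.succ : L →+* L) (t l.succ) = q⁻¹ • t l.succ := hs.τ_self _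
  rw [h3, C_sub]
  ring

lemma coeff_shiftPoly_top (g : Fin (n + 1) → L) :
    (shiftPoly ι t g h).coeff n = ∑ j, ι (g j) * h j := by
  rw [coeff_shiftPoly]
  simp only [coeff_nodalErase_pred, mul_one]

/-- The shift of index 0 fixes `nodalErase t 0`, so subtracting the leading coefficient times this
polynomial removes h₀ altogether; the other terms acquire the factor X - t₀ minus its shifted
counterpart, a scalar. -/
lemma shiftPoly_sub (hs : IsShiftSystem q ι t h τ) (g : Fin (n + 1) → L) :
    shiftPoly ι t g h - C ((shiftPoly ι t g h).coeff n) * (nodalErase t 0).map (ι : L →+* E) =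
      shiftPoly ι (t ∘ Fin.succ) (fun l => g l.succ * (q⁻¹ • t l.succ - t 0)) (h ∘ Fin.succ) := by
  have h1 : ∀ j, (C (g j) * nodalErase t j).map (ι : L →+* E) * C (h j) -
      C (ι (g j) * h j) * (nodalErase t 0).map (ι : L →+* E) =
      (C (g j) * (nodalErase t j - (nodalErase t 0).map (τ j : L →+* L))).map (ι : L →+* E) *
        C (h j) := fun j => by
    rw [C_mul, mul_assoc, hs.C_h_mul_map, ← mul_assoc, ← sub_mul]
    congr 1
    rw [mul_sub, Polynomial.map_sub, Polynomial.map_mul, Polynomial.map_mul, map_C]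
    rfl
  rw [coeff_shiftPoly_top, map_sum, Finset.sum_mul, shiftPoly, ← Finset.sum_sub_distrib,
    Fin.sum_univ_succ, h1, hs.map_τ_zero, sub_self, mul_zero, Polynomial.map_zero, zero_mul,
    zero_add, shiftPoly]
  refine Finset.sum_congr rfl fun l _ => ?_
  rw [h1, hs.nodalErase_sub_map_τ, ← mul_assoc, ← C_mul]
  rfl

/-- The identity computing the limit of the second component of the reduction. -/
lemma limit_identity (hs : IsShiftSystem q ι t h τ) (g : Fin n → L) :
    shiftPoly ι (t ∘ Fin.succ) g (h ∘ Fin.succ) -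
      (revNodal (t ∘ Fin.succ)).map (ι : L →+* E) *
        C ((shiftPoly ι (t ∘ Fin.succ) g (h ∘ Fin.succ)).coeff 0) +
      C (ι (q • ∏ j, -(t j)⁻¹)) * (X * (shiftPoly ι (t ∘ Fin.succ) g (h ∘ Fin.succ) *
        C (ι ((nodalErase t 0).coeff 0)))) =
    X * shiftPoly ι (t ∘ Fin.succ) (fun l => g l * ((t l.succ)⁻¹ - (t 0)⁻¹)) (h ∘ Fin.succ) := by
  have e1 : (∏ j, -(t j)⁻¹) * (nodalErase t 0).coeff 0 = -(t 0)⁻¹ := by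
    rw [nodalErase_zero, coeff_zero_prod, Fin.prod_univ_succ, mul_assoc, ← Finset.prod_mul_distrib,
      Finset.prod_eq_one, mul_one]
    intro j _
    simp [hs.t_ne]
  have e2 : ∀ l : Fin n, τ l.succ ((nodalErase t 0).coeff 0) = q⁻¹ • (nodalErase t 0).coeff 0 := by
    intro l
    have h2 : nodalErase t 0 = (X - C (t l.succ)) * nodalErase (t ∘ Fin.succ) l := by
      rw [nodalErase_zero]
      exact (X_sub_C_mul_nodalErase (t ∘ Fin.succ) l).symm
    rw [h2, mul_coeff_zero, map_mul, coeff_sub, coeff_X_zero, coeff_C_zero, zero_sub, map_neg,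
      hs.τ_self, nodalErase, coeff_zero_prod, map_prod, ← smul_neg, smul_mul_assoc]
    congr 2
    refine Finset.prod_congr rfl fun j hj => ?_
    simp only [coeff_sub, coeff_X_zero, coeff_C_zero, zero_sub, map_neg, Function.comp_apply]
    rw [hs.τ_of_ne _ _ fun h => Finset.ne_of_mem_erase hj (Fin.succ_injective _ h).symm]
  rw [coeff_shiftPoly]
  simp only [shiftPoly, map_sum, Finset.sum_mul, Finset.mul_sum, ← Finset.sum_sub_distrib,
    ← Finset.sum_add_distrib]
  -- The terms are compared for each h of index `l.succ` separately, which leaves an identity of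
  -- polynomials over `L`.
  refine Finset.sum_congr rfl fun l _ => ?_
  have e3 : C (h l.succ) * C (ι ((nodalErase t 0).coeff 0)) =
      (C (q⁻¹ • (nodalErase t 0).coeff 0)).map (ι : L →+* E) * C (h l.succ) := by
    rw [← C_mul, hs.h_mul, e2, map_C, ← C_mul]
    rfl
  have e4 := revNodal_mul_coeff_zero (t ∘ Fin.succ) (fun j => hs.t_ne j.succ) l
  have e5 : ∀ c : L, C (ι c) = (C c).map (ι : L →+* E) := fun c => (map_C _).symm
  have e6 : (X : E[X]) = (X : L[X]).map (ι : L →+* E) := (map_X _).symm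
  have e7 : C (q • ∏ j, -(t j)⁻¹) * C (q⁻¹ • (nodalErase t 0).coeff 0) = C (-(t 0)⁻¹) := by
    rw [← C_mul, smul_mul_smul_comm, mul_inv_cancel₀ hs.q_ne, one_smul, e1]
  simp only [Function.comp_apply]
  rw [mul_assoc _ (C (h l.succ)), e3, C_mul, e5, e5, e6]
  simp only [← mul_assoc, ← Polynomial.map_mul, ← sub_mul, ← add_mul, ← Polynomial.map_sub,
    ← Polynomial.map_add]
  congr 2
  simp only [C_mul, C_sub, C_neg] at e7 ⊢
  simp only [Function.comp_apply] at e4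
  linear_combination (X * C (g l) * nodalErase (t ∘ Fin.succ) l) * e7 - C (g l) * e4

end IsShiftSystem

end Nondegenerate

section Nondegenerate

variable {k L E E' : Type*} [Field k] [Field L] [Algebra k L] [DivisionRing E] [Algebra k E]
  [DivisionRing E'] {q : k} {ι : L →ₐ[k] E} {θ : E →+* E'}

lemma IsPoleSystem.comp {n m : ℕ} {t : Fin n → L} {h : Fin n → E}
    {Ψ : Fin n → E →+* LaurentSeries E'} (hp : IsPoleSystem ι t h Ψ θ) (e : Fin m → Fin n)
    (he : Function.Injective e) : IsPoleSystem ι (t ∘ e) (h ∘ e) (Ψ ∘ e) θ where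
  t_mem _ _ := hp.t_mem _ _
  h_mem _ _ hij := hp.h_mem _ _ (he.ne hij)
  h_self _ := hp.h_self _

lemma IsPoleSystem.coeff_nodalErase_mem {n : ℕ} {t : Fin n → L} {h : Fin n → E}
    {Ψ : Fin n → E →+* LaurentSeries E'} (hp : IsPoleSystem ι t h Ψ θ) (i j : Fin n) (e : ℕ) :
    ι ((nodalErase t j).coeff e) ∈ constSubfield (Ψ i) θ :=
  coeff_prod_X_sub_C_mem ((constSubfield (Ψ i) θ).comap (ι : L →+* E)) t (hp.t_mem i) _ e

lemma IsPoleSystem.coeff_revNodal_mem {n m : ℕ} {t : Fin n → L} {h : Fin n → E}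
    {Ψ : Fin n → E →+* LaurentSeries E'} (hp : IsPoleSystem ι t h Ψ θ) (i : Fin n)
    (f : Fin m → Fin n) (e : ℕ) :
    ι ((revNodal (t ∘ f)).coeff e) ∈ constSubfield (Ψ i) θ := by
  rw [revNodal, coeff_C_mul]
  exact mul_mem (S := Subfield L) (s := (constSubfield (Ψ i) θ).comap (ι : L →+* E))
    (prod_mem fun j _ => neg_mem (inv_mem (hp.t_mem i (f j))))
    (coeff_prod_X_sub_C_mem ((constSubfield (Ψ i) θ).comap (ι : L →+* E)) (t ∘ f)
      (fun j => hp.t_mem i (f j)) _ e)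

lemma smul_mem_constSubfield {Ψ : E →+* LaurentSeries E'}
    (hΨ : ∀ c : k, algebraMap k E c ∈ constSubfield Ψ θ) (c : k) {e : E}
    (he : e ∈ constSubfield Ψ θ) : c • e ∈ constSubfield Ψ θ := by
  rw [Algebra.smul_def]
  exact mul_mem (hΨ c) he

/-- One step of the reduction, in the limit. -/
lemma IsShiftSystem.reduce_hasLimit {n : ℕ} {t g : Fin (n + 1) → L} {h : Fin (n + 1) → E}
    {τ : Fin (n + 1) → L →ₐ[k] L} {Ψ : Fin (n + 1) → E →+* LaurentSeries E'}
    (hs : IsShiftSystem q ι t h τ) (hp : IsPoleSystem ι t h Ψ θ)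
    (hΨ : ∀ i, ∀ c : k, algebraMap k E c ∈ constSubfield (Ψ i) θ)
    (hg : ∀ i j, ι (g j) ∈ constSubfield (Ψ i) θ) (hg0 : ∀ j, g j ≠ 0) :
    (shiftPoly ι t g h).coeff n ≠ 0 ∧
    PolyHasLimit (Ψ 0) θ (reduceP n ((revNodal t).map (ι : L →+* E)) (shiftPoly ι t g h))
      ((revNodal (t ∘ Fin.succ)).map (ι : L →+* E)) ∧
    PolyHasLimit (Ψ 0) θ
      (C (ι (g 0) * h 0) * reduceQ n ((revNodal t).map (ι : L →+* E)) (shiftPoly ι t g h))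
      (shiftPoly ι (t ∘ Fin.succ)
        (fun l => g l.succ * (q⁻¹ • t l.succ - t 0) * ((t l.succ)⁻¹ - (t 0)⁻¹)) (h ∘ Fin.succ)) := by
  set P := (revNodal t).map (ι : L →+* E) with hP
  set Q := shiftPoly ι t g h with hQ
  set P' := (revNodal (t ∘ Fin.succ)).map (ι : L →+* E) with hP'
  set R' := (nodalErase t 0).map (ι : L →+* E) with hR'
  set W := shiftPoly ι (t ∘ Fin.succ) (fun l => g l.succ * (q⁻¹ • t l.succ - t 0)) (h ∘ Fin.succ)
    with hW
  -- The dominant summand of the leading coefficient b: along `Ψ 0` only h₀ has a pole.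
  set D := ι (g 0) * h 0 with hD
  set b := Q.coeff n with hb
  set α := ∏ j, -(t j)⁻¹ with hα
  have hD0 : D ≠ 0 := mul_ne_zero ((_root_.map_ne_zero ι).2 (hg0 0)) (hs.h_ne 0)
  have hDl : ∀ l : L, D * ι l = ι (τ 0 l) * D := fun l => by
    rw [hD, mul_assoc, hs.h_mul, ← mul_assoc, ← mul_assoc, ← map_mul, ← map_mul, mul_comm]
  have hDmap : ∀ p : L[X], p.map (τ 0 : L →+* L) = p →
      C D * p.map (ι : L →+* E) = p.map (ι : L →+* E) * C D := fun p hp => by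
    rw [hD, C_mul, mul_assoc, hs.C_h_mul_map, hp, ← mul_assoc, ← mul_assoc]
    congr 1
    have e5 : C (ι (g 0)) = (C (g 0)).map (ι : L →+* E) := (map_C _).symm
    rw [e5, ← Polynomial.map_mul, ← Polynomial.map_mul, mul_comm]
  -- constants
  have hu : HasLimit (Ψ 0) θ D⁻¹ 0 := HasLimit.inv_of_single (by
    rw [hD, map_mul (Ψ 0), hp.h_self, mem_constSubfield.1 (hg 0 0), HahnSeries.C_apply,
      HahnSeries.single_mul_single, zero_add, map_mul θ]) hD0
  have hR'lim : PolyHasLimit (Ψ 0) θ R' R' := PolyHasLimit.map_of_mem (hp.coeff_nodalErase_mem 0 0)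
  have hP'lim : PolyHasLimit (Ψ 0) θ P' P' :=
    PolyHasLimit.map_of_mem (hp.coeff_revNodal_mem 0 Fin.succ)
  have hαlim : ι α ∈ constSubfield (Ψ 0) θ :=
    show α ∈ (constSubfield (Ψ 0) θ).comap (ι : L →+* E) from
      prod_mem fun j _ => neg_mem (inv_mem (hp.t_mem 0 j))
  have hWlim : PolyHasLimit (Ψ 0) θ W W := fun e => by
    refine HasLimit.of_mem ?_
    rw [hW, coeff_shiftPoly]
    refine sum_mem fun l _ => mul_mem ?_ (hp.h_mem 0 _ (Fin.succ_ne_zero l).symm)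
    simp only [map_mul, map_sub, map_smul, mul_assoc]
    refine mul_mem (hg 0 _) (mul_mem (sub_mem (smul_mem_constSubfield (hΨ 0) _ (hp.t_mem 0 _))
      (hp.t_mem 0 0)) ?_)
    exact coeff_prod_X_sub_C_mem ((constSubfield (Ψ 0) θ).comap (ι : L →+* E)) (t ∘ Fin.succ)
      (fun j => hp.t_mem 0 _) _ e
  -- the limit of `b D⁻¹`
  have hbu : HasLimit (Ψ 0) θ (b * D⁻¹) 1 := by
    have e1 : b * D⁻¹ = 1 + (∑ l : Fin n, ι (g l.succ) * h l.succ) * D⁻¹ := by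
      rw [hb, hQ, coeff_shiftPoly_top, Fin.sum_univ_succ, add_mul, mul_inv_cancel₀ hD0]
    have h2 : HasLimit (Ψ 0) θ ((∑ l : Fin n, ι (g l.succ) * h l.succ) * D⁻¹)
        ((∑ l : Fin n, ι (g l.succ) * h l.succ) * 0) := (HasLimit.of_mem (sum_mem fun l _ =>
      mul_mem (hg 0 _) (hp.h_mem 0 _ (Fin.succ_ne_zero l).symm))).mul hu
    rw [e1]
    simpa using HasLimit.one.add h2
  clear_value D
  have hb0 : b ≠ 0 := left_ne_zero_of_mul (hbu.ne_zero one_ne_zero)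
  have hDb : HasLimit (Ψ 0) θ (D * b⁻¹) 1 := by
    have := hbu.inv one_ne_zero
    rwa [mul_inv_rev, inv_inv, inv_one] at this
  have hbinv : HasLimit (Ψ 0) θ b⁻¹ 0 := by
    have := hu.mul hDb
    rwa [inv_mul_cancel_left₀ hD0, zero_mul] at this
  -- the difference of `b⁻¹ Q` and its limit
  have hΔ : monicPart n Q - R' = C b⁻¹ * W := by
    rw [hW, ← hs.shiftPoly_sub, mul_sub, ← hQ, ← hb, ← mul_assoc, ← C_mul, inv_mul_cancel₀ hb0, C_1,
      one_mul]
    rfl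
  have hR : PolyHasLimit (Ψ 0) θ (monicPart n Q) R' := by
    have := hR'lim.add ((PolyHasLimit.C hbinv).mul hWlim)
    rwa [C_0, zero_mul, add_zero, ← hΔ, add_sub_cancel] at this
  -- The difference b⁻¹Q - R' tends to zero, but after multiplication by D it has the limit W,
  -- because D b⁻¹ tends to 1. Hence the second component must be rescaled by D.
  have hV : PolyHasLimit (Ψ 0) θ (C D * (monicPart n Q - R')) W := by
    have := (PolyHasLimit.C hDb).mul hWlim
    rwa [C_mul, mul_assoc, ← hΔ, C_1, one_mul] at this
  have ha : P.coeff (n + 1) = ι α := by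
    rw [hP, coeff_map, coeff_revNodal]
    rfl
  have hPeq : P = P' + C (ι α) * (X * R') := by
    rw [hP, revNodal_succ t (hs.t_ne 0), Polynomial.map_add, Polynomial.map_mul, Polynomial.map_mul,
      map_C, map_X]
    rfl
  have hN : reduceP n P Q = P' - C (ι α) * (X * (monicPart n Q - R')) := by
    rw [reduceP, ha]
    conv_lhs => rw [hPeq]
    noncomm_ring
  have hlim : PolyHasLimit (Ψ 0) θ (C (ι α) * (X * (monicPart n Q - R')))
      (C (ι α) * (X * (C 0 * W))) := by
    rw [hΔ]
    exact (PolyHasLimit.C (HasLimit.of_mem hαlim)).mul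
      (PolyHasLimit.X.mul ((PolyHasLimit.C hbinv).mul hWlim))
  refine ⟨hb0, ?_, ?_⟩
  · rw [hN]
    have := hP'lim.sub hlim
    rwa [C_0, zero_mul, mul_zero, mul_zero, sub_zero] at this
  · have hDP : C D * P' = P' * C D := hDmap _ (by
      rw [revNodal, Polynomial.map_mul, map_C, Polynomial.map_prod]
      congr 2
      · simp only [map_prod, map_neg, map_inv₀, Function.comp_apply]
        exact Finset.prod_congr rfl fun l _ => by
          congr 2
          exact hs.τ_of_ne _ _ (Fin.succ_ne_zero l).symm
      · funext l
        rw [Polynomial.map_sub, map_X, map_C]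
        congr 2
        exact hs.τ_of_ne _ _ (Fin.succ_ne_zero l).symm)
    have hDα : C D * C (ι α) = C (ι (q • α)) * C D := by
      rw [← C_mul, ← C_mul, hDl]
      congr 3
      rw [hα, map_prod, Fin.prod_univ_succ, Fin.prod_univ_succ, map_neg, map_inv₀, hs.τ_self,
        smul_inv₀, inv_inv, ← smul_neg, smul_mul_assoc]
      congr 2
      exact Finset.prod_congr rfl fun l _ => by
        rw [map_neg, map_inv₀, hs.τ_of_ne _ _ (Fin.succ_ne_zero l).symm]
    -- Both polynomials have the same roots, and P' has constant term 1.
    have hR'P' : R' = P' * C (R'.coeff 0) := by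
      have h1 : (∏ j : Fin n, -(t j.succ)⁻¹) * (nodalErase t 0).coeff 0 = 1 := by
        rw [nodalErase_zero, coeff_zero_prod, ← Finset.prod_mul_distrib]
        refine Finset.prod_eq_one fun j _ => ?_
        simp [hs.t_ne]
      have e5 : C (R'.coeff 0) = (C ((nodalErase t 0).coeff 0)).map (ι : L →+* E) := by
        rw [map_C, hR', coeff_map]
      rw [e5, hP', hR', ← Polynomial.map_mul, revNodal, mul_right_comm, ← C_mul]
      simp only [Function.comp_apply]
      rw [h1, C_1, one_mul, nodalErase_zero]
    -- Everything is expressed through D(b⁻¹Q - R'), whose limit is known; D commutes with P' and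
    -- moves past α with the factor q.
    have key : C D * (monicPart n Q - reduceP n P Q * C ((monicPart n Q).coeff 0)) =
        C D * (monicPart n Q - R') - P' * C ((C D * (monicPart n Q - R')).coeff 0) +
        C (ι (q • α)) * (X * (C D * (monicPart n Q - R') * C ((monicPart n Q).coeff 0))) := by
      rw [coeff_C_mul, coeff_sub, C_mul, C_sub, hN]
      generalize C ((monicPart n Q).coeff 0) = c at *
      have e1 : C D * (monicPart n Q - (P' - C (ι α) * (X * (monicPart n Q - R'))) * c) =
        C D * monicPart n Q - C D * P' * c + C D * C (ι α) * (X * (monicPart n Q - R')) * c := by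
        noncomm_ring
      have e2 : C D * (monicPart n Q - R') - P' * (C D * (c - C (R'.coeff 0))) =
          C D * monicPart n Q - C D * R' - P' * C D * c + P' * C D * C (R'.coeff 0) := by
        noncomm_ring
      have e3 : C D * R' = P' * C D * C (R'.coeff 0) := by
        conv_lhs => rw [hR'P']
        rw [← mul_assoc, hDP]
      have e4 : X * (C D * (monicPart n Q - R') * c) = C D * (X * (monicPart n Q - R')) * c := by
        rw [← mul_assoc, ← mul_assoc, X_mul_C, mul_assoc (C D) X]
      rw [e1, e2, e3, e4, hDα, hDP]
      noncomm_ring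
    have hS : PolyHasLimit (Ψ 0) θ
        (C D * (monicPart n Q - reduceP n P Q * C ((monicPart n Q).coeff 0)))
        (X * shiftPoly ι (t ∘ Fin.succ) (fun l => g l.succ * (q⁻¹ • t l.succ - t 0) *
          ((t l.succ)⁻¹ - (t 0)⁻¹)) (h ∘ Fin.succ)) := by
      rw [← hs.limit_identity, key]
      refine (hV.sub (hP'lim.mul (PolyHasLimit.C (hV 0)))).add
        ((PolyHasLimit.C (HasLimit.of_mem ?_)).mul (PolyHasLimit.X.mul (hV.mul (PolyHasLimit.C ?_))))
      · rw [map_smul]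
        exact smul_mem_constSubfield (hΨ 0) _ hαlim
      · have := hR 0
        rwa [hR', coeff_map] at this
    have := hS.divX
    rw [divX_C_mul] at this
    refine fun e => ?_
    have h1 := this e
    rwa [coeff_divX, coeff_X_mul] at h1

/-- Let h₀ tend to infinity. The reduced pair, with its second component rescaled, tends to a pair
of the same shape in the remaining variables, to which induction applies. The coefficients change on
the way, which is why arbitrary nonzero `g` are allowed in place of `lagCoef`. -/
theorem IsShiftSystem.isNondegenerate {n : ℕ} {t g : Fin n → L} {h : Fin n → E}
    {τ : Fin n → L →ₐ[k] L} {Ψ : Fin n → E →+* LaurentSeries E'}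
    (hs : IsShiftSystem q ι t h τ) (hp : IsPoleSystem ι t h Ψ θ)
    (hΨ : ∀ i, ∀ c : k, algebraMap k E c ∈ constSubfield (Ψ i) θ)
    (hg : ∀ i j, ι (g j) ∈ constSubfield (Ψ i) θ) (hg0 : ∀ j, g j ≠ 0) :
    IsNondegenerate n ((revNodal t).map (ι : L →+* E)) (shiftPoly ι t g h) := by
  induction n with
  | zero => trivial
  | succ n ih =>
    obtain ⟨hb, h1, h2⟩ := hs.reduce_hasLimit hp hΨ hg hg0
    have hne := fun l : Fin n => (Fin.succ_ne_zero l)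
    refine ⟨?_, hb, IsNondegenerate.of_C_mul (mul_ne_zero ((_root_.map_ne_zero ι).2 (hg0 0))
      (hs.h_ne 0)) (h1.isNondegenerate h2 (ih (hs.comp Fin.succ (Fin.succ_injective n))
        (hp.comp Fin.succ (Fin.succ_injective n)) (fun i => hΨ _) (fun i l => ?_) fun l => ?_))⟩
    · rw [coeff_map, coeff_revNodal]
      exact (_root_.map_ne_zero ι).2 (Finset.prod_ne_zero_iff.2 fun j _ =>
        neg_ne_zero.2 (inv_ne_zero (hs.t_ne j)))
    · simp only [map_mul, map_sub, map_smul, map_inv₀]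
      exact mul_mem (mul_mem (hg _ _) (sub_mem (smul_mem_constSubfield (hΨ _) _ (hp.t_mem _ _))
        (hp.t_mem _ _))) (sub_mem (inv_mem (hp.t_mem _ _)) (inv_mem (hp.t_mem _ _)))
    · exact mul_ne_zero (mul_ne_zero (hg0 _) (sub_ne_zero.2 (hs.smul_ne _ _ (hne l))))
        (sub_ne_zero.2 fun h => hne l (hs.injective (inv_injective h)))

end Nondegenerate

/-! ### Laurent series over the skew field of fractions of a quantum torus -/

lemma isUnit_laurentSeries {E' : Type*} [DivisionRing E'] {f : LaurentSeries E'} (hf : f ≠ 0) :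
    IsUnit f := by
  rw [← LaurentSeries.single_order_mul_powerSeriesPart f]
  have h1 : PowerSeries.constantCoeff f.powerSeriesPart ≠ 0 := by
    rw [← PowerSeries.coeff_zero_eq_constantCoeff_apply, LaurentSeries.powerSeriesPart_coeff,
      Nat.cast_zero, add_zero]
    exact HahnSeries.coeff_order_eq_zero.not.2 hf
  refine IsUnit.mul ⟨⟨HahnSeries.single f.order 1, HahnSeries.single (-f.order) 1, ?_, ?_⟩, rfl⟩
    (IsUnit.map (HahnSeries.ofPowerSeries ℤ E') ⟨⟨f.powerSeriesPart,
      PowerSeries.invOfUnit f.powerSeriesPart (Units.mk0 _ h1),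
      PowerSeries.mul_invOfUnit _ _ rfl, PowerSeries.invOfUnit_mul _ _ rfl⟩, rfl⟩)
  · rw [HahnSeries.single_mul_single, add_neg_cancel, one_mul]
    rfl
  · rw [HahnSeries.single_mul_single, neg_add_cancel, one_mul]
    rfl

section Torus

variable {k : Type*} [Field k] {n : ℕ} {q : Fin n → kˣ}

/-- The quantum torus of rank `2n`. -/
abbrev QuantumTorus (q : Fin n → kˣ) : Type _ :=
  SkewMonoidAlgebra (ScaleLaurent q) (Multiplicative (Fin n → ℤ))

lemma scaleLaurent_induction {P : ScaleLaurent q → Prop} (h0 : P 0)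
    (hadd : ∀ a b, P a → P b → P (a + b))
    (h : ∀ (c : k) μ, P (c • ScaleLaurent.monomial q μ)) (a : ScaleLaurent q) : P a := by
  have ha : a ∈ Submodule.span k (Set.range (ScaleLaurent.monomial q)) := by
    rw [span_monomial]
    trivial
  obtain ⟨f, rfl⟩ := (Finsupp.mem_span_range_iff_exists_finsupp).1 ha
  exact Finset.sum_induction _ P hadd h0 fun μ _ => h _ μ

variable {E' : Type*} [DivisionRing E'] [Algebra k E'] (ψ : QuantumTorus q →ₐ[k] E')

/-- The restriction to the coefficient ring. -/
def torusCoeff : ScaleLaurent q →ₐ[k] E' := ψ.comp (skewCoeff k (ScaleLaurent q) n)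

/-- The monomials, as homogeneous Laurent series. -/
def torusMonomial (i : Fin n) : Multiplicative (Fin n → ℤ) →* LaurentSeries E' where
  toFun μ := HahnSeries.single (-Multiplicative.toAdd μ i)
    (torusCoeff ψ (ScaleLaurent.monomial q (Multiplicative.toAdd μ)))
  map_one' := by
    rw [toAdd_one, ScaleLaurent.monomial_zero, map_one, Pi.zero_apply, neg_zero]
    rfl
  map_mul' μ ν := by
    rw [toAdd_mul, HahnSeries.single_mul_single, ← ScaleLaurent.monomial_mul, map_mul,
      Pi.add_apply, neg_add]

/-- The homomorphism from the coefficient ring to Laurent series defined by the degree in the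
`i`-th variable. -/
def torusCoeffSeries (i : Fin n) : ScaleLaurent q →+* LaurentSeries E' :=
  AddMonoidAlgebra.liftNCRingHom (k := k)
    ((HahnSeries.C).comp (algebraMap k E')) (torusMonomial ψ i)
    fun c μ => by
      change HahnSeries.single 0 _ * HahnSeries.single _ _ =
        HahnSeries.single _ _ * HahnSeries.single 0 _
      rw [HahnSeries.single_mul_single, HahnSeries.single_mul_single, add_comm, Algebra.commutes]

lemma torusCoeffSeries_monomial (i : Fin n) (c : k) (μ : Fin n → ℤ) :
    torusCoeffSeries ψ i (c • ScaleLaurent.monomial q μ) =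
      HahnSeries.single (-μ i) (torusCoeff ψ (c • ScaleLaurent.monomial q μ)) := by
  have h1 : (c • ScaleLaurent.monomial q μ : ScaleLaurent q) =
      (AddMonoidAlgebra.single μ c : AddMonoidAlgebra k (Fin n → ℤ)) :=
    (AddMonoidAlgebra.smul_single c μ (1 : k)).trans (by rw [smul_eq_mul, mul_one])
  have h2 : torusCoeffSeries ψ i (c • ScaleLaurent.monomial q μ) =
      HahnSeries.C (algebraMap k E' c) * torusMonomial ψ i (Multiplicative.ofAdd μ) := by
    rw [h1]
    exact AddMonoidAlgebra.liftNCRingHom_single _ _ _ _ _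
  rw [h2, map_smul, Algebra.smul_def, HahnSeries.C_apply]
  change HahnSeries.single 0 _ * HahnSeries.single _ _ = _
  rw [HahnSeries.single_mul_single, zero_add]
  rfl

/-- The restriction to the group. -/
def torusGroup : Multiplicative (Fin n → ℤ) →* E' :=
  (ψ : QuantumTorus q →* E').comp
    { toFun := fun g => SkewMonoidAlgebra.single g 1
      map_one' := rfl
      map_mul' := fun g g' => by rw [SkewMonoidAlgebra.single_mul_single, smul_one, mul_one] }

lemma torusCoeff_mul_torusGroup (g : Multiplicative (Fin n → ℤ)) (a : ScaleLaurent q) :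
    torusCoeff ψ a * torusGroup ψ g = ψ (SkewMonoidAlgebra.single g a) := by
  change ψ (SkewMonoidAlgebra.single 1 a) * ψ (SkewMonoidAlgebra.single g 1) = _
  rw [← map_mul, SkewMonoidAlgebra.single_mul_single, one_mul, smul_one, mul_one]

lemma torusGroup_mul_torusCoeff (g : Multiplicative (Fin n → ℤ)) (a : ScaleLaurent q) :
    torusGroup ψ g * torusCoeff ψ a = torusCoeff ψ (g • a) * torusGroup ψ g := by
  rw [torusCoeff_mul_torusGroup]
  change ψ (SkewMonoidAlgebra.single g 1) * ψ (SkewMonoidAlgebra.single 1 a) = _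
  rw [← map_mul, SkewMonoidAlgebra.single_mul_single, one_mul, mul_one]

/-- The homomorphism from the quantum torus to Laurent series defined by the degree in the `i`-th
variable. -/
def torusSeries (i : Fin n) : QuantumTorus q →+* LaurentSeries E' :=
  SkewMonoidAlgebra.liftNCRingHom (torusCoeffSeries ψ i)
    (((HahnSeries.C : E' →+* LaurentSeries E') : E' →* _).comp (torusGroup ψ))
    fun {a g} => by
      change torusCoeffSeries ψ i (g • a) * HahnSeries.C (torusGroup ψ g) =
        HahnSeries.C (torusGroup ψ g) * torusCoeffSeries ψ i a
      induction a using scaleLaurent_induction with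
      | h0 => rw [smul_zero, map_zero, zero_mul, mul_zero]
      | hadd a b ha hb => rw [smul_add, map_add, map_add, add_mul, mul_add, ha, hb]
      | h c μ =>
        have h1 : g • (c • ScaleLaurent.monomial q μ) =
            (c * (scalePairing q g μ : k)) • ScaleLaurent.monomial q μ := by
          rw [smul_comm, ScaleLaurent.smul_monomial, smul_smul]
        rw [h1, torusCoeffSeries_monomial, torusCoeffSeries_monomial, ← h1, HahnSeries.C_apply,
          HahnSeries.single_mul_single, HahnSeries.single_mul_single, zero_add, add_zero,
          torusGroup_mul_torusCoeff]

lemma torusSeries_single (i : Fin n) (g : Multiplicative (Fin n → ℤ)) (c : k) (μ : Fin n → ℤ) :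
    torusSeries ψ i (SkewMonoidAlgebra.single g (c • ScaleLaurent.monomial q μ)) =
      HahnSeries.single (-μ i) (ψ (SkewMonoidAlgebra.single g (c • ScaleLaurent.monomial q μ))) := by
  have h1 : torusSeries ψ i (SkewMonoidAlgebra.single g (c • ScaleLaurent.monomial q μ)) =
      torusCoeffSeries ψ i (c • ScaleLaurent.monomial q μ) * HahnSeries.C (torusGroup ψ g) :=
    SkewMonoidAlgebra.liftNC_single _ _ _ _
  rw [h1, torusCoeffSeries_monomial, HahnSeries.C_apply, HahnSeries.single_mul_single, add_zero,
    torusCoeff_mul_torusGroup]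

/-- Setting the series variable equal to 1 recovers ψ, legitimately since only finitely many
coefficients occur. So a nonzero element has a nonzero series. -/
lemma sum_coeff_torusSeries (i : Fin n) (s : QuantumTorus q) : ∃ F₀ : Finset ℤ, ∀ F, F₀ ⊆ F →
    ∑ d ∈ F, (torusSeries ψ i s).coeff d = ψ s := by
  classical
  have hadd : ∀ s s' : QuantumTorus q, (∃ F₀ : Finset ℤ, ∀ F, F₀ ⊆ F →
      ∑ d ∈ F, (torusSeries ψ i s).coeff d = ψ s) →
      (∃ F₀ : Finset ℤ, ∀ F, F₀ ⊆ F → ∑ d ∈ F, (torusSeries ψ i s').coeff d = ψ s') →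
      ∃ F₀ : Finset ℤ, ∀ F, F₀ ⊆ F →
        ∑ d ∈ F, (torusSeries ψ i (s + s')).coeff d = ψ (s + s') := by
    rintro s s' ⟨F, h⟩ ⟨F', h'⟩
    refine ⟨F ∪ F', fun G hG => ?_⟩
    simp only [map_add, HahnSeries.coeff_add, Finset.sum_add_distrib]
    rw [h G (Finset.union_subset_left hG), h' G (Finset.union_subset_right hG)]
  have h0 : ∃ F₀ : Finset ℤ, ∀ F, F₀ ⊆ F →
      ∑ d ∈ F, (torusSeries ψ i 0).coeff d = ψ 0 :=
    ⟨∅, fun F _ => by simp only [map_zero, HahnSeries.coeff_zero, Finset.sum_const_zero]⟩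
  induction s using SkewMonoidAlgebra.induction_on with
  | zero => exact h0
  | add s s' hs hs' => exact hadd s s' hs hs'
  | single g a =>
    induction a using scaleLaurent_induction with
    | h0 => rw [SkewMonoidAlgebra.single_zero]; exact h0
    | hadd a b ha hb => rw [SkewMonoidAlgebra.single_add]; exact hadd _ _ ha hb
    | h c μ =>
      refine ⟨{-μ i}, fun F hF => ?_⟩
      rw [torusSeries_single, Finset.sum_eq_single (-μ i), HahnSeries.coeff_single_same]
      · intro d _ hd
        rw [HahnSeries.coeff_single_of_ne hd]
      · exact fun h => absurd (Finset.singleton_subset_iff.1 hF) h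

lemma torusSeries_isUnit (hψ : Function.Injective ψ) (i : Fin n) {s : QuantumTorus q}
    (hs : s ≠ 0) : IsUnit (torusSeries ψ i s) := by
  refine isUnit_laurentSeries fun h => hs ?_
  obtain ⟨F, hF⟩ := sum_coeff_torusSeries ψ i s
  have := hF F subset_rfl
  rw [h] at this
  simp only [HahnSeries.coeff_zero, Finset.sum_const_zero] at this
  exact hψ (this.symm.trans (map_zero _).symm)

end Torus

section QuantumEmb

variable {k : Type*} [Field k] {n : ℕ} {a : k[T;T⁻¹]} {σ : k[T;T⁻¹] ≃ₐ[k] k[T;T⁻¹]} {q₀ : kˣ}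

lemma gwaEmb_Xp (hι : IsShiftEmbedding σ (scaleEmb fun _ : Fin n => q₀)) (i : Fin n) :
    gwaEmb a hι (PiTensorProduct.singleAlgHom i (GWA.Xp a σ)) =
    SkewMonoidAlgebra.single (shiftGen i) ((1 : k) • ScaleLaurent.monomial _ 0) := by
  rw [gwaEmb_single, factorHom_Xp, one_smul, ScaleLaurent.monomial_zero]

lemma gwaEmb_base (hι : IsShiftEmbedding σ (scaleEmb fun _ : Fin n => q₀)) (i : Fin n) :
    gwaEmb a hι (PiTensorProduct.singleAlgHom i (GWA.base a σ (LaurentPolynomial.T 1))) =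
    SkewMonoidAlgebra.single 1 ((1 : k) • ScaleLaurent.monomial _ (Pi.single i 1)) := by
  rw [gwaEmb_single, factorHom_base, one_smul, scaleEmb_T]

end QuantumEmb

/-! ### Nondegeneracy for generalized Weyl algebras of quantum type. -/

section QuantumGWA

variable {k : Type*} [Field k] {n : ℕ} {a : k[T;T⁻¹]} {σ : k[T;T⁻¹] ≃ₐ[k] k[T;T⁻¹]}
  [IsOreDomain (GWATensor a σ n)]

section Embedding

variable {q₀ : kˣ} {E' : Type*} [DivisionRing E'] [Algebra k E']
  {ψ : QuantumTorus (fun _ : Fin n => q₀) →ₐ[k] E'} (hψ : Function.Injective ψ)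
  {hι : IsShiftEmbedding σ (scaleEmb fun _ : Fin n => q₀)} (hinj : Function.Injective (gwaEmb a hι))

/-- The embedding of the skew field of fractions extending an embedding of a quantum torus. -/
def GWAFrac.torusEmb : GWAFrac a σ n →ₐ[k] E' :=
  fracLift (ψ.comp (gwaEmb a hι)) (hψ.comp hinj)

lemma GWAFrac.torusEmb_toFrac (z : GWATensor a σ n) :
    GWAFrac.torusEmb hψ hinj (toFrac k _ z) = ψ (gwaEmb a hι z) :=
  fracLift_toFrac _ _ _

/-- The embedding of the skew field of fractions into Laurent series defined by the degree in
`hᵢ`. -/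
def GWAFrac.series (i : Fin n) : GWAFrac a σ n →+* LaurentSeries E' :=
  fracLiftRingHom ((torusSeries ψ i).comp (gwaEmb a hι).toRingHom) fun _ hz =>
    torusSeries_isUnit ψ hψ i fun h => hz (hinj (h.trans (map_zero _).symm))

lemma GWAFrac.series_toFrac (i : Fin n) (z : GWATensor a σ n) :
    GWAFrac.series hψ hinj i (toFrac k _ z) = torusSeries ψ i (gwaEmb a hι z) :=
  fracLiftRingHom_toFrac _ _ _

lemma GWAFrac.series_eq_single (i : Fin n) {z : GWATensor a σ n}
    {g : Multiplicative (Fin n → ℤ)} {c : k} {μ : Fin n → ℤ}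
    (h : gwaEmb a hι z = SkewMonoidAlgebra.single g (c • ScaleLaurent.monomial _ μ)) :
    GWAFrac.series hψ hinj i (toFrac k _ z) =
      HahnSeries.single (-μ i) (GWAFrac.torusEmb hψ hinj (toFrac k _ z)) := by
  rw [GWAFrac.series_toFrac, GWAFrac.torusEmb_toFrac, h, torusSeries_single]

/-- The elements of degree zero in `hᵢ`. -/
def GWAFrac.constField (i : Fin n) : Subfield (GWAFrac a σ n) :=
  constSubfield (GWAFrac.series hψ hinj i) (GWAFrac.torusEmb hψ hinj : GWAFrac a σ n →+* E')

lemma GWAFrac.mem_constField (i : Fin n) {z : GWATensor a σ n}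
    {g : Multiplicative (Fin n → ℤ)} {c : k} {μ : Fin n → ℤ}
    (h : gwaEmb a hι z = SkewMonoidAlgebra.single g (c • ScaleLaurent.monomial _ μ)) (hμ : μ i = 0) :
    toFrac k _ z ∈ GWAFrac.constField hψ hinj i := by
  refine (GWAFrac.series_eq_single hψ hinj i h).trans ?_
  rw [hμ, neg_zero]
  rfl

lemma GWAFrac.algebraMap_mem_constField (i : Fin n) (c : k) :
    algebraMap k (GWAFrac a σ n) c ∈ GWAFrac.constField hψ hinj i := by
  have h : gwaEmb a hι (algebraMap k _ c) =
      SkewMonoidAlgebra.single 1 (c • ScaleLaurent.monomial _ 0) := by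
    refine ((gwaEmb a hι).commutes c).trans ?_
    rw [SkewMonoidAlgebra.coe_algebraMap, Function.comp_apply, ScaleLaurent.monomial_zero,
      Algebra.algebraMap_eq_smul_one]
  exact GWAFrac.mem_constField hψ hinj i h rfl

/-- The series grade by the degree in hᵢ with the sign reversed: the xⱼ and the other hⱼ have degree
0, and hᵢ has a simple pole. -/
lemma GWAFrac.isPoleSystem (hX : ∀ i, GWAFrac.X a σ n i ≠ 0) (m : ℕ) :
    IsPoleSystem (gwaFrame a σ n hX (LaurentPolynomial.T 1)).ι
      ((gwaFrame a σ n hX (LaurentPolynomial.T 1)).t m)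
      (gwaFrame a σ n hX (LaurentPolynomial.T 1)).h (GWAFrac.series hψ hinj)
      (GWAFrac.torusEmb hψ hinj : GWAFrac a σ n →+* E') where
  t_mem i j := by
    rw [Frame.t, map_pow]
    exact pow_mem (GWAFrac.mem_constField hψ hinj i (gwaEmb_Xp hι j) rfl) m
  h_mem i j hij := GWAFrac.mem_constField hψ hinj i (gwaEmb_base hι j)
    (Pi.single_eq_of_ne hij 1)
  h_self i := by
    refine (GWAFrac.series_eq_single hψ hinj i (gwaEmb_base hι i)).trans ?_
    rw [Pi.single_eq_same]
    rfl

end Embedding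

/-- Conjugation by hᵢ rescales each xⱼ, so it preserves their double commutant and induces an
automorphism there. -/
lemma gwaFrame_isQuantum {q : k} (hq : q ≠ 0) (hroot : ∀ j : ℕ, 1 ≤ j → q ^ j ≠ 1)
    (hσ : σ (LaurentPolynomial.T 1) = q • LaurentPolynomial.T 1)
    (hX : ∀ i, GWAFrac.X a σ n i ≠ 0) :
    (gwaFrame a σ n hX (LaurentPolynomial.T 1)).IsQuantum q := by
  have hne : ∀ i, GWAFrac.base a σ n i (LaurentPolynomial.T 1) ≠ 0 := fun i =>
    ((LaurentPolynomial.isUnit_T 1).map (GWAFrac.base a σ n i)).ne_zero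
  have hself : ∀ i, GWAFrac.base a σ n i (LaurentPolynomial.T 1) * GWAFrac.X a σ n i =
      q⁻¹ • (GWAFrac.X a σ n i * GWAFrac.base a σ n i (LaurentPolynomial.T 1)) := fun i => by
    rw [GWAFrac.X_base, hσ, map_smul, smul_mul_assoc, inv_smul_smul₀ hq]
  refine
    { q_ne := hq
      not_root := hroot
      h_ne := hne
      h_x_self := hself
      exists_conj := fun i l => ?_ }
  have := conj_mem_bicomm (k := k) (s := Set.range (GWAFrac.X a σ n)) (hne i) (by
    rintro _ ⟨j, rfl⟩
    by_cases hij : i = j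
    · subst hij
      exact ⟨q⁻¹, hself i⟩
    · exact ⟨1, by rw [one_smul, (GWAFrac.base_X a σ n i j hij _).eq]⟩) l.2
  refine ⟨⟨_, this⟩, ?_⟩
  change _ = GWAFrac.base a σ n i (LaurentPolynomial.T 1) * _ *
    (GWAFrac.base a σ n i (LaurentPolynomial.T 1))⁻¹ * GWAFrac.base a σ n i (LaurentPolynomial.T 1)
  rw [inv_mul_cancel_right₀ (hne i)]
  rfl

lemma laurent_eq_top_of_T_mem (U : Subalgebra k k[T;T⁻¹]) (h1 : LaurentPolynomial.T 1 ∈ U)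
    (h2 : LaurentPolynomial.T (-1) ∈ U) : U = ⊤ := by
  have hT : ∀ j : ℤ, LaurentPolynomial.T j ∈ U := fun j => by
    induction j using Int.induction_on with
    | zero => rw [LaurentPolynomial.T_zero]; exact one_mem U
    | succ j ih => rw [LaurentPolynomial.T_add]; exact mul_mem ih h1
    | pred j ih => rw [sub_eq_add_neg, LaurentPolynomial.T_add]; exact mul_mem ih h2
  refine eq_top_iff.2 fun d _ => ?_
  induction d using LaurentPolynomial.induction_on' with
  | add f g hf hg => exact add_mem (hf trivial) (hg trivial)
  | C_mul_T j c => exact mul_mem (U.algebraMap_mem c) (hT j)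

theorem gwaFrame_isNondegenerate [CharZero k] {q : k} {q₀ : kˣ} {m : ℕ} (hm : 1 ≤ m)
    {hι : IsShiftEmbedding σ (scaleEmb fun _ : Fin n => q₀)} (hinj : Function.Injective (gwaEmb a hι))
    {E' : Type*} [DivisionRing E'] [Algebra k E']
    {ψ : QuantumTorus (fun _ : Fin n => q₀) →ₐ[k] E'} (hψ : Function.Injective ψ)
    (hX : ∀ i, GWAFrac.X a σ n i ≠ 0)
    (hF : (gwaFrame a σ n hX (LaurentPolynomial.T 1)).IsQuantum q) :
    IsNondegenerate n ((gwaFrame a σ n hX (LaurentPolynomial.T 1)).exchangeP m)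
      ((gwaFrame a σ n hX (LaurentPolynomial.T 1)).exchangeQ m) := by
  have hpole := GWAFrac.isPoleSystem hψ hinj hX m
  refine (hF.shiftSystem hm).isNondegenerate hpole
    (GWAFrac.algebraMap_mem_constField hψ hinj) (fun i j => ?_)
    fun j => lagCoef_ne (hF.t_injective hm) j
  have h1 : ∀ l, (gwaFrame a σ n hX (LaurentPolynomial.T 1)).t m l ∈
      (GWAFrac.constField hψ hinj i).comap
        ((gwaFrame a σ n hX (LaurentPolynomial.T 1)).ι : GWAField a σ n →+* GWAFrac a σ n) := fun l => hpole.t_mem i l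
  change lagCoef _ j ∈ (GWAFrac.constField hψ hinj i).comap
    ((gwaFrame a σ n hX (LaurentPolynomial.T 1)).ι : GWAField a σ n →+* GWAFrac a σ n)
  exact prod_mem fun l _ => inv_mem (sub_mem (h1 j) (h1 l))

end QuantumGWA

/-- The skew field generated by the image of the quantum planes contains y and the coefficients of P
and Q. This suffices for averaging, so it contains the invariants; conversely y and those
coefficients lie in the skew field generated by the invariants. -/
theorem quantum_fracIsomorphic {k : Type*} [Field k] [IsAlgClosed k] [CharZero k]
    {N m p : ℕ} (hm : 1 ≤ m) (hp : p ∣ m) {q : k} (hq : q ≠ 0)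
    (hroot : ∀ j : ℕ, 1 ≤ j → q ^ j ≠ 1) (a : k[T;T⁻¹]) (σ : k[T;T⁻¹] ≃ₐ[k] k[T;T⁻¹])
    (ha : a ≠ 0) (hσ : σ (LaurentPolynomial.T 1) = q • LaurentPolynomial.T 1) :
    FracIsomorphic k (GWAInvariants m p (N + 1) a σ)
      (QuantumPlane k (q ^ (m / p)) ⊗[k] (⨂[k] _ : Fin N, QuantumPlane k (q ^ m))) := by
  have hι := isShiftEmbedding_quantum (n := N + 1) σ (Units.mk0 q hq) hσ
  have hinj := gwaEmb_injective ha hι (AddMonoidAlgebra.basis ℤ k) linearIndependent_scaleEmb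
  have hgr := quantum_hasPolyGrowth fun _ : Fin (N + 1) => Units.mk0 q hq
  have : IsOreDomain (GWATensor a σ (N + 1)) := hgr.isOreDomain_of_injective _ hinj
  have : IsOreDomain (GWAInvariants m p (N + 1) a σ) := hgr.isOreDomain_of_injective
    ((gwaEmb a hι).comp (GWAInvariants m p (N + 1) a σ).val) (hinj.comp Subtype.val_injective)
  have hr : 1 ≤ m / p := Nat.div_pos (Nat.le_of_dvd (by omega) hp)
    (Nat.pos_of_ne_zero fun h0 => by rw [h0, zero_dvd_iff] at hp; omega)
  have hroot' : ∀ i, 1 ≤ i → ∀ j : ℕ, 1 ≤ j → (q ^ i) ^ j ≠ 1 := fun i hi j hj => by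
    rw [← pow_mul]
    exact hroot _ (Nat.mul_pos hi hj)
  have := quantumTarget_isOreDomain (N := N) (pow_ne_zero (m / p) hq) (hroot' _ hr)
    (pow_ne_zero m hq) (hroot' _ hm)
  have hX := GWAFrac.X_ne (a := a) hι
  have hF := gwaFrame_isQuantum (n := N + 1) (a := a) hq hroot hσ hX
  have : IsOreDomain (QuantumTorus fun _ : Fin (N + 1) => Units.mk0 q hq) := hgr.isOreDomain
  -- The coefficients of the Laurent series are taken in the skew field of fractions of the quantum
  -- torus itself.
  have hnd := gwaFrame_isNondegenerate hm hinj
    (toFrac_injective (k := k) (R := QuantumTorus fun _ : Fin (N + 1) => Units.mk0 q hq)) hX hF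
  obtain ⟨f, hf, hK, hy, hc⟩ := hF.exists_hom hm hp hnd
  refine fracIsomorphic_of_skewAdjoin_eq
    ((toFrac k (GWATensor a σ (N + 1))).comp (GWAInvariants m p (N + 1) a σ).val)
    ((toFrac_injective (k := k) (R := GWATensor a σ (N + 1))).comp Subtype.val_injective) f hf ?_
  have hgood : (gwaFrame a σ (N + 1) hX (LaurentPolynomial.T 1)).IsGood
      (skewAdjoin k (Set.range f)) m p := by
    refine Frame.isGood_of_coeffsMem _ hp (fun g hg => ?_) hc hy
    rintro _ ⟨w, rfl⟩
    refine hK (RingHom.eqLocusField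
      ((gwaFrame a σ (N + 1) hX (LaurentPolynomial.T 1)).γ g).toRingHom
      (RingHom.id (GWAFrac a σ (N + 1)))) (fun c =>
        ((gwaFrame a σ (N + 1) hX (LaurentPolynomial.T 1)).γ g).commutes c)
      ?_ (Frame.IsQuantum.coeffsMem_fixed hg hp) w
    change Frame.γ _ g _ = _
    rw [← Frame.ι_γL, Frame.γL_y _ hg]
    rfl
  refine GWAFrac.invariantField_eq hX (LaurentPolynomial.T 1) hm hp hgood (fun i d => ?_) ?_
  · have h1 := hF.h_mem_stab hm hc
    have h2 := hF.inv_h_mem_stab hm hp hgood h1 i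
    -- The base ring consists of Laurent polynomials, so the inverses of the hᵢ must preserve the
    -- span as well.
    have : ((gwaFrame a σ (N + 1) hX (LaurentPolynomial.T 1)).stab
        (skewAdjoin k (Set.range f))).comap (GWAFrac.base a σ (N + 1) i) = ⊤ := by
      refine laurent_eq_top_of_T_mem _ (h1 i) ?_
      have e : (GWAFrac.base a σ (N + 1) i (LaurentPolynomial.T 1))⁻¹ =
          GWAFrac.base a σ (N + 1) i (LaurentPolynomial.T (-1)) := by
        refine (eq_inv_of_mul_eq_one_right ?_).symm
        rw [← map_mul, ← LaurentPolynomial.T_add, add_neg_cancel, LaurentPolynomial.T_zero, map_one]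
      change GWAFrac.base a σ (N + 1) i (LaurentPolynomial.T (-1)) ∈ Frame.stab _ _
      rw [← e]
      exact h2
    have hd : d ∈ ((gwaFrame a σ (N + 1) hX (LaurentPolynomial.T 1)).stab
        (skewAdjoin k (Set.range f))).comap (GWAFrac.base a σ (N + 1) i) := this ▸ trivial
    exact hd
  · have hy' : (gwaFrame a σ (N + 1) hX (LaurentPolynomial.T 1)).ι 
        ((gwaFrame a σ (N + 1) hX (LaurentPolynomial.T 1)).y (m / p)) ∈ GWAFrac.invariantField a σ (N + 1) m p := by
      refine GWAFrac.mem_invariantField ?_ fun g hg => ?_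
      · have hx : ∀ i, (gwaFrame a σ (N + 1) hX (LaurentPolynomial.T 1)).x i ∈
            (toFrac k (GWATensor a σ (N + 1))).range.comap (gwaFrame a σ (N + 1) hX (LaurentPolynomial.T 1)).ι := fun i => ⟨_, rfl⟩
        exact (pow_mem (prod_mem fun i _ => hx i) _ :
          (gwaFrame a σ (N + 1) hX (LaurentPolynomial.T 1)).y (m / p) ∈
            (toFrac k (GWATensor a σ (N + 1))).range.comap (gwaFrame a σ (N + 1) hX (LaurentPolynomial.T 1)).ι)
      · refine Eq.trans ((gwaFrame a σ (N + 1) hX (LaurentPolynomial.T 1)).ι_γL g _).symm ?_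
        rw [(gwaFrame a σ (N + 1) hX (LaurentPolynomial.T 1)).γL_y hg]
    rintro _ ⟨w, rfl⟩
    exact hK _ (algebraMap_mem_skewAdjoin _) hy' (hF.coeffsMem_of_fixed_mem hm hp
      (toFrac k (GWATensor a σ (N + 1))).range _ (fun e he h => GWAFrac.mem_invariantField he h)
      (fun i => ⟨_, rfl⟩) (fun i => ⟨_, rfl⟩) hy') w

end GWANoether

end

theorem theorem7 (k : Type*) [Field k] [IsAlgClosed k] [CharZero k]
    (n m p : ℕ) (hn : 1 ≤ n) (hm : 1 ≤ m) (hp : p ∣ m) :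
    -- classical type: base ring `k[h]`, `σ(h) = h - 1`
    (∀ (a : k[X]) (σ : k[X] ≃ₐ[k] k[X]), a ≠ 0 → σ X = X - 1 →
      FracIsomorphic k (GWAInvariants m p n a σ) (WeylAlgebra k n)) ∧
    -- quantum type: base ring `k[h, h⁻¹]`, `σ(h) = q h`, `q` not a root of unity
    (∀ (q : k) (a : k[T;T⁻¹]) (σ : k[T;T⁻¹] ≃ₐ[k] k[T;T⁻¹]),
      q ≠ 0 → (∀ j : ℕ, 1 ≤ j → q ^ j ≠ 1) → a ≠ 0 →
      σ (LaurentPolynomial.T 1) = q • LaurentPolynomial.T 1 →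
      FracIsomorphic k (GWAInvariants m p n a σ)
        (QuantumPlane k (q ^ (m / p)) ⊗[k]
          (⨂[k] _ : Fin (n - 1), QuantumPlane k (q ^ m)))) := by
  refine ⟨fun a σ ha hσ => classical_fracIsomorphic hn hm hp a σ ha hσ, ?_⟩
  obtain ⟨N, rfl⟩ : ∃ N, n = N + 1 := ⟨n - 1, by omega⟩
  exact fun q a σ hq hroot ha hσ => quantum_fracIsomorphic hm hp hq hroot a σ ha hσ
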